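/- **Theorem (Safety of D-DEMOS/Async).** *System.* An election has $n$ voters, $m$ options, $N_v$ vote collectors (VC), $N_b$ bulletin board (BB) nodes and $N_t$ trustees. An honest election authority (EA) sets it up as follows. Ballot $\ell$ has two parts; for every part and option it lists a random $128$-bit vote code (distinct within the ballot) and a random $64$-bit receipt. VC nodes hold, for every ballot line (randomly permuted within each part), a salted hash of the vote code and an EA-signed Shamir share of the receipt with threshold $N_v-f_v$; they also hold EA-signed shares, with the same threshold, of a $128$-bit key $\mathsf{msk}$, and a signing key each. BB nodes hold, and publish, the vote codes encrypted under $\mathsf{msk}$, a salted hash of $\mathsf{msk}$, and lifted ElGamal commitments (in a group of prime order $q$) to the unit vectors encoding the options, with the commitments that make the shares verifiable. Trustees hold $h_t$-out-of-$N_t$ shares of the openings. *Voting.* A voter posts $\langle\ell,\text{vote code}\rangle$ to VC nodes, each at most once, compares the first answer of each of them with her printed receipt, and stops contacting nodes once a receipt is valid. During voting hours a VC node that gets a vote code matching a hash asks all VC nodes to endorse it; a VC node signs at most one vote code per ballot. Valid signatures of $N_v-f_v$ VC nodes on (ballot, vote code) form a uniqueness certificate UCERT. A VC node discloses its receipt share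 for a vote code only together with a valid UCERT; $N_v-f_v$ validly signed shares reconstruct the receipt, which the responder returns to the voter. *Vote set consensus.* When its clock reaches the end of the election, a VC node announces to all VC nodes, for each ballot, the certified vote code it knows (or null), waits for $N_v-f_v$ announcements, adopting any valid certified vote code in them, and enters an asynchronous binary consensus instance with opinion $1$ if it knows a certified vote code and $0$ otherwise. Result $0$ means not voted; result $1$ means voted for the certified vote code, which is requested from all VC nodes (RECOVER) if unknown. Then the node sends its vote set and its share of $\mathsf{msk}$ to all BB nodes. Binary consensus is used as a primitive, in the most general behaviour its definition permits: all honest nodes get the same result, the result is the opinion of some honest node that has entered, and everything else is decided by the adversary. *Tally.* A BB node publishes a vote set received identically from $f_v+1$ VC nodes; it reconstructs $\mathsf{msk}$ from $N_v-f_v$ validly signed shares, checks it against its hash, and decrypts the vote codes. A trustee accepts data on which $f_b+1$ BB nodes agree and posts its share of the opening of the sum of the commitments marked as voted (and of the openings in the parts not voted). With $h_t$ shares that verify, a BB node publishes the result. *Adversary.* $\mathcal A$ is a randomized interactive algorithm given by a (non-uniform) family of circuits; its state, random bits, number of rounds and circuit sizes are polynomial in the security parameter $\lambda$. It statically corrupts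 at most $f_v$ VC nodes, at most $f_b$ BB nodes, at most $N_t-h_t$ trustees and any set of voters, gets their initialization data and all public data, and acts for them. It reads all messages, schedules, drops, delays, duplicates and reorders them at will, advances the clocks of the VC nodes at will, and chooses the votes of honest voters and the VC nodes they contact. It cannot make a message appear to come from an honest sender that did not send it to that receiver. *Claim.* Assume $f_v<N_v/3$, $f_b<N_b/2$, $1\le h_t\le N_t$, $2m\le 2^{128}$, that voting hours are non-empty, that $\max(n,N_t)<q(\lambda)$ for all $\lambda$ and $\log q(\lambda)$ is polynomially bounded, and that the receipts and $\mathsf{msk}$ are shared over $\mathbb F_{2^{64}}$ and $\mathbb F_{2^{128}}$ at $N_v$ distinct nonzero points. Assume that the signature scheme is efficient and EUF-CMA secure and that the (keyed) hash family is efficient and collision resistant, against adversaries of polynomial circuit size. Then for every such $\mathcal A$ there is a negligible function $\mathsf{negl}$ such that for all $\lambda$, with probability at least $$1-\frac{n f_v}{2^{64}-f_v}-\mathsf{negl}(\lambda)$$ the following holds at the end of the run for all honest voters $V$ who have received a valid receipt from a VC node, and for all honest BB nodes $B$: 1. if $B$ has published a vote set, it contains the vote code cast by $V$; 2. if $B$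 has published a result, then $B$ has published a vote set, and for every option the result is exactly the number of votes for that option in it; 3. if the run is complete, i.e. all honest VC nodes have reached the end of the election, all messages between honest servers have been delivered, and every consensus instance entered by all honest VC nodes has returned at all of them, then $B$ has published both a vote set and a result. -/

import Mathlib

open scoped Classical

noncomputable section

namespace DDemos

/-! ## Bit strings, Boolean circuits, polynomial size -/

/-- Bit strings of length `w`. -/
abbrev Word (w : ℕ) : Type := Fin w → Bool

/-- A binary encoding of the elements of `α` on a finite set `W` of wires. -/
class Bits (α : Type) where
  W : Type
  fin : Fintype W
  enc : α → W → Bool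
  inj : Function.Injective enc

attribute [reducible, instance] Bits.fin

/-- Decoding; bit patterns that encode nothing are decoded to `none`. -/
def Bits.dec {α : Type} [Bits α] (x : Bits.W α → Bool) : Option α :=
  if h : ∃ a : α, Bits.enc a = x then some h.choose else none

instance : Bits Bool where
  W := Unit
  fin := inferInstance
  enc b _ := b
  inj := fun _ _ h => congrFun h ()

instance (k : ℕ) : Bits (Fin k) where
  W := Fin k
  fin := inferInstance
  enc a i := decide (i = a)
  inj := fun a _ h => by
    have := congrFun h a
    simpa using this

instance (q : ℕ) [NeZero q] : Bits (ZMod q) where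
  W := Fin q.size
  fin := inferInstance
  enc a i := a.val.testBit i
  inj := fun a b h => by
    apply ZMod.val_injective q
    apply Nat.eq_of_testBit_eq
    intro i
    by_cases hi : i < q.size
    · exact congrFun h ⟨i, hi⟩
    · have hq : ∀ c : ZMod q, c.val < 2 ^ i := fun c =>
        lt_of_lt_of_le ((ZMod.val_lt c).trans (Nat.lt_size_self q))
          (Nat.pow_le_pow_right (by norm_num) (not_lt.mp hi))
      rw [Nat.testBit_lt_two_pow (hq a), Nat.testBit_lt_two_pow (hq b)]

instance (ι α : Type) [Fintype ι] [Bits α] : Bits (ι → α) where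
  W := ι × Bits.W α
  fin := inferInstance
  enc f w := Bits.enc (f w.1) w.2
  inj := fun _ _ h => funext fun i => Bits.inj (funext fun w => congrFun h (i, w))

instance (α β : Type) [Bits α] [Bits β] : Bits (α × β) where
  W := Bits.W α ⊕ Bits.W β
  fin := inferInstance
  enc x := Sum.elim (Bits.enc x.1) (Bits.enc x.2)
  inj := fun _ _ h => Prod.ext
    (Bits.inj (funext fun w => congrFun h (Sum.inl w)))
    (Bits.inj (funext fun w => congrFun h (Sum.inr w)))

instance (α : Type) [Bits α] : Bits (Option α) where
  W := Unit ⊕ Bits.W α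
  fin := inferInstance
  enc x := match x with
    | none => fun _ => false
    | some a => Sum.elim (fun _ => true) (Bits.enc a)
  inj := fun x y h => by
    rcases x with _ | a <;> rcases y with _ | b
    · rfl
    · exact absurd (congrFun h (Sum.inl ())) (by simp)
    · exact absurd (congrFun h (Sum.inl ())) (by simp)
    · exact congrArg some (Bits.inj (funext fun w => congrFun h (Sum.inr w)))

instance (α β : Type) [Bits α] [Bits β] : Bits (α ⊕ β) where
  W := Unit ⊕ (Bits.W α ⊕ Bits.W β)
  fin := inferInstance
  enc x := match x with
    | Sum.inl a => Sum.elim (fun _ => false) (Sum.elim (Bits.enc a) (fun _ => false))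
    | Sum.inr b => Sum.elim (fun _ => true) (Sum.elim (fun _ => false) (Bits.enc b))
  inj := fun x y h => by
    rcases x with a | a <;> rcases y with b | b
    · exact congrArg Sum.inl (Bits.inj (funext fun w => congrFun h (Sum.inr (Sum.inl w))))
    · exact absurd (congrFun h (Sum.inl ())) (by simp)
    · exact absurd (congrFun h (Sum.inl ())) (by simp)
    · exact congrArg Sum.inr (Bits.inj (funext fun w => congrFun h (Sum.inr (Sum.inr w))))

/-- Encode `α` through an injection into an encoded type. -/
@[reducible] def Bits.ofInjective {α β : Type} [Bits β] (f : α → β)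
    (hf : Function.Injective f) : Bits α where
  W := Bits.W β
  fin := inferInstance
  enc a := Bits.enc (f a)
  inj := Bits.inj.comp hf

/-- A Boolean circuit: a list of NAND gates, each reading input wires or outputs of earlier gates
(a reference to a gate that has not been evaluated yet reads `false`). -/
structure Circuit (I O : Type) where
  gates : List ((I ⊕ ℕ) × (I ⊕ ℕ))
  out : O → I ⊕ ℕ

namespace Circuit

variable {I O : Type}

def read (x : I → Bool) (ws : List Bool) (r : I ⊕ ℕ) : Bool :=
  Sum.elim x (fun j => ws.getD j false) r

def wires (C : Circuit I O) (x : I → Bool) : List Bool :=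
  C.gates.foldl (fun ws g => ws ++ [!(read x ws g.1 && read x ws g.2)]) []

def eval (C : Circuit I O) (x : I → Bool) : O → Bool :=
  fun o => read x (C.wires x) (C.out o)

def size (C : Circuit I O) : ℕ := C.gates.length

end Circuit

def PolyBounded (f : ℕ → ℕ) : Prop := ∃ p : Polynomial ℕ, ∀ k, f k ≤ p.eval k

/-- The family `f` is computed by circuits of polynomial size. -/
def PolyTime {α β : ℕ → Type} [∀ k, Bits (α k)] [∀ k, Bits (β k)]
    (f : ∀ k, α k → β k) : Prop :=
  ∃ s : ℕ → ℕ, PolyBounded s ∧ ∀ k, ∃ C : Circuit (Bits.W (α k)) (Bits.W (β k)),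
    C.size ≤ s k ∧ ∀ x, C.eval (Bits.enc x) = Bits.enc (f k x)

def Negligible (ε : ℕ → ℝ) : Prop :=
  Asymptotics.SuperpolynomialDecay Filter.atTop (fun k : ℕ => (k : ℝ)) ε

/-- Probability of `E` under the uniform distribution on the finite type `Ω`. -/
def prob (Ω : Type) [Finite Ω] (E : Ω → Prop) : ℝ :=
  (Nat.card {ω : Ω // E ω} : ℝ) / (Nat.card Ω : ℝ)

/-! ## Interactive randomized algorithms -/

/-- A stateful interactive randomized algorithm, given by circuits: `start` maps the initial input
to a state; in each of `rounds` rounds `step` maps the state, the last answer of the environment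
and fresh random bits to a new state and an action. -/
structure Machine (V A R : Type) [Bits V] [Bits A] [Bits R] where
  st : ℕ
  coin : ℕ
  rounds : ℕ
  start : Circuit (Bits.W V) (Fin st)
  step : Circuit (Fin st ⊕ (Bits.W (Option R) ⊕ Fin coin)) (Fin st ⊕ Bits.W A)

namespace Machine

variable {V A R S : Type} [Bits V] [Bits A] [Bits R]

def cost (M : Machine V A R) : ℕ :=
  M.st + M.coin + M.rounds + M.start.size + M.step.size

/-- Random bits of a whole run. -/
abbrev Coins (M : Machine V A R) : Type := Fin M.rounds → Word M.coin

/-- Run `M` against an environment with state `S`; the result is the final environment state. -/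
def play (M : Machine V A R) (v : V) (react : S → Option A → S × R) (s₀ : S)
    (coins : M.Coins) : S :=
  ((List.finRange M.rounds).foldl
    (fun (c : Word M.st × Option R × S) r =>
      let o := M.step.eval (Sum.elim c.1 (Sum.elim (Bits.enc c.2.1) (coins r)))
      let a := react c.2.2 (Bits.dec fun w => o (Sum.inr w))
      (fun i => o (Sum.inl i), some a.2, a.1))
    (M.start.eval (Bits.enc v), none, s₀)).2.2

end Machine

/-! ## Cryptographic primitives -/

/-- A (perfectly correct) digital signature scheme for messages in `M`; `k` is the security
parameter. -/
structure SigScheme (M : Type) where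
  (vkLen skLen sigLen keyCoinLen signCoinLen : ℕ → ℕ)
  keyGen : ∀ k, Word (keyCoinLen k) → Word (vkLen k) × Word (skLen k)
  sign : ∀ k, Word (skLen k) → Word (signCoinLen k) → M → Word (sigLen k)
  verify : ∀ k, Word (vkLen k) → M → Word (sigLen k) → Bool
  correct : ∀ k c r x, verify k (keyGen k c).1 x (sign k (keyGen k c).2 r x) = true

namespace SigScheme

variable {M : Type} [Bits M]

structure Efficient (Sc : SigScheme M) : Prop where
  vkLen : PolyBounded Sc.vkLen
  skLen : PolyBounded Sc.skLen
  sigLen : PolyBounded Sc.sigLen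
  keyCoinLen : PolyBounded Sc.keyCoinLen
  signCoinLen : PolyBounded Sc.signCoinLen
  keyGen : PolyTime (α := fun k => Word (Sc.keyCoinLen k))
    (β := fun k => Word (Sc.vkLen k) × Word (Sc.skLen k)) fun k c => Sc.keyGen k c
  sign : PolyTime (α := fun k => Word (Sc.skLen k) × Word (Sc.signCoinLen k) × M)
    (β := fun k => Word (Sc.sigLen k)) fun k x => Sc.sign k x.1 x.2.1 x.2.2
  verify : PolyTime (α := fun k => Word (Sc.vkLen k) × M × Word (Sc.sigLen k))
    (β := fun _ => Bool) fun k x => Sc.verify k x.1 x.2.1 x.2.2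

/-- A chosen-message attacker: its input is the verification key, its actions are signing queries
(`Sum.inl`) and the final forgery (`Sum.inr`), and queries are answered by signatures. -/
abbrev Forger (Sc : SigScheme M) (k : ℕ) : Type :=
  Machine (Word (Sc.vkLen k)) (M ⊕ M × Word (Sc.sigLen k)) (Word (Sc.sigLen k))

/-- State of the chosen-message game: unused signing coins, queried messages, and the verdict on
the (first) forgery attempt. -/
structure GameState (Sc : SigScheme M) (k : ℕ) where
  coins : List (Word (Sc.signCoinLen k))
  queried : List M
  verdict : Option Bool

def gameReact (Sc : SigScheme M) (k : ℕ) (keys : Word (Sc.vkLen k) × Word (Sc.skLen k))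
    (s : Sc.GameState k) :
    Option (M ⊕ M × Word (Sc.sigLen k)) → Sc.GameState k × Word (Sc.sigLen k)
  | some (Sum.inl x) =>
      ({ s with coins := s.coins.tail, queried := x :: s.queried },
        Sc.sign k keys.2 (s.coins.headD fun _ => false) x)
  | some (Sum.inr (x, σ)) =>
      (if s.verdict = none then
        { s with verdict := some (Sc.verify k keys.1 x σ && decide (x ∉ s.queried)) }
       else s, fun _ => false)
  | none => (s, fun _ => false)

def Forges (Sc : SigScheme M) (k : ℕ) (B : Sc.Forger k)
    (ω : Word (Sc.keyCoinLen k) × (Fin B.rounds → Word (Sc.signCoinLen k)) × B.Coins) : Prop :=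
  (B.play (Sc.keyGen k ω.1).1 (Sc.gameReact k (Sc.keyGen k ω.1))
    ⟨List.ofFn ω.2.1, [], none⟩ ω.2.2).verdict = some true

/-- Existential unforgeability under chosen-message attacks. -/
def EUFCMA (Sc : SigScheme M) : Prop :=
  ∀ B : ∀ k, Sc.Forger k, PolyBounded (fun k => (B k).cost) →
    Negligible fun k => prob
      (Word (Sc.keyCoinLen k) × (Fin (B k).rounds → Word (Sc.signCoinLen k)) × (B k).Coins)
      (Sc.Forges k (B k))

end SigScheme

/-- A keyed family of hash functions on pairs (128-bit string, 64-bit salt). -/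
structure HashFamily where
  (keyLen digLen : ℕ → ℕ)
  hash : ∀ k, Word (keyLen k) → Word 128 × Word 64 → Word (digLen k)

namespace HashFamily

structure Efficient (H : HashFamily) : Prop where
  keyLen : PolyBounded H.keyLen
  digLen : PolyBounded H.digLen
  hash : PolyTime (α := fun k => Word (H.keyLen k) × (Word 128 × Word 64))
    (β := fun k => Word (H.digLen k)) fun k x => H.hash k x.1 x.2

def CollisionResistant (H : HashFamily) : Prop :=
  ∀ (r : ℕ → ℕ) (F : ∀ k, Word (H.keyLen k) × Word (r k) →
      (Word 128 × Word 64) × (Word 128 × Word 64)),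
    PolyBounded r →
    PolyTime (α := fun k => Word (H.keyLen k) × Word (r k))
      (β := fun _ => (Word 128 × Word 64) × (Word 128 × Word 64)) F →
    Negligible fun k => prob (Word (H.keyLen k) × Word (r k)) fun ω =>
      (F k ω).1 ≠ (F k ω).2 ∧ H.hash k ω.1 (F k ω).1 = H.hash k ω.1 (F k ω).2

end HashFamily

/-- Randomized symmetric encryption of 128-bit strings under 128-bit keys. -/
structure SymEnc where
  (ivLen ctLen : ℕ)
  enc : Word 128 → Word ivLen → Word 128 → Word ctLen
  dec : Word 128 → Word ctLen → Word 128
  dec_enc : ∀ key iv x, dec key (enc key iv x) = x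

/-- A family of cyclic groups of prime order, with generators. -/
structure GroupFamily where
  q : ℕ → ℕ
  prime : ∀ k, (q k).Prime
  G : ℕ → Type
  grp : ∀ k, AddCommGroup (G k)
  bits : ∀ k, Bits (G k)
  card : ∀ k, Nat.card (G k) = q k
  gen : ∀ k, G k
  gen_ne : ∀ k, gen k ≠ 0

attribute [instance] GroupFamily.grp GroupFamily.bits

instance (Γ : GroupFamily) (k : ℕ) : NeZero (Γ.q k) := ⟨(Γ.prime k).ne_zero⟩

instance (Γ : GroupFamily) (k : ℕ) : Fact (Γ.q k).Prime := ⟨Γ.prime k⟩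

/-- Lifted ElGamal commitment to `x` with randomness `r` under the commitment key `h`. -/
def GroupFamily.com (Γ : GroupFamily) (k : ℕ) (h : Γ.G k) (x r : ZMod (Γ.q k)) :
    Γ.G k × Γ.G k :=
  (r.val • Γ.gen k, x.val • Γ.gen k + r.val • h)

/-! ## Shamir secret sharing -/

/-- `w`-bit strings are identified with the field of `2 ^ w` elements by a fixed bijection. -/
def toField (w : ℕ) [NeZero w] : Word w ≃ GaloisField 2 w :=
  Classical.choice (Finite.card_eq.mp (by
    rw [GaloisField.card 2 w (NeZero.ne w)]
    simp))

/-- Share at the point `x`, for threshold `t`: the value of the polynomial with constant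
coefficient `secret` and higher coefficients `c`. -/
def shamirShare {F : Type} [Field F] {t : ℕ} (secret : F) (c : Fin (t - 1) → F) (x : F) : F :=
  secret + ∑ j, c j * x ^ (j.val + 1)

/-- Interpolation at `0` from the available shares. -/
def shamirRec {F : Type} [Field F] {N : ℕ} (x : Fin N → F) (sh : Fin N → Option F) : F :=
  (Lagrange.interpolate (Finset.univ.filter fun i => (sh i).isSome) x
    fun i => (sh i).getD 0).eval 0

/-- Number of filled slots. -/
def count {ι α : Type} [Fintype ι] (f : ι → Option α) : ℕ :=
  (Finset.univ.filter fun i => (f i).isSome).card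

/-! ## Election parameters -/

/-- `n` voters, `m` options; `Nv` vote collectors (VC), `Nb` bulletin board (BB) nodes, `Nt`
trustees; fault bounds `fv`, `fb`; trustee threshold `ht`; voting hours `[Tbeg, Tend)`; evaluation
points for the sharing of 64-bit receipts and of the 128-bit master key among the VC nodes. -/
structure Params where
  (n m Nv Nb Nt fv fb ht Tbeg Tend : ℕ)
  pt64 : Fin Nv ↪ (GaloisField 2 64)ˣ
  pt128 : Fin Nv ↪ (GaloisField 2 128)ˣ

/-- A ballot line: part (A or B) and a position or an option within the part. -/
abbrev Line (P : Params) : Type := Bool × Fin P.m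

/-- The things that get signed: (serial number, vote code) endorsements, signed by VC nodes;
receipt shares and master key shares, signed by the election authority. -/
inductive SMsg (P : Params) : Type
  | endorse (s : Fin P.n) (vc : Word 128)
  | rshare (s : Fin P.n) (l : Line P) (i : Fin P.Nv) (x : Word 64)
  | kshare (i : Fin P.Nv) (x : Word 128)

instance (P : Params) : Bits (SMsg P) :=
  Bits.ofInjective
    (β := (Fin P.n × Word 128) ⊕ (Fin P.n × Line P × Fin P.Nv × Word 64) ⊕ (Fin P.Nv × Word 128))
    (fun
      | .endorse s vc => .inl (s, vc)
      | .rshare s l i x => .inr (.inl (s, l, i, x))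
      | .kshare i x => .inr (.inr (i, x)))
    (by rintro (_ | _ | _) (_ | _ | _) h <;> simp_all)

/-- The primitives the system is built from. -/
structure Prims (P : Params) where
  sig : SigScheme (SMsg P)
  hash : HashFamily
  sym : SymEnc
  grp : GroupFamily

section System

variable {P : Params}

/-! ## Setup by the election authority -/

/-- The random choices of the election authority. `code` and `rcpt` (vote codes, distinct within a
ballot, and receipts) are indexed by (part, option); all tables handed to the servers are indexed by
(part, position), where position `p` of part `X` of ballot `s` holds option `perm s X p`. -/
structure Setup (C : Prims P) (k : ℕ) where
  hk : Word (C.hash.keyLen k)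
  code : Fin P.n → (Line P ↪ Word 128)
  rcpt : Fin P.n → Line P → Word 64
  perm : Fin P.n → Bool → Equiv.Perm (Fin P.m)
  salt : Fin P.n → Line P → Word 64
  msk : Word 128
  saltM : Word 64
  iv : Fin P.n → Line P → Word C.sym.ivLen
  rpoly : Fin P.n → Line P → Fin (P.Nv - P.fv - 1) → GaloisField 2 64
  mpoly : Fin (P.Nv - P.fv - 1) → GaloisField 2 128
  eaKey : Word (C.sig.keyCoinLen k)
  vcKey : Fin P.Nv → Word (C.sig.keyCoinLen k)
  vcCoin : Fin P.Nv → Fin P.n → Word (C.sig.signCoinLen k)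
  rCoin : Fin P.n → Line P → Fin P.Nv → Word (C.sig.signCoinLen k)
  mCoin : Fin P.Nv → Word (C.sig.signCoinLen k)
  trap : ZMod (C.grp.q k)
  comR : Fin P.n → Line P → Fin P.m → ZMod (C.grp.q k)
  tpoly : Fin P.n → Line P → Fin P.m → Fin (P.ht - 1) → ZMod (C.grp.q k) × ZMod (C.grp.q k)

set_option synthInstance.maxSize 1000 in
set_option synthInstance.maxHeartbeats 400000 in
instance (C : Prims P) (k : ℕ) : Finite (Setup C k) :=
  Finite.of_injective
    (fun S : Setup C k => ((S.hk, S.code, S.rcpt, S.perm, S.salt, S.msk, S.saltM, S.iv),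
      (S.rpoly, S.mpoly, S.eaKey, S.vcKey, S.vcCoin, S.rCoin, S.mCoin),
      (S.trap, S.comR, S.tpoly)))
    (by rintro ⟨⟩ ⟨⟩ h; simp_all)

variable {C : Prims P} {k : ℕ}

/-- Signatures. -/
abbrev Sg (C : Prims P) (k : ℕ) : Type := Word (C.sig.sigLen k)

/-- Uniqueness certificates (UCERT): signatures of VC nodes, at most one per node. -/
abbrev Cert (C : Prims P) (k : ℕ) : Type := Fin P.Nv → Option (Sg C k)

/-- Sets of (serial number, vote code) pairs, at most one vote code per ballot. -/
abbrev VoteSet (P : Params) : Type := Fin P.n → Option (Word 128)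

/-- Tables of vote codes by position. -/
abbrev CodeTable (P : Params) : Type := Fin P.n → Line P → Word 128

/-- Shares of the opening (message and randomness) of a vector of `m` commitments. -/
abbrev OpenShare (C : Prims P) (k : ℕ) : Type :=
  Fin P.m → ZMod (C.grp.q k) × ZMod (C.grp.q k)

namespace Setup

variable (S : Setup C k)

/-- The (part, option) at a given (part, position). -/
def opt (s : Fin P.n) (l : Line P) : Line P := (l.1, S.perm s l.1 l.2)

def vk (i : Fin P.Nv) : Word (C.sig.vkLen k) := (C.sig.keyGen k (S.vcKey i)).1

def sk (i : Fin P.Nv) : Word (C.sig.skLen k) := (C.sig.keyGen k (S.vcKey i)).2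

def eaVk : Word (C.sig.vkLen k) := (C.sig.keyGen k S.eaKey).1

def eaSign (r : Word (C.sig.signCoinLen k)) (x : SMsg P) : Sg C k :=
  C.sig.sign k (C.sig.keyGen k S.eaKey).2 r x

/-- Hash commitment to the vote code at a position. -/
def row (s : Fin P.n) (l : Line P) : Word (C.hash.digLen k) :=
  C.hash.hash k S.hk (S.code s (S.opt s l), S.salt s l)

/-- Share of the receipt at a position, for VC node `i`; threshold `Nv - fv`. -/
def rshare (s : Fin P.n) (l : Line P) (i : Fin P.Nv) : Word 64 :=
  (toField 64).symm (shamirShare (toField 64 (S.rcpt s (S.opt s l))) (S.rpoly s l) (P.pt64 i))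

def rshareSig (s : Fin P.n) (l : Line P) (i : Fin P.Nv) : Sg C k :=
  S.eaSign (S.rCoin s l i) (.rshare s l i (S.rshare s l i))

/-- Share of the master key for VC node `i`; threshold `Nv - fv`. -/
def kshare (i : Fin P.Nv) : Word 128 :=
  (toField 128).symm (shamirShare (toField 128 S.msk) S.mpoly (P.pt128 i))

def kshareSig (i : Fin P.Nv) : Sg C k := S.eaSign (S.mCoin i) (.kshare i (S.kshare i))

def hmsk : Word (C.hash.digLen k) := C.hash.hash k S.hk (S.msk, S.saltM)

/-- Encrypted vote code at a position. -/
def ct (s : Fin P.n) (l : Line P) : Word C.sym.ctLen :=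
  C.sym.enc S.msk (S.iv s l) (S.code s (S.opt s l))

/-- Commitment key. -/
def ck : C.grp.G k := S.trap.val • C.grp.gen k

/-- Coordinate `o` of the unit vector that encodes the option at a position. -/
def unit (s : Fin P.n) (l : Line P) (o : Fin P.m) : ZMod (C.grp.q k) :=
  if (S.opt s l).2 = o then 1 else 0

/-- Commitment to the option encoding at a position. -/
def com₀ (s : Fin P.n) (l : Line P) (o : Fin P.m) : C.grp.G k × C.grp.G k :=
  C.grp.com k S.ck (S.unit s l o) (S.comR s l o)

/-- Commitments to the higher coefficients of the polynomials that share the opening of `com₀`. -/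
def comC (s : Fin P.n) (l : Line P) (o : Fin P.m) (j : Fin (P.ht - 1)) :
    C.grp.G k × C.grp.G k :=
  C.grp.com k S.ck (S.tpoly s l o j).1 (S.tpoly s l o j).2

end Setup

/-- Evaluation point of trustee `t`. -/
def tpt (C : Prims P) (k : ℕ) (t : Fin P.Nt) : ZMod (C.grp.q k) := ((t.val + 1 : ℕ) : ZMod _)

/-- Share, for trustee `t`, of the opening of the option commitment at a position; threshold
`ht`. -/
def Setup.tshare (S : Setup C k) (s : Fin P.n) (l : Line P) (t : Fin P.Nt) : OpenShare C k :=
  fun o =>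
    (shamirShare (S.unit s l o) (fun j => (S.tpoly s l o j).1) (tpt C k t),
     shamirShare (S.comR s l o) (fun j => (S.tpoly s l o j).2) (tpt C k t))

/-! ## Parties, messages, corruption -/

inductive Party (P : Params) : Type
  | vc (i : Fin P.Nv)
  | bb (b : Fin P.Nb)
  | tr (t : Fin P.Nt)
  | voter (v : Fin P.n)
  | env

instance : Bits (Party P) :=
  Bits.ofInjective (β := Fin P.Nv ⊕ Fin P.Nb ⊕ Fin P.Nt ⊕ Option (Fin P.n))
    (fun
      | .vc i => .inl i
      | .bb b => .inr (.inl b)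
      | .tr t => .inr (.inr (.inl t))
      | .voter v => .inr (.inr (.inr (some v)))
      | .env => .inr (.inr (.inr none)))
    (by rintro (_ | _ | _ | _ | _) (_ | _ | _ | _ | _) h <;> simp_all)

/-- Messages. `bcInput`, `published` and `result` only tell the adversary (party `env`) the inputs
to binary consensus and the public content of the bulletin board. -/
inductive Msg (C : Prims P) (k : ℕ) : Type
  | vote (s : Fin P.n) (vc : Word 128)
  | endorse (s : Fin P.n) (vc : Word 128)
  | endorsement (s : Fin P.n) (vc : Word 128) (σ : Sg C k)
  | voteP (s : Fin P.n) (vc : Word 128) (x : Word 64) (σ : Sg C k) (u : Cert C k)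
  | receipt (r : Word 64)
  | announce (s : Fin P.n) (c : Option (Word 128 × Cert C k))
  | recoverReq (s : Fin P.n)
  | recoverResp (s : Fin P.n) (vc : Word 128) (u : Cert C k)
  | bcInput (s : Fin P.n) (b : Bool)
  | voteSet (Q : VoteSet P) (x : Word 128) (σ : Sg C k)
  | published (Q : VoteSet P)
  | bbData (Q : VoteSet P) (D : CodeTable P)
  | opening (o : Fin P.n → Line P → Option (OpenShare C k)) (T : OpenShare C k)
  | result (R : Fin P.m → ZMod (C.grp.q k))

set_option synthInstance.maxSize 1000 in
set_option synthInstance.maxHeartbeats 400000 in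
set_option maxHeartbeats 1000000 in
instance : Bits (Msg C k) :=
  Bits.ofInjective
    (β := (Fin P.n × Word 128) ⊕ (Fin P.n × Word 128) ⊕ (Fin P.n × Word 128 × Sg C k) ⊕
      (Fin P.n × Word 128 × Word 64 × Sg C k × Cert C k) ⊕ Word 64 ⊕
      (Fin P.n × Option (Word 128 × Cert C k)) ⊕ Fin P.n ⊕ (Fin P.n × Word 128 × Cert C k) ⊕
      (Fin P.n × Bool) ⊕ (VoteSet P × Word 128 × Sg C k) ⊕ VoteSet P ⊕
      (VoteSet P × CodeTable P) ⊕
      ((Fin P.n → Line P → Option (OpenShare C k)) × OpenShare C k) ⊕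
      (Fin P.m → ZMod (C.grp.q k)))
    (fun
      | .vote s vc => .inl (s, vc)
      | .endorse s vc => .inr (.inl (s, vc))
      | .endorsement s vc σ => .inr (.inr (.inl (s, vc, σ)))
      | .voteP s vc x σ u => .inr (.inr (.inr (.inl (s, vc, x, σ, u))))
      | .receipt r => .inr (.inr (.inr (.inr (.inl r))))
      | .announce s c => .inr (.inr (.inr (.inr (.inr (.inl (s, c))))))
      | .recoverReq s => .inr (.inr (.inr (.inr (.inr (.inr (.inl s))))))
      | .recoverResp s vc u => .inr (.inr (.inr (.inr (.inr (.inr (.inr (.inl (s, vc, u))))))))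
      | .bcInput s b => .inr (.inr (.inr (.inr (.inr (.inr (.inr (.inr (.inl (s, b)))))))))
      | .voteSet Q x σ =>
          .inr (.inr (.inr (.inr (.inr (.inr (.inr (.inr (.inr (.inl (Q, x, σ))))))))))
      | .published Q =>
          .inr (.inr (.inr (.inr (.inr (.inr (.inr (.inr (.inr (.inr (.inl Q))))))))))
      | .bbData Q D =>
          .inr (.inr (.inr (.inr (.inr (.inr (.inr (.inr (.inr (.inr (.inr (.inl (Q, D))))))))))))
      | .opening o T =>
          .inr (.inr (.inr (.inr (.inr (.inr (.inr (.inr (.inr (.inr (.inr (.inr (.inl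
            (o, T)))))))))))))
      | .result R =>
          .inr (.inr (.inr (.inr (.inr (.inr (.inr (.inr (.inr (.inr (.inr (.inr (.inr
            R)))))))))))))
    (by
      intro a b h
      cases a <;> cases b <;> simp_all)

/-- (sender, receiver, message). -/
abbrev Envelope (C : Prims P) (k : ℕ) : Type := Party P × Party P × Msg C k

/-- Outgoing messages of a party: (receiver, message). -/
abbrev Outbox (C : Prims P) (k : ℕ) : Type := List (Party P × Msg C k)

def toVCs (x : Msg C k) : Outbox C k := (List.finRange P.Nv).map fun j => (.vc j, x)

def toBBs (x : Msg C k) : Outbox C k := (List.finRange P.Nb).map fun j => (.bb j, x)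

def toTrs (x : Msg C k) : Outbox C k := (List.finRange P.Nt).map fun j => (.tr j, x)

/-- The statically corrupted parties, within the fault thresholds (any set of voters). -/
structure Corruption (P : Params) where
  vcs : Finset (Fin P.Nv)
  bbs : Finset (Fin P.Nb)
  trs : Finset (Fin P.Nt)
  voters : Finset (Fin P.n)
  vcs_le : vcs.card ≤ P.fv
  bbs_le : bbs.card ≤ P.fb
  trs_le : trs.card ≤ P.Nt - P.ht

def Corruption.Bad (K : Corruption P) : Party P → Prop
  | .vc i => i ∈ K.vcs
  | .bb b => b ∈ K.bbs
  | .tr t => t ∈ K.trs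
  | .voter v => v ∈ K.voters
  | .env => True

/-! ## Vote collectors -/

/-- What a VC node stores for one ballot. The ballot is not voted / pending / voted when
`used = none` / `used ≠ none` and `receipt = none` / `receipt ≠ none`. -/
structure VCBallot (C : Prims P) (k : ℕ) where
  /-- endorsed vote code with this node's signature -/
  endorsed : Option (Word 128 × Sg C k) := none
  /-- open request that this node handles as responder: vote code and requester -/
  req : Option (Word 128 × Party P) := none
  /-- endorsements collected for `req` -/
  sigs : Cert C k := fun _ => none
  /-- vote code used for this ballot, with its certificate -/
  used : Option (Word 128 × Cert C k) := none
  /-- list of receipt shares, by VC node -/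
  lrs : Fin P.Nv → Option (Word 64) := fun _ => none
  receipt : Option (Word 64) := none
  /-- announcements received, by VC node -/
  ann : Fin P.Nv → Option (Option (Word 128 × Cert C k)) := fun _ => none
  /-- opinion with which this node has entered binary consensus -/
  entered : Option Bool := none
  /-- result of binary consensus -/
  decided : Option Bool := none

structure VCState (C : Prims P) (k : ℕ) where
  clock : ℕ := 0
  ballot : Fin P.n → VCBallot C k := fun _ => {}
  /-- the final vote set has been sent -/
  done : Bool := false

def VCState.set (st : VCState C k) (s : Fin P.n) (b : VCBallot C k) : VCState C k :=
  { st with ballot := Function.update st.ballot s b }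

def VCState.Voting (st : VCState C k) : Prop := P.Tbeg ≤ st.clock ∧ st.clock < P.Tend

def VCState.Ended (st : VCState C k) : Prop := P.Tend ≤ st.clock

namespace Setup

variable (S : Setup C k)

/-- Locate a vote code on a ballot through the hash commitments. -/
def lineOf (s : Fin P.n) (vc : Word 128) : Option (Line P) :=
  ([false, true].product (List.finRange P.m)).find? fun l =>
    decide (C.hash.hash k S.hk (vc, S.salt s l) = S.row s l)

/-- Valid uniqueness certificate: valid signatures of at least `Nv - fv` VC nodes. -/
def ValidCert (s : Fin P.n) (vc : Word 128) (u : Cert C k) : Prop :=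
  P.Nv - P.fv ≤ (Finset.univ.filter fun i : Fin P.Nv =>
    ∃ σ, u i = some σ ∧ C.sig.verify k (S.vk i) (.endorse s vc) σ = true).card

/-- Valid vote code with a valid certificate. -/
def Certified (s : Fin P.n) (c : Word 128 × Cert C k) : Prop :=
  (S.lineOf s c.1).isSome ∧ S.ValidCert s c.1 c.2

/-- The VOTE_P message of node `i` for a vote code at line `l`. -/
def votePMsg (i : Fin P.Nv) (s : Fin P.n) (vc : Word 128) (l : Line P) (u : Cert C k) : Msg C k :=
  .voteP s vc (S.rshare s l i) (S.rshareSig s l i) u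

def onVote (st : VCState C k) (src : Party P) (s : Fin P.n) (vc : Word 128) :
    VCState C k × Outbox C k :=
  let b := st.ballot s
  if ¬ st.Voting then (st, []) else
  match b.used with
  | none =>
      if (S.lineOf s vc).isSome then
        (st.set s { b with req := some (vc, src), sigs := fun _ => none }, toVCs (.endorse s vc))
      else (st, [])
  | some (vc', _) =>
      match b.receipt with
      | some r => if vc' = vc then (st, [(src, .receipt r)]) else (st, [])
      | none => (st, [])

def onEndorse (i : Fin P.Nv) (st : VCState C k) (j : Fin P.Nv) (s : Fin P.n) (vc : Word 128) :
    VCState C k × Outbox C k :=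
  let b := st.ballot s
  if ¬ st.Voting then (st, []) else
  match b.endorsed with
  | none =>
      let σ := C.sig.sign k (S.sk i) (S.vcCoin i s) (.endorse s vc)
      (st.set s { b with endorsed := some (vc, σ) }, [(.vc j, .endorsement s vc σ)])
  | some (vc', σ) => if vc' = vc then (st, [(.vc j, .endorsement s vc σ)]) else (st, [])

def onEndorsement (i : Fin P.Nv) (st : VCState C k) (j : Fin P.Nv) (s : Fin P.n) (vc : Word 128)
    (σ : Sg C k) : VCState C k × Outbox C k :=
  let b := st.ballot s
  if st.Voting ∧ b.used = none ∧ (∃ src, b.req = some (vc, src)) ∧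
      C.sig.verify k (S.vk j) (.endorse s vc) σ = true then
    let u : Cert C k := Function.update b.sigs j (some σ)
    match S.lineOf s vc with
    | some l =>
        if P.Nv - P.fv ≤ count u then
          (st.set s { b with sigs := u, used := some (vc, u) }, toVCs (S.votePMsg i s vc l u))
        else (st.set s { b with sigs := u }, [])
    | none => (st, [])
  else (st, [])

/-- Record a receipt share; with `Nv - fv` shares the receipt is reconstructed, and sent to the
requester if this node is the responder for the vote code used. -/
def addShare (st : VCState C k) (s : Fin P.n) (j : Fin P.Nv) (x : Word 64) :
    VCState C k × Outbox C k :=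
  let b := st.ballot s
  let lrs := Function.update b.lrs j (some x)
  if b.receipt = none ∧ P.Nv - P.fv ≤ count lrs then
    let r := (toField 64).symm
      (shamirRec (fun i => (P.pt64 i : GaloisField 2 64)) fun i => (lrs i).map (toField 64))
    (st.set s { b with lrs := lrs, receipt := some r },
      match b.req, b.used with
      | some (vc, src), some (vc', _) => if vc = vc' then [(src, .receipt r)] else []
      | _, _ => [])
  else (st.set s { b with lrs := lrs }, [])

def onVoteP (i : Fin P.Nv) (st : VCState C k) (j : Fin P.Nv) (s : Fin P.n) (vc : Word 128)
    (x : Word 64) (σ : Sg C k) (u : Cert C k) : VCState C k × Outbox C k :=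
  if ¬ (st.Voting ∧ S.ValidCert s vc u) then (st, []) else
  match S.lineOf s vc with
  | none => (st, [])
  | some l =>
      if C.sig.verify k S.eaVk (.rshare s l j x) σ = true then
        let b := st.ballot s
        match b.used with
        | none =>
            let r := addShare (st.set s { b with used := some (vc, u) }) s j x
            (r.1, toVCs (S.votePMsg i s vc l u) ++ r.2)
        | some (vc', _) => if vc' = vc then addShare st s j x else (st, [])
      else (st, [])

def vcHandle (i : Fin P.Nv) (st : VCState C k) (src : Party P) (x : Msg C k) :
    VCState C k × Outbox C k :=
  match src, x with
  | src, .vote s vc => S.onVote st src s vc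
  | .vc j, .endorse s vc => S.onEndorse i st j s vc
  | .vc j, .endorsement s vc σ => S.onEndorsement i st j s vc σ
  | .vc j, .voteP s vc y σ u => S.onVoteP i st j s vc y σ u
  | .vc j, .announce s c =>
      let b := st.ballot s
      if b.ann j = none then (st.set s { b with ann := Function.update b.ann j (some c) }, [])
      else (st, [])
  | .vc j, .recoverReq s =>
      match (st.ballot s).used with
      | some (vc, u) => if st.Ended then (st, [(.vc j, .recoverResp s vc u)]) else (st, [])
      | none => (st, [])
  | .vc _, .recoverResp s vc u =>
      let b := st.ballot s
      if b.decided = some true ∧ b.used = none ∧ S.Certified s (vc, u) then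
        (st.set s { b with used := some (vc, u) }, [])
      else (st, [])
  | _, _ => (st, [])

/-- Vote set consensus, for one ballot: adopt a certified announced vote code if none is known;
enter binary consensus as soon as `Nv - fv` announcements have arrived. -/
def vcAdvance (s : Fin P.n) (b : VCBallot C k) : VCBallot C k :=
  let b' : VCBallot C k := { b with
    used := b.used <|> (List.finRange P.Nv).findSome? fun j =>
      (b.ann j).join.filter fun c => decide (S.Certified s c) }
  if b'.entered = none ∧ P.Nv - P.fv ≤ count b'.ann then
    { b' with entered := some b'.used.isSome }
  else b'

/-- Steps of vote set consensus enabled after the election end; once every ballot is settled, the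
final vote set and the master key share go to all BB nodes. -/
def vcSettle (i : Fin P.Nv) (st : VCState C k) : VCState C k × Outbox C k :=
  if ¬ st.Ended then (st, []) else
  let st' : VCState C k := { st with ballot := fun s => S.vcAdvance s (st.ballot s) }
  let out : Outbox C k := (List.finRange P.n).filterMap fun s =>
    match (st.ballot s).entered, (st'.ballot s).entered with
    | none, some b => some (.env, .bcInput s b)
    | _, _ => none
  if st'.done = false ∧ ∀ s, (st'.ballot s).decided = some false ∨
      ((st'.ballot s).decided = some true ∧ (st'.ballot s).used.isSome) then
    ({ st' with done := true }, out ++ toBBs (.voteSet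
      (fun s => if (st'.ballot s).decided = some true then (st'.ballot s).used.map Prod.fst
        else none) (S.kshare i) (S.kshareSig i)))
  else (st', out)

def vcFinish (i : Fin P.Nv) (r : VCState C k × Outbox C k) : VCState C k × Outbox C k :=
  let t := S.vcSettle i r.1
  (t.1, r.2 ++ t.2)

def vcRecv (i : Fin P.Nv) (st : VCState C k) (src : Party P) (x : Msg C k) :
    VCState C k × Outbox C k :=
  S.vcFinish i (S.vcHandle i st src x)

/-- Advance of the internal clock; at the election end the node announces, for every ballot, the
vote code it knows. -/
def vcTick (i : Fin P.Nv) (st : VCState C k) : VCState C k × Outbox C k :=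
  S.vcFinish i ({ st with clock := st.clock + 1 },
    if st.clock + 1 = P.Tend then
      (List.finRange P.n).flatMap fun s => toVCs (.announce s (st.ballot s).used)
    else [])

/-- Binary consensus for ballot `s` returns `v`. -/
def vcDecide (i : Fin P.Nv) (st : VCState C k) (s : Fin P.n) (v : Bool) :
    VCState C k × Outbox C k :=
  let b := st.ballot s
  if b.entered.isSome ∧ b.decided = none then
    S.vcFinish i (st.set s { b with decided := some v },
      if v = true ∧ b.used = none then toVCs (.recoverReq s) else [])
  else (st, [])

end Setup

/-! ## Tally, bulletin board, trustees -/

/-- The tally set determined by a vote set and a table of vote codes: the lines marked as voted;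
ballots with more than one marked line are discarded. -/
def tallySet (Q : VoteSet P) (D : CodeTable P) : Finset (Fin P.n × Line P) :=
  Finset.univ.filter fun x => Q x.1 = some (D x.1 x.2) ∧ ∀ l', D x.1 l' = D x.1 x.2 → l' = x.2

structure BBState (C : Prims P) (k : ℕ) where
  /-- vote set and signed master key share received from each VC node -/
  got : Fin P.Nv → Option (VoteSet P × Word 128 × Sg C k) := fun _ => none
  /-- published final vote set -/
  pub : Option (VoteSet P) := none
  /-- reconstructed master key -/
  key : Option (Word 128) := none
  /-- the vote set and the decrypted vote codes have been made available -/
  shown : Bool := false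
  /-- tally opening shares received from the trustees -/
  posts : Fin P.Nt → Option (OpenShare C k) := fun _ => none
  /-- published election result -/
  result : Option (Fin P.m → ZMod (C.grp.q k)) := none

namespace Setup

variable (S : Setup C k)

def bbHandle (st : BBState C k) (src : Party P) (x : Msg C k) : BBState C k × Outbox C k :=
  match src, x with
  | .vc i, .voteSet Q y σ =>
      if st.got i = none then
        let got := Function.update st.got i (some (Q, y, σ))
        if st.pub = none ∧ P.fv + 1 ≤ (Finset.univ.filter fun j =>
            (got j).map Prod.fst = some Q).card then
          ({ st with got := got, pub := some Q }, [(.env, .published Q)])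
        else ({ st with got := got }, [])
      else (st, [])
  | .tr t, .opening _ T =>
      if st.posts t = none then
        ({ st with posts := Function.update st.posts t (some T) }, [])
      else (st, [])
  | _, _ => (st, [])

/-- Reconstruct the master key from `Nv - fv` validly signed shares; check it against its hash. -/
def bbKey (st : BBState C k) : BBState C k :=
  let sh : Fin P.Nv → Option (Word 128) := fun i =>
    (st.got i).bind fun g =>
      if C.sig.verify k S.eaVk (.kshare i g.2.1) g.2.2 = true then some g.2.1 else none
  let key := (toField 128).symm
    (shamirRec (fun i => (P.pt128 i : GaloisField 2 128)) fun i => (sh i).map (toField 128))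
  if st.key = none ∧ P.Nv - P.fv ≤ count sh ∧ C.hash.hash k S.hk (key, S.saltM) = S.hmsk then
    { st with key := some key }
  else st

/-- Decrypted vote codes. -/
def codes (key : Word 128) : CodeTable P := fun s l => C.sym.dec key (S.ct s l)

/-- Verification of trustee `t`'s share of the opening of the homomorphic total of a tally set,
against the published commitments. -/
def ValidPost (E : Finset (Fin P.n × Line P)) (t : Fin P.Nt) (T : OpenShare C k) : Prop :=
  ∀ o, C.grp.com k S.ck (T o).1 (T o).2 =
    ∑ x ∈ E, (S.com₀ x.1 x.2 o + ∑ j, (tpt C k t ^ (j.val + 1)).val • S.comC x.1 x.2 o j)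

/-- Once vote set and key are known, show the data to trustees and public; with `ht` valid opening
shares, publish the result. -/
def bbSettle (st : BBState C k) : BBState C k × Outbox C k :=
  match st.pub, st.key with
  | some Q, some key =>
      let D := S.codes key
      let out : Outbox C k :=
        if st.shown = false then (.env, .bbData Q D) :: toTrs (.bbData Q D) else []
      let valid : Fin P.Nt → Option (OpenShare C k) := fun t =>
        (st.posts t).filter fun T => decide (S.ValidPost (tallySet Q D) t T)
      let R : Fin P.m → ZMod (C.grp.q k) := fun o =>
        shamirRec (tpt C k) fun t => (valid t).map fun T => (T o).1
      if st.result = none ∧ P.ht ≤ count valid then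
        ({ st with shown := true, result := some R }, out ++ [(.env, .result R)])
      else ({ st with shown := true }, out)
  | _, _ => (st, [])

def bbRecv (st : BBState C k) (src : Party P) (x : Msg C k) : BBState C k × Outbox C k :=
  let r := bbHandle st src x
  let t := S.bbSettle (S.bbKey r.1)
  (t.1, r.2 ++ t.2)

end Setup

structure TrState (P : Params) where
  /-- data read from each BB node -/
  got : Fin P.Nb → Option (VoteSet P × CodeTable P) := fun _ => none
  done : Bool := false

/-- A trustee accepts the data that `fb + 1` BB nodes agree on. It posts its shares of the openings
of all commitments that lie outside voted ballot parts, and its share of the opening of the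
total of the tally set. -/
def Setup.trRecv (S : Setup C k) (t : Fin P.Nt) (st : TrState P) (src : Party P) (x : Msg C k) :
    TrState P × Outbox C k :=
  match src, x with
  | .bb b, .bbData Q D =>
      if st.got b = none then
        let got := Function.update st.got b (some (Q, D))
        if st.done = false ∧
            P.fb + 1 ≤ (Finset.univ.filter fun c => got c = some (Q, D)).card then
          ({ got := got, done := true }, toBBs (.opening
            (fun s l => if ∃ p, (s, (l.1, p)) ∈ tallySet Q D then none else some (S.tshare s l t))
            (∑ y ∈ tallySet Q D, S.tshare y.1 y.2 t)))
        else ({ st with got := got }, [])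
      else (st, [])
  | _, _ => (st, [])

/-! ## Honest voters -/

structure VoterState (P : Params) where
  /-- chosen ballot part and option -/
  choice : Option (Line P) := none
  contacted : Finset (Fin P.Nv) := ∅
  answered : Finset (Fin P.Nv) := ∅
  /-- a valid receipt has been received -/
  ok : Bool := false

/-- The voter compares the (first) answer of a VC node she has contacted with the receipt printed
next to the vote code she has cast. -/
def Setup.voterRecv (S : Setup C k) (v : Fin P.n) (st : VoterState P) (src : Party P)
    (x : Msg C k) : VoterState P :=
  match src, x, st.choice with
  | .vc i, .receipt r, some c =>
      if i ∈ st.contacted ∧ i ∉ st.answered then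
        { st with answered := insert i st.answered, ok := st.ok || decide (r = S.rcpt v c) }
      else st
  | _, _, _ => st

/-! ## The whole system, driven by the adversary -/

structure Sys (C : Prims P) (k : ℕ) where
  vc : Fin P.Nv → VCState C k := fun _ => {}
  bb : Fin P.Nb → BBState C k := fun _ => {}
  tr : Fin P.Nt → TrState P := fun _ => {}
  voter : Fin P.n → VoterState P := fun _ => {}
  /-- values decided by the binary consensus instances, one per ballot -/
  bc : Fin P.n → Option Bool := fun _ => none
  /-- everything sent by honest parties -/
  sent : List (Envelope C k) := []
  /-- what the adversary has delivered to honest parties -/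
  delivered : List (Envelope C k) := []
  /-- messages sent and not yet read by the adversary -/
  unread : List (Envelope C k) := []

/-- Adversarial actions: deliver a message; advance the internal clock of a VC node; fix the part
and option of an honest voter; make an honest voter send her vote code to a VC node she has not
contacted before; fix the value of a binary consensus instance; let it return at a VC node. -/
inductive Act (C : Prims P) (k : ℕ) : Type
  | deliver (e : Envelope C k)
  | tick (i : Fin P.Nv)
  | engage (v : Fin P.n) (c : Line P)
  | contact (v : Fin P.n) (i : Fin P.Nv)
  | bcFix (s : Fin P.n) (b : Bool)
  | bcReturn (s : Fin P.n) (i : Fin P.Nv)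

instance : Bits (Act C k) :=
  Bits.ofInjective
    (β := Envelope C k ⊕ Fin P.Nv ⊕ (Fin P.n × Line P) ⊕ (Fin P.n × Fin P.Nv) ⊕
      (Fin P.n × Bool) ⊕ (Fin P.n × Fin P.Nv))
    (fun
      | .deliver e => .inl e
      | .tick i => .inr (.inl i)
      | .engage v c => .inr (.inr (.inl (v, c)))
      | .contact v i => .inr (.inr (.inr (.inl (v, i))))
      | .bcFix s b => .inr (.inr (.inr (.inr (.inl (s, b)))))
      | .bcReturn s i => .inr (.inr (.inr (.inr (.inr (s, i))))))
    (by rintro (_ | _ | _ | _ | _ | _) (_ | _ | _ | _ | _ | _) h <;> simp_all)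

def Sys.emit (y : Sys C k) (src : Party P) (out : Outbox C k) : Sys C k :=
  let es : List (Envelope C k) := out.map fun o => (src, o.1, o.2)
  { y with sent := y.sent ++ es, unread := y.unread ++ es }

namespace Setup

variable (S : Setup C k) (K : Corruption P)

/-- Delivery of an envelope to an honest receiver. -/
def receive (y : Sys C k) (e : Envelope C k) : Sys C k :=
  let y' : Sys C k := { y with delivered := e :: y.delivered }
  match e with
  | (src, .vc i, x) =>
      let r := S.vcRecv i (y.vc i) src x
      Sys.emit { y' with vc := Function.update y.vc i r.1 } (.vc i) r.2
  | (src, .bb b, x) =>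
      let r := S.bbRecv (y.bb b) src x
      Sys.emit { y' with bb := Function.update y.bb b r.1 } (.bb b) r.2
  | (src, .tr t, x) =>
      let r := S.trRecv t (y.tr t) src x
      Sys.emit { y' with tr := Function.update y.tr t r.1 } (.tr t) r.2
  | (src, .voter v, x) =>
      { y' with voter := Function.update y.voter v (S.voterRecv v (y.voter v) src x) }
  | (_, .env, _) => y'

/-- Effect of an adversarial action. Channels are authenticated: a message is accepted from an
honest sender only if that sender has sent it to the receiver. Binary consensus is represented by
the most general behaviour its definition allows: the adversary fixes the common value of an
instance, which must be the opinion of some honest node that has entered the instance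
(agreement, validity), and the moments at which the nodes learn it. -/
def exec (y : Sys C k) : Act C k → Sys C k
  | .deliver e =>
      if (K.Bad e.1 ∨ e ∈ y.sent) ∧ ¬ K.Bad e.2.1 then S.receive y e else y
  | .tick i =>
      if i ∈ K.vcs then y else
        let r := S.vcTick i (y.vc i)
        Sys.emit { y with vc := Function.update y.vc i r.1 } (.vc i) r.2
  | .engage v c =>
      if v ∉ K.voters ∧ (y.voter v).choice = none then
        { y with voter := Function.update y.voter v { y.voter v with choice := some c } }
      else y
  | .contact v i =>
      match (y.voter v).choice with
      | some c =>
          if v ∉ K.voters ∧ (y.voter v).ok = false ∧ i ∉ (y.voter v).contacted then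
            let st' : VoterState P :=
              { y.voter v with contacted := insert i (y.voter v).contacted }
            Sys.emit { y with voter := Function.update y.voter v st' } (.voter v) [(.vc i, .vote v (S.code v c))]
          else y
      | none => y
  | .bcFix s b =>
      if y.bc s = none ∧ ∃ i, i ∉ K.vcs ∧ ((y.vc i).ballot s).entered = some b then
        { y with bc := Function.update y.bc s (some b) }
      else y
  | .bcReturn s i =>
      match y.bc s with
      | some b =>
          if i ∈ K.vcs then y else
            let r := S.vcDecide i (y.vc i) s b
            Sys.emit { y with vc := Function.update y.vc i r.1 } (.vc i) r.2
      | none => y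

/-- One round: the action is executed, and the adversary reads the next unread message. -/
def react (y : Sys C k) (a : Option (Act C k)) : Sys C k × Option (Envelope C k) :=
  let y' := match a with
    | some a => S.exec K y a
    | none => y
  ({ y' with unread := y'.unread.tail }, y'.unread.head?)

end Setup

/-! ## The adversary -/

/-- Public keys. -/
abbrev KeyView (C : Prims P) (k : ℕ) : Type :=
  Word (C.hash.keyLen k) × Word (C.sig.vkLen k) × (Fin P.Nv → Word (C.sig.vkLen k)) × C.grp.G k

/-- BB initialization data, which is public. -/
abbrev BBView (C : Prims P) (k : ℕ) : Type :=
  (Word (C.hash.digLen k) × Word 64) × (Fin P.n → Line P → Word C.sym.ctLen) ×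
  (Fin P.n → Line P → Fin P.m →
    (C.grp.G k × C.grp.G k) × (Fin (P.ht - 1) → C.grp.G k × C.grp.G k))

/-- Initialization data of a VC node: signing key, master key share, and for every line the hash
commitment, the salt, and the receipt share. -/
abbrev VCView (C : Prims P) (k : ℕ) : Type :=
  Word (C.sig.skLen k) × (Word 128 × Sg C k) ×
  (Fin P.n → Line P → Word (C.hash.digLen k) × Word 64 × (Word 64 × Sg C k))

/-- Initialization data of a trustee. -/
abbrev TrView (C : Prims P) (k : ℕ) : Type := Fin P.n → Line P → OpenShare C k

/-- A ballot, by part and option: vote codes and receipts. -/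
abbrev BallotView (P : Params) : Type := Line P → Word 128 × Word 64

/-- Input of the adversary. -/
abbrev View (C : Prims P) (k : ℕ) : Type :=
  (KeyView C k × BBView C k) × (Fin P.Nv → Option (VCView C k)) ×
  (Fin P.Nt → Option (TrView C k)) × (Fin P.n → Option (BallotView P))

/-- The adversary gets the public data and the initialization data of the corrupted parties. -/
def Setup.view (S : Setup C k) (K : Corruption P) : View C k :=
  (((S.hk, S.eaVk, S.vk, S.ck),
    ((S.hmsk, S.saltM), S.ct, fun s l o => (S.com₀ s l o, S.comC s l o))),
   (fun i => if i ∈ K.vcs then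
      some (S.sk i, (S.kshare i, S.kshareSig i), fun s l =>
        (S.row s l, S.salt s l, (S.rshare s l i, S.rshareSig s l i))) else none),
   (fun t => if t ∈ K.trs then some fun s l => S.tshare s l t else none),
   (fun v => if v ∈ K.voters then some fun c => (S.code v c, S.rcpt v c) else none))

structure Adversary (C : Prims P) (k : ℕ) where
  corr : Corruption P
  alg : Machine (View C k) (Act C k) (Option (Envelope C k))

/-- Final state of a run. -/
def Adversary.run (A : Adversary C k) (ω : Setup C k × A.alg.Coins) : Sys C k :=
  A.alg.play (ω.1.view A.corr) (ω.1.react A.corr) {} ω.2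

/-! ## The safety contract -/

def Party.IsServer : Party P → Prop
  | .vc _ | .bb _ | .tr _ => True
  | _ => False

/-- The run is complete: the election has ended at all honest VC nodes, all messages between
honest servers have been delivered, and binary consensus has terminated (it returns at all honest
nodes if all of them have entered). -/
def Sys.Complete (y : Sys C k) (K : Corruption P) : Prop :=
  (∀ i, i ∉ K.vcs → (y.vc i).Ended) ∧
  (∀ e ∈ y.sent, e.1.IsServer → e.2.1.IsServer → ¬ K.Bad e.2.1 → e ∈ y.delivered) ∧
  (∀ s, (∀ i, i ∉ K.vcs → ((y.vc i).ballot s).entered.isSome) →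
    ∀ i, i ∉ K.vcs → ((y.vc i).ballot s).decided.isSome)

/-- Number of votes for option `o` in a vote set. -/
def Setup.votesFor (S : Setup C k) (Q : VoteSet P) (o : Fin P.m) : ℕ :=
  (Finset.univ.filter fun s => ∃ X, Q s = some (S.code s (X, o))).card

/-- The vote `c` of voter `v` is published at a BB node and counted there: a published vote set
contains it, a published result is the count of a published vote set, and in a complete run both
have been published. -/
def Recorded (S : Setup C k) (v : Fin P.n) (c : Line P) (st : BBState C k) (complete : Prop) :
    Prop :=
  (∀ Q, st.pub = some Q → Q v = some (S.code v c)) ∧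
  (∀ R, st.result = some R → ∃ Q, st.pub = some Q ∧ ∀ o, (R o).val = S.votesFor Q o) ∧
  (complete → st.pub.isSome ∧ st.result.isSome)

/-- Every honest voter who has received a valid receipt has her vote recorded at all honest BB
nodes. -/
def Safe (S : Setup C k) (K : Corruption P) (y : Sys C k) : Prop :=
  ∀ v, v ∉ K.voters → (y.voter v).ok = true → ∃ c, (y.voter v).choice = some c ∧
    ∀ b, b ∉ K.bbs → Recorded S v c (y.bb b) (y.Complete K)

end System

end DDemos

end

/-!
A run is safe unless one of four events occurs: a valid endorsement of an honest VC node is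
delivered that the node never gives (`ForgesVC`); a wrong share of `msk` with a valid signature of
the election authority is delivered (`ForgesEA`); the hash function collides (`Collides`); or a
corrupted VC node tells an honest voter her receipt although fewer than `Nv - fv` VC nodes are
corrupted or have disclosed their shares of it (`Guesses`).

*Safety without these events* (`safe_of_not`). The invariants `SysInv` hold along every run. An
honest VC node endorses one vote code per ballot and two quorums of `Nv - fv` nodes have an honest
node in common, so there is at most one certified vote code per ballot (`SysInv.used_eq`). A valid
receipt implies that a quorum has disclosed shares of it, hence has adopted the vote code before the
end of the election; then one of any `Nv - fv` announcements contains it, no honest node enters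
consensus with opinion 0, and every honest vote set contains the vote code
(`SysInv.voteSet_of_quorum`). The rest of safety, and the termination of complete runs, follow by
counting honest servers (`safe_of_inv`).

*Forgeries.* An adversary that forges with noticeable probability gives a circuit that attacks the
signature scheme. The vote codes that a given honest node endorses, the round of the forgery and the
message are guessed, at the cost of a polynomial factor (`negligible_of_guess`), and all randomness
but that of one signer is fixed as favourably as possible (`exists_prob_le`). The attack then
consists of fixed signing queries followed by one circuit (`SigScheme.EUFCMA.static`), which has to
compute the run from the key and the signatures. The definition of the system gives no circuits for
its servers, but a server uses a signature only by storing it, sending it and verifying it. So a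
state is described by its *slices* (`Sliced`): for each bit position, the bits at that position of
all signatures and scalars, along with all verdicts of verification on them. A slice is one of
boundedly many possibilities, and the same slice of the next state depends only on it and on the
same slice of the received data: two states with equal slices are related (`SysRel`), and related
states have related successors (`exec_rel`). A truth table of bounded size therefore
computes a round at each position, and together with the circuits of the adversary and of the
verification algorithm these compute the run (`Sim.exists_circuit`, `Forging.negligible`).

*Collisions* are negligible since only boundedly many inputs can be hashed
(`negligible_collides`).

*Guesses.* Let `D` be the set of nodes that are corrupted or have disclosed their shares when the
receipt is guessed. It has fewer than `Nv - fv` elements, so the receipt can be shifted by any `δ`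
without a change of the shares of the nodes in `D`, by adding to the sharing polynomial one that
vanishes at their points (`Setup.shift`). The run up to that moment stays the same as long as the
new receipt is none of the answers of corrupted nodes to the voter (`Cheats.conf_eq`). A voter
considers one answer of each node, which leaves at least `2 ^ 64 - fv` values of the receipt for
which the run is the same, and one of them is guessed. Summing over honest voters and corrupted
nodes gives `n * fv / (2 ^ 64 - fv)` (`prob_guesses_le`).
-/

open scoped Classical

noncomputable section

namespace DDemos

section

/-! ### Complexity of families of Boolean functions -/

/-- Lists of gates, given by their two input wires. -/
abbrev Gates (I : Type) : Type := List ((I ⊕ ℕ) × (I ⊕ ℕ))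

/-- Values of all gates of a gate list, in order. -/
def gateVals {I : Type} (x : I → Bool) (G : Gates I) : List Bool :=
  G.foldl (fun ws g => ws ++ [!(Circuit.read x ws g.1 && Circuit.read x ws g.2)]) []

theorem gateVals_concat {I : Type} (x : I → Bool) (G : Gates I)
    (g : (I ⊕ ℕ) × (I ⊕ ℕ)) :
    gateVals x (G ++ [g]) = gateVals x G ++
      [!(Circuit.read x (gateVals x G) g.1 && Circuit.read x (gateVals x G) g.2)] := by
  simp [gateVals]

theorem gateVals_length {I : Type} (x : I → Bool) (G : Gates I) :
    (gateVals x G).length = G.length := by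
  induction G using List.reverseRecOn with
  | nil => rfl
  | append_singleton G g ih => simp [gateVals_concat, ih]

theorem gateVals_append {I : Type} (x : I → Bool) (G H : Gates I) :
    ∃ W, gateVals x (G ++ H) = gateVals x G ++ W := by
  induction H using List.reverseRecOn with
  | nil => exact ⟨[], by simp⟩
  | append_singleton H g ih =>
    obtain ⟨W, hW⟩ := ih
    rw [← List.append_assoc, gateVals_concat, hW]
    exact ⟨_, List.append_assoc _ _ _⟩

/-- A wire reference is valid for a list of `n` gates. -/
def ValidRef {I : Type} (n : ℕ) (r : I ⊕ ℕ) : Prop := ∀ j, r = .inr j → j < n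

theorem ValidRef.mono {I : Type} {n n' : ℕ} {r : I ⊕ ℕ} (h : ValidRef n r) (hn : n ≤ n') :
    ValidRef n' r := fun j hj => (h j hj).trans_le hn

theorem read_append {I : Type} (x : I → Bool) (W W' : List Bool) (r : I ⊕ ℕ)
    (h : ValidRef W.length r) : Circuit.read x (W ++ W') r = Circuit.read x W r := by
  rcases r with i | j
  · rfl
  · simp [Circuit.read, List.getElem?_append_left (h j rfl)]

section Cost

variable {X I : Type} (inp : X → I → Bool)

/-- The predicate `f` of the object `x`, which is presented by the input bits `inp x`, is the value
of a wire of the gate list `G`. -/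
def CompBy (G : Gates I) (f : X → Prop) : Prop :=
  ∃ r : I ⊕ ℕ, ValidRef G.length r ∧
    ∀ x, Circuit.read (inp x) (gateVals (inp x) G) r = true ↔ f x

/-- Every gate list can be extended by at most `n` gates so that all the predicates `f t` become
available. -/
def CostAll {T : Type} (f : T → X → Prop) (n : ℕ) : Prop :=
  ∀ G, ∃ H : Gates I, H.length ≤ n ∧ ∀ t, CompBy inp (G ++ H) (f t)

/-- The predicate `f` can be computed with at most `n` additional gates. -/
def Cost (f : X → Prop) (n : ℕ) : Prop := CostAll inp (fun _ : Unit => f) n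

variable {inp}

theorem CompBy.append {G : Gates I} {f : X → Prop} (h : CompBy inp G f)
    (H : Gates I) : CompBy inp (G ++ H) f := by
  obtain ⟨r, hr, h⟩ := h
  refine ⟨r, hr.mono (by simp), fun x => ?_⟩
  obtain ⟨W, hW⟩ := gateVals_append (inp x) G H
  rw [hW, read_append _ _ _ _ (by rwa [gateVals_length]), h]

theorem CompBy.nand {G : Gates I} {f g : X → Prop} (hf : CompBy inp G f)
    (hg : CompBy inp G g) : ∃ a, CompBy inp (G ++ [a]) (fun x => ¬ (f x ∧ g x)) := by
  obtain ⟨r, hr, hf⟩ := hf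
  obtain ⟨s, hs, hg⟩ := hg
  refine ⟨(r, s), .inr G.length, fun j hj => ?_, fun x => ?_⟩
  · cases hj; simp
  · have hl := gateVals_length (inp x) G
    have hf := hf x
    have hg := hg x
    simp only [gateVals_concat, ← hf, ← hg]
    rw [Circuit.read, Sum.elim_inr, ← hl]
    cases Circuit.read (inp x) (gateVals (inp x) G) r <;> simp

theorem Cost.mono {f : X → Prop} {n m : ℕ} (h : Cost inp f n) (hnm : n ≤ m) : Cost inp f m :=
  fun G => let ⟨H, hH, h⟩ := h G; ⟨H, hH.trans hnm, h⟩

theorem CostAll.mono {T : Type} {f : T → X → Prop} {n m : ℕ} (h : CostAll inp f n) (hnm : n ≤ m) :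
    CostAll inp f m :=
  fun G => let ⟨H, hH, h⟩ := h G; ⟨H, hH.trans hnm, h⟩

theorem Cost.congr {f g : X → Prop} {n : ℕ} (h : Cost inp f n) (hfg : ∀ x, f x ↔ g x) :
    Cost inp g n := by
  obtain rfl : f = g := funext fun x => propext (hfg x)
  exact h

theorem Cost.input (i : I) : Cost inp (fun x => inp x i = true) 0 :=
  fun _ => ⟨[], le_rfl, fun _ => ⟨.inl i, (fun _ h => nomatch h), fun _ => Iff.rfl⟩⟩

theorem Cost.nand {f g : X → Prop} {n m : ℕ} (hf : Cost inp f n) (hg : Cost inp g m) :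
    Cost inp (fun x => ¬ (f x ∧ g x)) (n + m + 1) := by
  intro G
  obtain ⟨H, hH, h⟩ := hf G
  obtain ⟨H', hH', h'⟩ := hg (G ++ H)
  obtain ⟨a, ha⟩ := ((h ()).append H').nand (h' ())
  exact ⟨H ++ (H' ++ [a]), by simp; omega, fun _ => by simpa using ha⟩

theorem Cost.not {f : X → Prop} {n : ℕ} (hf : Cost inp f n) :
    Cost inp (fun x => ¬ f x) (n + 1) := by
  intro G
  obtain ⟨H, hH, h⟩ := hf G
  obtain ⟨a, ha⟩ := (h ()).nand (h ())
  exact ⟨H ++ [a], by simp; omega, fun _ => by simpa using ha⟩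

theorem Cost.true : Cost inp (fun _ => True) 1 := by
  intro G
  -- a gate that reads itself reads `false` twice
  refine ⟨[(.inr G.length, .inr G.length)], le_rfl, fun _ => ⟨.inr G.length, ?_, fun x => ?_⟩⟩
  · intro j hj; cases hj; simp
  · have hl := gateVals_length (inp x) G
    rw [gateVals_concat, ← hl]
    simp [Circuit.read]

theorem Cost.const (p : Prop) : Cost inp (fun _ => p) 2 := by
  by_cases hp : p
  · exact (Cost.true.mono (by norm_num)).congr fun _ => by simp [hp]
  · exact Cost.true.not.congr fun _ => by simp [hp]

theorem Cost.and {f g : X → Prop} {n m : ℕ} (hf : Cost inp f n) (hg : Cost inp g m) :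
    Cost inp (fun x => f x ∧ g x) (n + m + 2) :=
  (hf.nand hg).not.congr fun _ => by tauto

theorem Cost.or {f g : X → Prop} {n m : ℕ} (hf : Cost inp f n) (hg : Cost inp g m) :
    Cost inp (fun x => f x ∨ g x) (n + m + 3) :=
  ((hf.not.nand hg.not).mono (by omega)).congr fun _ => by tauto

theorem Cost.exists {T : Type} [Fintype T] {f : T → X → Prop} {n : ℕ}
    (hf : ∀ t, Cost inp (f t) n) :
    Cost inp (fun x => ∃ t, f t x) (Fintype.card T * (n + 3) + 2) := by
  suffices ∀ s : Finset T, Cost inp (fun x => ∃ t ∈ s, f t x) (s.card * (n + 3) + 2) by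
    exact (this Finset.univ).congr fun _ => by simp
  intro s
  induction s using Finset.induction_on with
  | empty => exact ((Cost.const False).mono (by omega)).congr fun _ => by simp
  | insert a s ha ih =>
    refine (((hf a).or ih).mono ?_).congr fun _ => by simp
    rw [Finset.card_insert_of_notMem ha]
    ring_nf; omega

theorem CostAll.of_forall {T : Type} [Fintype T] {f : T → X → Prop} {n : ℕ}
    (hf : ∀ t, Cost inp (f t) n) : CostAll inp f (Fintype.card T * n) := by
  suffices ∀ s : Finset T, ∀ G, ∃ H : Gates I, H.length ≤ s.card * n ∧
      ∀ t ∈ s, CompBy inp (G ++ H) (f t) from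
    fun G => let ⟨H, h1, h2⟩ := this Finset.univ G; ⟨H, h1, fun t => h2 t (Finset.mem_univ t)⟩
  intro s G
  induction s using Finset.induction_on with
  | empty => exact ⟨[], by simp, by simp⟩
  | insert a s ha ih =>
    obtain ⟨H, hH, h⟩ := ih
    obtain ⟨H', hH', h'⟩ := hf a (G ++ H)
    refine ⟨H ++ H', ?_, fun t ht => ?_⟩
    · rw [Finset.card_insert_of_notMem ha, add_mul, List.length_append]; omega
    · rw [← List.append_assoc]
      rcases Finset.mem_insert.mp ht with rfl | ht
      · exact h' ()
      · exact (h t ht).append H'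

/-- Bits that are constants or inputs cost nothing but the two constants, however many they are. -/
theorem CostAll.of_atomic {T : Type} {f : T → X → Prop}
    (hf : ∀ t, (∃ i, ∀ x, f t x ↔ inp x i = true) ∨ ∃ p : Prop, ∀ x, f t x ↔ p) :
    CostAll inp f 3 := by
  intro G
  obtain ⟨H, hH, h⟩ := Cost.true (inp := inp) G
  obtain ⟨a, ha⟩ := (h ()).nand (h ())
  refine ⟨H ++ [a], by simp; omega, fun t => ?_⟩
  rcases hf t with ⟨i, hi⟩ | ⟨p, hp⟩
  · exact ⟨.inl i, (fun _ h => nomatch h), fun x => (hi x).symm⟩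
  · by_cases hpp : p
    · have : f t = fun _ => True := funext fun x => by simp [hp, hpp]
      rw [this, ← List.append_assoc]
      exact (h ()).append [a]
    · have : f t = fun _ => ¬ (True ∧ True) := funext fun x => by simp [hp, hpp]
      rw [this, ← List.append_assoc]
      exact ha

/-- Running a circuit on bits that are available. -/
theorem CostAll.eval {J O : Type} {b : X → J → Bool} {n : ℕ}
    (hb : CostAll inp (fun j x => b x j = true) n) (C : Circuit J O) :
    CostAll inp (fun o x => C.eval (b x) o = true) (n + C.size + 2) := by
  intro G
  obtain ⟨H, hH, h⟩ := hb G
  choose ρ hρ hb using h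
  let sub : J ⊕ ℕ → I ⊕ ℕ := Sum.elim ρ fun j => .inr ((G ++ H).length + j)
  let K : Gates I := C.gates.map fun g => (sub g.1, sub g.2)
  have hread : ∀ x (W : List Bool) r,
      Circuit.read (inp x) (gateVals (inp x) (G ++ H) ++ W) (sub r) = Circuit.read (b x) W r := by
    intro x W r
    rcases r with j | j
    · have h1 := hb j x
      simp only [sub, Sum.elim_inl]
      rw [read_append _ _ _ _ (by rw [gateVals_length]; exact hρ j)]
      rw [Bool.eq_iff_iff, h1]
      rfl
    · have hl := gateVals_length (inp x) (G ++ H)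
      simp only [sub, Sum.elim_inr, Circuit.read]
      rw [← hl, List.getD_append_right _ _ _ _ (by omega)]
      simp
  have key : ∀ x (L : Gates J),
      gateVals (inp x) (G ++ H ++ L.map fun g => (sub g.1, sub g.2)) =
        gateVals (inp x) (G ++ H) ++ gateVals (b x) L := by
    intro x L
    induction L using List.reverseRecOn with
    | nil => simp [gateVals]
    | append_singleton L g ih =>
      rw [List.map_append, ← List.append_assoc]
      simp only [List.map_cons, List.map_nil]
      rw [gateVals_concat, ih, gateVals_concat, hread, hread, List.append_assoc]
  -- an output that refers to no gate reads `false`, which is provided separately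
  obtain ⟨F, hF, hF'⟩ := Cost.const (inp := inp) False (G ++ H ++ K)
  have hKl : K.length = C.size := by simp [K, Circuit.size]
  refine ⟨H ++ (K ++ F), by simp; omega, fun o => ?_⟩
  have e : G ++ (H ++ (K ++ F)) = G ++ H ++ K ++ F := by simp
  rw [e]
  have hev : ∀ x, C.eval (b x) o = Circuit.read (b x) (gateVals (b x) C.gates) (C.out o) :=
    fun x => rfl
  by_cases hv : ValidRef C.size (C.out o)
  · refine CompBy.append ⟨sub (C.out o), ?_, fun x => ?_⟩ F
    · intro j hj
      rcases ho : C.out o with i | i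
      · rw [ho] at hj
        exact (hρ i j hj).trans_le (by simp)
      · rw [ho] at hj
        cases hj
        have := hv i ho
        simp only [List.length_append] at this ⊢
        omega
    · rw [show gateVals (inp x) (G ++ H ++ K) = _ from key x C.gates, hread, ← hev]
  · have : (fun x => C.eval (b x) o = true) = fun _ => False := by
      funext x
      rw [hev]
      simp only [ValidRef, not_forall] at hv
      obtain ⟨j, hj, hlt⟩ := hv
      have hl : (gateVals (b x) C.gates).length = C.size := gateVals_length _ _
      rw [hj, Circuit.read]
      simp [List.getElem?_eq_none (show (gateVals (b x) C.gates).length ≤ j by omega)]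
    have h2 := hF' ()
    simp only at h2 ⊢
    rwa [this]

theorem CostAll.circuit {O : Type} {f : O → X → Prop} {n : ℕ} (h : CostAll inp f n) :
    ∃ C : Circuit I O, C.size ≤ n ∧ ∀ x o, C.eval (inp x) o = true ↔ f o x := by
  obtain ⟨H, hH, h⟩ := h []
  choose r _ h using h
  refine ⟨⟨[] ++ H, r⟩, by simpa [Circuit.size] using hH, fun x o => h o x⟩

end Cost

/-! ### Polynomial bounds -/

/-- `s` is bounded by a polynomial in `κ`. -/
def PolyBd {ι : Type} (κ s : ι → ℕ) : Prop := ∃ p : Polynomial ℕ, ∀ i, s i ≤ p.eval (κ i)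

section PolyBd

variable {ι : Type} {κ s t : ι → ℕ}

theorem PolyBd.const (c : ℕ) : PolyBd κ fun _ => c := ⟨Polynomial.C c, fun _ => by simp⟩

theorem PolyBd.mono (h : PolyBd κ t) (hst : ∀ i, s i ≤ t i) : PolyBd κ s :=
  let ⟨p, hp⟩ := h; ⟨p, fun i => (hst i).trans (hp i)⟩

theorem PolyBd.add (hs : PolyBd κ s) (ht : PolyBd κ t) : PolyBd κ fun i => s i + t i :=
  let ⟨p, hp⟩ := hs; let ⟨q, hq⟩ := ht
  ⟨p + q, fun i => by rw [Polynomial.eval_add]; exact add_le_add (hp i) (hq i)⟩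

theorem PolyBd.mul (hs : PolyBd κ s) (ht : PolyBd κ t) : PolyBd κ fun i => s i * t i :=
  let ⟨p, hp⟩ := hs; let ⟨q, hq⟩ := ht
  ⟨p * q, fun i => by rw [Polynomial.eval_mul]; exact Nat.mul_le_mul (hp i) (hq i)⟩

theorem PolyBd.comp {s : ℕ → ℕ} (h : PolyBounded s) (κ : ι → ℕ) : PolyBd κ fun i => s (κ i) :=
  let ⟨p, hp⟩ := h; ⟨p, fun i => hp (κ i)⟩

theorem PolyBounded.polyBd {s : ℕ → ℕ} (h : PolyBounded s) : PolyBd (fun k => k) s := h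

end PolyBd

/-! ### Predicates computed by circuits of polynomial size -/

/-- A family of sets `X i` of objects presented by input bits, with a size parameter `κ i`. -/
structure Fam where
  ι : Type
  κ : ι → ℕ
  X : ι → Type
  I : ι → Type
  inp : ∀ i, X i → I i → Bool

namespace Fam

variable (𝓕 : Fam)

/-- Families of predicates of the objects. -/
abbrev Pred (J : 𝓕.ι → Type) : Type := ∀ i, J i → 𝓕.X i → Prop

/-- The predicates `φ i j` of objects in `X i` are computed by circuits of size polynomial in `κ i`,
uniformly in `j`. -/
def Easy {J : 𝓕.ι → Type} (φ : 𝓕.Pred J) : Prop :=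
  ∃ s : 𝓕.ι → ℕ, PolyBd 𝓕.κ s ∧ ∀ i j, Cost (𝓕.inp i) (φ i j) (s i)

/-- As `Easy`, but all the predicates `φ i j t` for `t : T i j` are computed by a single circuit. -/
def EasyAll {J : 𝓕.ι → Type} {T : ∀ i, J i → Type} (φ : ∀ i j, T i j → 𝓕.X i → Prop) : Prop :=
  ∃ s : 𝓕.ι → ℕ, PolyBd 𝓕.κ s ∧ ∀ i j, CostAll (𝓕.inp i) (φ i j) (s i)

variable {𝓕} {J L : 𝓕.ι → Type}

theorem Easy.congr {φ ψ : 𝓕.Pred J} (h : 𝓕.Easy φ)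
    (hφ : ∀ i j x, φ i j x ↔ ψ i j x) : 𝓕.Easy ψ :=
  let ⟨s, hs, h⟩ := h; ⟨s, hs, fun i j => (h i j).congr (hφ i j)⟩

theorem Easy.reindex {φ : 𝓕.Pred J} (h : 𝓕.Easy φ) (f : ∀ i, L i → J i) :
    𝓕.Easy fun i l x => φ i (f i l) x :=
  let ⟨s, hs, h⟩ := h; ⟨s, hs, fun i l => h i (f i l)⟩

theorem Easy.input (w : ∀ i, J i → 𝓕.I i) : 𝓕.Easy fun i j x => 𝓕.inp i x (w i j) = true :=
  ⟨fun _ => 0, .const 0, fun i j => .input (w i j)⟩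

theorem Easy.const (p : ∀ i, J i → Prop) : 𝓕.Easy fun i j _ => p i j :=
  ⟨fun _ => 2, .const 2, fun i j => .const (p i j)⟩

theorem Easy.not {φ : 𝓕.Pred J} (h : 𝓕.Easy φ) : 𝓕.Easy fun i j x => ¬ φ i j x :=
  let ⟨_, hs, h⟩ := h; ⟨_, hs.add (.const 1), fun i j => (h i j).not⟩

theorem Easy.and {φ ψ : 𝓕.Pred J} (h : 𝓕.Easy φ) (h' : 𝓕.Easy ψ) :
    𝓕.Easy fun i j x => φ i j x ∧ ψ i j x :=
  let ⟨_, hs, h⟩ := h; let ⟨_, hs', h'⟩ := h'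
  ⟨_, (hs.add hs').add (.const 2), fun i j => (h i j).and (h' i j)⟩

theorem Easy.or {φ ψ : 𝓕.Pred J} (h : 𝓕.Easy φ) (h' : 𝓕.Easy ψ) :
    𝓕.Easy fun i j x => φ i j x ∨ ψ i j x :=
  let ⟨_, hs, h⟩ := h; let ⟨_, hs', h'⟩ := h'
  ⟨_, (hs.add hs').add (.const 3), fun i j => (h i j).or (h' i j)⟩

/-- Polynomially bounded existential quantifiers. -/
theorem Easy.exists [∀ i, Fintype (L i)] (hL : PolyBd 𝓕.κ fun i => Fintype.card (L i))
    {φ : ∀ i, J i → L i → 𝓕.X i → Prop}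
    (h : 𝓕.Easy (J := fun i => J i × L i) fun i j x => φ i j.1 j.2 x) :
    𝓕.Easy fun i j x => ∃ l, φ i j l x :=
  let ⟨_, hs, h⟩ := h
  ⟨_, (hL.mul (hs.add (.const 3))).add (.const 2), fun i j => .exists fun l => h i (j, l)⟩

theorem Easy.forall [∀ i, Fintype (L i)] (hL : PolyBd 𝓕.κ fun i => Fintype.card (L i))
    {φ : ∀ i, J i → L i → 𝓕.X i → Prop}
    (h : 𝓕.Easy (J := fun i => J i × L i) fun i j x => φ i j.1 j.2 x) :
    𝓕.Easy fun i j x => ∀ l, φ i j l x :=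
  (Easy.exists hL (φ := fun i j l x => ¬ φ i j l x) h.not).not.congr fun i j x => by simp

/-- A predicate that is determined by a bounded number of easy bits is easy: a truth table of
bounded size computes it. -/
theorem Easy.of_local {T : Type} [Finite T] {β : ∀ i, J i → T → 𝓕.X i → Prop}
    (hβ : 𝓕.Easy (J := fun i => J i × T) fun i j x => β i j.1 j.2 x)
    {φ : 𝓕.Pred J}
    (h : ∀ i j x x', (∀ t, β i j t x ↔ β i j t x') → φ i j x → φ i j x') : 𝓕.Easy φ := by
  have := Fintype.ofFinite T
  have h1 : 𝓕.Easy (J := fun i => (J i × (T → Prop)) × T)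
      fun i j x => (β i j.1.1 j.2 x ↔ j.1.2 j.2) := by
    have hb : 𝓕.Easy (J := fun i => (J i × (T → Prop)) × T)
        fun i (j : (J i × (T → Prop)) × T) x => β i j.1.1 j.2 x :=
      hβ.reindex fun i (j : (J i × (T → Prop)) × T) => (j.1.1, j.2)
    have hc : 𝓕.Easy (J := fun i => (J i × (T → Prop)) × T)
        fun i (j : (J i × (T → Prop)) × T) x => j.1.2 j.2 :=
      Easy.const fun i (j : (J i × (T → Prop)) × T) => j.1.2 j.2
    exact ((hb.and hc).or (hb.not.and hc.not)).congr fun i j x => by tauto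
  have h2 : 𝓕.Easy (J := fun i => J i × (T → Prop))
      fun i j x => ∀ t, (β i j.1 t x ↔ j.2 t) := Easy.forall (.const _) h1
  have h3 : 𝓕.Easy (J := fun i => J i × (T → Prop)) fun i j x =>
      (∃ x', (∀ t, β i j.1 t x' ↔ j.2 t) ∧ φ i j.1 x') ∧ ∀ t, (β i j.1 t x ↔ j.2 t) :=
    (Easy.const fun i j => ∃ x', (∀ t, β i j.1 t x' ↔ j.2 t) ∧ φ i j.1 x').and h2
  refine (Easy.exists (L := fun _ => T → Prop) (.const _)
    (φ := fun i j a x => (∃ x', (∀ t, β i j t x' ↔ a t) ∧ φ i j x') ∧ ∀ t, (β i j t x ↔ a t))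
    h3).congr fun i j x => ?_
  constructor
  · rintro ⟨a, ⟨x', h1, h2⟩, h3⟩
    exact h i j x' x (fun t => (h1 t).trans (h3 t).symm) h2
  · intro hx
    exact ⟨fun t => β i j t x, ⟨x, fun _ => Iff.rfl, hx⟩, fun _ => Iff.rfl⟩

theorem Easy.all {T : ∀ i, J i → Type} [∀ i j, Fintype (T i j)] {t : 𝓕.ι → ℕ}
    (ht : PolyBd 𝓕.κ t) (hT : ∀ i j, Fintype.card (T i j) ≤ t i)
    {φ : ∀ i j, T i j → 𝓕.X i → Prop}
    (h : 𝓕.Easy (J := fun i => Σ j, T i j) fun i (j : Σ j, T i j) x => φ i j.1 j.2 x) :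
    𝓕.EasyAll φ :=
  let ⟨_, hs, h⟩ := h
  ⟨_, ht.mul hs, fun i j =>
    (CostAll.of_forall fun l => h i ⟨j, l⟩).mono (Nat.mul_le_mul_right _ (hT i j))⟩

theorem EasyAll.of_atomic {T : ∀ i, J i → Type} {φ : ∀ i j, T i j → 𝓕.X i → Prop}
    (h : ∀ i j t, (∃ w, ∀ x, φ i j t x ↔ 𝓕.inp i x w = true) ∨ ∃ p : Prop, ∀ x, φ i j t x ↔ p) :
    𝓕.EasyAll φ :=
  ⟨_, .const 3, fun i j => .of_atomic (h i j)⟩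

theorem EasyAll.apply {T : ∀ i, J i → Type} {φ : ∀ i j, T i j → 𝓕.X i → Prop} (h : 𝓕.EasyAll φ)
    (f : ∀ i, L i → J i) (g : ∀ i l, T i (f i l)) :
    𝓕.Easy fun i l x => φ i (f i l) (g i l) x :=
  let ⟨s, hs, h⟩ := h
  ⟨s, hs, fun i l G => let ⟨H, h1, h2⟩ := h i (f i l) G; ⟨H, h1, fun _ => h2 (g i l)⟩⟩

/-- Composition with circuits of polynomial size. -/
theorem EasyAll.eval {T O : ∀ i, J i → Type} {b : ∀ i j, 𝓕.X i → T i j → Bool}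
    (h : 𝓕.EasyAll fun i j t x => b i j x t = true) {c : 𝓕.ι → ℕ} (hc : PolyBd 𝓕.κ c)
    (C : ∀ i j, Circuit (T i j) (O i j)) (hC : ∀ i j, (C i j).size ≤ c i) :
    𝓕.EasyAll fun i j o x => (C i j).eval (b i j x) o = true :=
  let ⟨_, hs, h⟩ := h
  ⟨_, (hs.add hc).add (.const 2), fun i j => ((h i j).eval (C i j)).mono (by
    have := hC i j; omega)⟩

theorem EasyAll.circuit {T : ∀ i, J i → Type} {φ : ∀ i j, T i j → 𝓕.X i → Prop}
    (h : 𝓕.EasyAll φ) : ∃ s : 𝓕.ι → ℕ, PolyBd 𝓕.κ s ∧ ∀ i j,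
      ∃ C : Circuit (𝓕.I i) (T i j), C.size ≤ s i ∧
        ∀ x t, C.eval (𝓕.inp i x) t = true ↔ φ i j t x :=
  let ⟨s, hs, h⟩ := h; ⟨s, hs, fun i j => (h i j).circuit⟩

end Fam

end

section

/-! ### Uniform probabilities and negligible functions -/

section Prob

variable {Ω Ω' Θ Z : Type} [Finite Ω] [Finite Ω'] [Finite Θ] [Finite Z]

theorem prob_nonneg (E : Ω → Prop) : 0 ≤ prob Ω E := by unfold prob; positivity

theorem prob_mono {E F : Ω → Prop} (h : ∀ ω, E ω → F ω) : prob Ω E ≤ prob Ω F := by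
  unfold prob
  gcongr
  exact_mod_cast Nat.card_le_card_of_injective (fun x : {ω // E ω} => (⟨x.1, h _ x.2⟩ : {ω // F ω}))
    fun a b hab => by simpa [Subtype.ext_iff] using hab

theorem prob_equiv (e : Ω ≃ Ω') (E : Ω' → Prop) : prob Ω (fun ω => E (e ω)) = prob Ω' E := by
  unfold prob
  rw [Nat.card_congr e, Nat.card_congr (e.subtypeEquiv (p := fun ω => E (e ω)) (q := E)
    fun _ => Iff.rfl)]

theorem prob_eq_sum [Fintype Ω] (E : Ω → Prop) :
    prob Ω E = (∑ ω, if E ω then (1 : ℝ) else 0) / Fintype.card Ω := by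
  unfold prob
  rw [Nat.card_eq_fintype_card, Nat.card_eq_fintype_card, Fintype.card_subtype]
  simp

theorem prob_or_le (E F : Ω → Prop) : prob Ω (fun ω => E ω ∨ F ω) ≤ prob Ω E + prob Ω F := by
  have := Fintype.ofFinite Ω
  rw [prob_eq_sum, prob_eq_sum, prob_eq_sum, ← add_div, ← Finset.sum_add_distrib]
  gcongr with ω
  by_cases h1 : E ω <;> by_cases h2 : F ω <;> simp [h1, h2]

theorem prob_exists_le {T : Type} [Fintype T] (E : T → Ω → Prop) :
    prob Ω (fun ω => ∃ t, E t ω) ≤ ∑ t, prob Ω (E t) := by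
  suffices ∀ s : Finset T, prob Ω (fun ω => ∃ t ∈ s, E t ω) ≤ ∑ t ∈ s, prob Ω (E t) by
    simpa using this Finset.univ
  intro s
  induction s using Finset.induction_on with
  | empty => simp [prob]
  | insert a s ha ih =>
    rw [Finset.sum_insert ha]
    refine (prob_mono fun ω h => ?_).trans
      ((prob_or_le (E a) fun ω => ∃ t ∈ s, E t ω).trans (add_le_add le_rfl ih))
    simpa using h

theorem one_sub_prob_le [Nonempty Ω] {E F : Ω → Prop} (h : ∀ ω, ¬ E ω → F ω) :
    1 - prob Ω E ≤ prob Ω F := by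
  have h1 : prob Ω (fun _ : Ω => True) = 1 := by
    have := Fintype.ofFinite Ω
    rw [prob_eq_sum]; simp
  have h2 := prob_or_le E F
  have h3 : prob Ω (fun _ : Ω => True) ≤ prob Ω (fun ω => E ω ∨ F ω) :=
    prob_mono fun ω _ => by by_cases hE : E ω <;> simp [hE, h]
  linarith

theorem prob_fst [Nonempty Z] (E : Ω → Prop) : prob (Ω × Z) (fun x => E x.1) = prob Ω E := by
  unfold prob
  have e : {x : Ω × Z // E x.1} ≃ {ω // E ω} × Z :=
    { toFun := fun x => (⟨x.1.1, x.2⟩, x.1.2)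
      invFun := fun y => ⟨(y.1.1, y.2), y.1.2⟩
      left_inv := fun _ => rfl
      right_inv := fun _ => rfl }
  rw [Nat.card_congr e, Nat.card_prod, Nat.card_prod]
  push_cast
  rw [mul_div_mul_right]
  exact_mod_cast Nat.card_pos.ne'

/-- Resampling a component: an event is at most as likely as in the best conditional experiment in
which everything but that component is fixed. -/
theorem exists_prob_le [Nonempty Ω] (get : Ω → Θ) (upd : Ω → Θ → Ω)
    (h1 : ∀ ω θ, get (upd ω θ) = θ) (h2 : ∀ ω θ, upd (upd ω θ) (get ω) = ω)
    (E : Ω → Prop) : ∃ ω, prob Ω E ≤ prob Θ fun θ => E (upd ω θ) := by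
  have := Fintype.ofFinite Ω
  have := Fintype.ofFinite Θ
  have : Nonempty Θ := ⟨get (Classical.arbitrary Ω)⟩
  let e : Ω × Θ ≃ Ω × Θ :=
    { toFun := fun x => (upd x.1 x.2, get x.1)
      invFun := fun x => (upd x.1 x.2, get x.1)
      left_inv := fun x => by simp [h1, h2]
      right_inv := fun x => by simp [h1, h2] }
  have key : prob Ω E = (∑ ω, prob Θ fun θ => E (upd ω θ)) / Fintype.card Ω := by
    rw [← prob_fst (Z := Θ) E, ← prob_equiv e, prob_eq_sum, Fintype.sum_prod_type]
    simp only [prob_eq_sum (Ω := Θ), ← Finset.sum_div]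
    rw [Fintype.card_prod, div_div]
    push_cast
    rw [mul_comm (Fintype.card Θ : ℝ)]
    rfl
  by_contra! hlt
  have hpos : (0 : ℝ) < Fintype.card Ω := by exact_mod_cast Fintype.card_pos
  have : ∑ ω : Ω, prob Θ (fun θ => E (upd ω θ)) < ∑ _ω : Ω, prob Ω E :=
    Finset.sum_lt_sum_of_nonempty Finset.univ_nonempty fun ω _ => hlt ω
  rw [Finset.sum_const, Finset.card_univ, nsmul_eq_mul] at this
  rw [eq_div_iff hpos.ne'] at key
  linarith

end Prob

theorem Negligible.of_le {f g : ℕ → ℝ} (hg : Negligible g) (h0 : ∀ k, 0 ≤ f k)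
    (h : ∀ k, f k ≤ g k) : Negligible f :=
  hg.trans_abs_le fun k => by
    rw [abs_of_nonneg (h0 k)]; exact (h k).trans (le_abs_self _)

theorem Negligible.add {f g : ℕ → ℝ} (hf : Negligible f) (hg : Negligible g) :
    Negligible fun k => f k + g k :=
  Asymptotics.SuperpolynomialDecay.add hf hg

theorem Negligible.zero : Negligible fun _ => 0 :=
  Asymptotics.superpolynomialDecay_zero _ _

theorem Negligible.sum {T : Type} (s : Finset T) {f : T → ℕ → ℝ} (hf : ∀ t, Negligible (f t)) :
    Negligible fun k => ∑ t ∈ s, f t k := by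
  induction s using Finset.induction_on with
  | empty => simpa using Negligible.zero
  | insert a s ha ih =>
    simp only [Finset.sum_insert ha]
    exact (hf a).add ih

theorem Negligible.poly_mul {f : ℕ → ℝ} (hf : Negligible f) (p : Polynomial ℕ) :
    Negligible fun k => ((p.eval k : ℕ) : ℝ) * f k := by
  have := Asymptotics.SuperpolynomialDecay.polynomial_mul hf (p.map (Nat.castRingHom ℝ))
  refine Asymptotics.SuperpolynomialDecay.congr this fun k => ?_
  simp only [Polynomial.eval_map, Polynomial.eval₂_at_natCast]
  simp

/-- Union bound over polynomially many events: it suffices to bound every sequence of them. -/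
theorem Negligible.exists {Ω Idx : ℕ → Type} [∀ k, Finite (Ω k)] [∀ k, Fintype (Idx k)]
    [∀ k, Nonempty (Idx k)] (hI : PolyBounded fun k => Fintype.card (Idx k))
    (E : ∀ k, Idx k → Ω k → Prop)
    (h : ∀ c : ∀ k, Idx k, Negligible fun k => prob (Ω k) (E k (c k))) :
    Negligible fun k => prob (Ω k) fun ω => ∃ i, E k i ω := by
  have hmax : ∀ k, ∃ i, ∀ j, prob (Ω k) (E k j) ≤ prob (Ω k) (E k i) := fun k =>
    Finite.exists_max fun i => prob (Ω k) (E k i)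
  choose c hc using hmax
  obtain ⟨p, hp⟩ := hI
  refine ((h c).poly_mul p).of_le (fun k => prob_nonneg _) fun k => ?_
  refine (prob_exists_le _).trans ((Finset.sum_le_sum fun j _ => hc k j).trans ?_)
  rw [Finset.sum_const, Finset.card_univ, nsmul_eq_mul]
  exact mul_le_mul_of_nonneg_right (by exact_mod_cast hp k) (prob_nonneg _)

end

section

/-! ### Runs of interactive algorithms, round by round -/

theorem Bits.dec_enc {α : Type} [Bits α] (a : α) : Bits.dec (Bits.enc a) = some a := by
  have h : ∃ b : α, Bits.enc b = Bits.enc a := ⟨a, rfl⟩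
  rw [Bits.dec, dif_pos h]
  exact congrArg some (Bits.inj h.choose_spec)

theorem Bits.dec_eq_some {α : Type} [Bits α] {x : Bits.W α → Bool} {a : α} :
    Bits.dec x = some a ↔ x = Bits.enc a := by
  constructor
  · intro h
    unfold Bits.dec at h
    split_ifs at h with h'
    rw [← Option.some.inj h, h'.choose_spec]
  · rintro rfl; exact Bits.dec_enc a

theorem foldl_finRange {α : Type} (n : ℕ) (f : α → Fin n → α) (a : α) (g : ℕ → α) (h0 : g 0 = a)
    (hs : ∀ i : Fin n, g (i + 1) = f (g i) i) : (List.finRange n).foldl f a = g n := by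
  induction n with
  | zero => simp [h0]
  | succ n ih =>
    rw [List.finRange_succ_last, List.foldl_append, List.foldl_map,
      ih (fun a i => f a i.castSucc) fun i => by simpa using hs i.castSucc]
    simpa using (hs (Fin.last n)).symm

namespace Machine

variable {V A R S : Type} [Bits V] [Bits A] [Bits R]

/-- State of the algorithm, last answer, and state of the environment. -/
abbrev Conf (M : Machine V A R) (S : Type) : Type := Word M.st × Option R × S

/-- The action in a round; an output that encodes no action counts as none. -/
def act (M : Machine V A R) (c : M.Conf S) (ρ : Word M.coin) : Option A :=
  Bits.dec fun w => M.step.eval (Sum.elim c.1 (Sum.elim (Bits.enc c.2.1) ρ)) (Sum.inr w)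

/-- The configuration after a further round. -/
def next (M : Machine V A R) (react : S → Option A → S × R) (c : M.Conf S) (ρ : Word M.coin) :
    M.Conf S :=
  (fun i => M.step.eval (Sum.elim c.1 (Sum.elim (Bits.enc c.2.1) ρ)) (Sum.inl i),
    some (react c.2.2 (M.act c ρ)).2, (react c.2.2 (M.act c ρ)).1)

/-- The configuration after `r` rounds (constant after the last round). -/
def conf (M : Machine V A R) (v : V) (react : S → Option A → S × R) (s₀ : S) (coins : M.Coins) :
    ℕ → M.Conf S
  | 0 => (M.start.eval (Bits.enc v), none, s₀)
  | r + 1 => if h : r < M.rounds then M.next react (M.conf v react s₀ coins r) (coins ⟨r, h⟩)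
      else M.conf v react s₀ coins r

theorem play_eq_conf (M : Machine V A R) (v : V) (react : S → Option A → S × R) (s₀ : S)
    (coins : M.Coins) : M.play v react s₀ coins = (M.conf v react s₀ coins M.rounds).2.2 := by
  refine congrArg (fun c => c.2.2) (foldl_finRange _ _ _ (M.conf v react s₀ coins) rfl fun i => ?_)
  rw [conf, dif_pos i.2]
  rfl

theorem conf_succ (M : Machine V A R) (v : V) (react : S → Option A → S × R) (s₀ : S)
    (coins : M.Coins) {r : ℕ} (h : r < M.rounds) : M.conf v react s₀ coins (r + 1) =
      M.next react (M.conf v react s₀ coins r) (coins ⟨r, h⟩) :=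
  dif_pos h

end Machine

/-! ### Forgeries after signing queries fixed in advance -/

namespace SigScheme

variable {M : Type}

section Static

variable (Sc : SigScheme M) (k q : ℕ) (msg : Fin q → M) (target : M)
  (C : Circuit (Fin (Sc.vkLen k) ⊕ Fin q × Fin (Sc.sigLen k)) (Fin (Sc.sigLen k)))

/-- Memory of the forger: a round counter, the verification key, and the signatures obtained. -/
abbrev StaticWire : Type := Fin (q + 2) ⊕ (Fin (Sc.vkLen k) ⊕ Fin q × Fin (Sc.sigLen k))

/-- Input wires of the step circuit of the forger: memory and last answer, without coins. -/
abbrev StaticIn : Type :=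
  Fin (Fintype.card (StaticWire Sc k q)) ⊕ (Bits.W (Option (Word (Sc.sigLen k))) ⊕ Fin 0)

variable {Sc k q} in
def StaticIn.wire (x : StaticIn Sc k q → Bool) (s : StaticWire Sc k q) : Bool :=
  x (.inl (Fintype.equivFin _ s))

/-- The key and the signatures, including the one that has just arrived. -/
def staticData (x : StaticIn Sc k q → Bool) :
    Fin (Sc.vkLen k) ⊕ Fin q × Fin (Sc.sigLen k) → Bool
  | .inl b => StaticIn.wire x (.inr (.inl b))
  | .inr (j, b) =>
      if StaticIn.wire x (.inl j.succ.castSucc) then x (.inr (.inl (.inr (b, ()))))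
      else StaticIn.wire x (.inr (.inr (j, b)))

/-- The memory after a round: the counter moves on, and the new signature is stored. -/
def staticOut (x : StaticIn Sc k q → Bool) : StaticWire Sc k q → Prop
  | .inl c => ∃ r : Fin (q + 1), c = r.succ ∧ StaticIn.wire x (.inl r.castSucc)
  | .inr d => staticData Sc k q x d

theorem cost_staticData (d : Fin (Sc.vkLen k) ⊕ Fin q × Fin (Sc.sigLen k)) :
    Cost (fun x : StaticIn Sc k q → Bool => x) (fun x => staticData Sc k q x d = true) 8 := by
  rcases d with b | ⟨j, b⟩
  · exact (Cost.input (inp := fun x : StaticIn Sc k q → Bool => x)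
      (.inl (Fintype.equivFin _ (.inr (.inl b))))).mono (by norm_num)
  · have h1 := Cost.input (inp := fun x : StaticIn Sc k q → Bool => x)
      (.inl (Fintype.equivFin _ (.inl j.succ.castSucc)))
    have h2 := Cost.input (inp := fun x : StaticIn Sc k q → Bool => x)
      (.inr (.inl (.inr (b, ()))))
    have h3 := Cost.input (inp := fun x : StaticIn Sc k q → Bool => x)
      (.inl (Fintype.equivFin _ (.inr (.inr (j, b)))))
    refine (((h1.and h2).or (h1.not.and h3)).mono (by norm_num)).congr fun x => ?_
    by_cases h : StaticIn.wire x (.inl j.succ.castSucc) = true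
    · have h' : x (.inl (Fintype.equivFin _ (.inl j.succ.castSucc))) = true := h
      rw [staticData, if_pos h]
      simp only [h', true_and, not_true, false_and, or_false]
    · have h' : ¬ x (.inl (Fintype.equivFin _ (.inl j.succ.castSucc))) = true := h
      rw [staticData, if_neg h]
      exact ⟨fun h => (h.resolve_left fun h => h' h.1).2, fun h => .inr ⟨h', h⟩⟩

theorem cost_static_start : ∃ D : Circuit (Bits.W (Word (Sc.vkLen k)))
      (Fin (Fintype.card (StaticWire Sc k q))), D.size ≤ 3 ∧
    ∀ (vk : Word (Sc.vkLen k)) s, D.eval (Bits.enc vk) (Fintype.equivFin _ s) = match s with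
      | .inl c => decide (c.val = 0)
      | .inr (.inl b) => vk b
      | .inr (.inr _) => false := by
  have h : CostAll (fun vk : Word (Sc.vkLen k) => Bits.enc vk)
      (fun (s : Fin (Fintype.card (StaticWire Sc k q))) vk =>
        (match (Fintype.equivFin _).symm s with
          | .inl c => decide (c.val = 0)
          | .inr (.inl b) => vk b
          | .inr (.inr _) => false) = true) 3 := by
    refine CostAll.of_atomic fun s => ?_
    rcases (Fintype.equivFin (StaticWire Sc k q)).symm s with c | b | j
    · exact .inr ⟨decide (c.val = 0) = true, fun _ => Iff.rfl⟩
    · exact .inl ⟨(b, ()), fun _ => Iff.rfl⟩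
    · exact .inr ⟨false = true, fun _ => Iff.rfl⟩
  obtain ⟨D, hD, h⟩ := h.circuit
  refine ⟨D, hD, fun vk s => ?_⟩
  rw [Bool.eq_iff_iff, h]
  simp

variable [Bits M]

/-- The action in a round: the next query or, after all of them, the forgery output by `C`. -/
def staticAct (x : StaticIn Sc k q → Bool) (w : Bits.W (M ⊕ M × Word (Sc.sigLen k))) : Prop :=
  (∃ r : Fin q, StaticIn.wire x (.inl r.castSucc.castSucc) = true ∧
    Bits.enc (Sum.inl (msg r) : M ⊕ M × Word (Sc.sigLen k)) w = true) ∨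
  (StaticIn.wire x (.inl (Fin.last q).castSucc) = true ∧
    Bits.enc (Sum.inr (target, C.eval (staticData Sc k q x)) : M ⊕ M × Word (Sc.sigLen k)) w =
      true)

/-- Bound for the size of the circuits of the forger. -/
def staticSize : ℕ :=
  (Fintype.card (StaticWire Sc k q) + Fintype.card (Bits.W (M ⊕ M × Word (Sc.sigLen k)))) *
    (Fintype.card (StaticWire Sc k q) * 8 + C.size + 10 * q + 30)

theorem cost_static : ∃ D : Circuit (StaticIn Sc k q)
      (Fin (Fintype.card (StaticWire Sc k q)) ⊕ Bits.W (M ⊕ M × Word (Sc.sigLen k))),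
    D.size ≤ staticSize Sc k q C ∧
    ∀ x, (∀ s, D.eval x (.inl (Fintype.equivFin _ s)) = true ↔ staticOut Sc k q x s) ∧
      ∀ w, D.eval x (.inr w) = true ↔ staticAct Sc k q msg target C x w := by
  let f : Fin (Fintype.card (StaticWire Sc k q)) ⊕ Bits.W (M ⊕ M × Word (Sc.sigLen k)) →
      (StaticIn Sc k q → Bool) → Prop := fun o x => match o with
    | .inl s => staticOut Sc k q x ((Fintype.equivFin _).symm s)
    | .inr w => staticAct Sc k q msg target C x w
  have hcost : ∀ o, Cost (fun x : StaticIn Sc k q → Bool => x) (f o)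
      (Fintype.card (StaticWire Sc k q) * 8 + C.size + 10 * q + 30) := by
    have hdata := cost_staticData Sc k q
    have hin := Cost.input (inp := fun x : StaticIn Sc k q → Bool => x)
    rintro (s | w)
    · rcases hs : (Fintype.equivFin (StaticWire Sc k q)).symm s with c | d
      · by_cases hc : ∃ r : Fin (q + 1), c = r.succ
        · obtain ⟨r, rfl⟩ := hc
          refine ((hin (.inl (Fintype.equivFin _ (.inl r.castSucc)))).mono
            (by omega)).congr fun x => ?_
          simp only [f, hs, staticOut, StaticIn.wire]
          constructor
          · exact fun h => ⟨r, rfl, h⟩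
          · rintro ⟨r', h, h'⟩
            rwa [Fin.succ_injective _ h]
        · refine ((Cost.const False).mono (by omega)).congr fun x => ?_
          simp only [f, hs, staticOut, false_iff]
          rintro ⟨r, h, _⟩
          exact hc ⟨r, h⟩
      · refine ((hdata d).mono (by omega)).congr fun x => ?_
        simp only [f, hs, staticOut]
    · have h1 : Cost (fun x : StaticIn Sc k q → Bool => x) (fun x => ∃ r : Fin q,
          StaticIn.wire x (.inl r.castSucc.castSucc) = true ∧
          Bits.enc (Sum.inl (msg r) : M ⊕ M × Word (Sc.sigLen k)) w = true) (q * 7 + 2) := by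
        have := Cost.exists (n := 4) fun r : Fin q =>
          (hin (.inl (Fintype.equivFin _ (.inl r.castSucc.castSucc)))).and
            (Cost.const (Bits.enc (Sum.inl (msg r) : M ⊕ M × Word (Sc.sigLen k)) w = true))
        exact (this.mono (by rw [Fintype.card_fin])).congr fun x => Iff.rfl
      have hall := (CostAll.of_forall hdata).eval C
      have h2 : Cost (fun x : StaticIn Sc k q → Bool => x) (fun x =>
          Bits.enc (Sum.inr (target, C.eval (staticData Sc k q x)) :
            M ⊕ M × Word (Sc.sigLen k)) w = true)
          (Fintype.card (StaticWire Sc k q) * 8 + C.size + 4) := by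
        rcases w with _ | _ | w | ⟨b, _⟩
        · exact ((Cost.const True).mono (by omega)).congr fun x => by simp [Bits.enc]
        · exact ((Cost.const False).mono (by omega)).congr fun x => by simp [Bits.enc]
        · exact ((Cost.const (Bits.enc target w = true)).mono (by omega)).congr fun x => by
            simp [Bits.enc]
        · have hb : Cost (fun x : StaticIn Sc k q → Bool => x)
              (fun x => C.eval (staticData Sc k q x) b = true)
              (Fintype.card (Fin (Sc.vkLen k) ⊕ Fin q × Fin (Sc.sigLen k)) * 8 + C.size + 2) :=
            fun G => let ⟨H, h1, h2⟩ := hall G; ⟨H, h1, fun _ => h2 b⟩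
          refine (hb.mono ?_).congr fun x => by simp [Bits.enc]
          have : Fintype.card (Fin (Sc.vkLen k) ⊕ Fin q × Fin (Sc.sigLen k)) ≤
              Fintype.card (StaticWire Sc k q) := by
            rw [Fintype.card_sum (α := Fin (q + 2))]; omega
          omega
      exact (h1.or ((hin _).and h2)).mono (by omega)
  obtain ⟨D, hD, h⟩ := (CostAll.of_forall hcost).circuit
  refine ⟨D, hD.trans ?_, fun x => ⟨fun s => ?_, fun w => h x (.inr w)⟩⟩
  · rw [Fintype.card_sum, Fintype.card_fin]; rfl
  · rw [h]; simp [f]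

/-- The forger that queries the messages `msg` one after the other and then outputs, as a
signature of `target`, the value of `C` at the key and the signatures obtained. -/
abbrev staticForger : Sc.Forger k where
  st := Fintype.card (StaticWire Sc k q)
  coin := 0
  rounds := q + 1
  start := (cost_static_start Sc k q).choose
  step := (cost_static Sc k q msg target C).choose

variable (keys : Word (Sc.vkLen k) × Word (Sc.skLen k)) (coins : ℕ → Word (Sc.signCoinLen k))

theorem staticForger_conf (cs : List (Word (Sc.signCoinLen k))) (hcs : cs.length = q + 1)
    (ρ : (staticForger Sc k q msg target C).Coins)
    (σ : Fin q → Word (Sc.sigLen k))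
    (hσ : ∀ j : Fin q, σ j = Sc.sign k keys.2 (cs[j.val]'(by omega)) (msg j)) (r : ℕ)
    (hr : r ≤ q) :
    (staticForger Sc k q msg target C).conf keys.1 (Sc.gameReact k keys) ⟨cs, [], none⟩ ρ r =
      (fun i => match (Fintype.equivFin (StaticWire Sc k q)).symm i with
        | .inl c => decide (c.val = r)
        | .inr (.inl b) => keys.1 b
        | .inr (.inr (j, b)) => decide (j.val + 1 < r) && σ j b,
      if h : 0 < r then some (σ ⟨r - 1, by omega⟩) else none,
      ⟨cs.drop r, ((List.ofFn msg).take r).reverse, none⟩) := by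
  have hstart := (cost_static_start Sc k q).choose_spec.2 keys.1
  induction r with
  | zero =>
    rw [Machine.conf]
    refine Prod.ext (funext fun i => ?_) (Prod.ext (by simp) (by simp))
    obtain ⟨s, rfl⟩ := (Fintype.equivFin (StaticWire Sc k q)).surjective i
    rw [show (staticForger Sc k q msg target C).start = _ from rfl]
    refine (hstart s).trans ?_
    rcases s with c | b | j <;> simp
  | succ r ih =>
    rw [Machine.conf_succ _ _ _ _ _ (show r < q + 1 by omega), ih (by omega)]
    set c : (staticForger Sc k q msg target C).Conf (Sc.GameState k) := (_, _, _) with hc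
    have hD := (cost_static Sc k q msg target C).choose_spec.2
      (Sum.elim c.1 (Sum.elim (Bits.enc c.2.1) (ρ ⟨r, (show r < q + 1 by omega)⟩)))
    set x : StaticIn Sc k q → Bool :=
      Sum.elim c.1 (Sum.elim (Bits.enc c.2.1) (ρ ⟨r, (show r < q + 1 by omega)⟩)) with hx
    have hw : ∀ s, StaticIn.wire x s = match s with
        | .inl c => decide (c.val = r)
        | .inr (.inl b) => keys.1 b
        | .inr (.inr (j, b)) => decide (j.val + 1 < r) && σ j b := by
      intro s
      simp [StaticIn.wire, hx, hc]
    have hact : (staticForger Sc k q msg target C).act c (ρ ⟨r, (show r < q + 1 by omega)⟩) =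
        some (.inl (msg ⟨r, by omega⟩)) := by
      refine Bits.dec_eq_some.mpr (funext fun w => ?_)
      rw [Bool.eq_iff_iff]
      refine (hD.2 w).trans ?_
      simp only [staticAct, hw]
      have : q ≠ r := by omega
      simp only [Fin.val_castSucc, decide_eq_true_eq, Fin.val_last, this, false_and, or_false]
      constructor
      · rintro ⟨i, rfl, h⟩; exact h
      · exact fun h => ⟨⟨r, by omega⟩, rfl, h⟩
    rw [Machine.next, hact]
    refine Prod.ext (funext fun i => ?_) (Prod.ext ?_ ?_)
    · obtain ⟨s, rfl⟩ := (Fintype.equivFin (StaticWire Sc k q)).surjective i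
      rw [Bool.eq_iff_iff]
      refine (hD.1 s).trans ?_
      rcases s with d | b | ⟨j, b⟩
      · simp only [staticOut, hw, Equiv.symm_apply_apply, decide_eq_true_eq]
        constructor
        · rintro ⟨i, rfl, h⟩; simpa using h
        · intro h
          exact ⟨⟨r, by omega⟩, Fin.ext (by simpa using h), rfl⟩
      · simp only [staticOut, staticData, hw, Equiv.symm_apply_apply]
      · simp only [staticOut, staticData, hw, Equiv.symm_apply_apply]
        by_cases hj : j.val + 1 = r
        · have h0 : 0 < r := by omega
          have hjr : (⟨r - 1, by omega⟩ : Fin q) = j := Fin.ext (by simp; omega)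
          simp [hj, hx, hc, h0, hjr, Bits.enc]
        · have h1 : j.val + 1 < r + 1 ↔ j.val + 1 < r := by omega
          simp [hj, h1]
    · simp only [hc, gameReact]
      have : cs.drop r = cs[r] :: cs.drop (r + 1) := List.drop_eq_getElem_cons (by omega)
      rw [dif_pos (Nat.succ_pos r), hσ, this]
      rfl
    · simp only [hc, gameReact]
      have hl : r < (List.ofFn msg).length := by simp; omega
      have : (List.ofFn msg).take (r + 1) = (List.ofFn msg).take r ++ [msg ⟨r, by omega⟩] := by
        rw [List.take_add_one, List.getElem?_eq_getElem hl]; simp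
      rw [this]
      simp [List.tail_drop]

theorem staticForger_verdict (cs : List (Word (Sc.signCoinLen k))) (hcs : cs.length = q + 1)
    (ρ : (staticForger Sc k q msg target C).Coins)
    (σ : Fin q → Word (Sc.sigLen k))
    (hσ : ∀ j : Fin q, σ j = Sc.sign k keys.2 (cs[j.val]'(by omega)) (msg j))
    (ht : ∀ j, msg j ≠ target)
    (hv : Sc.verify k keys.1 target (C.eval (Sum.elim keys.1 fun d => σ d.1 d.2)) = true) :
    ((staticForger Sc k q msg target C).play keys.1 (Sc.gameReact k keys) ⟨cs, [], none⟩ ρ).verdict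
      = some true := by
  rw [Machine.play_eq_conf, Machine.conf_succ _ _ _ _ _ (show q < q + 1 by omega),
    staticForger_conf Sc k q msg target C keys cs hcs ρ σ hσ q le_rfl]
  set c : (staticForger Sc k q msg target C).Conf (Sc.GameState k) := (_, _, _) with hc
  have hD := (cost_static Sc k q msg target C).choose_spec.2
    (Sum.elim c.1 (Sum.elim (Bits.enc c.2.1) (ρ ⟨q, (show q < q + 1 by omega)⟩)))
  set x : StaticIn Sc k q → Bool :=
    Sum.elim c.1 (Sum.elim (Bits.enc c.2.1) (ρ ⟨q, (show q < q + 1 by omega)⟩)) with hx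
  have hw : ∀ s, StaticIn.wire x s = match s with
      | .inl c => decide (c.val = q)
      | .inr (.inl b) => keys.1 b
      | .inr (.inr (j, b)) => decide (j.val + 1 < q) && σ j b := by
    intro s
    simp [StaticIn.wire, hx, hc]
  have hdata : staticData Sc k q x = Sum.elim keys.1 fun d => σ d.1 d.2 := by
    funext d
    rcases d with b | ⟨j, b⟩
    · simp [staticData, hw]
    · simp only [staticData, hw]
      by_cases hj : j.val + 1 = q
      · have h0 : 0 < q := by omega
        have hjr : (⟨q - 1, by omega⟩ : Fin q) = j := Fin.ext (by simp; omega)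
        simp [hj, hx, hc, h0, hjr, Bits.enc]
      · have h1 : j.val + 1 < q := by omega
        simp [hj, h1]
  have hact : (staticForger Sc k q msg target C).act c (ρ ⟨q, (show q < q + 1 by omega)⟩) =
      some (.inr (target, C.eval (Sum.elim keys.1 fun d => σ d.1 d.2))) := by
    refine Bits.dec_eq_some.mpr (funext fun w => ?_)
    rw [Bool.eq_iff_iff]
    refine (hD.2 w).trans ?_
    simp only [staticAct, hw, hdata]
    have : ∀ r : Fin q, r.val ≠ q := fun r => by omega
    simp [this]
  rw [Machine.next, hact]
  have hq : target ∉ ((List.ofFn msg).take q).reverse := by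
    rw [List.mem_reverse]
    intro h
    obtain ⟨j, hj⟩ := List.mem_ofFn.mp (List.mem_of_mem_take h)
    exact ht j hj
  simp [gameReact, hc, hv] at hq ⊢
  exact hq

end Static

/-- A circuit that sees the verification key and signatures of messages fixed in advance does not
output a valid signature of another fixed message. -/
theorem EUFCMA.static [Bits M] {Sc : SigScheme M} (hS : Sc.EUFCMA) (hvk : PolyBounded Sc.vkLen)
    (hsig : PolyBounded Sc.sigLen) {ι : Type} [Fintype ι] (msg : ∀ _ : ℕ, ι → M) (target : ℕ → M)
    (ht : ∀ k i, msg k i ≠ target k)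
    (C : ∀ k, Circuit (Fin (Sc.vkLen k) ⊕ ι × Fin (Sc.sigLen k)) (Fin (Sc.sigLen k)))
    (hC : PolyBounded fun k => (C k).size) :
    Negligible fun k => prob (Word (Sc.keyCoinLen k) × (ι → Word (Sc.signCoinLen k))) fun θ =>
      Sc.verify k (Sc.keyGen k θ.1).1 (target k) ((C k).eval (Sum.elim (Sc.keyGen k θ.1).1
        fun d => Sc.sign k (Sc.keyGen k θ.1).2 (θ.2 d.1) (msg k d.1) d.2)) = true := by
  let q := Fintype.card ι
  let e : ι ≃ Fin q := Fintype.equivFin ι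
  -- rename the input wires of the circuits
  have hren : ∀ k, ∃ D : Circuit (Fin (Sc.vkLen k) ⊕ Fin q × Fin (Sc.sigLen k))
      (Fin (Sc.sigLen k)), D.size ≤ 3 + (C k).size + 2 ∧ ∀ x, D.eval x =
        (C k).eval (Sum.elim (fun b => x (.inl b)) fun d => x (.inr (e d.1, d.2))) := by
    intro k
    have h : CostAll (fun x : Fin (Sc.vkLen k) ⊕ Fin q × Fin (Sc.sigLen k) → Bool => x)
        (fun d x => (Sum.elim (fun b => x (.inl b)) fun d => x (.inr (e d.1, d.2)) :
          Fin (Sc.vkLen k) ⊕ ι × Fin (Sc.sigLen k) → Bool) d = true) 3 :=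
      CostAll.of_atomic fun d => by
        rcases d with b | d
        · exact .inl ⟨_, fun _ => Iff.rfl⟩
        · exact .inl ⟨_, fun _ => Iff.rfl⟩
    obtain ⟨D, hD, h⟩ := (h.eval (C k)).circuit
    exact ⟨D, hD, fun x => funext fun o => by rw [Bool.eq_iff_iff]; exact h x o⟩
  choose D hD hDe using hren
  have hW : ∀ k, Fintype.card (StaticWire Sc k q) = q + 2 + (Sc.vkLen k + q * Sc.sigLen k) :=
    fun k => by simp [StaticWire]
  have hWA : ∀ k, Fintype.card (Bits.W (M ⊕ M × Word (Sc.sigLen k))) =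
      1 + (Fintype.card (Bits.W M) + (Fintype.card (Bits.W M) + Sc.sigLen k)) := by
    intro k
    have h1 : Fintype.card (Bits.W (M ⊕ M × Word (Sc.sigLen k))) =
      Fintype.card (Unit ⊕ (Bits.W M ⊕ (Bits.W M ⊕ Fin (Sc.sigLen k) × Unit))) := rfl
    rw [h1]; simp
  have hcost : PolyBounded fun k =>
      (staticForger Sc k q (fun j => msg k (e.symm j)) (target k) (D k)).cost := by
    have hvk := hvk.polyBd
    have hsig := hsig.polyBd
    have hC := hC.polyBd
    have hWb : PolyBd (fun k => k) fun k => Fintype.card (StaticWire Sc k q) := by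
      simp only [hW]
      exact (PolyBd.const _).add (hvk.add ((PolyBd.const _).mul hsig))
    have hsz : PolyBd (fun k => k) fun k => staticSize Sc k q (D k) := by
      unfold staticSize
      refine (hWb.add ?_).mul ((((hWb.mul (.const 8)).add ?_).add (.const _)).add (.const _))
      · simp only [hWA]
        exact (PolyBd.const _).add ((PolyBd.const _).add ((PolyBd.const _).add hsig))
      · exact (((PolyBd.const 3).add hC).add (.const 2)).mono hD
    refine PolyBd.mono ((((hWb.add (.const 0)).add (.const (q + 1))).add (.const 3)).add hsz)
      fun k => ?_
    exact add_le_add (add_le_add le_rfl (cost_static_start Sc k q).choose_spec.1)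
      (cost_static Sc k q (fun j => msg k (e.symm j)) (target k) (D k)).choose_spec.1
  have hneg := hS (fun k => staticForger Sc k q (fun j => msg k (e.symm j)) (target k) (D k)) hcost
  refine hneg.of_le (fun k => prob_nonneg _) fun k => ?_
  -- the forger does not use the signing coins of its last round, nor coins of its own
  let Z := Word (Sc.signCoinLen k) ×
    (staticForger Sc k q (fun j => msg k (e.symm j)) (target k) (D k)).Coins
  let E : (Word (Sc.keyCoinLen k) × (Fin (q + 1) → Word (Sc.signCoinLen k)) ×
      (staticForger Sc k q (fun j => msg k (e.symm j)) (target k) (D k)).Coins) ≃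
      (Word (Sc.keyCoinLen k) × (ι → Word (Sc.signCoinLen k))) × Z :=
    { toFun := fun x => ((x.1, fun i => x.2.1 (e i).castSucc), (x.2.1 (Fin.last q), x.2.2))
      invFun := fun y => (y.1.1, Fin.snoc (fun j => y.1.2 (e.symm j)) y.2.1, y.2.2)
      left_inv := fun x => by
        refine Prod.ext rfl (Prod.ext (funext fun j => ?_) rfl)
        refine Fin.lastCases ?_ (fun j => ?_) j <;> simp
      right_inv := fun y => by simp }
  rw [← prob_fst (Z := Z), ← prob_equiv E]
  refine prob_mono (Ω := Word (Sc.keyCoinLen k) × (Fin (q + 1) → Word (Sc.signCoinLen k)) ×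
      (staticForger Sc k q (fun j => msg k (e.symm j)) (target k) (D k)).Coins) ?_
  rintro ⟨c, s, ρ⟩ h
  refine staticForger_verdict Sc k q (fun j => msg k (e.symm j)) (target k) (D k)
    (Sc.keyGen k c) (List.ofFn s) (by simp) ρ
    (fun j => Sc.sign k (Sc.keyGen k c).2 (s j.castSucc) (msg k (e.symm j))) (fun j => ?_)
    (fun j => ht k _) ?_
  · rw [List.getElem_ofFn]; rfl
  · rw [hDe]
    simpa [E] using h

end SigScheme

end

section

namespace Fam

variable {𝓕 : Fam} {J L K : 𝓕.ι → Type}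

/-- Case distinction on the index. -/
theorem Easy.split {φ : 𝓕.Pred J} {φ₁ : 𝓕.Pred L}
    {φ₂ : 𝓕.Pred K} (h₁ : 𝓕.Easy φ₁) (h₂ : 𝓕.Easy φ₂)
    (h : ∀ i j, (∃ l, ∀ x, φ i j x ↔ φ₁ i l x) ∨ ∃ l, ∀ x, φ i j x ↔ φ₂ i l x) : 𝓕.Easy φ := by
  obtain ⟨s, hs, h₁⟩ := h₁
  obtain ⟨t, ht, h₂⟩ := h₂
  refine ⟨_, hs.add ht, fun i j => ?_⟩
  rcases h i j with ⟨l, hl⟩ | ⟨l, hl⟩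
  · exact ((h₁ i l).mono (by omega)).congr fun x => (hl x).symm
  · exact ((h₂ i l).mono (by omega)).congr fun x => (hl x).symm

theorem Easy.iff_const {φ : 𝓕.Pred J} (h : 𝓕.Easy φ) (p : ∀ i, J i → Prop) :
    𝓕.Easy fun i j x => (φ i j x ↔ p i j) :=
  ((h.and (Easy.const p)).or (h.not.and (Easy.const p).not)).congr fun i j x => by tauto

theorem Easy.iff {φ ψ : 𝓕.Pred J} (h : 𝓕.Easy φ) (h' : 𝓕.Easy ψ) :
    𝓕.Easy fun i j x => (φ i j x ↔ ψ i j x) :=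
  ((h.and h').or (h.not.and h'.not)).congr fun i j x => by tauto

end Fam

/-! ### Slices: what the system can see of a signature or a scalar -/

instance (priority := low) Bits.finite {α : Type} [Bits α] : Finite α :=
  Finite.of_injective Bits.enc Bits.inj

variable {P : Params}

/-- The primitives have polynomial size. -/
structure Prims.Efficient (C : Prims P) : Prop where
  sig : C.sig.Efficient
  size : PolyBounded fun k => (C.grp.q k).size

/-- What the behaviour of the servers depends on, apart from data of bounded size: the
verification keys (of the election authority and of the VC nodes) and the valid opening shares of
all tally sets. -/
structure Ctx (C : Prims P) (k : ℕ) where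
  vk : Option (Fin P.Nv) → Word (C.sig.vkLen k)
  tv : Finset (Fin P.n × Line P) → Fin P.Nt → OpenShare C k

/-- Number of bit positions. -/
def posLen (C : Prims P) (k : ℕ) : ℕ := C.sig.sigLen k + (C.grp.q k).size + 1

/-- Contexts that vary with the objects of a family: the verification keys are easy to compute and
the opening shares are fixed. -/
structure VarCtx (C : Prims P) (𝓕 : Fam) where
  ctx : ∀ i, 𝓕.X i → Ctx C (𝓕.κ i)
  vk_easy : 𝓕.Easy (J := fun i => Option (Fin P.Nv) × Fin (C.sig.vkLen (𝓕.κ i)))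
    fun i j x => (ctx i x).vk j.1 j.2 = true
  tv_const : ∀ i x x', (ctx i x).tv = (ctx i x').tv

/-- A family of types whose elements are described, for every bit position, by a bounded number of
tests. All the tests together determine the element, they are easy to compute from its encoding,
and the bits of the encoding are among them. -/
structure Sliced (C : Prims P) (α : ℕ → Type) [∀ k, Bits (α k)] where
  J : Type
  fin : Finite J
  tst : ∀ k, Ctx C k → ℕ → α k → J → Bool
  width : PolyBounded fun k => Fintype.card (Bits.W (α k))
  loc : ∀ k (w : Bits.W (α k)), ∃ p < posLen C k, ∃ j, ∀ c a, Bits.enc a w = tst k c p a j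
  valid : ∀ (𝓕 : Fam) (_ : VarCtx C 𝓕) (I : 𝓕.ι → Type)
    (raw : ∀ i, I i → 𝓕.X i → Bits.W (α (𝓕.κ i)) → Bool),
    𝓕.Easy (J := fun i => I i × Bits.W (α (𝓕.κ i))) (fun i j x => raw i j.1 x j.2 = true) →
    𝓕.Easy fun i j x => ∃ a, raw i j x = Bits.enc a
  dec : ∀ (𝓕 : Fam) (V : VarCtx C 𝓕) (I : 𝓕.ι → Type)
    (raw : ∀ i, I i → 𝓕.X i → Bits.W (α (𝓕.κ i)) → Bool),
    𝓕.Easy (J := fun i => I i × Bits.W (α (𝓕.κ i))) (fun i j x => raw i j.1 x j.2 = true) →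
    𝓕.Easy (J := fun i => I i × ℕ × J) fun i j x =>
      ∃ a, raw i j.1 x = Bits.enc a ∧ tst _ (V.ctx i x) j.2.1 a j.2.2 = true

namespace Sliced

variable {C : Prims P} {α β : ℕ → Type} [∀ k, Bits (α k)] [∀ k, Bits (β k)]

theorem posLen_pos (C : Prims P) (k : ℕ) : 0 < posLen C k := Nat.succ_pos _

/-- The tests at all positions determine the element. -/
theorem ext (A : Sliced C α) {k : ℕ} (c : Ctx C k) {a a' : α k}
    (h : ∀ p < posLen C k, A.tst k c p a = A.tst k c p a') : a = a' := by
  refine Bits.inj (funext fun w => ?_)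
  obtain ⟨p, hp, j, hj⟩ := A.loc k w
  rw [hj c, hj c, h p hp]

/-- Types that do not depend on the security parameter. -/
def const (C : Prims P) (α : Type) [Bits α] : Sliced C fun _ => α where
  J := Bits.W α
  fin := inferInstance
  tst _ _ _ a := Bits.enc a
  width := ⟨Polynomial.C (Fintype.card (Bits.W α)), fun _ => by simp⟩
  loc k w := ⟨0, posLen_pos C k, w, fun _ _ => rfl⟩
  valid 𝓕 V I raw h := by
    refine Fam.Easy.of_local (T := Bits.W α) (β := fun i j t x => raw i j x t = true) h ?_
    rintro i j x x' ht ⟨a, ha⟩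
    exact ⟨a, by rw [← ha]; exact funext fun t => Bool.eq_iff_iff.mpr (ht t).symm⟩
  dec 𝓕 V I raw h := by
    refine Fam.Easy.of_local (T := Bits.W α) (β := fun i j t x => raw i j.1 x t = true)
      (h.reindex fun i (j : (I i × ℕ × Bits.W α) × Bits.W α) => (j.1.1, j.2)) ?_
    rintro i j x x' ht ⟨a, ha, ha'⟩
    exact ⟨a, by rw [← ha]; exact funext fun t => Bool.eq_iff_iff.mpr (ht t).symm, ha'⟩

theorem const_tst {α : Type} [Bits α] {k p : ℕ} {c c' : Ctx C k} {a a' : α} :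
    (const C α).tst k c p a = (const C α).tst k c' p a' ↔ a = a' :=
  ⟨fun h => Bits.inj h, fun h => by rw [h]; rfl⟩

section Enc

variable {α β : Type} [Bits α] [Bits β]

theorem eq_enc_prod {r : Bits.W (α × β) → Bool} {a : α} {b : β} : r = Bits.enc (a, b) ↔
    (fun w => r (.inl w)) = Bits.enc a ∧ (fun w => r (.inr w)) = Bits.enc b := by
  simp only [funext_iff]
  exact Sum.forall

theorem eq_enc_some {r : Bits.W (Option α) → Bool} {a : α} : r = Bits.enc (some a) ↔
    r (.inl ()) = true ∧ (fun w => r (.inr w)) = Bits.enc a := by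
  simp only [funext_iff]
  exact Sum.forall.trans (and_congr_left' ⟨fun h => h (), fun h _ => h⟩)

theorem eq_enc_none {r : Bits.W (Option α) → Bool} :
    r = Bits.enc (none : Option α) ↔ ∀ w, ¬ r w = true := by
  simp [funext_iff, Bits.enc]

theorem eq_enc_inl {r : Bits.W (α ⊕ β) → Bool} {a : α} : r = Bits.enc (Sum.inl a : α ⊕ β) ↔
    ¬ r (.inl ()) = true ∧ (∀ w, ¬ r (.inr (.inr w)) = true) ∧
      (fun w => r (.inr (.inl w))) = Bits.enc a := by
  simp only [funext_iff, Bool.not_eq_true, and_comm (b := ∀ w, r _ = Bits.enc a w)]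
  exact Sum.forall.trans (and_congr ⟨fun h => h (), fun h _ => h⟩ Sum.forall)

theorem eq_enc_inr {r : Bits.W (α ⊕ β) → Bool} {b : β} : r = Bits.enc (Sum.inr b : α ⊕ β) ↔
    r (.inl ()) = true ∧ (∀ w, ¬ r (.inr (.inl w)) = true) ∧
      (fun w => r (.inr (.inr w))) = Bits.enc b := by
  simp only [funext_iff, Bool.not_eq_true]
  exact Sum.forall.trans (and_congr ⟨fun h => h (), fun h _ => h⟩ Sum.forall)

end Enc

/-- A pair is tested by the tests of both components. -/
def prod (A : Sliced C α) (B : Sliced C β) : Sliced C fun k => α k × β k where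
  J := A.J ⊕ B.J
  fin := have := A.fin; have := B.fin; inferInstance
  tst k c p x := Sum.elim (A.tst k c p x.1) (B.tst k c p x.2)
  width := by
    refine (A.width.polyBd.add B.width.polyBd).mono fun k => ?_
    exact (Fintype.card_sum (α := Bits.W (α k)) (β := Bits.W (β k))).le
  loc k w := by
    rcases w with w | w
    · obtain ⟨p, hp, j, h⟩ := A.loc k w
      exact ⟨p, hp, .inl j, fun c a => h c a.1⟩
    · obtain ⟨p, hp, j, h⟩ := B.loc k w
      exact ⟨p, hp, .inr j, fun c a => h c a.2⟩
  valid 𝓕 V I raw h := by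
    have h1 := A.valid 𝓕 V I (fun i j x w => raw i j x (.inl w))
      (h.reindex fun i (j : I i × Bits.W (α (𝓕.κ i))) => (j.1, .inl j.2))
    have h2 := B.valid 𝓕 V I (fun i j x w => raw i j x (.inr w))
      (h.reindex fun i (j : I i × Bits.W (β (𝓕.κ i))) => (j.1, .inr j.2))
    exact (h1.and h2).congr fun i j x => by simp only [Prod.exists, eq_enc_prod, exists_and_left,
      exists_and_right]
  dec 𝓕 V I raw h := by
    have e1 := h.reindex fun i (j : I i × Bits.W (α (𝓕.κ i))) => (j.1, .inl j.2)
    have e2 := h.reindex fun i (j : I i × Bits.W (β (𝓕.κ i))) => (j.1, .inr j.2)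
    have v1 := A.valid 𝓕 V I (fun i j x w => raw i j x (.inl w)) e1
    have v2 := B.valid 𝓕 V I (fun i j x w => raw i j x (.inr w)) e2
    have d1 := A.dec 𝓕 V I (fun i j x w => raw i j x (.inl w)) e1
    have d2 := B.dec 𝓕 V I (fun i j x w => raw i j x (.inr w)) e2
    refine Fam.Easy.split
      (d1.and (v2.reindex fun i (j : I i × ℕ × A.J) => j.1))
      (d2.and (v1.reindex fun i (j : I i × ℕ × B.J) => j.1)) ?_
    rintro i ⟨j, p, t | t⟩
    · refine .inl ⟨(j, p, t), fun x => ⟨fun ⟨⟨a, b⟩, h, h'⟩ => ?_, fun ⟨⟨a, ha, h'⟩, b, hb⟩ =>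
        ⟨(a, b), eq_enc_prod.mpr ⟨ha, hb⟩, h'⟩⟩⟩
      have h := eq_enc_prod.mp h
      exact ⟨⟨a, h.1, h'⟩, b, h.2⟩
    · refine .inr ⟨(j, p, t), fun x => ⟨fun ⟨⟨a, b⟩, h, h'⟩ => ?_, fun ⟨⟨b, hb, h'⟩, a, ha⟩ =>
        ⟨(a, b), eq_enc_prod.mpr ⟨ha, hb⟩, h'⟩⟩⟩
      have h := eq_enc_prod.mp h
      exact ⟨⟨b, h.2, h'⟩, a, h.1⟩

theorem prod_tst {A : Sliced C α} {B : Sliced C β} {k p : ℕ} {c c' : Ctx C k} {a a' : α k × β k} :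
    (A.prod B).tst k c p a = (A.prod B).tst k c' p a' ↔
      A.tst k c p a.1 = A.tst k c' p a'.1 ∧ B.tst k c p a.2 = B.tst k c' p a'.2 :=
  ⟨fun h => ⟨funext fun w => congrFun h (.inl w), funext fun w => congrFun h (.inr w)⟩,
    fun h => by simp only [prod, h.1, h.2]⟩

/-- A function is tested by the tests of its values. -/
def pi (ι : Type) [Fintype ι] (A : Sliced C α) : Sliced C fun k => ι → α k where
  J := ι × A.J
  fin := have := A.fin; inferInstance
  tst k c p f t := A.tst k c p (f t.1) t.2
  width := by
    refine ((PolyBd.const (Fintype.card ι)).mul A.width.polyBd).mono fun k => ?_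
    exact (Fintype.card_prod ι (Bits.W (α k))).le
  loc k w := by
    obtain ⟨p, hp, j, h⟩ := A.loc k w.2
    exact ⟨p, hp, (w.1, j), fun c a => h c (a w.1)⟩
  valid 𝓕 V I raw h := by
    have h1 := A.valid 𝓕 V (fun i => I i × ι) (fun i j x w => raw i j.1 x (j.2, w))
      (h.reindex fun i (j : (I i × ι) × Bits.W (α (𝓕.κ i))) => (j.1.1, (j.1.2, j.2)))
    refine (Fam.Easy.forall (L := fun _ => ι) (.const _)
      (φ := fun i j l x => ∃ a, (fun w => raw i j x (l, w)) = Bits.enc a) h1).congr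
      fun i j x => ⟨?_, ?_⟩
    · intro h
      choose a ha using h
      exact ⟨a, funext fun w => congrFun (ha w.1) w.2⟩
    · rintro ⟨a, h⟩ l
      exact ⟨a l, funext fun w => congrFun h (l, w)⟩
  dec 𝓕 V I raw h := by
    have h0 := h.reindex fun i (j : (I i × ι) × Bits.W (α (𝓕.κ i))) => (j.1.1, (j.1.2, j.2))
    have h1 := A.valid 𝓕 V (fun i => I i × ι) (fun i j x w => raw i j.1 x (j.2, w)) h0
    have h2 := A.dec 𝓕 V (fun i => I i × ι) (fun i j x w => raw i j.1 x (j.2, w)) h0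
    have h3 := Fam.Easy.forall (L := fun _ => ι) (.const _)
      (φ := fun i j l x => ∃ a, (fun w => raw i j x (l, w)) = Bits.enc a) h1
    refine ((h2.reindex fun i (j : I i × ℕ × ι × A.J) => ((j.1, j.2.2.1), j.2.1, j.2.2.2)).and
      (h3.reindex fun i (j : I i × ℕ × ι × A.J) => j.1)).congr fun i j x => ⟨?_, ?_⟩
    · rintro ⟨⟨a, ha, h'⟩, h⟩
      choose b hb using h
      refine ⟨b, funext fun w => congrFun (hb w.1) w.2, ?_⟩
      have : b j.2.2.1 = a := Bits.inj (by rw [← hb, ← ha])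
      simpa [this] using h'
    · rintro ⟨a, h, h'⟩
      exact ⟨⟨a j.2.2.1, funext fun w => congrFun h (_, w), h'⟩,
        fun l => ⟨a l, funext fun w => congrFun h (l, w)⟩⟩

theorem pi_tst {ι : Type} [Fintype ι] {A : Sliced C α} {k p : ℕ} {c c' : Ctx C k}
    {f f' : ι → α k} : (A.pi ι).tst k c p f = (A.pi ι).tst k c' p f' ↔
      ∀ i, A.tst k c p (f i) = A.tst k c' p (f' i) :=
  ⟨fun h i => funext fun w => congrFun h (i, w), fun h => funext fun w => congrFun (h w.1) w.2⟩

/-- An additional test tells whether there is an element. -/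
def option (A : Sliced C α) : Sliced C fun k => Option (α k) where
  J := Unit ⊕ A.J
  fin := have := A.fin; inferInstance
  tst k c p x := match x with
    | none => fun _ => false
    | some a => Sum.elim (fun _ => true) (A.tst k c p a)
  width := by
    refine ((PolyBd.const 1).add A.width.polyBd).mono fun k => ?_
    exact (Fintype.card_sum (α := Unit) (β := Bits.W (α k))).le.trans (by simp)
  loc k w := by
    rcases w with w | w
    · refine ⟨0, posLen_pos C k, .inl w, fun c a => ?_⟩
      rcases a with _ | a <;> rfl
    · obtain ⟨p, hp, j, h⟩ := A.loc k w
      refine ⟨p, hp, .inr j, fun c a => ?_⟩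
      rcases a with _ | a
      · rfl
      · exact h c a
  valid 𝓕 V I raw h := by
    have h1 := A.valid 𝓕 V I (fun i j x w => raw i j x (.inr w))
      (h.reindex fun i (j : I i × Bits.W (α (𝓕.κ i))) => (j.1, .inr j.2))
    have h2 := h.reindex fun i (j : I i) => (j, .inl ())
    have h3 := Fam.Easy.forall (L := fun i => Bits.W (Option (α (𝓕.κ i))))
      (((PolyBd.const 1).add (PolyBd.comp A.width 𝓕.κ)).mono fun i =>
        (Fintype.card_sum (α := Unit) (β := Bits.W (α (𝓕.κ i)))).le.trans (by simp))
      (φ := fun i j l x => ¬ raw i j x l = true) h.not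
    exact (h3.or (h2.and h1)).congr fun i j x => by
      simp only [Option.exists, eq_enc_none, eq_enc_some, exists_and_left]
  dec 𝓕 V I raw h := by
    have e1 := h.reindex fun i (j : I i × Bits.W (α (𝓕.κ i))) => (j.1, .inr j.2)
    have h1 := A.valid 𝓕 V I (fun i j x w => raw i j x (.inr w)) e1
    have h2 := h.reindex fun i (j : I i) => (j, .inl ())
    have h3 := A.dec 𝓕 V I (fun i j x w => raw i j x (.inr w)) e1
    refine Fam.Easy.split (h2.and h1)
      ((h2.reindex fun i (j : I i × ℕ × A.J) => j.1).and h3) ?_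
    rintro i ⟨j, p, t | t⟩
    · refine .inl ⟨j, fun x => ⟨?_, fun ⟨h, a, ha⟩ => ⟨some a, eq_enc_some.mpr ⟨h, ha⟩, rfl⟩⟩⟩
      rintro ⟨_ | a, h, h'⟩
      · simp at h'
      · exact (eq_enc_some.mp h).imp_right fun h => ⟨a, h⟩
    · refine .inr ⟨(j, p, t), fun x => ⟨?_, fun ⟨h, a, ha, h'⟩ =>
        ⟨some a, eq_enc_some.mpr ⟨h, ha⟩, h'⟩⟩⟩
      rintro ⟨_ | a, h, h'⟩
      · simp at h'
      · exact (eq_enc_some.mp h).imp_right fun h => ⟨a, h, h'⟩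

theorem option_tst {A : Sliced C α} {k p : ℕ} {c c' : Ctx C k} {a a' : Option (α k)} :
    A.option.tst k c p a = A.option.tst k c' p a' ↔
      Option.Rel (fun x y => A.tst k c p x = A.tst k c' p y) a a' := by
  constructor
  · intro h
    rcases a with _ | a <;> rcases a' with _ | a'
    · exact .none
    · exact absurd (congrFun h (.inl ())) (by simp [option])
    · exact absurd (congrFun h (.inl ())) (by simp [option])
    · exact .some (funext fun w => congrFun h (.inr w))
  · rintro (⟨h⟩ | _)
    · simp only [option, h]
    · rfl

/-- An additional test tells the summand. -/
def sum (A : Sliced C α) (B : Sliced C β) : Sliced C fun k => α k ⊕ β k where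
  J := Unit ⊕ (A.J ⊕ B.J)
  fin := have := A.fin; have := B.fin; inferInstance
  tst k c p x := match x with
    | Sum.inl a => Sum.elim (fun _ => false) (Sum.elim (A.tst k c p a) (fun _ => false))
    | Sum.inr b => Sum.elim (fun _ => true) (Sum.elim (fun _ => false) (B.tst k c p b))
  width := by
    refine ((PolyBd.const 1).add (A.width.polyBd.add B.width.polyBd)).mono fun k => ?_
    have : Fintype.card (Bits.W (α k ⊕ β k)) =
      Fintype.card (Unit ⊕ (Bits.W (α k) ⊕ Bits.W (β k))) := rfl
    rw [this]; simp
  loc k w := by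
    rcases w with w | w | w
    · refine ⟨0, posLen_pos C k, .inl w, fun c a => ?_⟩
      rcases a with a | a <;> rfl
    · obtain ⟨p, hp, j, h⟩ := A.loc k w
      refine ⟨p, hp, .inr (.inl j), fun c a => ?_⟩
      rcases a with a | a
      · exact h c a
      · rfl
    · obtain ⟨p, hp, j, h⟩ := B.loc k w
      refine ⟨p, hp, .inr (.inr j), fun c a => ?_⟩
      rcases a with a | a
      · rfl
      · exact h c a
  valid 𝓕 V I raw h := by
    have h1 := A.valid 𝓕 V I (fun i j x w => raw i j x (.inr (.inl w)))
      (h.reindex fun i (j : I i × Bits.W (α (𝓕.κ i))) => (j.1, .inr (.inl j.2)))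
    have h2 := B.valid 𝓕 V I (fun i j x w => raw i j x (.inr (.inr w)))
      (h.reindex fun i (j : I i × Bits.W (β (𝓕.κ i))) => (j.1, .inr (.inr j.2)))
    have h3 := h.reindex fun i (j : I i) => (j, .inl ())
    have z1 := Fam.Easy.forall (L := fun i => Bits.W (α (𝓕.κ i))) (PolyBd.comp A.width 𝓕.κ)
      (φ := fun i j l x => ¬ raw i j x (.inr (.inl l)) = true)
      (h.not.reindex fun i (j : I i × Bits.W (α (𝓕.κ i))) => (j.1, .inr (.inl j.2)))
    have z2 := Fam.Easy.forall (L := fun i => Bits.W (β (𝓕.κ i))) (PolyBd.comp B.width 𝓕.κ)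
      (φ := fun i j l x => ¬ raw i j x (.inr (.inr l)) = true)
      (h.not.reindex fun i (j : I i × Bits.W (β (𝓕.κ i))) => (j.1, .inr (.inr j.2)))
    exact ((h3.not.and (z2.and h1)).or (h3.and (z1.and h2))).congr fun i j x => by
      simp only [Sum.exists, eq_enc_inl, eq_enc_inr, exists_and_left]
  dec 𝓕 V I raw h := by
    have e1 := h.reindex fun i (j : I i × Bits.W (α (𝓕.κ i))) => (j.1, .inr (.inl j.2))
    have e2 := h.reindex fun i (j : I i × Bits.W (β (𝓕.κ i))) => (j.1, .inr (.inr j.2))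
    have h1 := A.dec 𝓕 V I (fun i j x w => raw i j x (.inr (.inl w))) e1
    have h2 := B.dec 𝓕 V I (fun i j x w => raw i j x (.inr (.inr w))) e2
    have v2 := B.valid 𝓕 V I (fun i j x w => raw i j x (.inr (.inr w))) e2
    have h3 := h.reindex fun i (j : I i) => (j, .inl ())
    have z1 := Fam.Easy.forall (L := fun i => Bits.W (α (𝓕.κ i))) (PolyBd.comp A.width 𝓕.κ)
      (φ := fun i j l x => ¬ raw i j x (.inr (.inl l)) = true)
      (h.not.reindex fun i (j : I i × Bits.W (α (𝓕.κ i))) => (j.1, .inr (.inl j.2)))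
    have z2 := Fam.Easy.forall (L := fun i => Bits.W (β (𝓕.κ i))) (PolyBd.comp B.width 𝓕.κ)
      (φ := fun i j l x => ¬ raw i j x (.inr (.inr l)) = true)
      (h.not.reindex fun i (j : I i × Bits.W (β (𝓕.κ i))) => (j.1, .inr (.inr j.2)))
    have g1 := ((h3.not.and z2).reindex fun i (j : I i × ℕ × A.J) => j.1).and h1
    have g2 := ((h3.and z1).reindex fun i (j : I i × ℕ × B.J) => j.1).and h2
    have g3 := h3.and (z1.and v2)
    refine Fam.Easy.split (L := fun i => I i × ℕ × A.J) g1
      (Fam.Easy.split (J := fun i => I i ⊕ I i × ℕ × B.J) (φ := fun i j x => match j with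
        | .inl j => raw i j x (.inl ()) = true ∧ (∀ l, ¬ raw i j x (.inr (.inl l)) = true) ∧
            ∃ a, (fun w => raw i j x (.inr (.inr w))) = Bits.enc a
        | .inr j => (raw i j.1 x (.inl ()) = true ∧ ∀ l, ¬ raw i j.1 x (.inr (.inl l)) = true) ∧
            ∃ a, (fun w => raw i j.1 x (.inr (.inr w))) = Bits.enc a ∧
              B.tst _ (V.ctx i x) j.2.1 a j.2.2 = true) g3 g2 ?_) ?_
    · rintro i (j | j)
      · exact .inl ⟨j, fun _ => Iff.rfl⟩
      · exact .inr ⟨j, fun _ => Iff.rfl⟩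
    rintro i ⟨j, p, t | t | t⟩
    · refine .inr ⟨.inl j, fun x => ⟨?_, fun ⟨h, hz, a, ha⟩ =>
        ⟨.inr a, eq_enc_inr.mpr ⟨h, hz, ha⟩, rfl⟩⟩⟩
      rintro ⟨a | a, h, h'⟩
      · simp at h'
      · exact (eq_enc_inr.mp h).imp_right fun h => h.imp_right fun h => ⟨a, h⟩
    · refine .inl ⟨(j, p, t), fun x => ⟨?_, fun ⟨⟨h, hz⟩, a, ha, h'⟩ =>
        ⟨.inl a, eq_enc_inl.mpr ⟨h, hz, ha⟩, h'⟩⟩⟩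
      rintro ⟨a | a, h, h'⟩
      · have h := eq_enc_inl.mp h
        exact ⟨⟨h.1, h.2.1⟩, a, h.2.2, h'⟩
      · simp at h'
    · refine .inr ⟨.inr (j, p, t), fun x => ⟨?_, fun ⟨⟨h, hz⟩, a, ha, h'⟩ =>
        ⟨.inr a, eq_enc_inr.mpr ⟨h, hz, ha⟩, h'⟩⟩⟩
      rintro ⟨a | a, h, h'⟩
      · simp at h'
      · have h := eq_enc_inr.mp h
        exact ⟨⟨h.1, h.2.1⟩, a, h.2.2, h'⟩

theorem sum_tst {A : Sliced C α} {B : Sliced C β} {k p : ℕ} {c c' : Ctx C k}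
    {a a' : α k ⊕ β k} : (A.sum B).tst k c p a = (A.sum B).tst k c' p a' ↔
      Sum.LiftRel (fun x y => A.tst k c p x = A.tst k c' p y)
        (fun x y => B.tst k c p x = B.tst k c' p y) a a' := by
  constructor
  · intro h
    rcases a with a | a <;> rcases a' with a' | a'
    · exact .inl (funext fun w => congrFun h (.inr (.inl w)))
    · exact absurd (congrFun h (.inl ())) (by simp [sum])
    · exact absurd (congrFun h (.inl ())) (by simp [sum])
    · exact .inr (funext fun w => congrFun h (.inr (.inr w)))
  · rintro (⟨h⟩ | ⟨h⟩) <;> simp only [sum, h]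

/-- Transport along a bijection that defines the encoding. -/
def comap {α β : ℕ → Type} [∀ k, Bits (β k)] (f : ∀ k, α k → β k)
    (hf : ∀ k, Function.Injective (f k)) (hs : ∀ k, Function.Surjective (f k)) (B : Sliced C β) :
    @Sliced P C α fun k => Bits.ofInjective (f k) (hf k) :=
  letI : ∀ k, Bits (α k) := fun k => Bits.ofInjective (f k) (hf k)
  { J := B.J
    fin := B.fin
    tst := fun k c p a => B.tst k c p (f k a)
    width := B.width
    loc := fun k w =>
      let ⟨p, hp, j, h⟩ := B.loc k w
      ⟨p, hp, j, fun c a => h c (f k a)⟩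
    valid := fun 𝓕 V I raw h => (B.valid 𝓕 V I raw h).congr fun _ _ _ =>
      ⟨fun ⟨b, hb⟩ => let ⟨a, ha⟩ := hs _ b; ⟨a, by subst ha; exact hb⟩,
        fun ⟨a, ha⟩ => ⟨f _ a, ha⟩⟩
    dec := fun 𝓕 V I raw h => (B.dec 𝓕 V I raw h).congr fun _ _ _ =>
      ⟨fun ⟨b, hb, hb'⟩ => let ⟨a, ha⟩ := hs _ b; ⟨a, by subst ha; exact ⟨hb, hb'⟩⟩,
        fun ⟨a, ha, ha'⟩ => ⟨f _ a, ha, ha'⟩⟩ }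

end Sliced

end

section

variable {P : Params} {C : Prims P}

theorem lt_iff_exists_testBit {n m : ℕ} :
    n < m ↔ ∃ i, m.testBit i = true ∧ n.testBit i = false ∧
      ∀ j, i < j → n.testBit j = m.testBit j := by
  constructor
  · intro h
    obtain ⟨i, hi, hj⟩ := Nat.exists_most_significant_bit (n := n ^^^ m)
      (by rw [Ne, Nat.xor_eq_zero_iff]; exact h.ne)
    have hj' : ∀ j, i < j → n.testBit j = m.testBit j := fun j hij => by
      have := hj j hij
      rw [Nat.testBit_xor] at this
      simpa using this
    rw [Nat.testBit_xor] at hi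
    rcases hm : m.testBit i with _ | _ <;> rcases hn : n.testBit i with _ | _
    · simp [hm, hn] at hi
    · exact absurd (Nat.lt_of_testBit i hm hn fun j h => (hj' j h).symm) h.le.not_gt
    · exact ⟨i, hm, hn, hj'⟩
    · simp [hm, hn] at hi
  · rintro ⟨i, hm, hn, hj⟩
    exact Nat.lt_of_testBit i hn hm hj

namespace Sliced

/-- A signature is described by one of its bits and by all the verdicts of the verification
algorithm on it. -/
def sg {C : Prims P} (hE : C.Efficient) : Sliced C fun k => Sg C k where
  J := Unit ⊕ (Option (Fin P.Nv) × SMsg P)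
  fin := inferInstance
  tst k c p σ := Sum.elim (fun _ => if h : p < C.sig.sigLen k then σ ⟨p, h⟩ else false)
    fun vm => C.sig.verify k (c.vk vm.1) vm.2 σ
  width := hE.sig.sigLen.polyBd.mono fun k =>
    ((Fintype.card_prod (Fin (C.sig.sigLen k)) Unit).trans (by simp)).le
  loc k w := ⟨w.1, by have := w.1.2; simp only [posLen]; omega, .inl (), fun c a => by simp; rfl⟩
  valid 𝓕 V I raw h := (Fam.Easy.const fun _ _ => True).congr fun i j x => by
    rw [true_iff]
    exact ⟨fun b => raw i j x (b, ()), rfl⟩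
  dec 𝓕 V I raw h := by
    obtain ⟨s, hs, hc⟩ := hE.sig.verify
    choose D hD hDe using hc
    -- the input wires of the verification circuits
    let b : ∀ i (j : I i × Option (Fin P.Nv) × SMsg P), 𝓕.X i →
        Bits.W (Word (C.sig.vkLen (𝓕.κ i)) × SMsg P × Sg C (𝓕.κ i)) → Bool := fun i j x =>
      Bits.enc ((V.ctx i x).vk j.2.1, j.2.2, fun b => raw i j.1 x (b, ()))
    have hb : 𝓕.EasyAll (J := fun i => I i × Option (Fin P.Nv) × SMsg P)
        fun i j t x => b i j x t = true := by
      have hW : ∀ k, Fintype.card (Bits.W (Word (C.sig.vkLen k) × SMsg P × Sg C k)) =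
          C.sig.vkLen k + (Fintype.card (Bits.W (SMsg P)) + C.sig.sigLen k) := by
        intro k
        have h1 : Fintype.card (Bits.W (Word (C.sig.vkLen k) × SMsg P × Sg C k)) =
          Fintype.card (Fin (C.sig.vkLen k) × Unit ⊕ (Bits.W (SMsg P) ⊕
            Fin (C.sig.sigLen k) × Unit)) := rfl
        rw [h1]; simp
      refine Fam.Easy.all (t := fun i => C.sig.vkLen (𝓕.κ i) +
          (Fintype.card (Bits.W (SMsg P)) + C.sig.sigLen (𝓕.κ i)))
        ((PolyBd.comp hE.sig.vkLen 𝓕.κ).add ((PolyBd.const _).add (PolyBd.comp hE.sig.sigLen 𝓕.κ)))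
        (fun i j => (hW _).le) ?_
      refine Fam.Easy.split (V.vk_easy)
        (Fam.Easy.split (J := fun i => (SMsg P × Bits.W (SMsg P)) ⊕
            (I i × Bits.W (Sg C (𝓕.κ i)))) (φ := fun i j x => match j with
          | .inl y => Bits.enc y.1 y.2 = true
          | .inr y => raw i y.1 x y.2 = true)
          (Fam.Easy.const fun i (y : SMsg P × Bits.W (SMsg P)) => Bits.enc y.1 y.2 = true) h ?_) ?_
      · rintro i (j | j)
        · exact .inl ⟨j, fun _ => Iff.rfl⟩
        · exact .inr ⟨j, fun _ => Iff.rfl⟩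
      · rintro i ⟨⟨j, v, m⟩, w | w | w⟩
        · exact .inl ⟨(v, w.1), fun _ => Iff.rfl⟩
        · exact .inr ⟨.inl (m, w), fun _ => Iff.rfl⟩
        · exact .inr ⟨.inr (j, w), fun _ => Iff.rfl⟩
    have hv := (hb.eval (PolyBd.comp hs 𝓕.κ) (fun i _ => D (𝓕.κ i)) fun i j => hD _).apply
      (L := fun i => I i × Option (Fin P.Nv) × SMsg P) (fun i j => j) fun i j => ()
    have hbit : 𝓕.Easy (J := fun i => I i × ℕ) fun i j x =>
        ∃ h : j.2 < C.sig.sigLen (𝓕.κ i), raw i j.1 x (⟨j.2, h⟩, ()) = true := by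
      refine Fam.Easy.split h (Fam.Easy.const (J := fun _ => Unit) fun _ _ => False) ?_
      rintro i ⟨j, p⟩
      by_cases hp : p < C.sig.sigLen (𝓕.κ i)
      · exact .inl ⟨(j, ⟨p, hp⟩, ()), fun x => by simp [hp]⟩
      · exact .inr ⟨(), fun x => by simp [hp]⟩
    refine Fam.Easy.split hbit hv ?_
    rintro i ⟨j, p, t | ⟨v, m⟩⟩
    · refine .inl ⟨(j, p), fun x => ⟨?_, ?_⟩⟩
      · rintro ⟨a, ha, h⟩
        by_cases hp : p < C.sig.sigLen (𝓕.κ i)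
        · simp only [Sum.elim_inl, hp, dite_true] at h
          exact ⟨hp, (congrFun ha _).trans h⟩
        · simp [hp] at h
      · rintro ⟨hp, h⟩
        refine ⟨fun b => raw i j x (b, ()), rfl, ?_⟩
        simp only at hp h
        simp [hp, h]
    · refine .inr ⟨(j, v, m), fun x => ?_⟩
      have h1 : (D (𝓕.κ i)).eval (b i (j, v, m) x) () =
          C.sig.verify (𝓕.κ i) ((V.ctx i x).vk v) m fun b => raw i j x (b, ()) :=
        congrFun (hDe (𝓕.κ i) ((V.ctx i x).vk v, m, fun b => raw i j x (b, ()))) ()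
      rw [h1]
      constructor
      · rintro ⟨a, ha, h⟩
        have : (fun b => raw i j x (b, ())) = a := funext fun b => congrFun ha (b, ())
        rw [this]; exact h
      · intro h
        exact ⟨fun b => raw i j x (b, ()), rfl, h⟩

/-- Deciding whether a bit string encodes a scalar, that is, a number below the group order. -/
theorem zmod_valid (hE : C.Efficient) (𝓕 : Fam) (I : 𝓕.ι → Type)
    (raw : ∀ i, I i → 𝓕.X i → Fin (C.grp.q (𝓕.κ i)).size → Bool)
    (h : 𝓕.Easy (J := fun i => I i × Fin (C.grp.q (𝓕.κ i)).size)
      fun i j x => raw i j.1 x j.2 = true) :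
    𝓕.Easy fun i (j : I i) x => ∃ a : ZMod (C.grp.q (𝓕.κ i)), raw i j x = Bits.enc a := by
  have h1 : 𝓕.Easy (J := I) fun i j x => ∃ l : Fin (C.grp.q (𝓕.κ i)).size,
      ((C.grp.q (𝓕.κ i)).testBit l = true ∧ ¬ raw i j x l = true) ∧
      ∀ l' : Fin (C.grp.q (𝓕.κ i)).size,
        ¬ l < l' ∨ (raw i j x l' = true ↔ (C.grp.q (𝓕.κ i)).testBit l' = true) := by
    have hcard : PolyBd 𝓕.κ fun i => Fintype.card (Fin (C.grp.q (𝓕.κ i)).size) :=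
      (PolyBd.comp hE.size 𝓕.κ).mono fun i => by simp
    refine Fam.Easy.exists (L := fun i => Fin (C.grp.q (𝓕.κ i)).size) hcard
      (((Fam.Easy.const fun i (j : I i × Fin (C.grp.q (𝓕.κ i)).size) =>
        (C.grp.q (𝓕.κ i)).testBit j.2 = true).and h.not).and ?_)
    refine Fam.Easy.forall (L := fun i => Fin (C.grp.q (𝓕.κ i)).size) hcard
      (J := fun i => I i × Fin (C.grp.q (𝓕.κ i)).size)
      (φ := fun i j l' x => ¬ j.2 < l' ∨ (raw i j.1 x l' = true ↔
        (C.grp.q (𝓕.κ i)).testBit l' = true)) ?_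
    refine (Fam.Easy.const fun i (j : (I i × Fin (C.grp.q (𝓕.κ i)).size) ×
      Fin (C.grp.q (𝓕.κ i)).size) => ¬ j.1.2 < j.2).or (Fam.Easy.iff_const ?_ _)
    exact h.reindex fun i (j : (I i × Fin (C.grp.q (𝓕.κ i)).size) ×
      Fin (C.grp.q (𝓕.κ i)).size) => (j.1.1, j.2)
  refine h1.congr fun i j x => ?_
  set q := C.grp.q (𝓕.κ i)
  have hb : ∀ l (hl : l < q.size), (Nat.ofBits (raw i j x)).testBit l = raw i j x ⟨l, hl⟩ :=
    fun l hl => Nat.testBit_ofBits_lt _ _ hl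
  have hbig : ∀ l, q.size ≤ l → (Nat.ofBits (raw i j x)).testBit l = false := fun l hl =>
    Nat.testBit_ofBits_ge _ _ hl
  have hqb : ∀ l, q.size ≤ l → q.testBit l = false := fun l hl =>
    Nat.testBit_lt_two_pow ((Nat.lt_size_self q).trans_le (Nat.pow_le_pow_right (by norm_num) hl))
  constructor
  · rintro ⟨l, ⟨hl1, hl2⟩, hl3⟩
    have hlt : Nat.ofBits (raw i j x) < q := by
      refine lt_iff_exists_testBit.mpr ⟨l, hl1, ?_, fun l' hll => ?_⟩
      · rw [hb l l.2]; simpa using hl2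
      · by_cases hl' : l' < q.size
        · rw [hb l' hl', Bool.eq_iff_iff]
          exact (hl3 ⟨l', hl'⟩).resolve_left (not_not.mpr hll)
        · rw [hbig l' (by omega), hqb l' (by omega)]
    refine ⟨((Nat.ofBits (raw i j x) : ℕ) : ZMod q), funext fun l => ?_⟩
    have : Bits.enc ((Nat.ofBits (raw i j x) : ℕ) : ZMod q) l =
      (((Nat.ofBits (raw i j x) : ℕ) : ZMod q).val).testBit l := rfl
    rw [this, ZMod.val_natCast_of_lt hlt, hb l l.2]
  · rintro ⟨a, ha⟩
    have hlt := lt_iff_exists_testBit.mp (ZMod.val_lt a)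
    have he : ∀ l : Fin q.size, raw i j x l = a.val.testBit l := fun l => congrFun ha l
    obtain ⟨l, h1, h2, h3⟩ := hlt
    have hl : l < q.size := by
      by_contra hl
      rw [hqb l (by omega)] at h1
      exact absurd h1 (by simp)
    refine ⟨⟨l, hl⟩, ⟨h1, by rw [he]; simp [h2]⟩, fun l' => ?_⟩
    by_cases hll : l < l'
    · exact .inr (by rw [he, h3 l' hll])
    · exact .inl hll

/-- A scalar is described by one of its bits. -/
def zmod {C : Prims P} (hE : C.Efficient) :
    Sliced C fun k => ZMod (C.grp.q k) where
  J := Unit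
  fin := inferInstance
  tst k c p a _ := a.val.testBit p
  width := hE.size.polyBd.mono fun k => (Fintype.card_fin _).le
  loc k w := ⟨w.1, by have := w.2; simp only [posLen]; omega, (), fun c a => rfl⟩
  valid 𝓕 V I raw h := zmod_valid hE 𝓕 I raw h
  dec 𝓕 V I raw h := by
    have hbit : 𝓕.Easy (J := fun i => I i × ℕ) fun i j x =>
        ∃ h : j.2 < (C.grp.q (𝓕.κ i)).size, raw i j.1 x ⟨j.2, h⟩ = true := by
      refine Fam.Easy.split h (Fam.Easy.const (J := fun _ => Unit) fun _ _ => False) ?_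
      rintro i ⟨j, p⟩
      by_cases hp : p < (C.grp.q (𝓕.κ i)).size
      · exact .inl ⟨(j, ⟨p, hp⟩), fun x => by simp [hp]⟩
      · exact .inr ⟨(), fun x => by simp [hp]⟩
    have hv := zmod_valid hE 𝓕 I raw h
    refine ((hv.reindex fun i (j : I i × ℕ × Unit) => j.1).and
      (hbit.reindex fun i (j : I i × ℕ × Unit) => (j.1, j.2.1))).congr fun i j x => ⟨?_, ?_⟩
    · rintro ⟨⟨a, ha⟩, hp, h⟩
      exact ⟨a, ha, by rw [← h, ha]; rfl⟩
    · rintro ⟨a, ha, h⟩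
      refine ⟨⟨a, ha⟩, ?_⟩
      have hp : j.2.1 < (C.grp.q (𝓕.κ i)).size := by
        by_contra hp
        have : a.val.testBit j.2.1 = false := Nat.testBit_lt_two_pow
          (((ZMod.val_lt a).trans (Nat.lt_size_self _)).trans_le
            (Nat.pow_le_pow_right (by norm_num) (not_lt.mp hp)))
        exact absurd (this.symm.trans h) (by simp)
      exact ⟨hp, by simp only [ha]; exact h⟩

/-- Additional tests that compare the element with fixed ones. -/
def withEq {α : ℕ → Type} [∀ k, Bits (α k)] (A : Sliced C α) (T : Type) [Finite T]
    (ref : ∀ k, (Finset (Fin P.n × Line P) → Fin P.Nt → OpenShare C k) → T → α k) :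
    Sliced C α where
  J := A.J ⊕ T
  fin := have := A.fin; inferInstance
  tst k c p a := Sum.elim (A.tst k c p a) fun t => decide (a = ref k c.tv t)
  width := A.width
  loc k w := let ⟨p, hp, j, h⟩ := A.loc k w; ⟨p, hp, .inl j, h⟩
  valid := A.valid
  dec 𝓕 V I raw h := by
    have hX : ∀ i, Nonempty (𝓕.X i) → ∃ tv, ∀ x, (V.ctx i x).tv = tv := fun i ⟨x⟩ =>
      ⟨_, fun x' => V.tv_const i x' x⟩
    have hX' : ∀ i, ∃ tv, ∀ x, (V.ctx i x).tv = tv := fun i => by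
      by_cases hi : Nonempty (𝓕.X i)
      · exact hX i hi
      · exact ⟨fun _ _ _ => (0, 0), fun x => absurd ⟨x⟩ hi⟩
    choose tv htv using hX'
    have heq : 𝓕.Easy (J := fun i => I i × T) fun i j x =>
        ∀ w, (raw i j.1 x w = true ↔ Bits.enc (ref (𝓕.κ i) (tv i) j.2) w = true) := by
      refine Fam.Easy.forall (L := fun i => Bits.W (α (𝓕.κ i))) (PolyBd.comp A.width 𝓕.κ)
        (J := fun i => I i × T) (φ := fun i j w x => (raw i j.1 x w = true ↔
          Bits.enc (ref (𝓕.κ i) (tv i) j.2) w = true)) (Fam.Easy.iff_const ?_ _)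
      exact h.reindex fun i (j : (I i × T) × Bits.W (α (𝓕.κ i))) => (j.1.1, j.2)
    refine Fam.Easy.split (A.dec 𝓕 V I raw h) heq ?_
    rintro i ⟨j, p, t | t⟩
    · exact .inl ⟨(j, p, t), fun x => Iff.rfl⟩
    · refine .inr ⟨(j, t), fun x => ?_⟩
      simp only [Sum.elim_inr, decide_eq_true_eq, htv, ← Bool.eq_iff_iff]
      constructor
      · rintro ⟨a, ha, rfl⟩ w
        rw [ha]
      · intro h
        exact ⟨_, funext h, rfl⟩

theorem withEq_tst {α : ℕ → Type} [∀ k, Bits (α k)] {A : Sliced C α} {T : Type} [Finite T]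
    {ref : ∀ k, (Finset (Fin P.n × Line P) → Fin P.Nt → OpenShare C k) → T → α k} {k p : ℕ}
    {c c' : Ctx C k} {a a' : α k} :
    (A.withEq T ref).tst k c p a = (A.withEq T ref).tst k c' p a' ↔
      A.tst k c p a = A.tst k c' p a' ∧ ∀ t, a = ref k c.tv t ↔ a' = ref k c'.tv t := by
  constructor
  · intro h
    exact ⟨funext fun w => congrFun h (.inl w), fun t => by
      simpa [withEq] using congrFun h (.inr t)⟩
  · rintro ⟨h, h'⟩
    simp only [withEq, h, h']

/-- Shares of openings, compared with the valid shares of all tally sets. -/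
def openShare {C : Prims P} (hE : C.Efficient) :
    Sliced C fun k => OpenShare C k :=
  ((zmod hE).prod (zmod hE)).pi (Fin P.m) |>.withEq
    (Finset (Fin P.n × Line P) × Fin P.Nt) fun _ tv t => tv t.1 t.2

end Sliced

end

section

variable {P : Params} {C : Prims P} {k : ℕ}

/-! ### Related states of two runs -/

/-- Relations between the data of unbounded size of two runs: signatures, shares of the opening of
a tally set, shares of openings outside the tally set, and results. -/
structure PayRel (C : Prims P) (k : ℕ) where
  sg : Sg C k → Sg C k → Prop
  os : OpenShare C k → OpenShare C k → Prop
  op : (Fin P.n → Line P → Option (OpenShare C k)) →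
    (Fin P.n → Line P → Option (OpenShare C k)) → Prop
  rs : (Fin P.m → ZMod (C.grp.q k)) → (Fin P.m → ZMod (C.grp.q k)) → Prop

section Rel

variable (R : PayRel C k)

def CertRel (u u' : Cert C k) : Prop := ∀ j, Option.Rel R.sg (u j) (u' j)

def CodeRel (c c' : Word 128 × Cert C k) : Prop := c.1 = c'.1 ∧ CertRel R c.2 c'.2

/-- Messages of the same kind that agree in all data of bounded size. -/
inductive MsgRel : Msg C k → Msg C k → Prop
  | vote s vc : MsgRel (.vote s vc) (.vote s vc)
  | endorse s vc : MsgRel (.endorse s vc) (.endorse s vc)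
  | endorsement s vc {σ σ'} (h : R.sg σ σ') : MsgRel (.endorsement s vc σ) (.endorsement s vc σ')
  | voteP s vc x {σ σ' u u'} (h : R.sg σ σ') (hu : CertRel R u u') :
      MsgRel (.voteP s vc x σ u) (.voteP s vc x σ' u')
  | receipt r : MsgRel (.receipt r) (.receipt r)
  | announce s {c c'} (h : Option.Rel (CodeRel R) c c') : MsgRel (.announce s c) (.announce s c')
  | recoverReq s : MsgRel (.recoverReq s) (.recoverReq s)
  | recoverResp s vc {u u'} (h : CertRel R u u') :
      MsgRel (.recoverResp s vc u) (.recoverResp s vc u')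
  | bcInput s b : MsgRel (.bcInput s b) (.bcInput s b)
  | voteSet Q x {σ σ'} (h : R.sg σ σ') : MsgRel (.voteSet Q x σ) (.voteSet Q x σ')
  | published Q : MsgRel (.published Q) (.published Q)
  | bbData Q D : MsgRel (.bbData Q D) (.bbData Q D)
  | opening {o o' T T'} (h : R.op o o') (h' : R.os T T') : MsgRel (.opening o T) (.opening o' T')
  | result {r r'} (h : R.rs r r') : MsgRel (.result r) (.result r')

def EnvRel (e e' : Envelope C k) : Prop :=
  e.1 = e'.1 ∧ e.2.1 = e'.2.1 ∧ MsgRel R e.2.2 e'.2.2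

def OutRel (o o' : Outbox C k) : Prop :=
  List.Forall₂ (fun a b => a.1 = b.1 ∧ MsgRel R a.2 b.2) o o'

structure BallotRel (b b' : VCBallot C k) : Prop where
  endorsed : Option.Rel (fun x y => x.1 = y.1 ∧ R.sg x.2 y.2) b.endorsed b'.endorsed
  req : b.req = b'.req
  sigs : CertRel R b.sigs b'.sigs
  used : Option.Rel (CodeRel R) b.used b'.used
  lrs : b.lrs = b'.lrs
  receipt : b.receipt = b'.receipt
  ann : ∀ j, Option.Rel (Option.Rel (CodeRel R)) (b.ann j) (b'.ann j)
  entered : b.entered = b'.entered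
  decided : b.decided = b'.decided

/-- Clocks count only up to the end of the election. -/
structure VCRel (st st' : VCState C k) : Prop where
  clock : min st.clock (P.Tend + 1) = min st'.clock (P.Tend + 1)
  ballot : ∀ s, BallotRel R (st.ballot s) (st'.ballot s)
  done : st.done = st'.done

/-- A result is related to any other: the node never reads it. -/
structure BBRel (st st' : BBState C k) : Prop where
  got : ∀ i, Option.Rel (fun g g' => g.1 = g'.1 ∧ g.2.1 = g'.2.1 ∧ R.sg g.2.2 g'.2.2)
    (st.got i) (st'.got i)
  pub : st.pub = st'.pub
  key : st.key = st'.key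
  shown : st.shown = st'.shown
  posts : ∀ t, Option.Rel R.os (st.posts t) (st'.posts t)
  result : st.result.isSome = st'.result.isSome

/-- The components of the system other than the lists of messages are related. -/
structure SysRel (y y' : Sys C k) : Prop where
  vc : ∀ i, VCRel R (y.vc i) (y'.vc i)
  bb : ∀ b, BBRel R (y.bb b) (y'.bb b)
  tr : y.tr = y'.tr
  voter : y.voter = y'.voter
  bc : y.bc = y'.bc

/-- Predicates of a VC node, a ballot and a vote code. -/
abbrev CodePred (P : Params) : Type := Fin P.Nv → Fin P.n → Word 128 → Prop

/-- Two setups under which the servers behave alike: `G i s vc` allows VC node `i` to endorse `vc`,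
and `D i s l` allows it to disclose its receipt share at line `l` of ballot `s`. -/
structure SetupRel (G : CodePred P)
    (D : Fin P.Nv → Fin P.n → Line P → Prop) (S S' : Setup C k) : Prop where
  lineOf : ∀ s vc, S.lineOf s vc = S'.lineOf s vc
  verify : ∀ i {σ σ'} x, R.sg σ σ' → C.sig.verify k (S.vk i) x σ = C.sig.verify k (S'.vk i) x σ'
  verifyEA : ∀ {σ σ'} x, R.sg σ σ' → C.sig.verify k S.eaVk x σ = C.sig.verify k S'.eaVk x σ'
  endorse : ∀ i s vc, G i s vc → R.sg (C.sig.sign k (S.sk i) (S.vcCoin i s) (.endorse s vc))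
    (C.sig.sign k (S'.sk i) (S'.vcCoin i s) (.endorse s vc))
  rshare : ∀ i s l, D i s l → S.rshare s l i = S'.rshare s l i ∧
    R.sg (S.rshareSig s l i) (S'.rshareSig s l i)
  kshare : ∀ i, S.kshare i = S'.kshare i ∧ R.sg (S.kshareSig i) (S'.kshareSig i)
  hmsk : ∀ key, (C.hash.hash k S.hk (key, S.saltM) = S.hmsk) ↔
    (C.hash.hash k S'.hk (key, S'.saltM) = S'.hmsk)
  codes : S.codes = S'.codes
  post : ∀ E t {T T'}, R.os T T' →
    ((S.ValidPost E t T ∨ S'.ValidPost E t T') → S.ValidPost E t T ∧ S'.ValidPost E t T' ∧ T = T')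
  tshare : S.tshare = S'.tshare
  code : S.code = S'.code
  os_refl : ∀ T, R.os T T
  op_refl : ∀ o, R.op o o
  rs_refl : ∀ r, R.rs r r

end Rel

section Congr

variable {R : PayRel C k} {G : CodePred P}
  {D : Fin P.Nv → Fin P.n → Line P → Prop} {S S' : Setup C k}

theorem optRel_isSome {α β : Type} {r : α → β → Prop} {a : Option α} {b : Option β}
    (h : Option.Rel r a b) : a.isSome = b.isSome := by
  cases h <;> rfl

theorem optRel_map {α β γ : Type} {r : α → β → Prop} {a : Option α} {b : Option β} {f : α → γ}
    {g : β → γ} (h : Option.Rel r a b) (hfg : ∀ x y, r x y → f x = g y) :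
    a.map f = b.map g := by
  rcases h with h | _
  · exact congrArg some (hfg _ _ h)
  · rfl

theorem optRel_none {α β : Type} {r : α → β → Prop} {a : Option α} {b : Option β}
    (h : Option.Rel r a b) : a = none ↔ b = none := by
  cases h <;> simp

theorem optRel_update {ι α : Type} [DecidableEq ι] {r : α → α → Prop} {f g : ι → Option α}
    (h : ∀ i, Option.Rel r (f i) (g i)) (j : ι) {a b : α} (hab : r a b) (i : ι) :
    Option.Rel r (Function.update f j (some a) i) (Function.update g j (some b) i) := by
  by_cases hij : i = j
  · subst hij; simpa using Option.Rel.some hab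
  · simpa [hij] using h i

theorem count_rel {ι α : Type} [Fintype ι] {r : α → α → Prop} {f g : ι → Option α}
    (h : ∀ i, Option.Rel r (f i) (g i)) : count f = count g := by
  unfold count
  simp only [fun i => optRel_isSome (h i)]

theorem outRel_nil : OutRel R ([] : Outbox C k) [] := .nil

theorem outRel_single {a : Party P} {m m' : Msg C k} (h : MsgRel R m m') :
    OutRel R [(a, m)] [(a, m')] := .cons ⟨rfl, h⟩ .nil

theorem outRel_append {o o' t t' : Outbox C k} (h : OutRel R o o') (h' : OutRel R t t') :
    OutRel R (o ++ t) (o' ++ t') := List.rel_append h h'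

theorem outRel_map {α : Type} (l : List α) {f g : α → Party P × Msg C k}
    (h : ∀ a, (f a).1 = (g a).1 ∧ MsgRel R (f a).2 (g a).2) : OutRel R (l.map f) (l.map g) := by
  induction l with
  | nil => exact .nil
  | cons a l ih => exact .cons (h a) ih

theorem outRel_flatMap {α : Type} (l : List α) {f g : α → Outbox C k}
    (h : ∀ a, OutRel R (f a) (g a)) : OutRel R (l.flatMap f) (l.flatMap g) := by
  induction l with
  | nil => exact .nil
  | cons a l ih =>
    rw [List.flatMap_cons, List.flatMap_cons]
    exact outRel_append (h a) ih

theorem outRel_toVCs {m m' : Msg C k} (h : MsgRel R m m') : OutRel R (toVCs m) (toVCs m') :=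
  outRel_map _ fun _ => ⟨rfl, h⟩

theorem outRel_toBBs {m m' : Msg C k} (h : MsgRel R m m') : OutRel R (toBBs m) (toBBs m') :=
  outRel_map _ fun _ => ⟨rfl, h⟩

theorem outRel_toTrs {m m' : Msg C k} (h : MsgRel R m m') : OutRel R (toTrs m) (toTrs m') :=
  outRel_map _ fun _ => ⟨rfl, h⟩

variable {st st' : VCState C k}

theorem VCRel.voting (h : VCRel R st st') : st.Voting ↔ st'.Voting := by
  have hc := h.clock
  unfold VCState.Voting
  omega

theorem VCRel.ended (h : VCRel R st st') : st.Ended ↔ st'.Ended := by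
  have hc := h.clock
  unfold VCState.Ended
  omega

theorem VCRel.set (h : VCRel R st st') (s : Fin P.n) {b b' : VCBallot C k}
    (hb : BallotRel R b b') : VCRel R (st.set s b) (st'.set s b') := by
  refine ⟨h.clock, fun t => ?_, h.done⟩
  by_cases hts : t = s
  · subst hts; simpa [VCState.set] using hb
  · simpa [VCState.set, hts] using h.ballot t

/-- Related results of a step of a VC node. -/
def StepRel (R : PayRel C k) (r r' : VCState C k × Outbox C k) : Prop :=
  VCRel R r.1 r'.1 ∧ OutRel R r.2 r'.2

theorem VCRel.nop (h : VCRel R st st') : StepRel R (st, []) (st', []) := ⟨h, outRel_nil⟩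

theorem SetupRel.validCert (hS : SetupRel R G D S S') {s : Fin P.n} {vc : Word 128}
    {u u' : Cert C k} (h : CertRel R u u') : S.ValidCert s vc u ↔ S'.ValidCert s vc u' := by
  unfold Setup.ValidCert
  have : ∀ i, (∃ σ, u i = some σ ∧ C.sig.verify k (S.vk i) (.endorse s vc) σ = true) ↔
      ∃ σ, u' i = some σ ∧ C.sig.verify k (S'.vk i) (.endorse s vc) σ = true := by
    intro i
    have hi := h i
    generalize u i = a, u' i = b at hi ⊢
    rcases hi with h | _
    · simp [hS.verify i _ h]
    · simp
  simp only [this]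

theorem SetupRel.certified (hS : SetupRel R G D S S') {s : Fin P.n} {c c' : Word 128 × Cert C k}
    (h : CodeRel R c c') : S.Certified s c ↔ S'.Certified s c' := by
  unfold Setup.Certified
  rw [hS.lineOf, hS.validCert h.2, h.1]

theorem onVote_rel (hS : SetupRel R G D S S') (h : VCRel R st st')
    (src : Party P) (s : Fin P.n) (vc : Word 128) :
    StepRel R (S.onVote st src s vc) (S'.onVote st' src s vc) := by
  have hb := h.ballot s
  have hu := hb.used
  unfold Setup.onVote
  simp only [h.voting, hS.lineOf, hb.receipt]
  by_cases hV : st'.Voting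
  · simp only [hV, not_true, if_false]
    rcases hu1 : (st.ballot s).used with _ | ⟨vc1, u1⟩ <;>
      rcases hu2 : (st'.ballot s).used with _ | ⟨vc2, u2⟩ <;> rw [hu1, hu2] at hu
    rotate_left
    · cases hu
    · cases hu
    · rcases hu with hu | _
      obtain rfl : vc1 = vc2 := hu.1
      simp only
      rcases (st'.ballot s).receipt with _ | r
      · exact h.nop
      · simp only
        split_ifs
        · exact ⟨h, outRel_single (.receipt r)⟩
        · exact h.nop
    · simp only
      split_ifs
      · exact ⟨h.set s { hb with req := rfl, sigs := fun _ => .none, used := .none, receipt := rfl },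
          outRel_toVCs (.endorse s vc)⟩
      · exact h.nop
  · simp only [hV, not_false_iff, if_true]
    exact h.nop

theorem onEndorse_rel (hS : SetupRel R G D S S') (h : VCRel R st st')
    (i j : Fin P.Nv) (s : Fin P.n) (vc : Word 128)
    (hG : ∀ vc' σ, ((S.onEndorse i st j s vc).1.ballot s).endorsed = some (vc', σ) → G i s vc') :
    StepRel R (S.onEndorse i st j s vc) (S'.onEndorse i st' j s vc) := by
  have hb := h.ballot s
  have hu := hb.endorsed
  revert hG
  unfold Setup.onEndorse
  simp only [h.voting]
  by_cases hV : st'.Voting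
  · simp only [hV, not_true, if_false]
    revert hu
    generalize (st.ballot s).endorsed = u
    generalize (st'.ballot s).endorsed = u'
    rintro (hu | _) hG
    · simp only [hu.1]
      split_ifs
      · exact ⟨h, outRel_single (.endorsement s vc hu.2)⟩
      · exact h.nop
    · have hg := hS.endorse i s vc (hG vc _ (by simp [VCState.set]; rfl))
      exact ⟨h.set s ⟨.some ⟨rfl, hg⟩, hb.req, hb.sigs, hb.used, hb.lrs, hb.receipt, hb.ann,
        hb.entered, hb.decided⟩, outRel_single (.endorsement s vc hg)⟩
  · simp only [hV, not_false_iff, if_true]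
    exact fun _ => h.nop

theorem addShare_rel (h : VCRel R st st') (s : Fin P.n) (j : Fin P.Nv)
    (x : Word 64) : StepRel R (Setup.addShare st s j x) (Setup.addShare st' s j x) := by
  have hb := h.ballot s
  have hu := hb.used
  unfold Setup.addShare
  simp only [hb.receipt, hb.lrs, hb.req]
  split_ifs
  · refine ⟨h.set s { hb with req := rfl, lrs := rfl, receipt := rfl }, ?_⟩
    simp only
    revert hu
    generalize (st.ballot s).used = u
    generalize (st'.ballot s).used = u'
    rintro (hu | _)
    · rcases (st'.ballot s).req with _ | ⟨vc, src⟩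
      · exact outRel_nil
      · simp only [hu.1]
        split_ifs
        · exact outRel_single (.receipt _)
        · exact outRel_nil
    · rcases (st'.ballot s).req with _ | ⟨vc, src⟩ <;> exact outRel_nil
  · exact ⟨h.set s { hb with req := rfl, lrs := rfl, receipt := rfl }, outRel_nil⟩

theorem votePMsg_rel (hS : SetupRel R G D S S') {i : Fin P.Nv} {s : Fin P.n} {l : Line P}
    (vc : Word 128) (hD : D i s l) {u u' : Cert C k} (hu : CertRel R u u') :
    MsgRel R (S.votePMsg i s vc l u) (S'.votePMsg i s vc l u') := by
  obtain ⟨h1, h2⟩ := hS.rshare i s l hD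
  unfold Setup.votePMsg
  rw [h1]
  exact .voteP s vc _ h2 hu

/-- All disclosures of receipt shares in an outbox of VC node `i` are allowed. -/
def Discloses (S : Setup C k) (D : Fin P.Nv → Fin P.n → Line P → Prop) (i : Fin P.Nv)
    (o : Outbox C k) : Prop :=
  ∀ dst s vc x σ u l, (dst, Msg.voteP s vc x σ u) ∈ o → S.lineOf s vc = some l → D i s l

theorem discloses_toVCs {i : Fin P.Nv} {s : Fin P.n} {vc : Word 128} {l l' : Line P}
    {u : Cert C k} (hl : S.lineOf s vc = some l) (o : Outbox C k)
    (h : Discloses S D i (toVCs (S.votePMsg i s vc l' u) ++ o)) : D i s l :=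
  h (.vc i) s vc _ _ u l (List.mem_append_left _ (List.mem_map.mpr ⟨i, List.mem_finRange i, rfl⟩))
    hl

theorem onEndorsement_rel (hS : SetupRel R G D S S') (h : VCRel R st st')
    (i j : Fin P.Nv) (s : Fin P.n) (vc : Word 128) {σ σ' : Sg C k} (hσ : R.sg σ σ')
    (hD : Discloses S D i (S.onEndorsement i st j s vc σ).2) :
    StepRel R (S.onEndorsement i st j s vc σ) (S'.onEndorsement i st' j s vc σ') := by
  have hb := h.ballot s
  have hu : CertRel R (Function.update (st.ballot s).sigs j (some σ))
      (Function.update (st'.ballot s).sigs j (some σ')) := optRel_update hb.sigs j hσ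
  revert hD
  unfold Setup.onEndorsement
  have hcnt := count_rel hu
  rcases hl : S'.lineOf s vc with _ | l
  · simp only [h.voting, hS.verify j _ hσ, hb.req, optRel_none hb.used, hS.lineOf, hl]
    exact fun _ => by split_ifs <;> exact h.nop
  · simp only [h.voting, hS.verify j _ hσ, hb.req, optRel_none hb.used, hS.lineOf, hl, hcnt]
    split_ifs
    · intro hD
      have hd := discloses_toVCs (by rw [hS.lineOf, hl]) [] (by simpa using hD)
      exact ⟨h.set s { hb with req := rfl, sigs := hu, used := .some ⟨rfl, hu⟩ },
        outRel_toVCs (votePMsg_rel hS vc hd hu)⟩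
    · exact fun _ => ⟨h.set s { hb with req := rfl, sigs := hu }, outRel_nil⟩
    · exact fun _ => h.nop

theorem onVoteP_rel (hS : SetupRel R G D S S') (h : VCRel R st st')
    (i j : Fin P.Nv) (s : Fin P.n) (vc : Word 128) (x : Word 64) {σ σ' : Sg C k} (hσ : R.sg σ σ')
    {u u' : Cert C k} (hu : CertRel R u u')
    (hD : Discloses S D i (S.onVoteP i st j s vc x σ u).2) :
    StepRel R (S.onVoteP i st j s vc x σ u) (S'.onVoteP i st' j s vc x σ' u') := by
  have hb := h.ballot s
  have hus := hb.used
  revert hD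
  unfold Setup.onVoteP
  simp only [h.voting, hS.validCert hu, hS.lineOf, hS.verifyEA _ hσ]
  split_ifs
  · rcases hl : S'.lineOf s vc with _ | l
    · exact fun _ => h.nop
    · simp only
      split_ifs
      · revert hus
        rcases hu1 : (st.ballot s).used with _ | ⟨vc1, u1⟩ <;>
          rcases hu2 : (st'.ballot s).used with _ | ⟨vc2, u2⟩
        · rintro _
          simp only
          intro hD
          have hd := discloses_toVCs (by rw [hS.lineOf, hl]) _ hD
          have h1 := addShare_rel (h.set s (b := { st.ballot s with used := some (vc, u) })
            (b' := { st'.ballot s with used := some (vc, u') })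
            { hb with used := .some ⟨rfl, hu⟩ }) s j x
          exact ⟨h1.1, outRel_append (outRel_toVCs (votePMsg_rel hS vc hd hu)) h1.2⟩
        · rintro ⟨⟩
        · rintro ⟨⟩
        · rintro (h1 | _)
          obtain rfl : vc1 = vc2 := h1.1
          simp only
          split_ifs
          · exact fun _ => addShare_rel h s j x
          · exact fun _ => h.nop
      · exact fun _ => h.nop
  · exact fun _ => h.nop

theorem vcHandle_rel (hS : SetupRel R G D S S') (h : VCRel R st st')
    (i : Fin P.Nv) (src : Party P) {x x' : Msg C k} (hx : MsgRel R x x')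
    (hG : ∀ s vc σ, ((S.vcHandle i st src x).1.ballot s).endorsed = some (vc, σ) → G i s vc)
    (hD : Discloses S D i (S.vcHandle i st src x).2) :
    StepRel R (S.vcHandle i st src x) (S'.vcHandle i st' src x') := by
  have nop : StepRel R (st, ([] : Outbox C k)) (st', []) := h.nop
  cases hx with
  | vote s vc =>
    cases src <;> exact onVote_rel hS h _ s vc
  | endorse s vc =>
    cases src with
    | vc j => exact onEndorse_rel hS h i j s vc fun vc' σ => hG s vc' σ
    | _ => exact nop
  | endorsement s vc hσ =>
    cases src with
    | vc j => exact onEndorsement_rel hS h i j s vc hσ hD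
    | _ => exact nop
  | voteP s vc y hσ hu =>
    cases src with
    | vc j => exact onVoteP_rel hS h i j s vc y hσ hu hD
    | _ => exact nop
  | announce s hc =>
    cases src with
    | vc j =>
      have hb := h.ballot s
      simp only [Setup.vcHandle, optRel_none (hb.ann j)]
      split_ifs
      · exact ⟨h.set s { hb with ann := optRel_update hb.ann j hc }, outRel_nil⟩
      · exact nop
    | _ => exact nop
  | recoverReq s =>
    cases src with
    | vc j =>
      have hu := (h.ballot s).used
      simp only [Setup.vcHandle, h.ended]
      revert hu
      generalize (st.ballot s).used = u
      generalize (st'.ballot s).used = u'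
      rintro (@⟨⟨vc1, u1⟩, ⟨vc2, u2⟩, hu⟩ | _)
      · obtain ⟨rfl, hu⟩ := hu
        simp only
        split_ifs
        · exact ⟨h, outRel_single (.recoverResp s _ hu)⟩
        · exact nop
      · exact nop
    | _ => exact nop
  | recoverResp s vc hu =>
    cases src with
    | vc j =>
      have hb := h.ballot s
      rename_i u u'
      have hc : S.Certified s (vc, u) ↔ S'.Certified s (vc, u') := hS.certified ⟨rfl, hu⟩
      simp only [Setup.vcHandle, hb.decided, optRel_none hb.used, hc]
      split_ifs
      · exact ⟨h.set s { hb with used := .some ⟨rfl, hu⟩, decided := rfl }, outRel_nil⟩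
      · exact nop
    | _ => exact nop
  | _ => cases src <;> exact nop

theorem findSome_rel {α β : Type} {r : β → β → Prop} (l : List α) {f g : α → Option β}
    (h : ∀ a, Option.Rel r (f a) (g a)) : Option.Rel r (l.findSome? f) (l.findSome? g) := by
  induction l with
  | nil => exact .none
  | cons a l ih =>
    rw [List.findSome?_cons, List.findSome?_cons]
    have ha := h a
    generalize f a = x, g a = y at ha ⊢
    rcases ha with ha | _
    · exact .some ha
    · exact ih

theorem vcAdvance_rel (hS : SetupRel R G D S S') (s : Fin P.n) {b b' : VCBallot C k}
    (h : BallotRel R b b') : BallotRel R (S.vcAdvance s b) (S'.vcAdvance s b') := by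
  have h1 : Option.Rel (CodeRel R)
      (b.used <|> (List.finRange P.Nv).findSome? fun j =>
        (b.ann j).join.filter fun c => decide (S.Certified s c))
      (b'.used <|> (List.finRange P.Nv).findSome? fun j =>
        (b'.ann j).join.filter fun c => decide (S'.Certified s c)) := by
    have hu := h.used
    revert hu
    generalize b.used = u
    generalize b'.used = u'
    rintro (hu | _)
    · exact .some hu
    · refine findSome_rel _ fun j => ?_
      have hj := h.ann j
      revert hj
      generalize b.ann j = a
      generalize b'.ann j = a'
      rintro (hj | _)
      · rcases hj with hj | _
        · simp only [Option.join_some, Option.filter_some, hS.certified hj]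
          split_ifs
          · exact .some hj
          · exact .none
        · exact .none
      · exact .none
  unfold Setup.vcAdvance
  simp only [count_rel h.ann, h.entered, optRel_isSome h1]
  split_ifs
  · exact { h with used := h1, entered := rfl }
  · exact { h with used := h1, entered := rfl }

theorem outRel_filterMap {α : Type} (l : List α) {f g : α → Option (Party P × Msg C k)}
    (h : ∀ a, Option.Rel (fun a b => a.1 = b.1 ∧ MsgRel R a.2 b.2) (f a) (g a)) :
    OutRel R (l.filterMap f) (l.filterMap g) := by
  induction l with
  | nil => exact .nil
  | cons a l ih =>
    rw [List.filterMap_cons, List.filterMap_cons]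
    have ha := h a
    generalize f a = x, g a = y at ha ⊢
    rcases ha with ha | _
    · exact .cons ha ih
    · exact ih

theorem vcSettle_rel (hS : SetupRel R G D S S') (h : VCRel R st st')
    (i : Fin P.Nv) : StepRel R (S.vcSettle i st) (S'.vcSettle i st') := by
  have hadv : ∀ s, BallotRel R (S.vcAdvance s (st.ballot s)) (S'.vcAdvance s (st'.ballot s)) :=
    fun s => vcAdvance_rel hS s (h.ballot s)
  have hout : OutRel R
      ((List.finRange P.n).filterMap fun s =>
        match (st.ballot s).entered, (S.vcAdvance s (st.ballot s)).entered with
        | none, some b => some (Party.env, Msg.bcInput s b)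
        | _, _ => none)
      ((List.finRange P.n).filterMap fun s =>
        match (st'.ballot s).entered, (S'.vcAdvance s (st'.ballot s)).entered with
        | none, some b => some (Party.env, Msg.bcInput s b)
        | _, _ => none) := by
    refine outRel_filterMap _ fun s => ?_
    rw [(h.ballot s).entered, (hadv s).entered]
    rcases (st'.ballot s).entered with _ | _ <;>
      rcases (S'.vcAdvance s (st'.ballot s)).entered with _ | b
    · exact .none
    · exact .some ⟨rfl, .bcInput s b⟩
    · exact .none
    · exact .none
  unfold Setup.vcSettle
  simp only [h.ended, h.done, fun s => (hadv s).decided, fun s => optRel_isSome (hadv s).used,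
    fun s => optRel_map (hadv s).used (f := Prod.fst) (g := Prod.fst) fun x y h => h.1]
  split_ifs
  · exact ⟨⟨h.clock, hadv, rfl⟩, outRel_append hout (outRel_toBBs (by
      rw [(hS.kshare i).1]; exact .voteSet _ _ (hS.kshare i).2))⟩
  · exact ⟨⟨h.clock, hadv, rfl⟩, hout⟩
  · exact h.nop

theorem vcFinish_rel (hS : SetupRel R G D S S') {r r' : VCState C k × Outbox C k}
    (h : StepRel R r r') (i : Fin P.Nv) : StepRel R (S.vcFinish i r) (S'.vcFinish i r') :=
  have h1 := vcSettle_rel hS h.1 i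
  ⟨h1.1, outRel_append h.2 h1.2⟩

theorem vcAdvance_endorsed (s : Fin P.n) (b : VCBallot C k) :
    (S.vcAdvance s b).endorsed = b.endorsed := by
  unfold Setup.vcAdvance
  simp only
  split_ifs <;> rfl

theorem vcFinish_endorsed (i : Fin P.Nv) (r : VCState C k × Outbox C k) (s : Fin P.n) :
    ((S.vcFinish i r).1.ballot s).endorsed = (r.1.ballot s).endorsed := by
  unfold Setup.vcFinish Setup.vcSettle
  simp only
  split_ifs <;> simp [vcAdvance_endorsed]

theorem vcRecv_rel (hS : SetupRel R G D S S') (h : VCRel R st st')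
    (i : Fin P.Nv) (src : Party P) {x x' : Msg C k} (hx : MsgRel R x x')
    (hG : ∀ s vc σ, ((S.vcRecv i st src x).1.ballot s).endorsed = some (vc, σ) → G i s vc)
    (hD : Discloses S D i (S.vcRecv i st src x).2) :
    StepRel R (S.vcRecv i st src x) (S'.vcRecv i st' src x') := by
  refine vcFinish_rel hS (vcHandle_rel hS h i src hx (fun s vc σ h => hG s vc σ ?_) ?_) i
  · rw [Setup.vcRecv, vcFinish_endorsed, h]
  · exact fun dst s vc x σ u l hm => hD dst s vc x σ u l (List.mem_append_left _ hm)

theorem vcTick_rel (hS : SetupRel R G D S S') (h : VCRel R st st')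
    (i : Fin P.Nv) : StepRel R (S.vcTick i st) (S'.vcTick i st') := by
  have hc := h.clock
  refine vcFinish_rel hS ⟨⟨by simp only; omega, h.ballot, h.done⟩, ?_⟩ i
  have h1 : st.clock + 1 = P.Tend ↔ st'.clock + 1 = P.Tend := by omega
  simp only [h1]
  split_ifs
  · exact outRel_flatMap _ fun s => outRel_toVCs (.announce s (h.ballot s).used)
  · exact outRel_nil

theorem vcDecide_rel (hS : SetupRel R G D S S') (h : VCRel R st st')
    (i : Fin P.Nv) (s : Fin P.n) (v : Bool) :
    StepRel R (S.vcDecide i st s v) (S'.vcDecide i st' s v) := by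
  have hb := h.ballot s
  unfold Setup.vcDecide
  simp only [hb.entered, hb.decided, optRel_none hb.used]
  by_cases hc : (st'.ballot s).entered.isSome = true ∧ (st'.ballot s).decided = none
  · rw [if_pos hc, if_pos hc]
    refine vcFinish_rel hS ⟨h.set s
      (b := { st.ballot s with entered := (st'.ballot s).entered, decided := some v })
      (b' := { st'.ballot s with decided := some v })
      { hb with entered := rfl, decided := rfl }, ?_⟩ i
    simp only
    split_ifs
    · exact outRel_toVCs (.recoverReq s)
    · exact outRel_nil
  · rw [if_neg hc, if_neg hc]
    exact h.nop

theorem bbHandle_rel {st st' : BBState C k} (h : BBRel R st st') (src : Party P) {x x' : Msg C k}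
    (hx : MsgRel R x x') :
    BBRel R (Setup.bbHandle st src x).1 (Setup.bbHandle st' src x').1 ∧
      OutRel R (Setup.bbHandle st src x).2 (Setup.bbHandle st' src x').2 := by
  have nop : BBRel R (st, ([] : Outbox C k)).1 (st', ([] : Outbox C k)).1 ∧
      OutRel R (st, ([] : Outbox C k)).2 (st', ([] : Outbox C k)).2 := ⟨h, outRel_nil⟩
  cases hx with
  | voteSet Q x hσ =>
    rename_i σ σ'
    cases src with
    | vc i =>
      have hgot := optRel_update h.got i (a := (Q, x, σ)) (b := (Q, x, σ')) ⟨rfl, rfl, hσ⟩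
      have hmap : ∀ j, (Function.update st.got i (some (Q, x, σ)) j).map Prod.fst =
          (Function.update st'.got i (some (Q, x, σ')) j).map Prod.fst := fun j =>
        optRel_map (hgot j) fun a b h => h.1
      simp only [Setup.bbHandle, optRel_none (h.got i), h.pub, hmap]
      split_ifs
      · exact ⟨⟨hgot, rfl, h.key, h.shown, h.posts, h.result⟩, outRel_single (.published Q)⟩
      · exact ⟨⟨hgot, rfl, h.key, h.shown, h.posts, h.result⟩, outRel_nil⟩
      · exact nop
    | _ => exact nop
  | opening ho hT =>
    cases src with
    | tr t =>
      simp only [Setup.bbHandle, optRel_none (h.posts t)]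
      split_ifs
      · exact ⟨{ h with posts := optRel_update h.posts t hT }, outRel_nil⟩
      · exact nop
    | _ => exact nop
  | _ => cases src <;> exact nop

theorem bbKey_rel (hS : SetupRel R G D S S') {st st' : BBState C k} (h : BBRel R st st') :
    BBRel R (S.bbKey st) (S'.bbKey st') := by
  have hsh : ∀ i, ((st.got i).bind fun g =>
        if C.sig.verify k S.eaVk (.kshare i g.2.1) g.2.2 = true then some g.2.1 else none) =
      ((st'.got i).bind fun g =>
        if C.sig.verify k S'.eaVk (.kshare i g.2.1) g.2.2 = true then some g.2.1 else none) := by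
    intro i
    have hi := h.got i
    generalize st.got i = a, st'.got i = b at hi ⊢
    rcases hi with hi | _
    · simp only [Option.bind_some, hi.2.1, hS.verifyEA _ hi.2.2]
    · rfl
  unfold Setup.bbKey
  simp only [hsh, h.key, hS.hmsk]
  split_ifs
  · exact { h with key := rfl }
  · exact h

theorem bbSettle_rel (hS : SetupRel R G D S S') {st st' : BBState C k} (h : BBRel R st st') :
    BBRel R (S.bbSettle st).1 (S'.bbSettle st').1 ∧
      OutRel R (S.bbSettle st).2 (S'.bbSettle st').2 := by
  unfold Setup.bbSettle
  rw [h.pub, h.key]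
  rcases st'.pub with _ | Q <;> rcases st'.key with _ | key
  · exact ⟨h, outRel_nil⟩
  · exact ⟨h, outRel_nil⟩
  · exact ⟨h, outRel_nil⟩
  · have hval : ∀ t, ((st.posts t).filter fun T =>
          decide (S.ValidPost (tallySet Q (S.codes key)) t T)) =
        ((st'.posts t).filter fun T =>
          decide (S'.ValidPost (tallySet Q (S'.codes key)) t T)) := by
      intro t
      rw [hS.codes]
      have ht := h.posts t
      generalize st.posts t = a, st'.posts t = b at ht ⊢
      rcases ht with ht | _
      · rename_i T T'
        simp only [Option.filter_some, decide_eq_true_eq]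
        by_cases hv : S.ValidPost (tallySet Q (S'.codes key)) t T
        · obtain ⟨h1, h2, rfl⟩ := hS.post _ t ht (.inl hv)
          rw [if_pos h1, if_pos h2]
        · by_cases hv' : S'.ValidPost (tallySet Q (S'.codes key)) t T'
          · exact absurd (hS.post _ t ht (.inr hv')).1 hv
          · rw [if_neg hv, if_neg hv']
      · rfl
    have hres : st.result = none ↔ st'.result = none := by
      rw [← Option.not_isSome_iff_eq_none, h.result, Option.not_isSome_iff_eq_none]
    have hout : OutRel R
        (if st'.shown = false then (Party.env, Msg.bbData Q (S.codes key)) ::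
          toTrs (.bbData Q (S.codes key)) else [])
        (if st'.shown = false then (Party.env, Msg.bbData Q (S'.codes key)) ::
          toTrs (.bbData Q (S'.codes key)) else []) := by
      rw [hS.codes]
      split_ifs
      · exact .cons ⟨rfl, .bbData _ _⟩ (outRel_toTrs (.bbData _ _))
      · exact outRel_nil
    simp only [hval, h.shown, hres]
    split_ifs
    · exact ⟨⟨h.got, rfl, rfl, rfl, h.posts, rfl⟩,
        outRel_append (by simpa [*] using hout) (outRel_single (.result (hS.rs_refl _)))⟩
    · exact ⟨⟨h.got, rfl, rfl, rfl, h.posts, rfl⟩,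
        outRel_append (by simpa [*] using hout) (outRel_single (.result (hS.rs_refl _)))⟩
    · exact ⟨⟨h.got, rfl, rfl, rfl, h.posts, h.result⟩, by simpa [*] using hout⟩
    · exact ⟨⟨h.got, rfl, rfl, rfl, h.posts, h.result⟩, by simpa [*] using hout⟩

theorem bbRecv_rel (hS : SetupRel R G D S S') {st st' : BBState C k} (h : BBRel R st st')
    (src : Party P) {x x' : Msg C k} (hx : MsgRel R x x') :
    BBRel R (S.bbRecv st src x).1 (S'.bbRecv st' src x').1 ∧
      OutRel R (S.bbRecv st src x).2 (S'.bbRecv st' src x').2 := by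
  have h1 := bbHandle_rel h src hx
  have h2 := bbSettle_rel hS (bbKey_rel hS h1.1)
  exact ⟨h2.1, outRel_append h1.2 h2.2⟩

theorem trRecv_rel (hS : SetupRel R G D S S') (t : Fin P.Nt) (st : TrState P) (src : Party P)
    {x x' : Msg C k} (hx : MsgRel R x x') :
    (S.trRecv t st src x).1 = (S'.trRecv t st src x').1 ∧
      OutRel R (S.trRecv t st src x).2 (S'.trRecv t st src x').2 := by
  have nop : (st, ([] : Outbox C k)).1 = (st, ([] : Outbox C k)).1 ∧
      OutRel R (st, ([] : Outbox C k)).2 (st, ([] : Outbox C k)).2 := ⟨rfl, outRel_nil⟩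
  cases hx with
  | bbData Q E =>
    cases src with
    | bb b =>
      simp only [Setup.trRecv, hS.tshare]
      split_ifs
      · exact ⟨trivial, outRel_toBBs (.opening (hS.op_refl _) (hS.os_refl _))⟩
      · exact ⟨trivial, outRel_nil⟩
      · exact ⟨trivial, outRel_nil⟩
    | _ => exact nop
  | _ => cases src <;> exact nop

theorem voterRecv_rel (v : Fin P.n) (st : VoterState P) (src : Party P)
    {x x' : Msg C k} (hx : MsgRel R x x') :
    S.voterRecv v st src x = S.voterRecv v st src x' := by
  cases hx with
  | receipt r => rfl
  | _ => cases src <;> rcases st with ⟨_ | _, _, _, _⟩ <;> rfl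

end Congr

end

section

variable {P : Params} {C : Prims P} {k : ℕ}

/-! ### Related executions of an action -/

/-- Bound on the number of messages that one action makes honest parties send. -/
def burst (P : Params) : ℕ := P.n * P.Nv + P.n + P.Nb + P.Nv + P.Nt + 3

section Length

variable (S : Setup C k)

theorem length_toVCs (m : Msg C k) : (toVCs m).length = P.Nv := by simp [toVCs]

theorem length_toBBs (m : Msg C k) : (toBBs m).length = P.Nb := by simp [toBBs]

theorem length_toTrs (m : Msg C k) : (toTrs m).length = P.Nt := by simp [toTrs]

theorem addShare_length (st : VCState C k) (s : Fin P.n) (j : Fin P.Nv) (x : Word 64) :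
    (Setup.addShare st s j x).2.length ≤ 1 := by
  unfold Setup.addShare
  simp only
  split_ifs
  · simp only
    split
    · split_ifs <;> simp
    · simp
  · simp

theorem vcHandle_length (i : Fin P.Nv) (st : VCState C k) (src : Party P) (x : Msg C k) :
    (S.vcHandle i st src x).2.length ≤ P.Nv + 1 := by
  unfold Setup.vcHandle
  split
  · unfold Setup.onVote
    simp only
    repeat' split
    all_goals simp [length_toVCs]
  · unfold Setup.onEndorse
    simp only
    repeat' split
    all_goals simp
  · unfold Setup.onEndorsement
    simp only
    repeat' split
    all_goals simp [length_toVCs]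
  · have h := fun st s j x => addShare_length (C := C) (k := k) st s j x
    unfold Setup.onVoteP
    simp only
    repeat' split
    · simp
    · simp
    · rw [List.length_append, length_toVCs]
      exact Nat.add_le_add_left (h _ _ _ _) _
    · exact (h _ _ _ _).trans (by omega)
    · simp
    · simp
  · simp only
    split_ifs <;> simp
  · repeat' split
    all_goals simp
  · simp only
    split_ifs <;> simp
  · simp

theorem vcSettle_length (i : Fin P.Nv) (st : VCState C k) :
    (S.vcSettle i st).2.length ≤ P.n + P.Nb := by
  have h : ∀ f : Fin P.n → Option (Party P × Msg C k),
      ((List.finRange P.n).filterMap f).length ≤ P.n := fun f =>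
    (List.length_filterMap_le _ _).trans (by simp)
  unfold Setup.vcSettle
  simp only
  split_ifs
  · simp only [List.length_append, length_toBBs]
    exact Nat.add_le_add_right (h _) _
  · exact (h _).trans (by omega)
  · simp

theorem vcRecv_length (i : Fin P.Nv) (st : VCState C k) (src : Party P) (x : Msg C k) :
    (S.vcRecv i st src x).2.length ≤ burst P := by
  have h1 := vcHandle_length S i st src x
  have h2 := vcSettle_length S i (S.vcHandle i st src x).1
  unfold Setup.vcRecv Setup.vcFinish burst
  simp only [List.length_append]
  omega

theorem vcTick_length (i : Fin P.Nv) (st : VCState C k) :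
    (S.vcTick i st).2.length ≤ burst P := by
  have h2 := vcSettle_length S i { st with clock := st.clock + 1 }
  unfold Setup.vcTick Setup.vcFinish burst
  simp only [List.length_append]
  split_ifs
  · simp only [List.length_flatMap, length_toVCs]
    simp
    omega
  · simp
    omega

theorem vcDecide_length (i : Fin P.Nv) (st : VCState C k) (s : Fin P.n) (b : Bool) :
    (S.vcDecide i st s b).2.length ≤ burst P := by
  have h := fun st' => vcSettle_length S i st'
  unfold Setup.vcDecide Setup.vcFinish
  simp only
  split_ifs with h1 h2
  · simp only [List.length_append, length_toVCs]
    exact (Nat.add_le_add_left (h _) _).trans (by unfold burst; omega)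
  · simp only [List.length_append, List.length_nil]
    exact (Nat.add_le_add_left (h _) _).trans (by unfold burst; omega)
  · simp

theorem bbRecv_length (st : BBState C k) (src : Party P) (x : Msg C k) :
    (S.bbRecv st src x).2.length ≤ burst P := by
  have h1 : (Setup.bbHandle st src x).2.length ≤ 1 := by
    unfold Setup.bbHandle
    simp only
    repeat' split
    all_goals simp
  have h2 : ∀ st', (S.bbSettle st').2.length ≤ P.Nt + 2 := by
    intro st'
    unfold Setup.bbSettle
    simp only
    repeat' split
    all_goals simp [length_toTrs]
  have h3 := h2 (S.bbKey (Setup.bbHandle st src x).1)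
  unfold Setup.bbRecv burst
  simp only [List.length_append]
  omega

theorem trRecv_length (t : Fin P.Nt) (st : TrState P) (src : Party P) (x : Msg C k) :
    (S.trRecv t st src x).2.length ≤ burst P := by
  unfold Setup.trRecv burst
  simp only
  repeat' split
  all_goals simp [length_toBBs]
  all_goals omega

end Length

/-- Related actions; the delivered envelopes may differ in the related data. -/
inductive ActRel (R : PayRel C k) : Act C k → Act C k → Prop
  | deliver {e e'} (h : EnvRel R e e') : ActRel R (.deliver e) (.deliver e')
  | refl (a) (h : ∀ e, a ≠ .deliver e) : ActRel R a a

/-- The states after an action are related, and so are the messages that the action has made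
honest parties send. -/
structure Advances (R : PayRel C k) (y y' z z' : Sys C k) : Prop where
  rel : SysRel R z z'
  sent : ∃ es es', z.sent = y.sent ++ es ∧ z'.sent = y'.sent ++ es' ∧
    z.unread = y.unread ++ es ∧ z'.unread = y'.unread ++ es' ∧
    List.Forall₂ (EnvRel R) es es' ∧ es.length ≤ burst P

section Exec

variable {R : PayRel C k} {G : CodePred P}
  {D : Fin P.Nv → Fin P.n → Line P → Prop} {S S' : Setup C k} {K : Corruption P}

theorem advances_refl {y y' : Sys C k} (h : SysRel R y y') : Advances R y y' y y' :=
  ⟨h, [], [], by simp, by simp, by simp, by simp, .nil, by simp⟩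

theorem advances_emit {y y' z z' : Sys C k} (h : SysRel R z z') (hs : z.sent = y.sent)
    (hs' : z'.sent = y'.sent) (hu : z.unread = y.unread) (hu' : z'.unread = y'.unread)
    (src : Party P) {o o' : Outbox C k} (ho : OutRel R o o') (hl : o.length ≤ burst P) :
    Advances R y y' (z.emit src o) (z'.emit src o') := by
  refine ⟨⟨h.vc, h.bb, h.tr, h.voter, h.bc⟩, _, _, by rw [Sys.emit, hs], by rw [Sys.emit, hs'],
    by rw [Sys.emit, hu], by rw [Sys.emit, hu'], ?_, by simpa using hl⟩
  rw [List.forall₂_map_left_iff, List.forall₂_map_right_iff]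
  exact ho.imp fun a b h => ⟨rfl, h⟩

theorem rel_update {ι α : Type} [DecidableEq ι] {r : α → α → Prop} {f g : ι → α}
    (h : ∀ i, r (f i) (g i)) (j : ι) {a b : α} (hab : r a b) (i : ι) :
    r (Function.update f j a i) (Function.update g j b i) := by
  by_cases hij : i = j
  · subst hij; simpa using hab
  · simpa [hij] using h i

theorem mem_emit_right {y : Sys C k} {src dst : Party P} {o : Outbox C k} {m : Msg C k}
    (h : (dst, m) ∈ o) : (src, dst, m) ∈ (y.emit src o).sent := by
  unfold Sys.emit
  exact List.mem_append_right _ (List.mem_map.mpr ⟨_, h, rfl⟩)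

/-- Disclosures of receipt shares in the system. -/
def Disclosed (S : Setup C k) (y : Sys C k) (i : Fin P.Nv) (s : Fin P.n) (l : Line P) : Prop :=
  ∃ dst vc x σ u, (Party.vc i, dst, Msg.voteP s vc x σ u) ∈ y.sent ∧ S.lineOf s vc = some l

/-- Endorsements given in the system. -/
def Endorsed (y : Sys C k) (i : Fin P.Nv) (s : Fin P.n) (vc : Word 128) : Prop :=
  ∃ σ, ((y.vc i).ballot s).endorsed = some (vc, σ)

theorem receive_rel (hS : SetupRel R G D S S') {y y' : Sys C k} (h : SysRel R y y')
    {e e' : Envelope C k} (he : EnvRel R e e')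
    (hv : ∀ v, e.2.1 = .voter v → S.voterRecv v (y.voter v) e.1 e.2.2 =
      S'.voterRecv v (y.voter v) e.1 e.2.2)
    (hG : ∀ i s vc, Endorsed (S.receive y e) i s vc → G i s vc)
    (hD : ∀ i s l, Disclosed S (S.receive y e) i s l → D i s l) :
    Advances R y y' (S.receive y e) (S'.receive y' e') := by
  obtain ⟨src, dst, x⟩ := e
  obtain ⟨src', dst', x'⟩ := e'
  obtain ⟨h1, h2, hx⟩ := he
  obtain rfl : src = src' := h1
  obtain rfl : dst = dst' := h2
  replace hx : MsgRel R x x' := hx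
  cases dst with
  | vc i =>
    have hr := vcRecv_rel hS (h.vc i) i src hx
      (fun s vc σ hb => hG i s vc ⟨σ, by simpa [Setup.receive, Sys.emit] using hb⟩)
      (fun dst s vc x σ u l hm hl => hD i s l ⟨dst, vc, x, σ, u, mem_emit_right hm, hl⟩)
    exact advances_emit (y := y) (y' := y')
      (z := { y with
        delivered := (src, .vc i, x) :: y.delivered
        vc := Function.update y.vc i (S.vcRecv i (y.vc i) src x).1 })
      (z' := { y' with
        delivered := (src, .vc i, x') :: y'.delivered
        vc := Function.update y'.vc i (S'.vcRecv i (y'.vc i) src x').1 })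
      ⟨rel_update h.vc i hr.1, h.bb, h.tr, h.voter, h.bc⟩ rfl rfl rfl rfl _ hr.2
      (vcRecv_length S i _ src x)
  | bb b =>
    have hr := bbRecv_rel hS (h.bb b) src hx
    exact advances_emit (y := y) (y' := y')
      (z := { y with
        delivered := (src, .bb b, x) :: y.delivered
        bb := Function.update y.bb b (S.bbRecv (y.bb b) src x).1 })
      (z' := { y' with
        delivered := (src, .bb b, x') :: y'.delivered
        bb := Function.update y'.bb b (S'.bbRecv (y'.bb b) src x').1 })
      ⟨h.vc, rel_update h.bb b hr.1, h.tr, h.voter, h.bc⟩ rfl rfl rfl rfl _ hr.2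
      (bbRecv_length S _ src x)
  | tr t =>
    have hr := trRecv_rel hS t (y.tr t) src hx
    refine advances_emit (y := y) (y' := y')
      (z := { y with
        delivered := (src, .tr t, x) :: y.delivered
        tr := Function.update y.tr t (S.trRecv t (y.tr t) src x).1 })
      (z' := { y' with
        delivered := (src, .tr t, x') :: y'.delivered
        tr := Function.update y'.tr t (S'.trRecv t (y'.tr t) src x').1 })
      ⟨h.vc, h.bb, ?_, h.voter, h.bc⟩ rfl rfl rfl rfl _ ?_
      (trRecv_length S t _ src x)
    · simp only [← h.tr]
      rw [hr.1]
    · rw [← h.tr]; exact hr.2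
  | voter v =>
    have hv' := hv v rfl
    simp only at hv'
    refine ⟨⟨h.vc, h.bb, h.tr, ?_, h.bc⟩, [], [], ?_, ?_, ?_, ?_, .nil, by simp⟩
    · simp only [Setup.receive, ← h.voter]
      rw [hv', voterRecv_rel v _ src hx]
    all_goals simp [Setup.receive]
  | env =>
    refine ⟨⟨h.vc, h.bb, h.tr, h.voter, h.bc⟩, [], [], ?_, ?_, ?_, ?_, .nil, by simp⟩
    all_goals simp [Setup.receive]

theorem exec_rel (hS : SetupRel R G D S S') {y y' : Sys C k} (h : SysRel R y y')
    {a a' : Act C k} (ha : ActRel R a a')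
    (hm : ∀ e e', a = .deliver e → a' = .deliver e' →
      ((K.Bad e.1 ∨ e ∈ y.sent) ↔ (K.Bad e'.1 ∨ e' ∈ y'.sent)))
    (hv : ∀ e v, a = .deliver e → e.2.1 = .voter v → S.voterRecv v (y.voter v) e.1 e.2.2 =
      S'.voterRecv v (y.voter v) e.1 e.2.2)
    (hG : ∀ i s vc, Endorsed (S.exec K y a) i s vc → G i s vc)
    (hD : ∀ i s l, Disclosed S (S.exec K y a) i s l → D i s l) :
    Advances R y y' (S.exec K y a) (S'.exec K y' a') := by
  cases ha with
  | @deliver e e' he =>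
    have hm' := hm e e' rfl rfl
    have hd := he.2.1
    simp only [Setup.exec] at hG hD ⊢
    by_cases hc : (K.Bad e.1 ∨ e ∈ y.sent) ∧ ¬ K.Bad e.2.1
    · rw [if_pos hc] at hG hD ⊢
      rw [if_pos (by rwa [← hm', ← hd])]
      exact receive_rel hS h he (fun v => hv e v rfl) hG hD
    · rw [if_neg hc, if_neg (by rwa [← hm', ← hd])]
      exact advances_refl h
  | refl _ hne =>
    cases a with
    | deliver e => exact absurd rfl (hne e)
    | tick i =>
      simp only [Setup.exec]
      split_ifs
      · exact advances_refl h
      · have hr := vcTick_rel hS (h.vc i) i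
        exact advances_emit (y := y) (y' := y')
          (z := { y with vc := Function.update y.vc i (S.vcTick i (y.vc i)).1 })
          (z' := { y' with vc := Function.update y'.vc i (S'.vcTick i (y'.vc i)).1 })
          ⟨rel_update h.vc i hr.1, h.bb, h.tr, h.voter, h.bc⟩ rfl rfl rfl rfl _
          hr.2 (vcTick_length S i _)
    | engage v c =>
      simp only [Setup.exec, ← h.voter]
      split_ifs
      · exact ⟨⟨h.vc, h.bb, h.tr, rfl, h.bc⟩, [], [], by simp, by simp, by simp,
          by simp, .nil, by simp⟩
      · exact advances_refl h
    | contact v i =>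
      simp only [Setup.exec, ← h.voter]
      rcases (y.voter v).choice with _ | c
      · exact advances_refl h
      · simp only
        split_ifs
        · rw [← hS.code]
          exact advances_emit (y := y) (y' := y')
            (z := { y with voter := Function.update y.voter v { y.voter v with
              choice := some c, contacted := insert i (y.voter v).contacted } })
            (z' := { y' with voter := Function.update y.voter v { y.voter v with
              choice := some c, contacted := insert i (y.voter v).contacted } })
            ⟨h.vc, h.bb, h.tr, rfl, h.bc⟩ rfl rfl rfl rfl _
            (outRel_single (.vote v _)) (by simp [burst])
        · exact advances_refl h
    | bcFix s b =>
      simp only [Setup.exec, ← h.bc, ← fun i => ((h.vc i).ballot s).entered]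
      split_ifs
      · exact ⟨⟨h.vc, h.bb, h.tr, h.voter, rfl⟩, [], [], by simp, by simp, by simp,
          by simp, .nil, by simp⟩
      · exact advances_refl h
    | bcReturn s i =>
      simp only [Setup.exec, ← h.bc]
      rcases y.bc s with _ | b
      · exact advances_refl h
      · simp only
        split_ifs
        · exact advances_refl h
        · have hr := vcDecide_rel hS (h.vc i) i s b
          exact advances_emit (y := y) (y' := y')
            (z := { y with vc := Function.update y.vc i (S.vcDecide i (y.vc i) s b).1 })
            (z' := { y' with
              vc := Function.update y'.vc i (S'.vcDecide i (y'.vc i) s b).1, bc := y.bc })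
            ⟨rel_update h.vc i hr.1, h.bb, h.tr, h.voter, rfl⟩ rfl rfl rfl rfl
            _ hr.2 (vcDecide_length S i _ s b)

end Exec

end

section

variable {P : Params}

set_option synthInstance.maxSize 1000
set_option synthInstance.maxHeartbeats 400000

/-! ### Slices of messages, actions and system states -/

section Slices

variable (C : Prims P)

/-- The type that encodes messages. -/
abbrev MsgSum (k : ℕ) : Type :=
  (Fin P.n × Word 128) ⊕ (Fin P.n × Word 128) ⊕
  (Fin P.n × Word 128 × Sg C k) ⊕
  (Fin P.n × Word 128 × Word 64 × Sg C k × Cert C k) ⊕ Word 64 ⊕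
  (Fin P.n × Option (Word 128 × Cert C k)) ⊕ Fin P.n ⊕ (Fin P.n × Word 128 × Cert C k) ⊕
  (Fin P.n × Bool) ⊕ (VoteSet P × Word 128 × Sg C k) ⊕ VoteSet P ⊕
  (VoteSet P × CodeTable P) ⊕
  ((Fin P.n → Line P → Option (OpenShare C k)) × OpenShare C k) ⊕
  (Fin P.m → ZMod (C.grp.q k))

/-- The bijection that defines the encoding of messages. -/
def msgSum (k : ℕ) : Msg C k → MsgSum C k
  | .vote s vc => .inl (s, vc)
  | .endorse s vc => .inr (.inl (s, vc))
  | .endorsement s vc σ => .inr (.inr (.inl (s, vc, σ)))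
  | .voteP s vc x σ u => .inr (.inr (.inr (.inl (s, vc, x, σ, u))))
  | .receipt r => .inr (.inr (.inr (.inr (.inl r))))
  | .announce s c => .inr (.inr (.inr (.inr (.inr (.inl (s, c))))))
  | .recoverReq s => .inr (.inr (.inr (.inr (.inr (.inr (.inl s))))))
  | .recoverResp s vc u => .inr (.inr (.inr (.inr (.inr (.inr (.inr (.inl (s, vc, u))))))))
  | .bcInput s b => .inr (.inr (.inr (.inr (.inr (.inr (.inr (.inr (.inl (s, b)))))))))
  | .voteSet Q x σ =>
      .inr (.inr (.inr (.inr (.inr (.inr (.inr (.inr (.inr (.inl (Q, x, σ))))))))))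
  | .published Q =>
      .inr (.inr (.inr (.inr (.inr (.inr (.inr (.inr (.inr (.inr (.inl Q))))))))))
  | .bbData Q D =>
      .inr (.inr (.inr (.inr (.inr (.inr (.inr (.inr (.inr (.inr (.inr (.inl (Q, D))))))))))))
  | .opening o T =>
      .inr (.inr (.inr (.inr (.inr (.inr (.inr (.inr (.inr (.inr (.inr (.inr (.inl
        (o, T)))))))))))))
  | .result R =>
      .inr (.inr (.inr (.inr (.inr (.inr (.inr (.inr (.inr (.inr (.inr (.inr (.inr
        R))))))))))))

/-- Inverse of `msgSum`. -/
def msgOfSum (k : ℕ) : MsgSum C k → Msg C k :=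
  Sum.elim (fun a => .vote a.1 a.2) <| Sum.elim (fun a => .endorse a.1 a.2) <|
  Sum.elim (fun a => .endorsement a.1 a.2.1 a.2.2) <|
  Sum.elim (fun a => .voteP a.1 a.2.1 a.2.2.1 a.2.2.2.1 a.2.2.2.2) <| Sum.elim .receipt <|
  Sum.elim (fun a => .announce a.1 a.2) <| Sum.elim .recoverReq <|
  Sum.elim (fun a => .recoverResp a.1 a.2.1 a.2.2) <| Sum.elim (fun a => .bcInput a.1 a.2) <|
  Sum.elim (fun a => .voteSet a.1 a.2.1 a.2.2) <| Sum.elim .published <|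
  Sum.elim (fun a => .bbData a.1 a.2) <| Sum.elim (fun a => .opening a.1 a.2) .result

theorem msgOfSum_msgSum (k : ℕ) (m : Msg C k) : msgOfSum C k (msgSum C k m) = m := by
  cases m <;> rfl

theorem msgSum_msgOfSum (k : ℕ) : Function.RightInverse (msgOfSum C k) (msgSum C k) := by
  rintro (_ | _ | _ | _ | _ | _ | _ | _ | _ | _ | _ | _ | _ | _) <;> rfl

variable {C} (hE : C.Efficient)

/-- Slices of certificates. -/
def Sliced.cert : Sliced C fun k => Cert C k := (Sliced.sg hE).option.pi (Fin P.Nv)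

/-- Slices of certified vote codes. -/
def Sliced.code : Sliced C fun k => Word 128 × Cert C k :=
  (Sliced.const C (Word 128)).prod (Sliced.cert hE)

/-- Slices of the openings posted outside the tally set. -/
def Sliced.openings : Sliced C fun k => Fin P.n → Line P → Option (OpenShare C k) :=
  ((Sliced.openShare hE).option.pi (Line P)).pi (Fin P.n)

/-- Slices of results. -/
def Sliced.result : Sliced C fun k => Fin P.m → ZMod (C.grp.q k) := (Sliced.zmod hE).pi (Fin P.m)

set_option maxHeartbeats 1000000 in
/-- Slices of messages. -/
def Sliced.msg : Sliced C fun k => Msg C k :=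
  Sliced.comap (msgSum C) (fun k => Function.LeftInverse.injective (msgOfSum_msgSum C k))
    (fun k => Function.RightInverse.surjective (msgSum_msgOfSum C k)) <|
  (Sliced.const C (Fin P.n × Word 128)).sum <| (Sliced.const C (Fin P.n × Word 128)).sum <|
  ((Sliced.const C (Fin P.n)).prod ((Sliced.const C (Word 128)).prod (Sliced.sg hE))).sum <|
  ((Sliced.const C (Fin P.n)).prod ((Sliced.const C (Word 128)).prod
    ((Sliced.const C (Word 64)).prod ((Sliced.sg hE).prod (Sliced.cert hE))))).sum <|
  (Sliced.const C (Word 64)).sum <|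
  ((Sliced.const C (Fin P.n)).prod (Sliced.code hE).option).sum <|
  (Sliced.const C (Fin P.n)).sum <|
  ((Sliced.const C (Fin P.n)).prod ((Sliced.const C (Word 128)).prod (Sliced.cert hE))).sum <|
  (Sliced.const C (Fin P.n × Bool)).sum <|
  ((Sliced.const C (VoteSet P)).prod ((Sliced.const C (Word 128)).prod (Sliced.sg hE))).sum <|
  (Sliced.const C (VoteSet P)).sum <| (Sliced.const C (VoteSet P × CodeTable P)).sum <|
  ((Sliced.openings hE).prod (Sliced.openShare hE)).sum (Sliced.result hE)

/-- Slices of envelopes. -/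
def Sliced.env : Sliced C fun k => Envelope C k :=
  (Sliced.const C (Party P)).prod ((Sliced.const C (Party P)).prod (Sliced.msg hE))

/-- Relations between data in two contexts: the tests at position `p` agree. -/
def ctxRel {k : ℕ} (p : ℕ) (c c' : Ctx C k) : PayRel C k where
  sg σ σ' := (Sliced.sg hE).tst k c p σ = (Sliced.sg hE).tst k c' p σ'
  os T T' := (Sliced.openShare hE).tst k c p T = (Sliced.openShare hE).tst k c' p T'
  op o o' := (Sliced.openings hE).tst k c p o = (Sliced.openings hE).tst k c' p o'
  rs r r' := (Sliced.result hE).tst k c p r = (Sliced.result hE).tst k c' p r'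

variable {hE} {k p : ℕ} {c c' : Ctx C k}

theorem cert_tst {u u' : Cert C k} :
    (Sliced.cert hE).tst k c p u = (Sliced.cert hE).tst k c' p u' ↔
      CertRel (ctxRel hE p c c') u u' := by
  unfold Sliced.cert CertRel ctxRel
  simp only [Sliced.pi_tst, Sliced.option_tst]

theorem code_tst {u u' : Word 128 × Cert C k} :
    (Sliced.code hE).tst k c p u = (Sliced.code hE).tst k c' p u' ↔
      CodeRel (ctxRel hE p c c') u u' := by
  unfold Sliced.code CodeRel
  simp only [Sliced.prod_tst, Sliced.const_tst, cert_tst]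

set_option maxHeartbeats 1000000 in
theorem msg_tst {m m' : Msg C k} :
    (Sliced.msg hE).tst k c p m = (Sliced.msg hE).tst k c' p m' ↔
      MsgRel (ctxRel hE p c c') m m' := by
  have key : (Sliced.msg hE).tst k c p m = (Sliced.msg hE).tst k c' p m' ↔ _ :=
    Sliced.sum_tst
  rw [key]
  clear key
  simp only [Sliced.sum_tst, Sliced.prod_tst, Sliced.const_tst, Sliced.option_tst,
    cert_tst, code_tst]
  constructor
  · intro h
    cases m <;> cases m' <;>
      simp only [msgSum, Sum.liftRel_inl_inl, Sum.liftRel_inr_inr, Sum.not_liftRel_inl_inr,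
        Sum.not_liftRel_inr_inl] at h
    · cases h; exact .vote _ _
    · cases h; exact .endorse _ _
    · obtain ⟨rfl, rfl, h⟩ := h; exact .endorsement _ _ h
    · obtain ⟨rfl, rfl, rfl, h, hu⟩ := h; exact .voteP _ _ _ h hu
    · cases h; exact .receipt _
    · obtain ⟨rfl, h⟩ := h; exact .announce _ h
    · cases h; exact .recoverReq _
    · obtain ⟨rfl, rfl, h⟩ := h; exact .recoverResp _ _ h
    · cases h; exact .bcInput _ _
    · obtain ⟨rfl, rfl, h⟩ := h; exact .voteSet _ _ h
    · cases h; exact .published _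
    · cases h; exact .bbData _ _
    · obtain ⟨h, h'⟩ := h; exact .opening h h'
    · exact .result h
  · intro h
    cases h <;>
      simp only [msgSum, Sum.liftRel_inl_inl, Sum.liftRel_inr_inr, true_and] <;>
      first
        | assumption
        | exact ⟨‹_›, ‹_›⟩

theorem env_tst {e e' : Envelope C k} :
    (Sliced.env hE).tst k c p e = (Sliced.env hE).tst k c' p e' ↔
      EnvRel (ctxRel hE p c c') e e' := by
  unfold Sliced.env EnvRel
  simp only [Sliced.prod_tst, Sliced.const_tst, msg_tst]

end Slices

end

section

variable {P : Params}

set_option synthInstance.maxSize 1000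
set_option synthInstance.maxHeartbeats 400000

section Slices

variable (C : Prims P)

/-- The bijection that defines the encoding of actions. -/
def actSum (k : ℕ) : Act C k → Envelope C k ⊕ Fin P.Nv ⊕ (Fin P.n × Line P) ⊕
    (Fin P.n × Fin P.Nv) ⊕ (Fin P.n × Bool) ⊕ (Fin P.n × Fin P.Nv)
  | .deliver e => .inl e
  | .tick i => .inr (.inl i)
  | .engage v c => .inr (.inr (.inl (v, c)))
  | .contact v i => .inr (.inr (.inr (.inl (v, i))))
  | .bcFix s b => .inr (.inr (.inr (.inr (.inl (s, b)))))
  | .bcReturn s i => .inr (.inr (.inr (.inr (.inr (s, i)))))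

/-- Inverse of `actSum`. -/
def actOfSum (k : ℕ) : Envelope C k ⊕ Fin P.Nv ⊕ (Fin P.n × Line P) ⊕
    (Fin P.n × Fin P.Nv) ⊕ (Fin P.n × Bool) ⊕ (Fin P.n × Fin P.Nv) → Act C k :=
  Sum.elim .deliver <| Sum.elim .tick <| Sum.elim (fun a => .engage a.1 a.2) <|
  Sum.elim (fun a => .contact a.1 a.2) <| Sum.elim (fun a => .bcFix a.1 a.2)
    fun a => .bcReturn a.1 a.2

theorem actOfSum_actSum (k : ℕ) (a : Act C k) : actOfSum C k (actSum C k a) = a := by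
  cases a <;> rfl

theorem actSum_actOfSum (k : ℕ) : Function.RightInverse (actOfSum C k) (actSum C k) := by
  rintro (_ | _ | _ | _ | _ | _) <;> rfl

variable {C} (hE : C.Efficient)

/-- Slices of actions. -/
def Sliced.act : Sliced C fun k => Act C k :=
  Sliced.comap (actSum C) (fun k => Function.LeftInverse.injective (actOfSum_actSum C k))
    (fun k => Function.RightInverse.surjective (actSum_actOfSum C k)) <|
  (Sliced.env hE).sum <| (Sliced.const C (Fin P.Nv)).sum <|
  (Sliced.const C (Fin P.n × Line P)).sum <| (Sliced.const C (Fin P.n × Fin P.Nv)).sum <|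
  (Sliced.const C (Fin P.n × Bool)).sum (Sliced.const C (Fin P.n × Fin P.Nv))

/-- The contents of a ballot record of a VC node. -/
abbrev BallotTup (C : Prims P) (k : ℕ) : Type :=
  Option (Word 128 × Sg C k) × Option (Word 128 × Party P) × Cert C k ×
  Option (Word 128 × Cert C k) × (Fin P.Nv → Option (Word 64)) × Option (Word 64) ×
  (Fin P.Nv → Option (Option (Word 128 × Cert C k))) × Option Bool × Option Bool

/-- The tuple of the components. -/
def ballotTup {k : ℕ} (b : VCBallot C k) : BallotTup C k :=
  (b.endorsed, b.req, b.sigs, b.used, b.lrs, b.receipt, b.ann, b.entered, b.decided)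

/-- Slices of ballot records. -/
def Sliced.ballot : Sliced C (BallotTup C) :=
  ((Sliced.const C (Word 128)).prod (Sliced.sg hE)).option.prod <|
  (Sliced.const C (Option (Word 128 × Party P))).prod <| (Sliced.cert hE).prod <|
  (Sliced.code hE).option.prod <| (Sliced.const C (Fin P.Nv → Option (Word 64))).prod <|
  (Sliced.const C (Option (Word 64))).prod <|
  ((Sliced.code hE).option.option.pi (Fin P.Nv)).prod <|
  (Sliced.const C (Option Bool)).prod (Sliced.const C (Option Bool))

/-- The contents of the state of a VC node. The clock is cut off after the end of the election. -/
abbrev VCTup (C : Prims P) (k : ℕ) : Type := Fin (P.Tend + 2) × (Fin P.n → BallotTup C k) × Bool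

def vcTup {k : ℕ} (st : VCState C k) : VCTup C k :=
  (⟨min st.clock (P.Tend + 1), by omega⟩, fun s => ballotTup (st.ballot s), st.done)

/-- Slices of states of VC nodes. -/
def Sliced.vc : Sliced C fun k => VCTup C k :=
  (Sliced.const C (Fin (P.Tend + 2))).prod
    (((Sliced.ballot hE).pi (Fin P.n)).prod (Sliced.const C Bool))

/-- The contents of the state of a BB node. The result is not read by the node itself. -/
abbrev BBTup (C : Prims P) (k : ℕ) : Type :=
  (Fin P.Nv → Option (VoteSet P × Word 128 × Sg C k)) × Option (VoteSet P) × Option (Word 128) ×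
  Bool × (Fin P.Nt → Option (OpenShare C k)) × Bool

def bbTup {k : ℕ} (st : BBState C k) : BBTup C k :=
  (st.got, st.pub, st.key, st.shown, st.posts, st.result.isSome)

/-- Slices of states of BB nodes. -/
def Sliced.bb : Sliced C fun k => BBTup C k :=
  (((Sliced.const C (VoteSet P)).prod
    ((Sliced.const C (Word 128)).prod (Sliced.sg hE))).option.pi (Fin P.Nv)).prod <|
  (Sliced.const C (Option (VoteSet P))).prod <| (Sliced.const C (Option (Word 128))).prod <|
  (Sliced.const C Bool).prod <| ((Sliced.openShare hE).option.pi (Fin P.Nt)).prod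
    (Sliced.const C Bool)

/-- The states of trustees, voters and consensus instances. -/
abbrev RestTup (P : Params) : Type :=
  (Fin P.Nt → (Fin P.Nb → Option (VoteSet P × CodeTable P)) × Bool) ×
  (Fin P.n → Option (Line P) × (Fin P.Nv → Bool) × (Fin P.Nv → Bool) × Bool) ×
  (Fin P.n → Option Bool)

def restTup {k : ℕ} (y : Sys C k) : RestTup P :=
  (fun t => ((y.tr t).got, (y.tr t).done),
    fun v => ((y.voter v).choice, fun i => decide (i ∈ (y.voter v).contacted),
      fun i => decide (i ∈ (y.voter v).answered), (y.voter v).ok), y.bc)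

/-- The contents of the system state other than the lists of messages. -/
abbrev SysTup (C : Prims P) (k : ℕ) : Type :=
  (Fin P.Nv → VCTup C k) × (Fin P.Nb → BBTup C k) × RestTup P

instance (k : ℕ) : Bits (SysTup C k) := inferInstance

def sysTup {k : ℕ} (y : Sys C k) : SysTup C k :=
  (fun i => vcTup (y.vc i), fun b => bbTup (y.bb b), restTup y)

/-- Slices of system states. -/
def Sliced.sys : Sliced C fun k => SysTup C k :=
  ((Sliced.vc hE).pi (Fin P.Nv)).prod
    (((Sliced.bb hE).pi (Fin P.Nb)).prod (Sliced.const C (RestTup P)))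

variable {hE} {k p : ℕ} {c c' : Ctx C k}

theorem act_tst {a a' : Act C k} :
    (Sliced.act hE).tst k c p a = (Sliced.act hE).tst k c' p a' ↔
      ActRel (ctxRel hE p c c') a a' := by
  have key : (Sliced.act hE).tst k c p a = (Sliced.act hE).tst k c' p a' ↔ _ :=
    Sliced.sum_tst
  rw [key]
  clear key
  simp only [Sliced.sum_tst, Sliced.const_tst, env_tst]
  constructor
  · intro h
    cases a <;> cases a' <;>
      simp only [actSum, Sum.liftRel_inl_inl, Sum.liftRel_inr_inr, Sum.not_liftRel_inl_inr,
        Sum.not_liftRel_inr_inl] at h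
    · exact .deliver h
    all_goals
      cases h
      exact .refl _ (by simp)
  · intro h
    rcases h with h | ⟨_, h⟩
    · exact .inl h
    · cases a
      · exact absurd rfl (h _)
      all_goals simp [actSum]

theorem ballot_tst {b b' : VCBallot C k} :
    (Sliced.ballot hE).tst k c p (ballotTup b) =
      (Sliced.ballot hE).tst k c' p (ballotTup b') ↔
      BallotRel (ctxRel hE p c c') b b' := by
  unfold Sliced.ballot ballotTup
  simp only [Sliced.prod_tst, Sliced.option_tst, Sliced.const_tst, Sliced.pi_tst,
    cert_tst, code_tst]
  exact ⟨fun ⟨h1, h2, h3, h4, h5, h6, h7, h8, h9⟩ => ⟨h1, h2, h3, h4, h5, h6, h7, h8, h9⟩,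
    fun ⟨h1, h2, h3, h4, h5, h6, h7, h8, h9⟩ => ⟨h1, h2, h3, h4, h5, h6, h7, h8, h9⟩⟩

theorem vc_tst {st st' : VCState C k} :
    (Sliced.vc hE).tst k c p (vcTup st) = (Sliced.vc hE).tst k c' p (vcTup st') ↔
      VCRel (ctxRel hE p c c') st st' := by
  unfold Sliced.vc vcTup
  simp only [Sliced.prod_tst, Sliced.const_tst, Sliced.pi_tst, ballot_tst,
    Fin.mk.injEq]
  exact ⟨fun ⟨h1, h2, h3⟩ => ⟨h1, h2, h3⟩, fun ⟨h1, h2, h3⟩ => ⟨h1, h2, h3⟩⟩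

theorem bb_tst {st st' : BBState C k} :
    (Sliced.bb hE).tst k c p (bbTup st) = (Sliced.bb hE).tst k c' p (bbTup st') ↔
      BBRel (ctxRel hE p c c') st st' := by
  unfold Sliced.bb bbTup
  simp only [Sliced.prod_tst, Sliced.option_tst, Sliced.const_tst, Sliced.pi_tst]
  exact ⟨fun ⟨h1, h2, h3, h4, h5, h6⟩ => ⟨h1, h2, h3, h4, h5, h6⟩,
    fun ⟨h1, h2, h3, h4, h5, h6⟩ => ⟨h1, h2, h3, h4, h5, h6⟩⟩

theorem restTup_eq {y y' : Sys C k} :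
    restTup y = restTup y' ↔ y.tr = y'.tr ∧ y.voter = y'.voter ∧ y.bc = y'.bc := by
  constructor
  · intro h
    simp only [restTup, Prod.mk.injEq] at h
    refine ⟨funext fun t => ?_, funext fun v => ?_, h.2.2⟩
    · have := congrFun h.1 t
      rcases ht : y.tr t with ⟨a, b⟩
      rcases ht' : y'.tr t with ⟨a', b'⟩
      simp_all
    · have := congrFun h.2.1 v
      rcases hv : y.voter v with ⟨a, b, c, d⟩
      rcases hv' : y'.voter v with ⟨a', b', c', d'⟩
      simp only [hv, hv', Prod.mk.injEq] at this
      obtain ⟨rfl, h1, h2, rfl⟩ := this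
      obtain rfl : b = b' := Finset.ext fun i => by simpa using congrFun h1 i
      obtain rfl : c = c' := Finset.ext fun i => by simpa using congrFun h2 i
      rfl
  · rintro ⟨h1, h2, h3⟩
    simp only [restTup, h1, h2, h3]

theorem sys_tst {y y' : Sys C k} :
    (Sliced.sys hE).tst k c p (sysTup y) = (Sliced.sys hE).tst k c' p (sysTup y') ↔
      SysRel (ctxRel hE p c c') y y' := by
  unfold Sliced.sys sysTup
  simp only [Sliced.prod_tst, Sliced.const_tst, Sliced.pi_tst, vc_tst, bb_tst,
    restTup_eq]
  exact ⟨fun ⟨h1, h2, h3, h4, h5⟩ => ⟨h1, h2, h3, h4, h5⟩,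
    fun ⟨h1, h2, h3, h4, h5⟩ => ⟨h1, h2, h3, h4, h5⟩⟩

end Slices

end

section

variable {P : Params} {C : Prims P} {k : ℕ}

/-! ### Homomorphic commitments -/

section Commit

/-- The group as a vector space over the field of scalars. -/
@[reducible] def grpModule (C : Prims P) (k : ℕ) : Module (ZMod (C.grp.q k)) (C.grp.G k) :=
  AddCommGroup.zmodModule fun x => by
    rw [← C.grp.card k]
    exact card_nsmul_eq_zero'

attribute [local instance] grpModule

theorem val_nsmul (a : ZMod (C.grp.q k)) (x : C.grp.G k) : a.val • x = a • x := by
  rw [← Nat.cast_smul_eq_nsmul (ZMod (C.grp.q k)), ZMod.natCast_zmod_val]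

/-- Commitments as a linear map of message and randomness. -/
def comLin (C : Prims P) (k : ℕ) (h : C.grp.G k) :
    ZMod (C.grp.q k) × ZMod (C.grp.q k) →ₗ[ZMod (C.grp.q k)] C.grp.G k × C.grp.G k where
  toFun x := C.grp.com k h x.1 x.2
  map_add' x y := by
    simp only [GroupFamily.com, val_nsmul, Prod.fst_add, Prod.snd_add, add_smul, Prod.mk_add_mk]
    congr 1
    abel
  map_smul' a x := by
    simp [GroupFamily.com, val_nsmul, mul_smul, smul_add]

theorem comLin_injective (h : C.grp.G k) : Function.Injective (comLin C k h) := by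
  rw [← LinearMap.ker_eq_bot, LinearMap.ker_eq_bot']
  rintro ⟨x, r⟩ hx
  have hx' : C.grp.com k h x r = 0 := hx
  simp only [GroupFamily.com, val_nsmul, Prod.mk_eq_zero] at hx'
  have hr : r = 0 := (smul_eq_zero.mp hx'.1).resolve_right (C.grp.gen_ne k)
  simp only [hr, zero_smul, add_zero] at hx'
  rw [hr, (smul_eq_zero.mp hx'.2).resolve_right (C.grp.gen_ne k)]
  rfl

/-- The opening share of a tally set that a trustee computes from its initialization data. -/
def Setup.tallyShare (S : Setup C k) (E : Finset (Fin P.n × Line P)) (t : Fin P.Nt) :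
    OpenShare C k :=
  ∑ x ∈ E, S.tshare x.1 x.2 t

/-- Commitments are perfectly binding, so the only share that is accepted from a trustee is the
true one. -/
theorem validPost_iff (S : Setup C k) (E : Finset (Fin P.n × Line P)) (t : Fin P.Nt)
    (T : OpenShare C k) : S.ValidPost E t T ↔ T = S.tallyShare E t := by
  have key : ∀ o, ∑ x ∈ E, (S.com₀ x.1 x.2 o +
      ∑ j, (tpt C k t ^ (j.val + 1)).val • S.comC x.1 x.2 o j) =
      comLin C k S.ck (S.tallyShare E t o) := by
    intro o
    rw [Setup.tallyShare, Finset.sum_apply, map_sum]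
    refine Finset.sum_congr rfl fun x _ => ?_
    have h0 : S.com₀ x.1 x.2 o = comLin C k S.ck (S.unit x.1 x.2 o, S.comR x.1 x.2 o) := rfl
    have hc : ∀ j, S.comC x.1 x.2 o j = comLin C k S.ck (S.tpoly x.1 x.2 o j) := fun _ => rfl
    have hv : ∀ (a : ZMod (C.grp.q k)) (z : C.grp.G k × C.grp.G k), a.val • z = a • z :=
      fun a z => Prod.ext (val_nsmul a z.1) (val_nsmul a z.2)
    simp only [h0, hc, hv, ← map_smul, ← map_sum, ← map_add]
    congr 1
    refine Prod.ext ?_ ?_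
    · simp [Setup.tshare, shamirShare, Prod.fst_sum, mul_comm]
    · simp [Setup.tshare, shamirShare, Prod.snd_sum, mul_comm]
  unfold Setup.ValidPost
  simp only [key]
  constructor
  · intro h
    exact funext fun o => comLin_injective S.ck (h o)
  · rintro rfl o
    rfl

end Commit

/-! ### Equal data -/

/-- The relation of equal data. -/
def PayRel.eq (C : Prims P) (k : ℕ) : PayRel C k := ⟨Eq, Eq, Eq, Eq⟩

theorem optRel_refl {α : Type} {r : α → α → Prop} (h : ∀ a, r a a) : ∀ a, Option.Rel r a a
  | none => .none
  | some a => .some (h a)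

theorem codeRel_refl (c : Word 128 × Cert C k) : CodeRel (PayRel.eq C k) c c :=
  ⟨rfl, fun _ => optRel_refl (fun _ => rfl) _⟩

theorem sysRel_refl (y : Sys C k) : SysRel (PayRel.eq C k) y y where
  vc _ := ⟨rfl, fun _ => ⟨optRel_refl (fun _ => ⟨rfl, rfl⟩) _, rfl,
    fun _ => optRel_refl (fun _ => rfl) _, optRel_refl codeRel_refl _, rfl, rfl,
    fun _ => optRel_refl (fun _ => optRel_refl codeRel_refl _) _, rfl, rfl⟩, rfl⟩
  bb _ := ⟨fun _ => optRel_refl (fun _ => ⟨rfl, rfl, rfl⟩) _, rfl, rfl, rfl,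
    fun _ => optRel_refl (fun _ => rfl) _, rfl⟩
  tr := rfl
  voter := rfl
  bc := rfl

theorem envRel_refl (e : Envelope C k) : EnvRel (PayRel.eq C k) e e := by
  obtain ⟨a, b, m⟩ := e
  refine ⟨rfl, rfl, ?_⟩
  have hc : ∀ u : Cert C k, CertRel (PayRel.eq C k) u u := fun u _ => optRel_refl (fun _ => rfl) _
  cases m
  · exact .vote _ _
  · exact .endorse _ _
  · exact .endorsement _ _ rfl
  · exact .voteP _ _ _ rfl (hc _)
  · exact .receipt _
  · exact .announce _ (optRel_refl codeRel_refl _)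
  · exact .recoverReq _
  · exact .recoverResp _ _ (hc _)
  · exact .bcInput _ _
  · exact .voteSet _ _ rfl
  · exact .published _
  · exact .bbData _ _
  · exact .opening rfl rfl
  · exact .result rfl

theorem actRel_refl (a : Act C k) : ActRel (PayRel.eq C k) a a := by
  cases a
  · exact .deliver (envRel_refl _)
  all_goals exact .refl _ (by simp)

theorem setupRel_refl (S : Setup C k) :
    SetupRel (PayRel.eq C k) (fun _ _ _ => True) (fun _ _ _ => True) S S where
  lineOf _ _ := rfl
  verify _ _ _ _ h := by rw [show _ = _ from h]
  verifyEA _ h := by rw [show _ = _ from h]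
  endorse _ _ _ _ := rfl
  rshare _ _ _ _ := ⟨rfl, rfl⟩
  kshare _ := ⟨rfl, rfl⟩
  hmsk _ := Iff.rfl
  codes := rfl
  post E t T T' h h' := by
    obtain rfl : T = T' := h
    exact ⟨h'.elim id id, h'.elim id id, rfl⟩
  tshare := rfl
  code := rfl
  os_refl _ := rfl
  op_refl _ := rfl
  rs_refl _ := rfl

/-- An action makes honest parties send a bounded number of messages. -/
theorem exec_lists (S : Setup C k) (K : Corruption P) (y : Sys C k) (a : Act C k) :
    ∃ es, (S.exec K y a).sent = y.sent ++ es ∧ (S.exec K y a).unread = y.unread ++ es ∧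
      es.length ≤ burst P := by
  obtain ⟨_, es, _, h1, _, h2, _, _, h3⟩ := exec_rel (K := K) (setupRel_refl S) (sysRel_refl y)
    (actRel_refl a) (fun e e' h h' => by rw [h] at h'; cases h'; rfl) (fun _ _ _ _ => rfl)
    (fun _ _ _ _ => trivial) (fun _ _ _ _ => trivial)
  exact ⟨es, h1, h2, h3⟩

/-! ### Endorsements are final -/

theorem addShare_endorsed (st : VCState C k) (s t : Fin P.n) (j : Fin P.Nv) (x : Word 64) :
    ((Setup.addShare st s j x).1.ballot t).endorsed = (st.ballot t).endorsed := by
  unfold Setup.addShare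
  simp only
  split_ifs <;> by_cases h : t = s <;> simp [VCState.set, h]

theorem vcHandle_endorsed (S : Setup C k) (i : Fin P.Nv) (st : VCState C k) (src : Party P)
    (x : Msg C k) (s : Fin P.n) {c : Word 128 × Sg C k} (h : (st.ballot s).endorsed = some c) :
    ((S.vcHandle i st src x).1.ballot s).endorsed = some c := by
  have hset : ∀ (t : Fin P.n) (b : VCBallot C k), b.endorsed = (st.ballot t).endorsed →
      ((st.set t b).ballot s).endorsed = some c := by
    intro t b hb
    by_cases hst : s = t
    · subst hst; simp [VCState.set, hb, h]
    · simp [VCState.set, hst, h]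
  unfold Setup.vcHandle
  split
  · unfold Setup.onVote
    simp only
    repeat' split
    all_goals first | exact h | exact hset _ _ rfl
  · unfold Setup.onEndorse
    simp only
    repeat' split
    all_goals first | exact h | skip
    rename_i s' vc' _ _ hn
    by_cases hst : s = s'
    · subst hst; rw [h] at hn; cases hn
    · simp [VCState.set, hst, h]
  · unfold Setup.onEndorsement
    simp only
    repeat' split
    all_goals first | exact h | exact hset _ _ rfl
  · unfold Setup.onVoteP
    simp only
    repeat' split
    all_goals first
      | exact h
      | exact (addShare_endorsed _ _ _ _ _).trans h
      | exact (addShare_endorsed _ _ _ _ _).trans (hset _ _ rfl)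
  · simp only
    split
    · exact hset _ _ rfl
    · exact h
  · repeat' split
    all_goals exact h
  · simp only
    split
    · exact hset _ _ rfl
    · exact h
  · exact h

theorem exec_endorsed (S : Setup C k) (K : Corruption P) (y : Sys C k) (a : Act C k)
    {i : Fin P.Nv} {s : Fin P.n} {c : Word 128 × Sg C k}
    (h : ((y.vc i).ballot s).endorsed = some c) :
    (((S.exec K y a).vc i).ballot s).endorsed = some c := by
  have hupd : ∀ (j : Fin P.Nv) (st : VCState C k),
      (((y.vc j).ballot s).endorsed = some c → (st.ballot s).endorsed = some c) →
        ((Function.update y.vc j st i).ballot s).endorsed = some c := by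
    intro j st h2
    by_cases hij : i = j
    · subst hij; simpa using h2 h
    · simpa [hij] using h
  cases a with
  | deliver e =>
    simp only [Setup.exec]
    split_ifs
    · obtain ⟨src, dst, x⟩ := e
      cases dst
      · refine hupd _ _ fun h => ?_
        rw [Setup.vcRecv, vcFinish_endorsed]
        exact vcHandle_endorsed S _ _ _ _ _ h
      all_goals exact h
    · exact h
  | tick j =>
    simp only [Setup.exec]
    split_ifs
    · exact h
    · refine hupd _ _ fun h => ?_
      rw [Setup.vcTick, vcFinish_endorsed]
      exact h
  | engage v c =>
    simp only [Setup.exec]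
    split_ifs <;> exact h
  | contact v j =>
    simp only [Setup.exec]
    repeat' split
    all_goals exact h
  | bcFix t b =>
    simp only [Setup.exec]
    split_ifs <;> exact h
  | bcReturn t j =>
    simp only [Setup.exec]
    repeat' split
    · exact h
    · rename_i b _ _
      refine hupd _ _ fun h => ?_
      unfold Setup.vcDecide
      simp only
      have hset : ((((y.vc j).set t { (y.vc j).ballot t with decided := some b }).ballot
          s).endorsed) = some c := by
        by_cases hst : s = t
        · subst hst; simpa [VCState.set] using h
        · simpa [VCState.set, hst] using h
      split_ifs
      · rw [vcFinish_endorsed]; exact hset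
      · rw [vcFinish_endorsed]; exact hset
      · exact h
    · exact h

end

section

variable {P : Params} {C : Prims P} {k : ℕ}

/-! ### Setups that differ in keys and signing coins -/

/-- The signatures that honest parties and the election authority can issue: endorsements of
vote codes, signed receipt shares, and signed master key shares. -/
abbrev SigIdx (P : Params) : Type :=
  (Fin P.Nv × Fin P.n × Word 128) ⊕ (Fin P.n × Line P × Fin P.Nv) ⊕ Fin P.Nv

namespace Setup

/-- The signature with the given index. -/
def sigOf (S : Setup C k) : SigIdx P → Sg C k
  | .inl (i, s, vc) => C.sig.sign k (S.sk i) (S.vcCoin i s) (.endorse s vc)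
  | .inr (.inl (s, l, i)) => S.rshareSig s l i
  | .inr (.inr i) => S.kshareSig i

/-- The verification keys and the shares of all tally sets. -/
def ctx (S : Setup C k) : Ctx C k := ⟨fun o => o.elim S.eaVk S.vk, S.tallyShare⟩

/-- The setups agree on everything but the keys and coins of the signature scheme. -/
structure Agree (S S' : Setup C k) : Prop where
  hk : S.hk = S'.hk
  code : S.code = S'.code
  rcpt : S.rcpt = S'.rcpt
  perm : S.perm = S'.perm
  salt : S.salt = S'.salt
  msk : S.msk = S'.msk
  saltM : S.saltM = S'.saltM
  iv : S.iv = S'.iv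
  rpoly : S.rpoly = S'.rpoly
  mpoly : S.mpoly = S'.mpoly
  trap : S.trap = S'.trap
  comR : S.comR = S'.comR
  tpoly : S.tpoly = S'.tpoly

namespace Agree

variable {S S' : Setup C k}

theorem row (h : S.Agree S') : S.row = S'.row := by
  funext s l; simp only [Setup.row, Setup.opt, h.hk, h.code, h.perm, h.salt]

theorem rshare (h : S.Agree S') : S.rshare = S'.rshare := by
  funext s l i; simp only [Setup.rshare, Setup.opt, h.rcpt, h.perm, h.rpoly]

theorem kshare (h : S.Agree S') : S.kshare = S'.kshare := by
  funext i; simp only [Setup.kshare, h.msk, h.mpoly]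

theorem hmsk (h : S.Agree S') : S.hmsk = S'.hmsk := by
  simp only [Setup.hmsk, h.hk, h.msk, h.saltM]

theorem ct (h : S.Agree S') : S.ct = S'.ct := by
  funext s l; simp only [Setup.ct, Setup.opt, h.msk, h.iv, h.code, h.perm]

theorem ck (h : S.Agree S') : S.ck = S'.ck := by simp only [Setup.ck, h.trap]

theorem unit (h : S.Agree S') : S.unit = S'.unit := by
  funext s l o
  exact if_congr (by rw [Setup.opt, Setup.opt, h.perm]) rfl rfl

theorem com₀ (h : S.Agree S') : S.com₀ = S'.com₀ := by
  funext s l o; simp only [Setup.com₀, h.ck, h.unit, h.comR]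

theorem comC (h : S.Agree S') : S.comC = S'.comC := by
  funext s l o j; simp only [Setup.comC, h.ck, h.tpoly]

theorem tshare (h : S.Agree S') : S.tshare = S'.tshare := by
  funext s l t o; simp only [Setup.tshare, h.unit, h.comR, h.tpoly]

theorem lineOf (h : S.Agree S') : S.lineOf = S'.lineOf := by
  funext s vc; simp only [Setup.lineOf, h.hk, h.salt, h.row]

theorem codes (h : S.Agree S') : S.codes = S'.codes := by
  funext key s l; simp only [Setup.codes, h.ct]

theorem tallyShare (h : S.Agree S') : S.tallyShare = S'.tallyShare := by
  funext E t; simp only [Setup.tallyShare, h.tshare]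

end Agree

end Setup

/-- The signatures issued if the endorsements are those that `G` allows. -/
def Allowed (G : CodePred P) : SigIdx P → Prop
  | .inl (i, s, vc) => G i s vc
  | .inr _ => True

/-- If the setups agree on everything but the keys and coins of the signature scheme, and all
signatures issued look alike at bit position `p`, then the servers behave alike at bit position
`p`. -/
theorem Setup.Agree.setupRel {hE : C.Efficient} {S S' : Setup C k} (h : S.Agree S') {p : ℕ}
    {G : CodePred P}
    (hs : ∀ d, Allowed G d → (Sliced.sg hE).tst k S.ctx p (S.sigOf d) =
      (Sliced.sg hE).tst k S'.ctx p (S'.sigOf d)) :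
    SetupRel (ctxRel hE p S.ctx S'.ctx) G (fun _ _ _ => True) S S' where
  lineOf s vc := by rw [h.lineOf]
  verify i σ σ' x hσ := congrFun hσ (.inr (some i, x))
  verifyEA x hσ := congrFun hσ (.inr (none, x))
  endorse i s vc hG := hs (.inl (i, s, vc)) hG
  rshare i s l _ := ⟨by rw [h.rshare], hs (.inr (.inl (s, l, i))) trivial⟩
  kshare i := ⟨by rw [h.kshare], hs (.inr (.inr i)) trivial⟩
  hmsk key := by rw [h.hk, h.saltM, h.hmsk]
  codes := h.codes
  post E t T T' hT := by
    have h1 : T = S.tallyShare E t ↔ T' = S'.tallyShare E t :=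
      (Sliced.withEq_tst.mp hT).2 (E, t)
    rw [validPost_iff, validPost_iff, ← h1, or_self]
    intro hT
    exact ⟨hT, hT, by rw [hT, h1.mp hT, h.tallyShare]⟩
  tshare := h.tshare
  code := h.code
  os_refl T := (Sliced.withEq_tst (c := S.ctx) (c' := S'.ctx)).mpr ⟨rfl, fun t => by
    rw [show S.ctx.tv = S'.ctx.tv from h.tallyShare]⟩
  op_refl o := Sliced.pi_tst.mpr fun s => Sliced.pi_tst.mpr fun l => Sliced.option_tst.mpr
    (optRel_refl (fun T => (Sliced.withEq_tst (c := S.ctx) (c' := S'.ctx)).mpr ⟨rfl, fun t => by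
      rw [show S.ctx.tv = S'.ctx.tv from h.tallyShare]⟩) _)
  rs_refl r := rfl

/-! ### Circuits that simulate runs -/

/-- The signature of VC node `j` (or of the election authority) in a delivered message. -/
def sigAt (j : Fin P.Nv) : Act C k → Option (Sg C k)
  | .deliver (_, _, .endorsement _ _ σ) => some σ
  | .deliver (_, _, .voteP _ _ _ _ u) => u j
  | .deliver (_, _, .announce _ (some (_, u))) => u j
  | .deliver (_, _, .recoverResp _ _ u) => u j
  | .deliver (_, _, .voteSet _ _ σ) => some σ
  | _ => none

theorem sigAt_rel {R : PayRel C k} {a a' : Act C k} (h : ActRel R a a') (j : Fin P.Nv) :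
    Option.Rel R.sg (sigAt j a) (sigAt j a') := by
  rcases h with ⟨h⟩ | ⟨_, h⟩
  · rename_i e e'
    obtain ⟨s, d, m⟩ := e
    obtain ⟨s', d', m'⟩ := e'
    obtain ⟨h1, h2, h⟩ := h
    clear h1 h2
    cases h
    case endorsement h => exact .some h
    case voteP h hu => exact hu j
    case announce h =>
      rcases h with h | _
      · exact h.2 j
      · exact .none
    case recoverResp h => exact h j
    case voteSet h => exact .some h
    all_goals exact .none
  · cases a
    case deliver e => exact absurd rfl (h e)
    all_goals exact .none

/-- Runs of adversaries with fixed coins, in setups `su k x` that agree on everything but keys and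
signing coins. All the keys and signatures that occur are input bits or fixed, where the
endorsements that occur are those allowed by `G`. -/
structure Sim (C : Prims P) (A : ∀ k, Adversary C k) where
  X : ℕ → Type
  su : ∀ k, X k → Setup C k
  coins : ∀ k, (A k).alg.Coins
  G : ℕ → CodePred P
  I : ℕ → Type
  inp : ∀ k, X k → I k → Bool
  agree : ∀ k x x', (su k x).Agree (su k x')
  vk_atom : ∀ k v b, (∃ w, ∀ x, (su k x).ctx.vk v b = inp k x w) ∨
    ∃ b₀, ∀ x, (su k x).ctx.vk v b = b₀
  sig_atom : ∀ k d, Allowed (G k) d → ∀ b, (∃ w, ∀ x, (su k x).sigOf d b = inp k x w) ∨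
    ∃ b₀, ∀ x, (su k x).sigOf d b = b₀
  sk_const : ∀ k, ∀ i ∈ (A k).corr.vcs, ∀ x x', (su k x).sk i = (su k x').sk i
  dom : ∀ k x r i s vc, Endorsed ((A k).alg.conf ((su k x).view (A k).corr)
    ((su k x).react (A k).corr) {} (coins k) r).2.2 i s vc → G k i s vc

namespace Sim

variable {A : ∀ k, Adversary C k} (M : Sim C A)

/-- Configuration after `r` rounds. -/
def cf (k : ℕ) (x : M.X k) (r : ℕ) : (A k).alg.Conf (Sys C k) :=
  (A k).alg.conf ((M.su k x).view (A k).corr) ((M.su k x).react (A k).corr) {} (M.coins k) r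

/-- System state after `r` rounds. -/
def sys (k : ℕ) (x : M.X k) (r : ℕ) : Sys C k := (M.cf k x r).2.2

/-- Action in round `r`. -/
def act (k : ℕ) (x : M.X k) (r : Fin (A k).alg.rounds) : Option (Act C k) :=
  (A k).alg.act (M.cf k x r) (M.coins k r)

/-- System state after the action in round `r`. -/
def mid (k : ℕ) (x : M.X k) (r : Fin (A k).alg.rounds) : Sys C k :=
  match M.act k x r with
  | some a => (M.su k x).exec (A k).corr (M.sys k x r) a
  | none => M.sys k x r

theorem cf_succ (k : ℕ) (x : M.X k) (r : Fin (A k).alg.rounds) : M.cf k x (r + 1) =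
    (fun i => (A k).alg.step.eval (Sum.elim (M.cf k x r).1
      (Sum.elim (Bits.enc (M.cf k x r).2.1) (M.coins k r))) (Sum.inl i),
      some (M.mid k x r).unread.head?,
      { M.mid k x r with unread := (M.mid k x r).unread.tail }) := by
  unfold cf
  rw [Machine.conf_succ _ _ _ _ _ r.2]
  rfl

/-- Messages sent in round `r`. -/
def news (k : ℕ) (x : M.X k) (r : Fin (A k).alg.rounds) : List (Envelope C k) :=
  (M.mid k x r).sent.drop (M.sys k x r).sent.length

theorem mid_lists (k : ℕ) (x : M.X k) (r : Fin (A k).alg.rounds) :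
    (M.mid k x r).sent = (M.sys k x r).sent ++ M.news k x r ∧
    (M.mid k x r).unread = (M.sys k x r).unread ++ M.news k x r ∧
    (M.news k x r).length ≤ burst P := by
  unfold news mid
  rcases M.act k x r with _ | a
  · simp
  · obtain ⟨es, h1, h2, h3⟩ := exec_lists (M.su k x) (A k).corr (M.sys k x r) a
    simp only [h1, h2, List.drop_left]
    exact ⟨trivial, trivial, h3⟩

theorem lists_length (k : ℕ) (x : M.X k) : ∀ r ≤ (A k).alg.rounds,
    (M.sys k x r).sent.length ≤ burst P * r ∧ (M.sys k x r).unread.length ≤ burst P * r := by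
  intro r
  induction r with
  | zero => intro _; exact ⟨le_rfl, le_rfl⟩
  | succ r ih =>
    intro hr
    obtain ⟨h1, h2⟩ := ih (by omega)
    obtain ⟨h3, h4, h5⟩ := M.mid_lists k x ⟨r, hr⟩
    have h6 := M.cf_succ k x ⟨r, hr⟩
    have h7 : M.sys k x (r + 1) =
      { M.mid k x ⟨r, hr⟩ with unread := (M.mid k x ⟨r, hr⟩).unread.tail } :=
      congrArg (fun c => c.2.2) h6
    rw [h7]
    simp only [h3, h4, List.length_append, List.length_tail, mul_add, mul_one]
    constructor <;> omega

end Sim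

end

section

variable {P : Params} {C : Prims P}

namespace Sim

section Round

variable {A : ∀ k, Adversary C k} (M : Sim C A) (hE : C.Efficient)

/-- Rounds of the runs. -/
abbrev Ix (A : ∀ k, Adversary C k) : Type := Σ k, Fin (A k).alg.rounds

/-- Bound on the number of messages sent in a run, with one cell to spare. -/
def cells (A : ∀ k, Adversary C k) (k : ℕ) : ℕ := burst P * (A k).alg.rounds + 1

/-- What a simulating circuit keeps of a configuration: the memory of the adversary and its last
answer, keys and signatures, and all tests on the system state and on the entries of the lists of
sent (`true`) and unread (`false`) messages. -/
abbrev Wire (A : ∀ k, Adversary C k) (k : ℕ) : Type :=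
  (Fin (A k).alg.st ⊕ Bits.W (Option (Option (Envelope C k)))) ⊕
  ((Option (Fin P.Nv) × Fin (C.sig.vkLen k)) ⊕ (SigIdx P × Fin (C.sig.sigLen k))) ⊕
  (Fin (posLen C k) × (Sliced.sys hE).J) ⊕
  (Bool × Fin (cells A k) × Fin (posLen C k) × (Sliced.env hE).option.J)

/-- The list of sent or of unread messages. -/
def msgs (b : Bool) (y : Sys C k) : List (Envelope C k) := if b then y.sent else y.unread

/-- Value of a wire after `r` rounds. -/
def wire (k r : ℕ) (x : M.X k) : Wire hE A k → Bool :=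
  Sum.elim (Sum.elim (M.cf k x r).1 (Bits.enc (M.cf k x r).2.1)) <|
  Sum.elim (Sum.elim (fun w => (M.su k x).ctx.vk w.1 w.2)
    fun w => if Allowed (M.G k) w.1 then (M.su k x).sigOf w.1 w.2 else false) <|
  Sum.elim (fun w => (Sliced.sys hE).tst k (M.su k x).ctx w.1 (sysTup (M.sys k x r)) w.2)
    fun w => (Sliced.env hE).option.tst k (M.su k x).ctx w.2.2.1
      ((msgs w.1 (M.sys k x r))[w.2.1.val]?) w.2.2.2

/-- The configurations after all numbers of rounds, presented by the wires. -/
abbrev fam : Fam where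
  ι := Ix A
  κ i := i.1
  X i := M.X i.1
  I i := Wire hE A i.1
  inp i x := M.wire hE i.1 i.2 x

/-- The contexts in the runs. -/
def varCtx : VarCtx C (M.fam hE) where
  ctx i x := (M.su i.1 x).ctx
  vk_easy := (Fam.Easy.input fun (i : Ix A) j =>
    (Sum.inr (Sum.inl (Sum.inl j)) : Wire hE A i.1)).congr fun _ _ _ => Iff.rfl
  tv_const i x x' := (M.agree i.1 x x').tallyShare

variable {M hE}

/-- Tests on the entries of a list of messages. -/
def CellsEasy (M : Sim C A) (hE : C.Efficient)
    (l : ∀ i : Ix A, M.X i.1 → List (Envelope C i.1)) : Prop :=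
  (M.fam hE).Easy (J := fun i : Ix A => ℕ × Fin (posLen C i.1) × (Sliced.env hE).option.J)
    fun i j x => (Sliced.env hE).option.tst i.1 (M.su i.1 x).ctx j.2.1 ((l i x)[j.1]?) j.2.2 =
      true

variable {l l' : ∀ i : Ix A, M.X i.1 → List (Envelope C i.1)}

theorem CellsEasy.some (h : CellsEasy M hE l) :
    (M.fam hE).Easy (J := fun _ => ℕ) fun i c x => ((l i x)[c]?).isSome = true := by
  refine (h.reindex fun i (c : ℕ) => (c, ⟨0, posLen_pos' i⟩, .inl ())).congr fun i j x => ?_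
  rcases (l i x)[j]? with _ | e <;> simp [Sliced.option]
where posLen_pos' (i : Ix A) : 0 < posLen C i.1 := Nat.succ_pos _

theorem CellsEasy.length (h : CellsEasy M hE l) :
    (M.fam hE).Easy (J := fun _ => ℕ) fun i c x => (l i x).length = c := by
  refine (h.some.not.and ((Fam.Easy.const fun i (c : ℕ) => c = 0).or
    (h.some.reindex fun i (c : ℕ) => c - 1))).congr fun i c x => ?_
  simp only [isSome_getElem?]
  omega

/-- The last test on an optional message and the tests on absent messages. -/
theorem option_tst_none {k p : ℕ} {c : Ctx C k} {j : (Sliced.env hE).option.J} :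
    (Sliced.env hE).option.tst k c p none j = false := rfl

theorem CellsEasy.append (h : CellsEasy M hE l) (h' : CellsEasy M hE l') {N : ℕ → ℕ}
    (hN : PolyBounded N) (hl : ∀ i x, (l i x).length < N i.1) :
    CellsEasy M hE fun i x => l i x ++ l' i x := by
  have hcard : PolyBd (M.fam hE).κ fun i => Fintype.card (Fin (N i.1)) := by
    simp only [Fintype.card_fin]
    exact PolyBd.comp hN _
  have h1 : (M.fam hE).Easy
      (J := fun i : Ix A => ℕ × Fin (posLen C i.1) × (Sliced.env hE).option.J)
      fun i j x => ∃ L : Fin (N i.1), ((l i x).length = L ∧ L.val ≤ j.1) ∧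
        (Sliced.env hE).option.tst i.1 (M.su i.1 x).ctx j.2.1 ((l' i x)[j.1 - L.val]?) j.2.2 =
          true := by
    refine Fam.Easy.exists (𝓕 := M.fam hE)
      (J := fun i : Ix A => ℕ × Fin (posLen C i.1) × (Sliced.env hE).option.J)
      (L := fun i : Ix A => Fin (N i.1)) hcard
      (φ := fun (i : Ix A) (j : ℕ × Fin (posLen C i.1) × (Sliced.env hE).option.J)
          (L : Fin (N i.1)) x => ((l i x).length = L ∧ L.val ≤ j.1) ∧
        (Sliced.env hE).option.tst i.1 (M.su i.1 x).ctx j.2.1 ((l' i x)[j.1 - L.val]?) j.2.2 =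
          true) (((h.length.reindex fun (i : Ix A) (j : (ℕ × Fin (posLen C i.1) ×
            (Sliced.env hE).option.J) × Fin (N i.1)) => j.2.val).and
          (Fam.Easy.const fun (i : Ix A) (j : (ℕ × Fin (posLen C i.1) ×
            (Sliced.env hE).option.J) × Fin (N i.1)) => j.2.val ≤ j.1.1)).and
          (h'.reindex fun (i : Ix A) (j : (ℕ × Fin (posLen C i.1) ×
            (Sliced.env hE).option.J) × Fin (N i.1)) => (j.1.1 - j.2.val, j.1.2)))
  refine (Fam.Easy.or h h1).congr fun i j x => ?_
  have hli := hl i x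
  by_cases hj : j.1 < (l i x).length
  · rw [List.getElem?_append_left hj]
    constructor
    · rintro (h | ⟨L, ⟨h1, h2⟩, _⟩)
      · exact h
      · omega
    · exact .inl
  · rw [List.getElem?_append_right (not_lt.mp hj)]
    constructor
    · rintro (h | ⟨L, ⟨h1, h2⟩, h⟩)
      · rw [List.getElem?_eq_none (not_lt.mp hj)] at h
        simp [option_tst_none] at h
      · rwa [h1]
    · exact fun h => .inr ⟨⟨_, hli⟩, ⟨rfl, not_lt.mp hj⟩, h⟩

theorem CellsEasy.tail (h : CellsEasy M hE l) : CellsEasy M hE fun i x => (l i x).tail := by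
  refine (h.reindex fun (i : Ix A) (j : ℕ × Fin (posLen C i.1) × (Sliced.env hE).option.J) =>
    (j.1 + 1, j.2)).congr fun i j x => ?_
  simp only [List.getElem?_tail]

variable (M hE) in
theorem cells_msgs (b : Bool) : CellsEasy M hE fun i x => msgs b (M.sys i.1 x i.2) := by
  refine Fam.Easy.split (Fam.Easy.input (J := fun i : Ix A =>
    Fin (cells A i.1) × Fin (posLen C i.1) × (Sliced.env hE).option.J)
    fun (i : Ix A) j => (Sum.inr (Sum.inr (Sum.inr (b, j))) : Wire hE A i.1))
    (Fam.Easy.const (J := fun _ => Unit) fun _ _ => False) ?_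
  rintro i ⟨c, p, j⟩
  by_cases hc : c < cells A i.1
  · exact .inl ⟨(⟨c, hc⟩, p, j), fun x => Iff.rfl⟩
  · refine .inr ⟨(), fun x => ?_⟩
    have h := M.lists_length i.1 x i.2 i.2.2.le
    have h3 : burst P * i.2.val ≤ burst P * (A i.1).alg.rounds :=
      Nat.mul_le_mul_left _ i.2.2.le
    have h2 : (msgs b (M.sys i.1 x i.2)).length ≤ c := by
      unfold cells at hc
      cases b
      · exact (h.2.trans h3).trans (by omega)
      · exact (h.1.trans h3).trans (by omega)
    simp only [List.getElem?_eq_none h2, option_tst_none]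
    simp

/-- The adversary's part of a round: new memory and encoded action. -/
def stepOut (M : Sim C A) (k : ℕ) (x : M.X k) (r : Fin (A k).alg.rounds) :
    Fin (A k).alg.st ⊕ Bits.W (Act C k) → Bool :=
  (A k).alg.step.eval (Sum.elim (M.cf k x r).1
    (Sum.elim (Bits.enc (M.cf k x r).2.1) (M.coins k r)))

variable (M hE) in
theorem easy_stepOut (hA : PolyBounded fun k => (A k).alg.cost) :
    (M.fam hE).Easy (J := fun i : Ix A => Fin (A i.1).alg.st ⊕ Bits.W (Act C i.1))
      fun i j x => stepOut M i.1 x i.2 j = true := by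
  have h := Fam.EasyAll.of_atomic (𝓕 := M.fam hE) (J := fun _ => Unit)
    (T := fun i _ => Fin (A i.1).alg.st ⊕ (Bits.W (Option (Option (Envelope C i.1))) ⊕
      Fin (A i.1).alg.coin))
    (φ := fun i _ t x => Sum.elim (M.cf i.1 x i.2).1
      (Sum.elim (Bits.enc (M.cf i.1 x i.2).2.1) (M.coins i.1 i.2)) t = true) (by
      rintro i _ (t | t | t)
      · exact .inl ⟨.inl (.inl t), fun x => Iff.rfl⟩
      · exact .inl ⟨.inl (.inr t), fun x => Iff.rfl⟩
      · exact .inr ⟨M.coins i.1 i.2 t = true, fun x => Iff.rfl⟩)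
  exact (h.eval (c := fun i => (A i.1).alg.cost) (PolyBd.comp hA _) (fun i _ => (A i.1).alg.step)
    fun i _ => Nat.le_add_left _ _).apply (fun _ _ => ()) fun _ j => j

/-- Bits that describe the action of a round at a bit position. -/
def actBit (M : Sim C A) (hE : C.Efficient)
    (i : Ix A) (p : ℕ) (t : Option (Sliced.act hE).J) (x : M.X i.1) : Prop :=
  t.elim (∃ a, M.act i.1 x i.2 = some a) fun t => ∃ a, M.act i.1 x i.2 = some a ∧
    (Sliced.act hE).tst i.1 (M.su i.1 x).ctx p a t = true

theorem act_eq_some {k : ℕ} {x : M.X k} {r : Fin (A k).alg.rounds} {a : Act C k} :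
    M.act k x r = some a ↔ (fun w => stepOut M k x r (.inr w)) = Bits.enc a := by
  exact Bits.dec_eq_some

variable (M hE) in
theorem easy_actBit (hA : PolyBounded fun k => (A k).alg.cost) :
    (M.fam hE).Easy (J := fun _ => ℕ × Option (Sliced.act hE).J)
      fun i j x => actBit M hE i j.1 j.2 x := by
  have h0 := (easy_stepOut M hE hA).reindex
    fun (i : Ix A) (j : Unit × Bits.W (Act C i.1)) => .inr j.2
  have h1 := (Sliced.act hE).dec (M.fam hE) (M.varCtx hE) (fun _ => Unit)
    (fun i _ x w => stepOut M i.1 x i.2 (.inr w)) h0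
  have h2 := (Sliced.act hE).valid (M.fam hE) (M.varCtx hE) (fun _ => Unit)
    (fun i _ x w => stepOut M i.1 x i.2 (.inr w)) h0
  refine Fam.Easy.split h1 h2 ?_
  rintro i ⟨p, _ | t⟩
  · exact .inr ⟨(), fun x => exists_congr fun a => act_eq_some⟩
  · exact .inl ⟨((), p, t), fun x => exists_congr fun a => and_congr_left' act_eq_some⟩

theorem act_rel {i : Ix A} {p : ℕ} {x x' : M.X i.1}
    (h : ∀ t, actBit M hE i p t x ↔ actBit M hE i p t x') :
    Option.Rel (ActRel (ctxRel hE p (M.su i.1 x).ctx (M.su i.1 x').ctx))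
      (M.act i.1 x i.2) (M.act i.1 x' i.2) := by
  have h0 := h none
  have h1 := fun t => h (some t)
  simp only [actBit, Option.elim_none, Option.elim_some] at h0 h1
  rcases ha : M.act i.1 x i.2 with _ | a <;> rcases ha' : M.act i.1 x' i.2 with _ | a'
  · exact .none
  · simp [ha, ha'] at h0
  · simp [ha, ha'] at h0
  · refine .some (act_tst.mp (funext fun t => ?_))
    have := h1 t
    simp only [ha, ha', Option.some.injEq, exists_eq_left'] at this
    exact Bool.eq_iff_iff.mpr this

/-- A message delivered in a round has been sent before. -/
def Sent (M : Sim C A) (k : ℕ) (x : M.X k) (r : Fin (A k).alg.rounds) : Prop :=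
  ∃ e, M.act k x r = some (.deliver e) ∧ e ∈ (M.sys k x r).sent

theorem polyBounded_cells (hA : PolyBounded fun k => (A k).alg.cost) :
    PolyBounded (cells A) := by
  refine PolyBd.mono (((PolyBd.const (burst P)).mul hA.polyBd).add (.const 1)) fun k => ?_
  exact Nat.add_le_add_right (Nat.mul_le_mul_left _ (by unfold Machine.cost; omega)) _

theorem polyBounded_posLen (hE : C.Efficient) : PolyBounded (posLen C) :=
  (hE.sig.sigLen.polyBd.add hE.size.polyBd).add (.const 1)

/-- The delivered message, if any. -/
def carried : Act C k → Option (Envelope C k)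
  | .deliver e => some e
  | _ => none

theorem carried_rel {R : PayRel C k} {a a' : Act C k} (h : ActRel R a a') :
    Option.Rel (EnvRel R) (carried a) (carried a') := by
  rcases h with h | ⟨_, h⟩
  · exact .some h
  · cases a
    · exact absurd rfl (h _)
    all_goals exact .none

variable (M hE) in
theorem easy_sent (hA : PolyBounded fun k => (A k).alg.cost) :
    (M.fam hE).Easy (J := fun _ => Unit) fun i _ x => Sent M i.1 x i.2 := by
  have hcell := cells_msgs M hE true
  have hcar : (M.fam hE).Easy
      (J := fun i : Ix A => Fin (posLen C i.1) × (Sliced.env hE).option.J)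
      fun i j x => (Sliced.env hE).option.tst i.1 (M.su i.1 x).ctx j.1
        ((M.act i.1 x i.2).bind carried) j.2 = true := by
    have := (Sliced.act hE).fin
    refine Fam.Easy.of_local (T := Option (Sliced.act hE).J)
      (β := fun i j t x => actBit M hE i j.1 t x)
      ((easy_actBit M hE hA).reindex fun (i : Ix A) (j : (Fin (posLen C i.1) ×
        (Sliced.env hE).option.J) × Option (Sliced.act hE).J) => (j.1.1.val, j.2)) ?_
    intro i j x x' ht hφ
    have hr := act_rel ht
    have : Option.Rel (EnvRel (ctxRel hE j.1 (M.su i.1 x).ctx (M.su i.1 x').ctx))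
        ((M.act i.1 x i.2).bind carried) ((M.act i.1 x' i.2).bind carried) := by
      revert hr
      rcases M.act i.1 x i.2 with _ | a <;> rcases M.act i.1 x' i.2 with _ | a' <;> intro hr <;>
        cases hr
      · exact .none
      · exact carried_rel ‹_›
    have h2 : (Sliced.env hE).option.tst i.1 (M.su i.1 x).ctx j.1
        ((M.act i.1 x i.2).bind carried) = (Sliced.env hE).option.tst i.1
          (M.su i.1 x').ctx j.1 ((M.act i.1 x' i.2).bind carried) := by
      rw [Sliced.option_tst]
      simpa only [env_tst] using this
    rw [← h2]
    exact hφ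
  have hpc : PolyBd (M.fam hE).κ fun i => Fintype.card (Fin (cells A i.1)) := by
    simp only [Fintype.card_fin]
    exact PolyBd.comp (polyBounded_cells hA) _
  have := (Sliced.env hE).option.fin
  have := Fintype.ofFinite (Sliced.env hE).option.J
  have hpp : PolyBd (M.fam hE).κ fun i =>
      Fintype.card (Fin (posLen C i.1) × (Sliced.env hE).option.J) := by
    simp only [Fintype.card_prod, Fintype.card_fin]
    exact (PolyBd.comp (polyBounded_posLen hE) _).mul (.const _)
  have h1 : (M.fam hE).Easy (J := fun i : Ix A => Unit × Fin (cells A i.1)) fun i j x =>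
      ∀ t : Fin (posLen C i.1) × (Sliced.env hE).option.J,
        ((Sliced.env hE).option.tst i.1 (M.su i.1 x).ctx t.1
          ((msgs true (M.sys i.1 x i.2))[j.2.val]?) t.2 = true ↔
        (Sliced.env hE).option.tst i.1 (M.su i.1 x).ctx t.1
          ((M.act i.1 x i.2).bind carried) t.2 = true) :=
    Fam.Easy.forall (𝓕 := M.fam hE) (J := fun i : Ix A => Unit × Fin (cells A i.1))
      (L := fun i : Ix A => Fin (posLen C i.1) × (Sliced.env hE).option.J) hpp
      (φ := fun (i : Ix A) (j : Unit × Fin (cells A i.1))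
        (t : Fin (posLen C i.1) × (Sliced.env hE).option.J) x =>
        ((Sliced.env hE).option.tst i.1 (M.su i.1 x).ctx t.1 ((msgs true (M.sys i.1 x i.2))[j.2.val]?) t.2 = true ↔
        (Sliced.env hE).option.tst i.1 (M.su i.1 x).ctx t.1
          ((M.act i.1 x i.2).bind carried) t.2 = true))
      ((hcell.reindex fun (i : Ix A) (j : (Unit × Fin (cells A i.1)) × Fin (posLen C i.1) ×
          (Sliced.env hE).option.J) => (j.1.2.val, j.2)).iff
        (hcar.reindex fun (i : Ix A) (j : (Unit × Fin (cells A i.1)) × Fin (posLen C i.1) ×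
          (Sliced.env hE).option.J) => j.2))
  have h2 : (M.fam hE).Easy (J := fun i : Ix A => Unit × Fin (cells A i.1)) fun i j x =>
      ((msgs true (M.sys i.1 x i.2))[j.2.val]?).isSome = true :=
    hcell.some.reindex fun (i : Ix A) (j : Unit × Fin (cells A i.1)) => j.2.val
  refine (Fam.Easy.exists (𝓕 := M.fam hE) (J := fun _ => Unit)
    (L := fun i : Ix A => Fin (cells A i.1))
    (φ := fun (i : Ix A) _ (c : Fin (cells A i.1)) x =>
      ((msgs true (M.sys i.1 x i.2))[c.val]?).isSome = true ∧
      ∀ t : Fin (posLen C i.1) × (Sliced.env hE).option.J,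
        ((Sliced.env hE).option.tst i.1 (M.su i.1 x).ctx t.1
          ((msgs true (M.sys i.1 x i.2))[c.val]?) t.2 = true ↔
        (Sliced.env hE).option.tst i.1 (M.su i.1 x).ctx t.1
          ((M.act i.1 x i.2).bind carried) t.2 = true))
    hpc (h2.and h1)).congr fun i j x => ?_
  constructor
  · rintro ⟨c, h, h'⟩
    have he : (msgs true (M.sys i.1 x i.2))[c.val]? = (M.act i.1 x i.2).bind carried :=
      (Sliced.env hE).option.ext (M.su i.1 x).ctx fun p hp => funext fun t =>
        Bool.eq_iff_iff.mpr (h' (⟨p, hp⟩, t))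
    obtain ⟨e, hc⟩ := Option.isSome_iff_exists.mp h
    rw [hc] at he
    obtain ⟨a, ha, ha'⟩ := Option.bind_eq_some_iff.mp he.symm
    refine ⟨e, ?_, List.mem_of_getElem? hc⟩
    rw [ha]
    cases a
    · cases ha'; rfl
    all_goals cases ha'
  · rintro ⟨e, ha, he⟩
    obtain ⟨c, hc⟩ := List.mem_iff_getElem?.mp he
    have hlt : c < cells A i.1 := by
      obtain ⟨hc', -⟩ := List.getElem?_eq_some_iff.mp hc
      have h := (M.lists_length i.1 x i.2 i.2.2.le).1
      have h3 : burst P * i.2.val ≤ burst P * (A i.1).alg.rounds :=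
        Nat.mul_le_mul_left _ i.2.2.le
      unfold cells
      omega
    refine ⟨⟨c, hlt⟩, ?_, fun t => ?_⟩
    · simp only [msgs, if_true, hc, Option.isSome_some]
    · simp only [msgs, if_true, hc, ha]
      rfl

end Round

end Sim

end

section

variable {P : Params} {C : Prims P}

namespace Sim

section Round

variable {A : ∀ k, Adversary C k} (M : Sim C A) (hE : C.Efficient)

/-- Signature number `d`, if it can be issued. -/
def sigM (M : Sim C A) (k : ℕ) (x : M.X k) (d : SigIdx P) : Sg C k := fun w =>
  if Allowed (M.G k) d then (M.su k x).sigOf d w else false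

/-- Indices of the bits on which the behaviour of the system in a round at a bit position
depends. -/
abbrev LocalIx {C : Prims P} (hE : C.Efficient) : Type :=
  ((Sliced.sys hE).J ⊕ Option (Sliced.act hE).J) ⊕
    ((SigIdx P × (Sliced.sg hE).J) ⊕ Unit)

instance : Finite (LocalIx hE) := by
  have := (Sliced.sys hE).fin
  have := (Sliced.act hE).fin
  have := (Sliced.sg hE).fin
  infer_instance

variable {hE}

/-- The bits on which the behaviour of the system in a round at a bit position depends. -/
def localBit (i : Ix A) (p : ℕ) (t : LocalIx hE) (x : M.X i.1) : Prop :=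
  Sum.elim (Sum.elim
    (fun t => (Sliced.sys hE).tst i.1 (M.su i.1 x).ctx p (sysTup (M.sys i.1 x i.2)) t = true)
    fun t => actBit M hE i p t x)
    (Sum.elim (fun t => (Sliced.sg hE).tst i.1 (M.su i.1 x).ctx p (sigM M i.1 x t.1) t.2 = true)
      fun _ => Sent M i.1 x i.2) t

variable {M}

/-- Equal bits at a position make the states after the action alike at that position. -/
theorem mid_rel {i : Ix A} {p : ℕ} {x x' : M.X i.1}
    (h : ∀ t : LocalIx hE, localBit M i p t x ↔ localBit M i p t x') :
    Advances (ctxRel hE p (M.su i.1 x).ctx (M.su i.1 x').ctx) (M.sys i.1 x i.2)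
      (M.sys i.1 x' i.2) (M.mid i.1 x i.2) (M.mid i.1 x' i.2) := by
  have h1 : SysRel (ctxRel hE p (M.su i.1 x).ctx (M.su i.1 x').ctx) (M.sys i.1 x i.2)
      (M.sys i.1 x' i.2) :=
    sys_tst.mp (funext fun t => Bool.eq_iff_iff.mpr (h (.inl (.inl t))))
  have h2 := act_rel fun t => h (.inl (.inr t))
  have h3 : ∀ d, Allowed (M.G i.1) d → (Sliced.sg hE).tst i.1 (M.su i.1 x).ctx p
      ((M.su i.1 x).sigOf d) = (Sliced.sg hE).tst i.1 (M.su i.1 x').ctx p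
      ((M.su i.1 x').sigOf d) := by
    intro d hd
    have e : ∀ z, sigM M i.1 z d = (M.su i.1 z).sigOf d := fun z =>
      funext fun w => if_pos hd
    rw [← e, ← e]
    exact funext fun t => Bool.eq_iff_iff.mpr (h (.inr (.inl (d, t))))
  have h4 : Sent M i.1 x i.2 ↔ Sent M i.1 x' i.2 := h (.inr (.inr ()))
  have hag := M.agree i.1 x x'
  have hS := hag.setupRel (hE := hE) h3
  have hdom : ∀ j s vc, Endorsed (M.mid i.1 x i.2) j s vc → M.G i.1 j s vc := by
    intro j s vc hj
    refine M.dom i.1 x (i.2 + 1) j s vc ?_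
    have h6 := congrArg (fun c => c.2.2) (M.cf_succ i.1 x i.2)
    change M.sys i.1 x (i.2 + 1) = _ at h6
    change Endorsed (M.sys i.1 x (i.2 + 1)) j s vc
    rw [h6]
    exact hj
  unfold mid at hdom ⊢
  unfold Sent at h4
  generalize M.act i.1 x i.2 = o at h2 h4 hdom ⊢
  generalize M.act i.1 x' i.2 = o' at h2 h4 ⊢
  cases h2 with
  | none => exact advances_refl h1
  | some ha =>
    refine exec_rel hS h1 ha ?_ ?_ hdom fun _ _ _ _ => trivial
    · rintro e e' rfl rfl
      have he : e.1 = e'.1 := by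
        cases ha with
        | deliver he => exact he.1
        | refl _ h => exact absurd rfl (h _)
      simp only [Option.some.injEq, Act.deliver.injEq, exists_eq_left'] at h4
      rw [he, h4]
    · intro e v _ _
      simp only [Setup.voterRecv, hag.rcpt]

variable (M hE)

theorem easy_localBit (hA : PolyBounded fun k => (A k).alg.cost) :
    (M.fam hE).Easy (J := fun i : Ix A => Fin (posLen C i.1) × LocalIx hE)
      fun i j x => localBit M i j.1 j.2 x := by
  have hsys : (M.fam hE).Easy (J := fun i : Ix A => Fin (posLen C i.1) × (Sliced.sys hE).J)
      fun i j x => (Sliced.sys hE).tst i.1 (M.su i.1 x).ctx j.1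
        (sysTup (M.sys i.1 x i.2)) j.2 = true :=
    (Fam.Easy.input fun (i : Ix A) (j : Fin (posLen C i.1) × (Sliced.sys hE).J) =>
      (Sum.inr (Sum.inr (Sum.inl j)) : Wire hE A i.1)).congr fun _ _ _ => Iff.rfl
  have hraw : (M.fam hE).Easy (J := fun i : Ix A => SigIdx P × Bits.W (Sg C i.1))
      fun i j x => sigM M i.1 x j.1 j.2.1 = true :=
    (Fam.Easy.input fun (i : Ix A) (j : SigIdx P × Bits.W (Sg C i.1)) =>
      (Sum.inr (Sum.inl (Sum.inr (j.1, j.2.1))) : Wire hE A i.1)).congr fun _ _ _ => Iff.rfl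
  have hsig : (M.fam hE).Easy (J := fun _ => SigIdx P × ℕ × (Sliced.sg hE).J)
      fun i j x => (Sliced.sg hE).tst i.1 (M.su i.1 x).ctx j.2.1 (sigM M i.1 x j.1) j.2.2 =
        true := by
    refine ((Sliced.sg hE).dec (M.fam hE) (M.varCtx hE) (fun _ => SigIdx P)
      (fun i d x w => sigM M i.1 x d w.1) hraw).congr fun i j x => ?_
    constructor
    · rintro ⟨a, ha, h⟩
      obtain rfl : sigM M i.1 x j.1 = a := funext fun b => congrFun ha (b, ())
      exact h
    · exact fun h => ⟨_, rfl, h⟩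
  refine Fam.Easy.split (Fam.Easy.split (J := fun i : Ix A =>
      Fin (posLen C i.1) × ((Sliced.sys hE).J ⊕ Option (Sliced.act hE).J))
    (φ := fun i j x => localBit M i j.1 (.inl j.2 : LocalIx hE) x)
    hsys (easy_actBit M hE hA) ?_) (Fam.Easy.split (J := fun i : Ix A =>
      Fin (posLen C i.1) × ((SigIdx P × (Sliced.sg hE).J) ⊕ Unit))
    (φ := fun i j x => localBit M i j.1 (.inr j.2 : LocalIx hE) x)
    hsig (easy_sent M hE hA) ?_) ?_
  · rintro i ⟨p, t | t⟩
    · exact .inl ⟨(p, t), fun x => Iff.rfl⟩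
    · exact .inr ⟨(p.1, t), fun x => Iff.rfl⟩
  · rintro i ⟨p, t | t⟩
    · exact .inl ⟨(t.1, p.1, t.2), fun x => Iff.rfl⟩
    · exact .inr ⟨(), fun x => Iff.rfl⟩
  · rintro i ⟨p, t | t⟩
    · exact .inl ⟨(p, t), fun x => Iff.rfl⟩
    · exact .inr ⟨(p, t), fun x => Iff.rfl⟩

theorem easy_mid (hA : PolyBounded fun k => (A k).alg.cost) :
    (M.fam hE).Easy (J := fun i : Ix A => Fin (posLen C i.1) × (Sliced.sys hE).J)
      fun i j x => (Sliced.sys hE).tst i.1 (M.su i.1 x).ctx j.1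
        (sysTup (M.mid i.1 x i.2)) j.2 = true := by
  refine Fam.Easy.of_local (𝓕 := M.fam hE) (T := LocalIx hE)
    (J := fun i : Ix A => Fin (posLen C i.1) × (Sliced.sys hE).J)
    (β := fun i j t x => localBit M i j.1 t x)
    ((easy_localBit M hE hA).reindex fun (i : Ix A) (j : (Fin (posLen C i.1) ×
        (Sliced.sys hE).J) × LocalIx hE) => (j.1.1, j.2)) ?_
  intro i j x x' ht hφ
  rw [← congrFun (sys_tst.mpr (mid_rel ht).rel) j.2]
  exact hφ

theorem news_rel {i : Ix A} {p : ℕ} {x x' : M.X i.1}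
    (h : ∀ t : LocalIx hE, localBit M i p t x ↔ localBit M i p t x') :
    List.Forall₂ (EnvRel (ctxRel hE p (M.su i.1 x).ctx (M.su i.1 x').ctx))
      (M.news i.1 x i.2) (M.news i.1 x' i.2) := by
  obtain ⟨es, es', h1, h2, -, -, h3, -⟩ := (mid_rel h).sent
  unfold news
  rw [h1, h2, List.drop_left, List.drop_left]
  exact h3

theorem _root_.List.Forall₂.optionRel_getElem? {α β : Type} {r : α → β → Prop} {l : List α}
    {l' : List β} (h : List.Forall₂ r l l') (c : ℕ) : Option.Rel r l[c]? l'[c]? := by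
  induction h generalizing c with
  | nil => exact .none
  | cons h _ ih =>
    cases c
    · exact .some h
    · simpa using ih _

theorem cells_news (hA : PolyBounded fun k => (A k).alg.cost) :
    CellsEasy M hE fun i x => M.news i.1 x i.2 := by
  refine Fam.Easy.of_local (𝓕 := M.fam hE) (T := LocalIx hE)
    (J := fun i : Ix A => ℕ × Fin (posLen C i.1) × (Sliced.env hE).option.J)
    (β := fun i j t x => localBit M i j.2.1 t x)
    ((easy_localBit M hE hA).reindex fun (i : Ix A) (j : (ℕ × Fin (posLen C i.1) ×
        (Sliced.env hE).option.J) × LocalIx hE) => (j.1.2.1, j.2)) ?_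
  intro i j x x' ht hφ
  have h2 : (Sliced.env hE).option.tst i.1 (M.su i.1 x).ctx j.2.1
      ((M.news i.1 x i.2)[j.1]?) = (Sliced.env hE).option.tst i.1
        (M.su i.1 x').ctx j.2.1 ((M.news i.1 x' i.2)[j.1]?) := by
    rw [Sliced.option_tst]
    simpa only [env_tst] using (news_rel M hE ht).optionRel_getElem? j.1
  rw [← h2]
  exact hφ

theorem msgs_length_lt (b : Bool) (i : Ix A) (x : M.X i.1) :
    (msgs b (M.sys i.1 x i.2)).length < cells A i.1 := by
  have h := M.lists_length i.1 x i.2 i.2.2.le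
  have h3 : burst P * i.2.val ≤ burst P * (A i.1).alg.rounds := Nat.mul_le_mul_left _ i.2.2.le
  unfold cells
  cases b
  · exact (h.2.trans h3).trans_lt (Nat.lt_succ_self _)
  · exact (h.1.trans h3).trans_lt (Nat.lt_succ_self _)

theorem sys_succ (k : ℕ) (x : M.X k) (r : Fin (A k).alg.rounds) : M.sys k x (r + 1) =
    { M.mid k x r with unread := (M.mid k x r).unread.tail } :=
  congrArg (fun c => c.2.2) (M.cf_succ k x r)

theorem cells_mid (hA : PolyBounded fun k => (A k).alg.cost) (b : Bool) :
    CellsEasy M hE fun i x => msgs b (M.mid i.1 x i.2) := by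
  have h : (fun (i : Ix A) (x : M.X i.1) => msgs b (M.mid i.1 x i.2)) =
      fun (i : Ix A) (x : M.X i.1) => msgs b (M.sys i.1 x i.2) ++ M.news i.1 x i.2 := by
    funext i x
    obtain ⟨h1, h2, -⟩ := M.mid_lists i.1 x i.2
    cases b
    · exact h2
    · exact h1
  rw [h]
  exact (cells_msgs M hE b).append (cells_news M hE hA) (polyBounded_cells hA)
    (msgs_length_lt M b)

/-- All wires after a round are easy to compute from those before the round. -/
theorem easy_wire (hA : PolyBounded fun k => (A k).alg.cost) :
    (M.fam hE).Easy (J := fun i : Ix A => Wire hE A i.1)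
      fun i w x => M.wire hE i.1 (i.2 + 1) x w = true := by
  have hans : (M.fam hE).Easy
      (J := fun i : Ix A => Bits.W (Option (Option (Envelope C i.1)))) fun i w x =>
      Bits.enc (M.cf i.1 x (i.2 + 1)).2.1 w = true := by
    refine Fam.Easy.split (Fam.Easy.const (J := fun _ => Unit) fun _ _ => True)
      (cells_mid M hE hA false) ?_
    rintro i (w | w)
    · refine .inl ⟨(), fun x => ?_⟩
      rw [M.cf_succ i.1 x i.2]
      exact ⟨fun _ => trivial, fun _ => rfl⟩
    · obtain ⟨p, hp, j, hj⟩ := (Sliced.env hE).option.loc i.1 w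
      refine .inr ⟨(0, ⟨p, hp⟩, j), fun x => ?_⟩
      rw [M.cf_succ i.1 x i.2, ← hj, ← List.head?_eq_getElem?]
      exact Iff.rfl
  have hkeep : (M.fam hE).Easy (J := fun i : Ix A => Wire hE A i.1) fun i w x =>
      M.wire hE i.1 i.2 x w = true := Fam.Easy.input fun _ w => w
  have hcell : ∀ b, (M.fam hE).Easy (J := fun i : Ix A => Fin (cells A i.1) ×
      Fin (posLen C i.1) × (Sliced.env hE).option.J) fun i j x =>
      (Sliced.env hE).option.tst i.1 (M.su i.1 x).ctx j.2.1
        ((msgs b (M.sys i.1 x (i.2 + 1)))[j.1.val]?) j.2.2 = true := by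
    intro b
    cases b
    · refine ((cells_mid M hE hA false).tail.reindex fun (i : Ix A) (j : Fin (cells A i.1) ×
        Fin (posLen C i.1) × (Sliced.env hE).option.J) => (j.1.val, j.2)).congr
        fun i j x => ?_
      rw [M.sys_succ i.1 x i.2]
      exact Iff.rfl
    · refine ((cells_mid M hE hA true).reindex fun (i : Ix A) (j : Fin (cells A i.1) ×
        Fin (posLen C i.1) × (Sliced.env hE).option.J) => (j.1.val, j.2)).congr
        fun i j x => ?_
      rw [M.sys_succ i.1 x i.2]
      exact Iff.rfl
  have hcells : (M.fam hE).Easy (J := fun i : Ix A => Bool × Fin (cells A i.1) ×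
      Fin (posLen C i.1) × (Sliced.env hE).option.J) fun i j x =>
      (Sliced.env hE).option.tst i.1 (M.su i.1 x).ctx j.2.2.1
        ((msgs j.1 (M.sys i.1 x (i.2 + 1)))[j.2.1.val]?) j.2.2.2 = true := by
    refine Fam.Easy.split (hcell true) (hcell false) ?_
    rintro i ⟨_ | _, j⟩
    · exact .inr ⟨j, fun x => Iff.rfl⟩
    · exact .inl ⟨j, fun x => Iff.rfl⟩
  have hmem : (M.fam hE).Easy (J := fun i : Ix A => Fin (A i.1).alg.st ⊕
      Bits.W (Option (Option (Envelope C i.1)))) fun i w x =>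
      M.wire hE i.1 (i.2 + 1) x (.inl w) = true := by
    refine Fam.Easy.split (easy_stepOut M hE hA) hans ?_
    rintro i (w | w)
    · refine .inl ⟨.inl w, fun x => ?_⟩
      unfold wire
      simp only [Sum.elim_inl]
      rw [M.cf_succ i.1 x i.2]
      exact Iff.rfl
    · exact .inr ⟨w, fun x => Iff.rfl⟩
  have hrest : (M.fam hE).Easy (J := fun i : Ix A =>
      (Fin (posLen C i.1) × (Sliced.sys hE).J) ⊕
      (Bool × Fin (cells A i.1) × Fin (posLen C i.1) × (Sliced.env hE).option.J))
      fun i w x => M.wire hE i.1 (i.2 + 1) x (.inr (.inr w)) = true := by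
    refine Fam.Easy.split (easy_mid M hE hA) hcells ?_
    rintro i (w | w)
    · refine .inl ⟨w, fun x => ?_⟩
      unfold wire
      simp only [Sum.elim_inl, Sum.elim_inr]
      rw [M.sys_succ i.1 x i.2]
      exact Iff.rfl
    · exact .inr ⟨w, fun x => Iff.rfl⟩
  refine Fam.Easy.split hmem (Fam.Easy.split (J := fun i : Ix A =>
      ((Option (Fin P.Nv) × Fin (C.sig.vkLen i.1)) ⊕ (SigIdx P × Fin (C.sig.sigLen i.1))) ⊕
      ((Fin (posLen C i.1) × (Sliced.sys hE).J) ⊕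
      (Bool × Fin (cells A i.1) × Fin (posLen C i.1) × (Sliced.env hE).option.J)))
      (φ := fun (i : Ix A) w x => M.wire hE i.1 (i.2 + 1) x (.inr w) = true) hkeep hrest ?_) ?_
  · rintro i (w | w)
    · exact .inl ⟨.inr (.inl w), fun x => Iff.rfl⟩
    · exact .inr ⟨w, fun x => Iff.rfl⟩
  · rintro i (w | w)
    · exact .inl ⟨w, fun x => Iff.rfl⟩
    · exact .inr ⟨w, fun x => Iff.rfl⟩

end Round

end Sim

end

section

/-! ### Encodings made of input bits and constants -/

/-- Every bit of the encoding of `f x` is an input bit or fixed. -/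
def Atomic {X I : Type} (inp : X → I → Bool) {α : Type} [Bits α] (f : X → α) : Prop :=
  ∀ w, (∃ i, ∀ x, Bits.enc (f x) w = inp x i) ∨ ∃ b, ∀ x, Bits.enc (f x) w = b

namespace Atomic

variable {X I : Type} {inp : X → I → Bool} {α β : Type} [Bits α] [Bits β]

theorem of_const {f : X → α} (h : ∀ x x', f x = f x') : Atomic inp f := fun w => by
  by_cases hX : Nonempty X
  · obtain ⟨x₀⟩ := hX
    exact .inr ⟨Bits.enc (f x₀) w, fun x => by rw [h x x₀]⟩
  · exact .inr ⟨true, fun x => absurd ⟨x⟩ hX⟩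

theorem prod {f : X → α} {g : X → β} (hf : Atomic inp f) (hg : Atomic inp g) :
    Atomic inp fun x => (f x, g x) := by
  rintro (w | w)
  · exact hf w
  · exact hg w

theorem pi {ι : Type} [Fintype ι] {f : ι → X → α} (hf : ∀ i, Atomic inp (f i)) :
    Atomic inp fun x i => f i x := fun w => hf w.1 w.2

theorem ite_some {f : X → α} (p : Prop) [Decidable p] (hf : p → Atomic inp f) :
    Atomic inp fun x => if p then some (f x) else none := by
  by_cases hp : p
  · simp only [hp, if_true]
    rintro (w | w)
    · exact .inr ⟨true, fun _ => rfl⟩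
    · exact hf hp w
  · simp only [hp, if_false]
    exact of_const fun _ _ => rfl

theorem word {n : ℕ} {f : X → Word n}
    (h : ∀ b, (∃ i, ∀ x, f x b = inp x i) ∨ ∃ b₀, ∀ x, f x b = b₀) : Atomic inp f :=
  fun w => h w.1

end Atomic

theorem CostAll.sum {X I : Type} {inp : X → I → Bool} {T U : Type} {f : T ⊕ U → X → Prop} {n m : ℕ}
    (h : CostAll inp (fun t => f (.inl t)) n) (h' : CostAll inp (fun t => f (.inr t)) m) :
    CostAll inp f (n + m) := by
  intro G
  obtain ⟨H, hH, h⟩ := h G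
  obtain ⟨H', hH', h'⟩ := h' (G ++ H)
  refine ⟨H ++ H', by simp; omega, ?_⟩
  rw [← List.append_assoc]
  rintro (t | t)
  · exact (h t).append H'
  · exact h' t

variable {P : Params} {C : Prims P}

namespace Sim

variable {A : ∀ k, Adversary C k} (M : Sim C A) (hE : C.Efficient)

theorem atomic_vk (k : ℕ) (v : Option (Fin P.Nv)) :
    Atomic (M.inp k) fun x => (M.su k x).ctx.vk v := .word (M.vk_atom k v)

theorem atomic_sig (k : ℕ) (d : SigIdx P) (hd : Allowed (M.G k) d) :
    Atomic (M.inp k) fun x => (M.su k x).sigOf d := .word (M.sig_atom k d hd)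

set_option synthInstance.maxSize 1000 in
set_option synthInstance.maxHeartbeats 400000 in
theorem atomic_view (k : ℕ) : Atomic (M.inp k) fun x => (M.su k x).view (A k).corr := by
  have ha := M.agree k
  refine .prod (.prod (.prod (.of_const fun x x' => (ha x x').hk) (.prod (M.atomic_vk k none)
    (.prod (.pi fun i => M.atomic_vk k (some i)) (.of_const fun x x' => (ha x x').ck))))
    (.of_const fun x x' => ?_)) (.prod (.pi fun i => .ite_some _ fun hi => ?_) (.prod
      (.pi fun t => .ite_some _ fun _ => .of_const fun x x' => ?_)
      (.pi fun v => .ite_some _ fun _ => .of_const fun x x' => ?_)))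
  · rw [(ha x x').hmsk, (ha x x').saltM, (ha x x').ct, (ha x x').com₀, (ha x x').comC]
  · refine .prod (.of_const (M.sk_const k i hi)) (.prod (.prod (.of_const fun x x' => ?_)
      (M.atomic_sig k (.inr (.inr i)) trivial)) (.pi fun s => .pi fun l =>
        .prod (.of_const fun x x' => ?_) (.prod (.of_const fun x x' => ?_) (.prod
          (.of_const fun x x' => ?_) (M.atomic_sig k (.inr (.inl (s, l, i))) trivial)))))
    · rw [(ha x x').kshare]
    · rw [(ha x x').row]
    · rw [(ha x x').salt]
    · rw [(ha x x').rshare]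
  · rw [(ha x x').tshare]
  · rw [(ha x x').code, (ha x x').rcpt]

theorem wire_zero_const (k : ℕ) (x x' : M.X k) (w : (Fin (posLen C k) × (Sliced.sys hE).J) ⊕
    (Bool × Fin (cells A k) × Fin (posLen C k) × (Sliced.env hE).option.J)) :
    M.wire hE k 0 x (.inr (.inr w)) = M.wire hE k 0 x' (.inr (.inr w)) := by
  rcases w with ⟨p, t⟩ | ⟨b, c, p, t⟩
  · have h : SysRel (ctxRel hE p (M.su k x).ctx (M.su k x').ctx) ({} : Sys C k) {} :=
      ⟨fun _ => ⟨rfl, fun _ => ⟨.none, rfl, fun _ => .none, .none, rfl, rfl, fun _ => .none, rfl,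
        rfl⟩, rfl⟩, fun _ => ⟨fun _ => .none, rfl, rfl, rfl, fun _ => .none, rfl⟩, rfl, rfl, rfl⟩
    exact congrFun (sys_tst.mpr h) t
  · cases b <;> rfl

theorem wire_zero (k : ℕ) : CostAll (M.inp k) (fun w x => M.wire hE k 0 x w = true)
    (((3 + (A k).alg.start.size + 2) + 3) + 3) := by
  refine .sum (.sum ?_ (.of_atomic fun w => .inr ⟨False, fun x => ?_⟩)) (.of_atomic fun w => ?_)
  · have h : CostAll (M.inp k) (fun w x => Bits.enc ((M.su k x).view (A k).corr) w = true) 3 := by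
      refine .of_atomic fun w => (M.atomic_view k w).imp ?_ ?_
      · exact fun ⟨i, h⟩ => ⟨i, fun x => by rw [h]⟩
      · exact fun ⟨b, h⟩ => ⟨b = true, fun x => by rw [h]⟩
    exact h.eval (A k).alg.start
  · exact iff_of_false (Bool.false_ne_true) id
  · rcases w with (w | w) | w
    · exact (M.vk_atom k w.1 w.2).imp (fun ⟨i, h⟩ => ⟨i, fun x => by rw [← h]; exact Iff.rfl⟩)
        fun ⟨b, h⟩ => ⟨b = true, fun x => by rw [← h x]; exact Iff.rfl⟩
    · by_cases hd : Allowed (M.G k) w.1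
      · have e : ∀ x, M.wire hE k 0 x (.inr (.inl (.inr w))) = (M.su k x).sigOf w.1 w.2 :=
          fun x => if_pos hd
        exact (M.sig_atom k w.1 hd w.2).imp (fun ⟨i, h⟩ => ⟨i, fun x => by rw [e, h]⟩)
          fun ⟨b, h⟩ => ⟨b = true, fun x => by rw [e, h]⟩
      · have e : ∀ x, M.wire hE k 0 x (.inr (.inl (.inr w))) = false := fun x => if_neg hd
        exact .inr ⟨False, fun x => by rw [e]; simp⟩
    · refine .inr ⟨∃ x, M.wire hE k 0 x (.inr (.inr w)) = true, fun x => ⟨fun h => ⟨x, h⟩, ?_⟩⟩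
      rintro ⟨x', h⟩
      rwa [M.wire_zero_const hE k x x' w]

instance (k : ℕ) : Finite (Wire hE A k) := by
  have := (Sliced.sys hE).fin
  have := (Sliced.env hE).option.fin
  infer_instance

instance (k : ℕ) : Fintype (Wire hE A k) := Fintype.ofFinite _

theorem polyBounded_wire (hA : PolyBounded fun k => (A k).alg.cost) :
    PolyBounded fun k => Fintype.card (Wire hE A k) := by
  have := (Sliced.sys hE).fin
  have := (Sliced.env hE).option.fin
  have := Fintype.ofFinite (Sliced.sys hE).J
  have := Fintype.ofFinite (Sliced.env hE).option.J
  have h1 := hA.polyBd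
  have h2 := (Sliced.env hE).option.option.width.polyBd
  have h3 := hE.sig.vkLen.polyBd
  have h4 := hE.sig.sigLen.polyBd
  have h5 := (polyBounded_posLen hE).polyBd
  have h6 := (polyBounded_cells hA).polyBd
  refine PolyBd.mono ((h1.add h2).add (((((PolyBd.const (Fintype.card (Option (Fin P.Nv)))).mul
    h3).add ((PolyBd.const (Fintype.card (SigIdx P))).mul h4))).add
    ((h5.mul (.const (Fintype.card (Sliced.sys hE).J))).add
      ((PolyBd.const 2).mul (h6.mul (h5.mul
        (.const (Fintype.card (Sliced.env hE).option.J)))))))) fun k => ?_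
  rw [← Nat.card_eq_fintype_card]
  unfold Wire
  simp only [Nat.card_sum, Nat.card_prod]
  simp only [Nat.card_eq_fintype_card, Fintype.card_fin, Fintype.card_bool]
  have : (A k).alg.st ≤ (A k).alg.cost := by unfold Machine.cost; omega
  gcongr
  simp [SigIdx]

/-- The wires after any number of rounds are computed by circuits of polynomial size. -/
theorem exists_wire (hA : PolyBounded fun k => (A k).alg.cost) : ∃ s, PolyBounded s ∧
    ∀ k (r : ℕ), r ≤ (A k).alg.rounds →
      CostAll (M.inp k) (fun w x => M.wire hE k r x w = true) (s k) := by
  obtain ⟨s, ⟨p, hs⟩, hD⟩ := (Fam.Easy.all (𝓕 := M.fam hE) (J := fun _ => Unit)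
    (T := fun (i : Ix A) _ => Wire hE A i.1)
    (φ := fun (i : Ix A) _ w x => M.wire hE i.1 (i.2 + 1) x w = true)
    (PolyBd.comp (polyBounded_wire hE hA) fun i : Ix A => i.1) (fun _ _ => le_rfl)
    ((M.easy_wire hE hA).reindex
      fun (i : Ix A) (j : Σ _ : Unit, Wire hE A i.1) => j.2)).circuit
  refine ⟨fun k => ((A k).alg.cost + 11) + (A k).alg.cost * (p.eval k + 2), ?_, ?_⟩
  · exact (hA.polyBd.add (.const 11)).add (hA.polyBd.mul
      (PolyBd.add ⟨p, fun _ => le_rfl⟩ (.const 2)))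
  · intro k r hr
    have h : CostAll (M.inp k) (fun w x => M.wire hE k r x w = true)
        (((A k).alg.cost + 11) + r * (p.eval k + 2)) := by
      induction r with
      | zero =>
        refine (M.wire_zero hE k).mono ?_
        unfold Machine.cost
        omega
      | succ r ih =>
        obtain ⟨D, hD1, hD2⟩ := hD ⟨k, r, hr⟩ ()
        have h1 := (ih (by omega)).eval D
        have h2 : D.size ≤ p.eval k := hD1.trans (hs _)
        have e : (fun o x => D.eval (M.wire hE k r x) o = true) =
            fun w x => M.wire hE k (r + 1) x w = true := by
          funext w x
          exact propext (hD2 x w)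
        have h3 : CostAll (M.inp k) (fun o x => D.eval (M.wire hE k r x) o = true) _ := h1
        rw [e] at h3
        exact h3.mono (by rw [add_mul]; omega)
    refine h.mono (Nat.add_le_add_left (Nat.mul_le_mul_right _ ?_) _)
    unfold Machine.cost
    omega

/-- The signatures in the messages that the adversary delivers are computed by circuits of
polynomial size from the input bits. -/
theorem exists_circuit (hE : C.Efficient)
    (hA : PolyBounded fun k => (A k).alg.cost) : ∃ s, PolyBounded s ∧
    ∀ k (r : Fin (A k).alg.rounds) (j : Fin P.Nv),
      ∃ D : Circuit (M.I k) (Fin (C.sig.sigLen k)), D.size ≤ s k ∧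
        ∀ x b, D.eval (M.inp k x) b = true ↔
          ∃ a σ, M.act k x r = some a ∧ sigAt j a = some σ ∧ σ b = true := by
  have hloc : (M.fam hE).Easy (J := fun i : Ix A => Fin P.Nv × Fin (C.sig.sigLen i.1))
      fun i j x => ∃ a σ, M.act i.1 x i.2 = some a ∧ sigAt j.1 a = some σ ∧ σ j.2 = true := by
    have := (Sliced.act hE).fin
    refine Fam.Easy.of_local (𝓕 := M.fam hE) (T := Option (Sliced.act hE).J)
      (J := fun i : Ix A => Fin P.Nv × Fin (C.sig.sigLen i.1))
      (β := fun i j t x => actBit M hE i j.2 t x)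
      ((easy_actBit M hE hA).reindex fun (i : Ix A) (j : (Fin P.Nv ×
        Fin (C.sig.sigLen i.1)) × Option (Sliced.act hE).J) => (j.1.2.val, j.2)) ?_
    rintro i ⟨j, b⟩ x x' ht ⟨a, σ, ha, hσ, hb⟩
    have hr := act_rel ht
    simp only at ha hr hσ hb
    rw [ha] at hr
    rcases ha' : M.act i.1 x' i.2 with _ | a'
    · rw [ha'] at hr; cases hr
    · rw [ha'] at hr
      cases hr with
      | some hr =>
        have h2 := sigAt_rel hr j
        rw [hσ] at h2
        rcases hσ' : sigAt j a' with _ | σ'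
        · rw [hσ'] at h2; cases h2
        · rw [hσ'] at h2
          cases h2 with
          | some h2 =>
            refine ⟨a', σ', rfl, hσ', ?_⟩
            have h3 : (if h : b.val < C.sig.sigLen i.1 then σ ⟨b, h⟩ else false) =
              if h : b.val < C.sig.sigLen i.1 then σ' ⟨b, h⟩ else false := congrFun h2 (.inl ())
            simp only [b.2, dite_true] at h3
            exact h3.symm.trans hb
  obtain ⟨s, ⟨p, hs⟩, hD⟩ := (Fam.Easy.all (𝓕 := M.fam hE) (J := fun _ => Fin P.Nv)
    (T := fun (i : Ix A) _ => Fin (C.sig.sigLen i.1))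
    (φ := fun (i : Ix A) j b x =>
      ∃ a σ, M.act i.1 x i.2 = some a ∧ sigAt j a = some σ ∧ σ b = true)
    (PolyBd.comp hE.sig.sigLen fun i : Ix A => i.1) (fun i _ => (Fintype.card_fin _).le)
    (hloc.reindex fun (i : Ix A) (j : Σ _ : Fin P.Nv, Fin (C.sig.sigLen i.1)) =>
      (j.1, j.2))).circuit
  obtain ⟨t, ht, hw⟩ := M.exists_wire hE hA
  refine ⟨fun k => t k + p.eval k + 2, (ht.polyBd.add ⟨p, fun _ => le_rfl⟩).add (.const 2),
    fun k r j => ?_⟩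
  obtain ⟨D, hD1, hD2⟩ := hD ⟨k, r⟩ j
  have h1 := (hw k r r.2.le).eval D
  obtain ⟨D', hD3, hD4⟩ := h1.circuit
  refine ⟨D', hD3.trans ?_, fun x b => (hD4 x b).trans (hD2 x b)⟩
  have h2 : D.size ≤ p.eval k := hD1.trans (hs _)
  change t k + D.size + 2 ≤ t k + p.eval k + 2
  omega

end Sim

end

section

variable {P : Params} {C : Prims P}

/-! ### Forgeries in runs -/

section Run

/-- The random choices in a run. -/
abbrev Adversary.Runs {k : ℕ} (A : Adversary C k) : Type := Setup C k × A.alg.Coins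

variable {k : ℕ} (A : Adversary C k) (ω : A.Runs)

/-- Configuration after `r` rounds of a run. -/
def Adversary.conf (r : ℕ) :
    A.alg.Conf (Sys C k) :=
  A.alg.conf (ω.1.view A.corr) (ω.1.react A.corr) {} ω.2 r

/-- System state after `r` rounds of a run. -/
def Adversary.sysAt (r : ℕ) : Sys C k :=
  (A.conf ω r).2.2

/-- Action in round `r` of a run. -/
def Adversary.actAt (r : Fin A.alg.rounds) :
    Option (Act C k) :=
  A.alg.act (A.conf ω r) (ω.2 r)

theorem Adversary.run_eq : A.run ω = A.sysAt ω A.alg.rounds :=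
  Machine.play_eq_conf _ _ _ _ _

/-- System state after the action in a round. -/
def Adversary.midAt (r : Fin A.alg.rounds) :
    Sys C k :=
  match A.actAt ω r with
  | some a => ω.1.exec A.corr (A.sysAt ω r) a
  | none => A.sysAt ω r

theorem Adversary.conf_succ (r : Fin A.alg.rounds) : A.conf ω (r + 1) =
    (fun i => A.alg.step.eval (Sum.elim (A.conf ω r).1
      (Sum.elim (Bits.enc (A.conf ω r).2.1) (ω.2 r))) (Sum.inl i),
      some (A.midAt ω r).unread.head?,
      { A.midAt ω r with unread := (A.midAt ω r).unread.tail }) := by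
  unfold Adversary.conf
  rw [Machine.conf_succ _ _ _ _ _ r.2]
  rfl

theorem Adversary.sysAt_succ (r : Fin A.alg.rounds) : A.sysAt ω (r + 1) =
    { A.midAt ω r with unread := (A.midAt ω r).unread.tail } :=
  congrArg (fun c => c.2.2) (A.conf_succ ω r)

theorem Adversary.sysAt_of_le {r : ℕ}
    (hr : A.alg.rounds ≤ r) : A.sysAt ω r = A.sysAt ω A.alg.rounds := by
  induction r, hr using Nat.le_induction with
  | base => rfl
  | succ r hr ih =>
    rw [← ih]
    unfold Adversary.sysAt Adversary.conf
    rw [Machine.conf, dif_neg (by omega)]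

/-- A property of the system state that actions and reading messages preserve is preserved in
runs. -/
theorem Adversary.sysAt_mono {p : Sys C k → Prop}
    (h1 : ∀ y a, p y → p (ω.1.exec A.corr y a))
    (h2 : ∀ y, p y → p { y with unread := y.unread.tail })
    {r r' : ℕ} (hr : r ≤ r') (h : p (A.sysAt ω r)) : p (A.sysAt ω r') := by
  induction r', hr using Nat.le_induction with
  | base => exact h
  | succ r' _ ih =>
    by_cases hr' : r' < A.alg.rounds
    · rw [A.sysAt_succ ω ⟨r', hr'⟩]
      apply h2
      unfold Adversary.midAt
      rcases A.actAt ω ⟨r', hr'⟩ with _ | a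
      · exact ih
      · exact h1 _ _ ih
    · rw [A.sysAt_of_le ω (by omega : _ ≤ r' + 1), ← A.sysAt_of_le ω (by omega : _ ≤ r')]
      exact ih

theorem Adversary.endorsed_run {r : ℕ}
    {i : Fin P.Nv} {s : Fin P.n} {c : Word 128 × Sg C k}
    (h : (((A.sysAt ω r).vc i).ballot s).endorsed = some c) :
    (((A.run ω).vc i).ballot s).endorsed = some c := by
  have key : ∀ r', r ≤ r' → (((A.sysAt ω r').vc i).ballot s).endorsed = some c := fun r' hr =>
    A.sysAt_mono ω (p := fun y => ((y.vc i).ballot s).endorsed = some c)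
      (fun y a hy => exec_endorsed _ _ y a hy) (fun y hy => hy) hr h
  rw [A.run_eq]
  rcases le_total r A.alg.rounds with hr | hr
  · exact key _ hr
  · rw [← A.sysAt_of_le ω hr]; exact h

end Run

/-- Key generation coins of a signer, and its signing coins for the messages indexed by `ι`. -/
abbrev SignerCoins (C : Prims P) (ι : Type) (k : ℕ) : Type :=
  Word (C.sig.keyCoinLen k) × (ι → Word (C.sig.signCoinLen k))

/-- Verification key and signatures of a signer. -/
def signerData {ι : Type} (msg : ι → SMsg P) {k : ℕ} (θ : SignerCoins C ι k) :
    Fin (C.sig.vkLen k) ⊕ ι × Fin (C.sig.sigLen k) → Bool :=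
  Sum.elim (C.sig.keyGen k θ.1).1 fun d =>
    C.sig.sign k (C.sig.keyGen k θ.1).2 (θ.2 d.1) (msg d.1) d.2

/-- Runs in which everything but the coins of one honest signer is fixed. The signer signs the
messages `msg`, and only these are needed as long as the condition `p` holds. -/
structure Forging (C : Prims P) (A : ∀ k, Adversary C k) (ι : Type) where
  msg : ℕ → ι → SMsg P
  p : ∀ k, SignerCoins C ι k → Prop
  su : ∀ k, SignerCoins C ι k → Setup C k
  coins : ∀ k, (A k).alg.Coins
  G : ℕ → CodePred P
  agree : ∀ k θ θ', (su k θ).Agree (su k θ')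
  vk_atom : ∀ k v b, (∃ w, ∀ θ, (su k θ).ctx.vk v b = signerData (msg k) θ w) ∨
    ∃ b₀, ∀ θ, (su k θ).ctx.vk v b = b₀
  sig_atom : ∀ k d, Allowed (G k) d → ∀ b,
    (∃ w, ∀ θ, (su k θ).sigOf d b = signerData (msg k) θ w) ∨ ∃ b₀, ∀ θ, (su k θ).sigOf d b = b₀
  sk_const : ∀ k, ∀ i ∈ (A k).corr.vcs, ∀ θ θ', p k θ → (su k θ).sk i = (su k θ').sk i
  dom : ∀ k θ, p k θ → ∀ r i s vc,
    Endorsed ((A k).sysAt (su k θ, coins k) r) i s vc → G k i s vc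

namespace Forging

variable {A : ∀ k, Adversary C k} {ι : Type} (F : Forging C A ι)

/-- The runs as a family of objects presented by the key and the signatures of the signer. -/
def sim : Sim C A where
  X k := { θ : SignerCoins C ι k // F.p k θ }
  su k θ := F.su k θ
  coins := F.coins
  G := F.G
  I k := Fin (C.sig.vkLen k) ⊕ ι × Fin (C.sig.sigLen k)
  inp k θ := signerData (F.msg k) θ.1
  agree k θ θ' := F.agree k θ θ'
  vk_atom k v b := (F.vk_atom k v b).imp (fun ⟨w, h⟩ => ⟨w, fun θ => h θ⟩)
    fun ⟨w, h⟩ => ⟨w, fun θ => h θ⟩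
  sig_atom k d hd b := (F.sig_atom k d hd b).imp (fun ⟨w, h⟩ => ⟨w, fun θ => h θ⟩)
    fun ⟨w, h⟩ => ⟨w, fun θ => h θ⟩
  sk_const k i hi θ θ' := F.sk_const k i hi θ θ' θ.2
  dom k θ r i s vc h := F.dom k θ θ.2 r i s vc h

/-- The adversary delivers a valid signature of a message that is never signed with negligible
probability. -/
theorem negligible [Fintype ι] (hE : C.Efficient) (hS : C.sig.EUFCMA)
    (hA : PolyBounded fun k => (A k).alg.cost) (target : ℕ → SMsg P)
    (ht : ∀ k i, F.msg k i ≠ target k) (j : Fin P.Nv) (c : ℕ → ℕ) :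
    Negligible fun k => prob (SignerCoins C ι k) fun θ => F.p k θ ∧ ∃ hr : c k < (A k).alg.rounds,
      ∃ a σ, (A k).actAt (F.su k θ, F.coins k) ⟨c k, hr⟩ = some a ∧ sigAt j a = some σ ∧
        C.sig.verify k (C.sig.keyGen k θ.1).1 (target k) σ = true := by
  obtain ⟨s, hs, hD⟩ := F.sim.exists_circuit hE hA
  have hD' : ∀ k, ∃ D : Circuit (Fin (C.sig.vkLen k) ⊕ ι × Fin (C.sig.sigLen k))
      (Fin (C.sig.sigLen k)), D.size ≤ s k ∧ ∀ hr : c k < (A k).alg.rounds,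
        ∀ (x : F.sim.X k) b, D.eval (signerData (F.msg k) x.1) b = true ↔
          ∃ a σ, F.sim.act k x ⟨c k, hr⟩ = some a ∧ sigAt j a = some σ ∧ σ b = true := by
    intro k
    by_cases hr : c k < (A k).alg.rounds
    · obtain ⟨D, h1, h2⟩ := hD k ⟨c k, hr⟩ j
      exact ⟨D, h1, fun _ => h2⟩
    · exact ⟨⟨[], fun _ => .inr 0⟩, Nat.zero_le _, fun h => absurd h hr⟩
  choose D hD1 hD2 using hD'
  refine (hS.static hE.sig.vkLen hE.sig.sigLen F.msg target ht D (hs.polyBd.mono hD1)).of_le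
    (fun k => prob_nonneg _) fun k => prob_mono ?_
  rintro θ ⟨hp, hr, a, σ, ha, hσ, hv⟩
  have e : (D k).eval (signerData (F.msg k) θ) = σ := by
    funext b
    rw [Bool.eq_iff_iff, hD2 k hr ⟨θ, hp⟩ b]
    constructor
    · rintro ⟨a', σ', ha', hσ', hb⟩
      obtain rfl : a = a' := Option.some.inj (ha.symm.trans ha')
      obtain rfl : σ = σ' := Option.some.inj (hσ.symm.trans hσ')
      exact hb
    · exact fun hb => ⟨a, σ, ha, hσ, hb⟩
  exact (congrArg (C.sig.verify k (C.sig.keyGen k θ.1).1 (target k)) e).trans hv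

end Forging

end

section

variable {P : Params} {C : Prims P}

theorem Setup.nonempty (hm : 2 * P.m ≤ 2 ^ 128) (C : Prims P) (k : ℕ) : Nonempty (Setup C k) := by
  have h : Fintype.card (Line P) ≤ Fintype.card (Word 128) := by simpa using hm
  obtain ⟨e⟩ := Function.Embedding.nonempty_of_card_le h
  exact ⟨{
    hk := fun _ => false
    code := fun _ => e
    rcpt := fun _ _ _ => false
    perm := fun _ _ => 1
    salt := fun _ _ _ => false
    msk := fun _ => false
    saltM := fun _ => false
    iv := fun _ _ _ => false
    rpoly := fun _ _ _ => 0
    mpoly := fun _ => 0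
    eaKey := fun _ => false
    vcKey := fun _ _ => false
    vcCoin := fun _ _ _ => false
    rCoin := fun _ _ _ _ => false
    mCoin := fun _ _ => false
    trap := 0
    comR := fun _ _ _ => 0
    tpoly := fun _ _ _ _ => 0 }⟩

/-! ### Forgeries of endorsements -/

/-- The adversary delivers a valid signature of an honest VC node on a vote code that the node
never endorses. -/
def ForgesVC {k : ℕ} (A : Adversary C k) (ω : A.Runs) : Prop :=
  ∃ j, j ∉ A.corr.vcs ∧ ∃ r a σ s vc, A.actAt ω r = some a ∧ sigAt j a = some σ ∧
    C.sig.verify k (ω.1.vk j) (.endorse s vc) σ = true ∧ ¬ Endorsed (A.run ω) j s vc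

/-- Replace key and coins of VC node `j`. -/
def Setup.setVC {k : ℕ} (S : Setup C k) (j : Fin P.Nv) (θ : SignerCoins C (Fin P.n) k) :
    Setup C k :=
  { S with vcKey := Function.update S.vcKey j θ.1, vcCoin := Function.update S.vcCoin j θ.2 }

/-- Forging for VC node `j`, where `g` is a guess at what it endorses. -/
def forgingVC {A : ∀ k, Adversary C k} (ω : ∀ k, (A k).Runs) (j : Fin P.Nv)
    (g : Fin P.n → Option (Word 128)) : Forging C A (Fin P.n) where
  msg _ s := match g s with
    | some vc => .endorse s vc
    | none => .kshare j fun _ => false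
  p k θ := j ∉ (A k).corr.vcs ∧ ∀ r s vc,
    Endorsed ((A k).sysAt ((ω k).1.setVC j θ, (ω k).2) r) j s vc → g s = some vc
  su k θ := (ω k).1.setVC j θ
  coins k := (ω k).2
  G _ i s vc := i = j → g s = some vc
  agree k θ θ' := ⟨rfl, rfl, rfl, rfl, rfl, rfl, rfl, rfl, rfl, rfl, rfl, rfl, rfl⟩
  vk_atom k v b := by
    rcases v with _ | i
    · exact .inr ⟨(ω k).1.eaVk b, fun _ => rfl⟩
    · by_cases hi : i = j
      · subst hi
        exact .inl ⟨.inl b, fun θ => by simp [Setup.ctx, Setup.vk, Setup.setVC, signerData]⟩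
      · exact .inr ⟨(ω k).1.vk i b, fun θ => by simp [Setup.ctx, Setup.vk, Setup.setVC, hi]⟩
  sig_atom k d hd b := by
    rcases d with ⟨i, s, vc⟩ | ⟨s, l, i⟩ | i
    · by_cases hi : i = j
      · subst hi
        have hg : g s = some vc := hd rfl
        refine .inl ⟨.inr (s, b), fun θ => ?_⟩
        simp [Setup.sigOf, Setup.sk, Setup.setVC, signerData, hg]
      · exact .inr ⟨(ω k).1.sigOf (.inl (i, s, vc)) b, fun θ => by
          simp [Setup.sigOf, Setup.sk, Setup.setVC, hi]⟩
    · exact .inr ⟨(ω k).1.rshareSig s l i b, fun _ => rfl⟩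
    · exact .inr ⟨(ω k).1.kshareSig i b, fun _ => rfl⟩
  sk_const k i hi θ θ' hp := by
    by_cases hij : i = j
    · exact absurd (hij ▸ hi) hp.1
    · simp [Setup.sk, Setup.setVC, hij]
  dom k θ hp r i s vc h hi := by
    subst hi
    exact hp.2 r s vc h

/-- If a bad event tells the value of a bounded parameter and a round, then these can be fixed. -/
theorem negligible_of_guess {A : ∀ k, Adversary C k} (hA : PolyBounded fun k => (A k).alg.cost)
    {T : Type} [Fintype T] (E : T → ∀ k, Fin ((A k).alg.rounds + 1) → (A k).Runs → Prop)
    {F : ∀ k, (A k).Runs → Prop}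
    (h : ∀ t (c : ∀ k, Fin ((A k).alg.rounds + 1)), Negligible fun k => prob _ (E t k (c k)))
    (hF : ∀ k ω, F k ω → ∃ t c, E t k c ω) : Negligible fun k => prob _ (F k) := by
  have hrd : PolyBounded fun k => Fintype.card (Fin ((A k).alg.rounds + 1)) := by
    simp only [Fintype.card_fin]
    exact (hA.polyBd.add (.const 1)).mono fun k => Nat.add_le_add_right (by
      unfold Machine.cost; omega) _
  exact (Negligible.sum Finset.univ fun t => Negligible.exists hrd (E t) (h t)).of_le
    (fun _ => prob_nonneg _) fun k => (prob_mono (hF k)).trans (prob_exists_le _)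

theorem negligible_forgesVC (hm : 2 * P.m ≤ 2 ^ 128) (hE : C.Efficient) (hS : C.sig.EUFCMA)
    {A : ∀ k, Adversary C k} (hA : PolyBounded fun k => (A k).alg.cost) :
    Negligible fun k => prob (A k).Runs (ForgesVC (A k)) := by
  let E : (Fin P.Nv × Fin P.n × Word 128 × (Fin P.n → Option (Word 128))) → ∀ k,
      Fin ((A k).alg.rounds + 1) → (A k).Runs → Prop := fun t k c ω =>
    t.2.2.2 t.2.1 ≠ some t.2.2.1 ∧ (t.1 ∉ (A k).corr.vcs ∧ ∀ r s vc,
      Endorsed ((A k).sysAt ω r) t.1 s vc → t.2.2.2 s = some vc) ∧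
    ∃ hr : c.val < (A k).alg.rounds, ∃ a σ, (A k).actAt ω ⟨c, hr⟩ = some a ∧
      sigAt t.1 a = some σ ∧ C.sig.verify k (ω.1.vk t.1) (.endorse t.2.1 t.2.2.1) σ = true
  refine negligible_of_guess hA E ?_ ?_
  · rintro ⟨j, s, vc, g⟩ c
    by_cases hg : g s = some vc
    · refine Negligible.zero.of_le (fun _ => prob_nonneg _) fun k => ?_
      have : ∀ ω, ¬ E (j, s, vc, g) k (c k) ω := fun ω h => h.1 hg
      simp [prob, this]
    have havg : ∀ k, ∃ ω : (A k).Runs,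
        prob _ (E (j, s, vc, g) k (c k)) ≤ prob (SignerCoins C (Fin P.n) k) fun θ =>
          E (j, s, vc, g) k (c k) (ω.1.setVC j θ, ω.2) := by
      intro k
      have := Setup.nonempty hm C k
      refine exists_prob_le (Ω := (A k).Runs) (Θ := SignerCoins C (Fin P.n) k)
        (fun ω => (ω.1.vcKey j, ω.1.vcCoin j)) (fun ω θ => (ω.1.setVC j θ, ω.2)) ?_ ?_ _
      · intro ω θ; simp [Setup.setVC]
      · intro ω θ; simp [Setup.setVC]
    choose ω hω using havg
    refine ((forgingVC ω j g).negligible hE hS hA (fun _ => .endorse s vc) ?_ j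
      fun k => (c k).val).of_le (fun k => prob_nonneg _) fun k => (hω k).trans (prob_mono ?_)
    · intro k s' h
      simp only [forgingVC] at h
      split at h
      · cases h; exact hg ‹_›
      · cases h
    · rintro θ ⟨-, hp, hr, a, σ, ha, hσ, hv⟩
      refine ⟨hp, hr, a, σ, ha, hσ, ?_⟩
      simpa [Setup.vk, Setup.setVC] using hv
  rintro k ω ⟨j, hj, r, a, σ, s, vc, ha, hσ, hv, hn⟩
  refine ⟨(j, s, vc, fun s' => (((((A k).run ω).vc j).ballot s').endorsed).map Prod.fst),
    r.castSucc, ?_, ⟨hj, ?_⟩, r.2, a, σ, ha, hσ, hv⟩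
  · intro h
    obtain ⟨⟨vc', σ'⟩, h1, h2⟩ := Option.map_eq_some_iff.mp h
    obtain rfl : vc' = vc := h2
    exact hn ⟨σ', h1⟩
  · rintro r' s' vc' ⟨σ', h⟩
    simp [(A k).endorsed_run ω h]

/-! ### Forgeries of master key shares -/

/-- The adversary delivers a wrong master key share with a valid signature. -/
def ForgesEA {k : ℕ} (A : Adversary C k) (ω : A.Runs) : Prop :=
  ∃ r src dst Q i x σ, A.actAt ω r = some (.deliver (src, dst, .voteSet Q x σ)) ∧
    C.sig.verify k ω.1.eaVk (.kshare i x) σ = true ∧ x ≠ ω.1.kshare i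

/-- The signatures issued by the election authority. -/
abbrev EAIdx (P : Params) : Type := (Fin P.n × Line P × Fin P.Nv) ⊕ Fin P.Nv

/-- Replace key and coins of the election authority. -/
def Setup.setEA {k : ℕ} (S : Setup C k) (θ : SignerCoins C (EAIdx P) k) : Setup C k :=
  { S with
    eaKey := θ.1
    rCoin := fun s l i => θ.2 (.inl (s, l, i))
    mCoin := fun i => θ.2 (.inr i) }

/-- Forging for the election authority. -/
def forgingEA {A : ∀ k, Adversary C k} (ω : ∀ k, (A k).Runs) :
    Forging C A (EAIdx P) where
  msg k
    | .inl (s, l, i) => .rshare s l i ((ω k).1.rshare s l i)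
    | .inr i => .kshare i ((ω k).1.kshare i)
  p k θ := True
  su k θ := (ω k).1.setEA θ
  coins k := (ω k).2
  G _ _ _ _ := True
  agree k θ θ' := ⟨rfl, rfl, rfl, rfl, rfl, rfl, rfl, rfl, rfl, rfl, rfl, rfl, rfl⟩
  vk_atom k v b := by
    rcases v with _ | i
    · exact .inl ⟨.inl b, fun _ => rfl⟩
    · exact .inr ⟨(ω k).1.vk i b, fun _ => rfl⟩
  sig_atom k d hd b := by
    rcases d with ⟨i, s, vc⟩ | d | d
    · exact .inr ⟨(ω k).1.sigOf (.inl (i, s, vc)) b, fun _ => rfl⟩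
    · exact .inl ⟨.inr (.inl d, b), fun _ => rfl⟩
    · exact .inl ⟨.inr (.inr d, b), fun _ => rfl⟩
  sk_const _ _ _ _ _ _ := rfl
  dom _ _ _ _ _ _ _ _ := trivial

theorem negligible_forgesEA (hv : 0 < P.Nv) (hm : 2 * P.m ≤ 2 ^ 128) (hE : C.Efficient)
    (hS : C.sig.EUFCMA) {A : ∀ k, Adversary C k} (hA : PolyBounded fun k => (A k).alg.cost) :
    Negligible fun k => prob (A k).Runs (ForgesEA (A k)) := by
  let j : Fin P.Nv := ⟨0, hv⟩
  let E : (Fin P.Nv × Word 128) → ∀ k,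
      Fin ((A k).alg.rounds + 1) → (A k).Runs → Prop := fun t k c ω =>
    t.2 ≠ ω.1.kshare t.1 ∧
    ∃ hr : c.val < (A k).alg.rounds, ∃ a σ, (A k).actAt ω ⟨c, hr⟩ = some a ∧
      sigAt j a = some σ ∧ C.sig.verify k ω.1.eaVk (.kshare t.1 t.2) σ = true
  refine negligible_of_guess hA E ?_ ?_
  · rintro ⟨i, x⟩ c
    have havg : ∀ k, ∃ ω : (A k).Runs,
        prob _ (E (i, x) k (c k)) ≤ prob (SignerCoins C (EAIdx P) k) fun θ =>
          E (i, x) k (c k) (ω.1.setEA θ, ω.2) := by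
      intro k
      have := Setup.nonempty hm C k
      refine exists_prob_le (Ω := (A k).Runs) (Θ := SignerCoins C (EAIdx P) k)
        (fun ω => (ω.1.eaKey, Sum.elim (fun d => ω.1.rCoin d.1 d.2.1 d.2.2) ω.1.mCoin))
        (fun ω θ => (ω.1.setEA θ, ω.2)) ?_ ?_ _
      · rintro ω ⟨θ, θ'⟩
        refine Prod.ext rfl (funext fun d => ?_)
        rcases d with d | d <;> rfl
      · intro ω θ; rfl
    choose ω hω using havg
    -- for parameters with `x` the true share, any other message serves as target
    have htar : ∀ k, ∃ z, z ≠ (ω k).1.kshare i ∧ (x ≠ (ω k).1.kshare i → z = x) := by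
      intro k
      by_cases hx : x = (ω k).1.kshare i
      · obtain ⟨z, hz⟩ := exists_ne ((ω k).1.kshare i)
        exact ⟨z, hz, fun h => absurd hx h⟩
      · exact ⟨x, hx, fun _ => rfl⟩
    choose z hz hzx using htar
    refine ((forgingEA ω).negligible hE hS hA (fun k => .kshare i (z k)) ?_ j
      fun k => (c k).val).of_le (fun k => prob_nonneg _) fun k => (hω k).trans (prob_mono ?_)
    · rintro k (⟨s, l, i'⟩ | i') h
      · cases h
      · simp only [forgingEA, SMsg.kshare.injEq] at h
        obtain ⟨rfl, h⟩ := h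
        exact hz k h.symm
    · rintro θ ⟨hx, hr, a, σ, ha, hσ, hv⟩
      have : z k = x := hzx k hx
      exact ⟨trivial, hr, a, σ, ha, hσ, by rw [this]; exact hv⟩
  rintro k ω ⟨r, src, dst, Q, i, x, σ, ha, hv, hn⟩
  exact ⟨(i, x), r.castSucc, hn, r.2, _, σ, ha, rfl, hv⟩

/-! ### Hash collisions -/

/-- The hash function collides. -/
def Collides {k : ℕ} (S : Setup C k) : Prop :=
  ∃ x y, x ≠ y ∧ C.hash.hash k S.hk x = C.hash.hash k S.hk y

/-- A bounded number of inputs can be hashed, so a collision resistant family of hash functions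
has no collisions at all, up to negligible probability: a constant circuit finds any of them. -/
theorem negligible_collides (hm : 2 * P.m ≤ 2 ^ 128)
    (hH : C.hash.CollisionResistant) {Z : ℕ → Type} [∀ k, Finite (Z k)] [∀ k, Nonempty (Z k)] :
    Negligible fun k => prob (Setup C k × Z k) fun ω => Collides ω.1 := by
  have key : ∀ t : (Word 128 × Word 64) × (Word 128 × Word 64), Negligible fun k =>
      prob (Setup C k) fun S => t.1 ≠ t.2 ∧ C.hash.hash k S.hk t.1 = C.hash.hash k S.hk t.2 := by
    intro t
    have hF : PolyTime (α := fun k => Word (C.hash.keyLen k) × Word 0)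
        (β := fun _ => (Word 128 × Word 64) × (Word 128 × Word 64)) fun _ _ => t := by
      refine ⟨fun _ => 3, ⟨Polynomial.C 3, fun _ => by simp⟩, fun k => ?_⟩
      have h : CostAll (fun x : Word (C.hash.keyLen k) × Word 0 => Bits.enc x)
          (fun w _ => Bits.enc t w = true) 3 := .of_atomic fun w => .inr ⟨_, fun _ => Iff.rfl⟩
      obtain ⟨D, h1, h2⟩ := h.circuit
      exact ⟨D, h1, fun x => funext fun w => by rw [Bool.eq_iff_iff]; exact h2 x w⟩
    refine (hH (fun _ => 0) _ ⟨0, fun _ => by simp⟩ hF).of_le (fun _ => prob_nonneg _) fun k => ?_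
    have := Setup.nonempty hm C k
    obtain ⟨S, hS⟩ := exists_prob_le (Ω := Setup C k) (Θ := Word (C.hash.keyLen k) × Word 0)
      (fun S => (S.hk, fun _ => false)) (fun S θ => { S with hk := θ.1 })
      (fun S θ => Prod.ext rfl (funext fun i => i.elim0)) (fun S θ => rfl)
      (fun S => t.1 ≠ t.2 ∧ C.hash.hash k S.hk t.1 = C.hash.hash k S.hk t.2)
    exact hS
  have hsum := Negligible.sum
    (Finset.univ : Finset ((Word 128 × Word 64) × (Word 128 × Word 64))) key
  refine hsum.of_le (fun _ => prob_nonneg _) fun k => ?_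
  rw [prob_fst (Ω := Setup C k) (Z := Z k) Collides]
  refine le_trans (prob_mono ?_) (prob_exists_le _)
  rintro S ⟨x, y, h, h'⟩
  exact ⟨(x, y), h, h'⟩

end

section

variable {P : Params} {C : Prims P} {k : ℕ}

/-! ### Quorums -/

/-- `Nv - fv` VC nodes are corrupted or satisfy `p`. -/
def Quorum (K : Corruption P) (p : Fin P.Nv → Prop) : Prop :=
  P.Nv - P.fv ≤ (Finset.univ.filter fun j => j ∈ K.vcs ∨ p j).card

theorem Quorum.mono {K : Corruption P} {p q : Fin P.Nv → Prop} (h : Quorum K p)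
    (hpq : ∀ j, j ∉ K.vcs → p j → q j) : Quorum K q :=
  h.trans (Finset.card_le_card fun j hj => by
    simp only [Finset.mem_filter, Finset.mem_univ, true_and] at hj ⊢
    by_cases hk : j ∈ K.vcs
    · exact .inl hk
    · exact .inr (hpq j hk (hj.resolve_left hk)))

theorem Quorum.of_subset {K : Corruption P} {p : Fin P.Nv → Prop} {J : Finset (Fin P.Nv)}
    (hJ : P.Nv - P.fv ≤ J.card) (h : ∀ j ∈ J, j ∉ K.vcs → p j) : Quorum K p :=
  hJ.trans (Finset.card_le_card fun j hj => by
    simp only [Finset.mem_filter, Finset.mem_univ, true_and]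
    by_cases hk : j ∈ K.vcs
    · exact .inl hk
    · exact .inr (h j hj hk))

/-- Two quorums have an honest node in common. -/
theorem Quorum.inter (hfv : 3 * P.fv < P.Nv) {K : Corruption P} {p q : Fin P.Nv → Prop}
    (hp : Quorum K p) (hq : Quorum K q) : ∃ j, j ∉ K.vcs ∧ p j ∧ q j := by
  by_contra hn
  push Not at hn
  unfold Quorum at hp hq
  have h1 := Finset.card_union_add_card_inter (Finset.univ.filter fun j => j ∈ K.vcs ∨ p j)
    (Finset.univ.filter fun j => j ∈ K.vcs ∨ q j)
  have h2 := Finset.card_le_univ ((Finset.univ.filter fun j => j ∈ K.vcs ∨ p j) ∪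
    (Finset.univ.filter fun j => j ∈ K.vcs ∨ q j))
  have h3 : ((Finset.univ.filter fun j => j ∈ K.vcs ∨ p j) ∩
      (Finset.univ.filter fun j => j ∈ K.vcs ∨ q j)).card ≤ K.vcs.card := by
    refine Finset.card_le_card fun j hj => ?_
    simp only [Finset.mem_inter, Finset.mem_filter, Finset.mem_univ, true_and] at hj
    by_contra hk
    exact hn j hk (hj.1.resolve_left hk) (hj.2.resolve_left hk)
  have h4 := K.vcs_le
  rw [Fintype.card_fin] at h2
  omega

/-- Every valid signature of an honest VC node in the certificate is on a vote code that the node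
has endorsed, according to `F`. -/
def LegitCert (S : Setup C k) (K : Corruption P) (F : CodePred P)
    (u : Cert C k) : Prop :=
  ∀ j, j ∉ K.vcs → ∀ σ, u j = some σ → ∀ s vc,
    C.sig.verify k (S.vk j) (.endorse s vc) σ = true → F j s vc

theorem LegitCert.quorum {S : Setup C k} {K : Corruption P}
    {F : CodePred P} {u : Cert C k} (h : LegitCert S K F u) {s : Fin P.n}
    {vc : Word 128} (hv : S.ValidCert s vc u) : Quorum K fun j => F j s vc :=
  .of_subset hv fun j hj hk => by
    obtain ⟨σ, h1, h2⟩ := (Finset.mem_filter.mp hj).2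
    exact h j hk σ h1 s vc h2

theorem LegitCert.update {S : Setup C k} {K : Corruption P}
    {F : CodePred P} {u : Cert C k} (h : LegitCert S K F u)
    {j : Fin P.Nv} {σ : Sg C k} (hσ : j ∉ K.vcs → ∀ s vc,
      C.sig.verify k (S.vk j) (.endorse s vc) σ = true → F j s vc) :
    LegitCert S K F (Function.update u j (some σ)) := by
  intro j' hj' σ' h'
  by_cases e : j' = j
  · subst e
    rw [Function.update_self] at h'
    cases h'
    exact hσ hj'
  · rw [Function.update_of_ne e] at h'
    exact h j' hj' σ' h'

/-! ### Invariants of a VC node -/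

/-- What the state of a VC node is related to: the messages it has sent and received, the VOTE_P
messages of all VC nodes, the vote codes cast by honest voters, the results of consensus. -/
structure VEnv (C : Prims P) (k : ℕ) where
  own : Party P → Msg C k → Prop
  rcv : Party P → Msg C k → Prop
  voteP : CodePred P
  cast : Fin P.n → Fin P.n → Word 128 → Prop
  bc : Fin P.n → Option Bool

/-- The node has sent the messages `out`, and the rest of the environment has advanced. -/
structure VEnv.Ext (E : VEnv C k) (out : Outbox C k) (E' : VEnv C k) : Prop where
  own : ∀ d x, E'.own d x ↔ E.own d x ∨ (d, x) ∈ out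
  rcv : ∀ d x, E.rcv d x → E'.rcv d x
  voteP : ∀ j s vc, E.voteP j s vc → E'.voteP j s vc
  cast : ∀ v s vc, E.cast v s vc → E'.cast v s vc
  bc : ∀ s b, E.bc s = some b → E'.bc s = some b

/-- What authenticated channels and unforgeable signatures guarantee about received messages. -/
structure VEnv.Good (E : VEnv C k) (S : Setup C k) (K : Corruption P)
    (F : CodePred P) : Prop where
  voteP : ∀ j s vc x σ u, j ∉ K.vcs → E.rcv (.vc j) (.voteP s vc x σ u) → E.voteP j s vc
  cast : ∀ v s vc, v ∉ K.voters → E.rcv (.voter v) (.vote s vc) → E.cast v s vc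
  endorsement : ∀ j s vc σ, j ∉ K.vcs → E.rcv (.vc j) (.endorsement s vc σ) → ∀ s' vc',
    C.sig.verify k (S.vk j) (.endorse s' vc') σ = true → F j s' vc'
  votePCert : ∀ j s vc x σ u, E.rcv (.vc j) (.voteP s vc x σ u) → LegitCert S K F u
  announce : ∀ j s c, E.rcv (.vc j) (.announce s (some c)) → LegitCert S K F c.2
  recoverResp : ∀ j s vc u, E.rcv (.vc j) (.recoverResp s vc u) → LegitCert S K F u

/-- Messages of a VC node that the invariants of ballot `s` refer to. -/
def Concerns (s : Fin P.n) : Msg C k → Prop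
  | .voteP s' _ _ _ _ => s' = s
  | .announce s' _ => s' = s
  | .recoverReq s' => s' = s
  | .recoverResp s' _ _ => s' = s
  | .voteSet _ _ _ => True
  | _ => False

/-- Invariants of the record of ballot `s` at honest VC node `i`. -/
structure BInv (S : Setup C k) (K : Corruption P) (F : CodePred P)
    (E : VEnv C k) (s : Fin P.n) (ended : Prop) (b : VCBallot C k) : Prop where
  sigs_legit : LegitCert S K F b.sigs
  sigs_req : ∀ vc src, b.req = some (vc, src) → ∀ j σ, b.sigs j = some σ →
    C.sig.verify k (S.vk j) (.endorse s vc) σ = true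
  used : ∀ c, b.used = some c → S.Certified s c ∧ LegitCert S K F c.2
  lrs : ∀ j, j ∉ K.vcs → (b.lrs j).isSome → ∃ c, b.used = some c ∧ E.voteP j s c.1
  receipt : b.receipt.isSome → ∃ c, b.used = some c ∧ Quorum K fun j => E.voteP j s c.1
  req : ∀ vc v, v ∉ K.voters → b.req = some (vc, .voter v) → E.cast v s vc
  ann : ∀ j c, b.ann j = some c → E.rcv (.vc j) (.announce s c)
  entered : ∀ x, b.entered = some x → ended ∧ (x = true → b.used.isSome) ∧
    ∃ J : Finset (Fin P.Nv), P.Nv - P.fv ≤ J.card ∧ ∀ j ∈ J, ∃ c, b.ann j = some c ∧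
      (x = false → ∀ c', c = some c' → ¬ S.Certified s c')
  decided : ∀ x, b.decided = some x → E.bc s = some x ∧ b.entered.isSome
  recover : b.decided = some true → b.used.isSome ∨ ∀ j, E.own (.vc j) (.recoverReq s)
  own_voteP : ∀ d vc x σ u, E.own d (.voteP s vc x σ u) → ∃ u', b.used = some (vc, u')
  own_announce : ∀ d c, E.own d (.announce s c) → ended ∧ ∀ d' vc x σ u,
    E.own d' (.voteP s vc x σ u) → ∃ u', c = some (vc, u') ∧ S.Certified s (vc, u')
  own_req : ∀ d, E.own d (.recoverReq s) → b.decided = some true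
  own_resp : ∀ j vc u, E.own (.vc j) (.recoverResp s vc u) →
    S.Certified s (vc, u) ∧ E.rcv (.vc j) (.recoverReq s)
  own_set : ∀ d Q x σ, E.own d (.voteSet Q x σ) → (b.decided = some false ∧ Q s = none) ∨
    (b.decided = some true ∧ ∃ c, b.used = some c ∧ Q s = some c.1)

/-- Invariants of honest VC node `i`. -/
structure VInv (S : Setup C k) (K : Corruption P) (F : CodePred P)
    (i : Fin P.Nv) (E : VEnv C k) (st : VCState C k) : Prop where
  ballot : ∀ s, BInv S K F E s st.Ended (st.ballot s)
  announced : st.Ended → ∀ s j, ∃ c, E.own (.vc j) (.announce s c)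
  done : st.done = true → ∃ Q, ∀ b, E.own (.bb b) (.voteSet Q (S.kshare i) (S.kshareSig i))
  own_receipt : ∀ v r, v ∉ K.voters → E.own (.voter v) (.receipt r) →
    ∃ s vc, E.cast v s vc ∧ Quorum K fun j => E.voteP j s vc
  own_share : ∀ d Q x σ, E.own d (.voteSet Q x σ) → x = S.kshare i ∧ σ = S.kshareSig i

/-- What is never undone at a VC node. -/
structure VLe (st st' : VCState C k) : Prop where
  clock : st.clock ≤ st'.clock
  used : ∀ s c, (st.ballot s).used = some c → (st'.ballot s).used = some c
  ann : ∀ s j c, (st.ballot s).ann j = some c → (st'.ballot s).ann j = some c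
  entered : ∀ s x, (st.ballot s).entered = some x → (st'.ballot s).entered = some x
  decided : ∀ s x, (st.ballot s).decided = some x → (st'.ballot s).decided = some x

theorem VLe.refl (st : VCState C k) : VLe st st :=
  ⟨le_rfl, fun _ _ h => h, fun _ _ _ h => h, fun _ _ h => h, fun _ _ h => h⟩

theorem VLe.trans {st st' st'' : VCState C k} (h : VLe st st') (h' : VLe st' st'') : VLe st st'' :=
  ⟨h.clock.trans h'.clock, fun s c hc => h'.used s c (h.used s c hc),
    fun s j c hc => h'.ann s j c (h.ann s j c hc),
    fun s c hc => h'.entered s c (h.entered s c hc),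
    fun s c hc => h'.decided s c (h.decided s c hc)⟩

section Inv

variable {S : Setup C k} {K : Corruption P} {F : CodePred P}
  {i : Fin P.Nv} {E E' : VEnv C k} {out : Outbox C k} {st : VCState C k}

/-- The messages `out` about ballot `s`, sent when the election end status changes from `e` to `e'`,
are in accordance with the record `b`. -/
structure OutOK (S : Setup C k) (E : VEnv C k) (s : Fin P.n) (e e' : Prop) (b : VCBallot C k)
    (out : Outbox C k) : Prop where
  voteP : ∀ d vc x σ u, (d, .voteP s vc x σ u) ∈ out → ¬ e ∧ ∃ u', b.used = some (vc, u')
  announce : ∀ d c, (d, .announce s c) ∈ out → e' ∧ c = b.used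
  req : ∀ d, (d, .recoverReq s) ∈ out → b.decided = some true
  resp : ∀ j vc u, (.vc j, .recoverResp s vc u) ∈ out →
    S.Certified s (vc, u) ∧ E.rcv (.vc j) (.recoverReq s)
  set : ∀ d Q x σ, (d, .voteSet Q x σ) ∈ out → (b.decided = some false ∧ Q s = none) ∨
    (b.decided = some true ∧ ∃ c, b.used = some c ∧ Q s = some c.1)

theorem OutOK.of_not_concerns {s : Fin P.n} {e e' : Prop} {b : VCBallot C k}
    (hout : ∀ o ∈ out, ¬ Concerns s o.2) : OutOK S E s e e' b out where
  voteP _ _ _ _ _ h := absurd rfl (hout _ h)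
  announce _ _ h := absurd rfl (hout _ h)
  req _ h := absurd rfl (hout _ h)
  resp _ _ _ h := absurd rfl (hout _ h)
  set _ _ _ _ h := absurd trivial (hout _ h)

theorem BInv.ext {s : Fin P.n} {e e' : Prop} {b : VCBallot C k} (h : BInv S K F E s e b)
    (hE : E.Ext out E') (he : e → e') (ho : OutOK S E' s e e' b out) : BInv S K F E' s e' b where
  sigs_legit := h.sigs_legit
  sigs_req := h.sigs_req
  used := h.used
  lrs j hj hl := (h.lrs j hj hl).imp fun c hc => ⟨hc.1, hE.voteP _ _ _ hc.2⟩
  receipt hr := (h.receipt hr).imp fun c hc => ⟨hc.1, hc.2.mono fun j _ => hE.voteP _ _ _⟩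
  req vc v hv hr := hE.cast _ _ _ (h.req vc v hv hr)
  ann j c ha := hE.rcv _ _ (h.ann j c ha)
  entered x hx := let ⟨h1, h2⟩ := h.entered x hx; ⟨he h1, h2⟩
  decided x hx := (h.decided x hx).imp_left (hE.bc _ _)
  recover hd := (h.recover hd).imp_right fun h j => (hE.own _ _).mpr (.inl (h j))
  own_voteP d vc x σ u h' := ((hE.own _ _).mp h').elim (h.own_voteP d vc x σ u)
    fun h' => (ho.voteP d vc x σ u h').2
  own_announce d c h' := by
    rcases (hE.own _ _).mp h' with h' | h'
    · refine (h.own_announce d c h').imp he fun h2 d' vc x σ u h3 => ?_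
      exact ((hE.own _ _).mp h3).elim (h2 d' vc x σ u)
        fun h3 => absurd (h.own_announce d c h').1 (ho.voteP _ _ _ _ _ h3).1
    · obtain ⟨h1, rfl⟩ := ho.announce d c h'
      refine ⟨h1, fun d' vc x σ u h3 => ?_⟩
      obtain ⟨u', h4⟩ := ((hE.own _ _).mp h3).elim (h.own_voteP d' vc x σ u)
        fun h3 => (ho.voteP _ _ _ _ _ h3).2
      exact ⟨u', h4, (h.used _ h4).1⟩
  own_req d h' := ((hE.own _ _).mp h').elim (h.own_req d) (ho.req d)
  own_resp j vc u h' := ((hE.own _ _).mp h').elim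
    (fun h' => (h.own_resp j vc u h').imp_right (hE.rcv _ _)) (ho.resp j vc u)
  own_set d Q x σ h' := ((hE.own _ _).mp h').elim (h.own_set d Q x σ) (ho.set d Q x σ)

theorem BInv.mono {s : Fin P.n} {e e' : Prop} {b : VCBallot C k} (h : BInv S K F E s e b)
    (hE : E.Ext out E') (hout : ∀ o ∈ out, ¬ Concerns s o.2) (he : e → e') :
    BInv S K F E' s e' b :=
  h.ext hE he (.of_not_concerns hout)

theorem VCState.set_ballot (st : VCState C k) (s s' : Fin P.n) (b : VCBallot C k) :
    (st.set s b).ballot s' = if s' = s then b else st.ballot s' :=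
  Function.update_apply _ _ _ _

/-- Receipts among the messages are sent to honest voters for a reason. -/
def ReceiptsOK (K : Corruption P) (E : VEnv C k) (out : Outbox C k) : Prop :=
  ∀ v r, v ∉ K.voters → (Party.voter v, Msg.receipt r) ∈ out →
    ∃ s vc, E.cast v s vc ∧ Quorum K fun j => E.voteP j s vc

theorem VInv.update (h : VInv S K F i E st) (hE : E.Ext out E') {bal : Fin P.n → VCBallot C k}
    (hb : ∀ s, BInv S K F E' s st.Ended (bal s)) (hset : ∀ o ∈ out, ∀ Q x σ, o.2 ≠ .voteSet Q x σ)
    (hr : ReceiptsOK K E' out) : VInv S K F i E' { st with ballot := bal } where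
  ballot := hb
  announced he s' j := (h.announced he s' j).imp fun c hc => (hE.own _ _).mpr (.inl hc)
  done hd := (h.done hd).imp fun Q hQ b => (hE.own _ _).mpr (.inl (hQ b))
  own_receipt v r hv ho := by
    rcases (hE.own _ _).mp ho with ho | ho
    · obtain ⟨s, vc, h1, h2⟩ := h.own_receipt v r hv ho
      exact ⟨s, vc, hE.cast _ _ _ h1, h2.mono fun j _ => hE.voteP _ _ _⟩
    · exact hr v r hv ho
  own_share d Q x σ ho := by
    rcases (hE.own _ _).mp ho with ho | ho
    · exact h.own_share d Q x σ ho
    · exact absurd rfl (hset _ ho Q x σ)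

theorem VInv.set (h : VInv S K F i E st) (hE : E.Ext out E') {s : Fin P.n} {b : VCBallot C k}
    (hb : BInv S K F E' s st.Ended b)
    (hout : ∀ s', s' ≠ s → ∀ o ∈ out, ¬ Concerns s' o.2 := by simp)
    (hset : ∀ o ∈ out, ∀ Q x σ, o.2 ≠ .voteSet Q x σ := by simp)
    (hr : ReceiptsOK K E' out := by simp [ReceiptsOK]) : VInv S K F i E' (st.set s b) := by
  refine h.update hE (fun s' => ?_) hset hr
  rw [Function.update_apply]
  split
  · rename_i hs
    exact hs ▸ hb
  · exact (h.ballot s').mono hE (hout s' ‹_›) id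

theorem VInv.mono (h : VInv S K F i E st) (hE : E.Ext out E')
    (hout : ∀ s, ∀ o ∈ out, ¬ Concerns s o.2) (hset : ∀ o ∈ out, ∀ Q x σ, o.2 ≠ .voteSet Q x σ)
    (hr : ReceiptsOK K E' out) : VInv S K F i E' st :=
  h.update hE (fun s' => (h.ballot s').mono hE (hout s') id) hset hr

theorem VLe.set {s : Fin P.n} {b : VCBallot C k}
    (h1 : ∀ c, (st.ballot s).used = some c → b.used = some c := by exact fun _ h => h)
    (h2 : ∀ j c, (st.ballot s).ann j = some c → b.ann j = some c := by exact fun _ _ h => h)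
    (h3 : ∀ c, (st.ballot s).entered = some c → b.entered = some c := by exact fun _ h => h)
    (h4 : ∀ c, (st.ballot s).decided = some c → b.decided = some c := by exact fun _ h => h) :
    VLe st (st.set s b) := by
  refine ⟨le_rfl, fun s' c h => ?_, fun s' j c h => ?_, fun s' c h => ?_, fun s' c h => ?_⟩ <;>
    rw [VCState.set_ballot] <;> split <;> rename_i hs
  · exact h1 c (hs ▸ h)
  · exact h
  · exact h2 j c (hs ▸ h)
  · exact h
  · exact h3 c (hs ▸ h)
  · exact h
  · exact h4 c (hs ▸ h)
  · exact h

/-! ### Steps of a VC node preserve its invariants -/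

theorem mem_toVCs {x : Msg C k} {o : Party P × Msg C k} (h : o ∈ toVCs (P := P) x) :
    ∃ j, o = (.vc j, x) := by
  obtain ⟨j, -, rfl⟩ := List.mem_map.mp h
  exact ⟨j, rfl⟩

theorem mem_toBBs {x : Msg C k} {o : Party P × Msg C k} (h : o ∈ toBBs (P := P) x) :
    ∃ j, o = (.bb j, x) := by
  obtain ⟨j, -, rfl⟩ := List.mem_map.mp h
  exact ⟨j, rfl⟩

theorem receiptsOK_toVCs {x : Msg C k} : ReceiptsOK K E (toVCs x) := by
  intro v r _ h
  obtain ⟨j, h⟩ := mem_toVCs h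
  cases h

theorem VInv.nil (h : VInv S K F i E st) (hE : E.Ext [] E') : VInv S K F i E' st :=
  h.mono hE (by simp) (by simp) (by simp [ReceiptsOK])

/-- A step of an honest VC node keeps its invariants and what it has achieved. -/
abbrev VStep (S : Setup C k) (K : Corruption P) (F : CodePred P) (i : Fin P.Nv) (E : VEnv C k)
    (st : VCState C k) (r : VCState C k × Outbox C k) : Prop :=
  ∀ E', E.Ext r.2 E' → VInv S K F i E' r.1 ∧ VLe st r.1

theorem VInv.skip (h : VInv S K F i E st) : VStep S K F i E st (st, []) :=
  fun _ hE => ⟨h.nil hE, .refl _⟩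

theorem onVote_inv (h : VInv S K F i E st) (hG : E.Good S K F) {src : Party P} {s : Fin P.n}
    {vc : Word 128} (hr : E.rcv src (.vote s vc)) :
    VStep S K F i E st (S.onVote st src s vc) := by
  unfold Setup.onVote
  simp only
  split
  · exact h.skip
  split
  · split
    · intro E' hE
      have hc : ∀ s', ∀ o ∈ toVCs (P := P) (C := C) (k := k) (.endorse s vc),
          ¬ Concerns s' o.2 := by
        intro s' o ho
        obtain ⟨j, rfl⟩ := mem_toVCs ho
        exact id
      refine ⟨h.set hE ?_ (fun s' _ => hc s') ?_ receiptsOK_toVCs,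
        .set⟩
      · exact { ((h.ballot s).mono hE (hc s) id) with
          sigs_legit := fun _ _ _ h => by cases h
          sigs_req := fun _ _ _ _ _ h => by cases h
          req := fun vc' v hv he => by
            simp only [Option.some.injEq, Prod.mk.injEq] at he
            obtain ⟨rfl, rfl⟩ := he
            exact hE.cast _ _ _ (hG.cast v s _ hv hr) }
      · intro o ho
        obtain ⟨j, rfl⟩ := mem_toVCs ho
        simp
    · exact h.skip
  · rename_i vc' u hu
    split
    · rename_i r hrc
      split
      · rename_i hvc
        subst hvc
        intro E' hE
        refine ⟨h.mono hE ?_ ?_ ?_, .refl _⟩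
        · intro s' o ho
          simp only [List.mem_singleton] at ho
          subst ho
          exact id
        · intro o ho
          simp only [List.mem_singleton] at ho
          subst ho
          simp
        · intro v r' hv ho
          simp only [List.mem_singleton, Prod.mk.injEq] at ho
          obtain ⟨rfl, -⟩ := ho
          obtain ⟨c, h1, h2⟩ := (h.ballot s).receipt (by simp [hrc])
          rw [hu] at h1
          cases h1
          exact ⟨s, vc', hE.cast _ _ _ (hG.cast v s _ hv hr), h2.mono fun j _ => hE.voteP _ _ _⟩
      · exact h.skip
    · exact h.skip

theorem onEndorse_inv (h : VInv S K F i E st) {j : Fin P.Nv} {s : Fin P.n}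
    {vc : Word 128} :
    VStep S K F i E st (S.onEndorse i st j s vc) := by
  unfold Setup.onEndorse
  simp only
  have hc : ∀ σ s', ∀ o ∈ [((.vc j : Party P), (.endorsement s vc σ : Msg C k))],
      ¬ Concerns s' o.2 := by
    intro σ s' o ho
    simp only [List.mem_singleton] at ho
    subst ho
    exact id
  have hs : ∀ σ, ∀ o ∈ [((.vc j : Party P), (.endorsement s vc σ : Msg C k))], ∀ Q x σ,
      o.2 ≠ .voteSet Q x σ := by
    intro σ o ho
    simp only [List.mem_singleton] at ho
    subst ho
    simp
  have hr : ∀ σ E', ReceiptsOK K E' [((.vc j : Party P), (.endorsement s vc σ : Msg C k))] := by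
    intro σ E' v r _ ho
    simp at ho
  split
  · exact h.skip
  split
  · intro E' hE
    exact ⟨h.set hE { ((h.ballot s).mono hE (hc _ s) id) with } (fun s' _ => hc _ s')
      (hs _) (hr _ _), .set⟩
  · split
    · exact fun E' hE => ⟨h.mono hE (hc _) (hs _) (hr _ _), .refl _⟩
    · exact h.skip

end Inv

end

section

variable {P : Params} {C : Prims P} {k : ℕ}

section Inv

variable {S : Setup C k} {K : Corruption P} {F : CodePred P}
  {i : Fin P.Nv} {E E' : VEnv C k} {out out' : Outbox C k} {st : VCState C k}

theorem VEnv.Good.ext (hG : E.Good S K F) (hE : E.Ext out E')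
    (hrcv : ∀ d x, E'.rcv d x → E.rcv d x) : E'.Good S K F where
  voteP j s vc x σ u hj h := hE.voteP _ _ _ (hG.voteP j s vc x σ u hj (hrcv _ _ h))
  cast v s vc hv h := hE.cast _ _ _ (hG.cast v s vc hv (hrcv _ _ h))
  endorsement j s vc σ hj h := hG.endorsement j s vc σ hj (hrcv _ _ h)
  votePCert j s vc x σ u h := hG.votePCert j s vc x σ u (hrcv _ _ h)
  announce j s c h := hG.announce j s c (hrcv _ _ h)
  recoverResp j s vc u h := hG.recoverResp j s vc u (hrcv _ _ h)

/-- A step that sends two batches of messages is split by an intermediate environment. -/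
theorem VEnv.Ext.split (hE : E.Ext (out ++ out') E') :
    ∃ E₁ : VEnv C k, E.Ext out E₁ ∧ E₁.Ext out' E' ∧ E₁.rcv = E'.rcv :=
  ⟨{ E' with own := fun d x => E.own d x ∨ (d, x) ∈ out },
    ⟨fun _ _ => Iff.rfl, hE.rcv, hE.voteP, hE.cast, hE.bc⟩,
    ⟨fun d x => by rw [hE.own, List.mem_append, or_assoc], fun _ _ h => h, fun _ _ _ h => h,
      fun _ _ _ h => h, fun _ _ h => h⟩, rfl⟩

/-- Messages other than vote sets concern at most one ballot. -/
theorem not_concerns_of_ne {s s' : Fin P.n} (hs : s' ≠ s) {x : Msg C k}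
    (hx : ∀ Q y σ, x ≠ .voteSet Q y σ) (h : Concerns s x) : ¬ Concerns s' x := by
  cases x <;> simp_all [Concerns, eq_comm]

theorem BInv.use {s : Fin P.n} {ended : Prop} {b : VCBallot C k} (h : BInv S K F E s ended b)
    (hn : b.used = none) {c : Word 128 × Cert C k} (hc : S.Certified s c)
    (hl : LegitCert S K F c.2) : BInv S K F E s ended { b with used := some c } := by
  have hu : ∀ {c'}, b.used = some c' → False := fun hc' => by rw [hn] at hc'; cases hc'
  exact { h with
    used := fun c' hc' => by cases hc'; exact ⟨hc, hl⟩
    lrs := fun j hj hjl => (hu (h.lrs j hj hjl).choose_spec.1).elim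
    receipt := fun hr => (hu (h.receipt hr).choose_spec.1).elim
    entered := fun x hx => ⟨(h.entered x hx).1, fun _ => rfl, (h.entered x hx).2.2⟩
    recover := fun _ => .inl rfl
    own_voteP := fun d vc x σ u ho => (hu (h.own_voteP d vc x σ u ho).choose_spec).elim
    own_set := fun d Q x σ ho => by
      rcases h.own_set d Q x σ ho with h' | ⟨h1, c', h2, -⟩
      · exact .inl h'
      · exact (hu h2).elim }

theorem VCState.Voting.not_ended (h : st.Voting) : st.Ended ↔ False := by
  simpa [VCState.Ended] using h.2

/-- A vote code with a valid certificate is taken up during voting hours. -/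
theorem VInv.use (h : VInv S K F i E st) (hV : st.Voting) {s : Fin P.n} {vc : Word 128}
    {u : Cert C k} {l : Line P} {b : VCBallot C k}
    (hb : BInv S K F E s st.Ended b) (hn : b.used = none) (hl : (S.lineOf s vc).isSome)
    (hu : S.ValidCert s vc u) (hleg : LegitCert S K F u)
    (hE : E.Ext (toVCs (S.votePMsg i s vc l u)) E') :
    VInv S K F i E' (st.set s { b with used := some (vc, u) }) := by
  have hc : ∀ o ∈ toVCs (S.votePMsg i s vc l u), ∃ x σ u', o.2 = .voteP s vc x σ u' := by
    intro o ho
    obtain ⟨j, rfl⟩ := mem_toVCs ho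
    exact ⟨_, _, _, rfl⟩
  have hc' : ∀ o ∈ toVCs (S.votePMsg i s vc l u), ∀ Q x σ, o.2 ≠ .voteSet Q x σ := by
    intro o ho Q x σ h
    obtain ⟨_, _, _, h'⟩ := hc o ho
    rw [h'] at h
    cases h
  refine h.set hE ?_ (fun s' hs o ho => ?_) hc' receiptsOK_toVCs
  · rw [hV.not_ended] at hb ⊢
    refine (hb.use hn ⟨hl, hu⟩ hleg).ext hE id
      ⟨fun d vc' x σ u' h' => ?_, fun d c h' => ?_, fun d h' => ?_, fun j vc u h' => ?_,
        fun d Q x σ h' => ?_⟩ <;> obtain ⟨_, _, _, e⟩ := hc _ h' <;> cases e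
    exact ⟨id, u, rfl⟩
  · obtain ⟨_, _, _, h'⟩ := hc o ho
    exact not_concerns_of_ne hs (hc' o ho) (by rw [h']; rfl)

theorem onEndorsement_inv (h : VInv S K F i E st) (hG : E.Good S K F) {j : Fin P.Nv} {s : Fin P.n}
    {vc : Word 128} {σ : Sg C k} (hr : E.rcv (.vc j) (.endorsement s vc σ)) :
    VStep S K F i E st (S.onEndorsement i st j s vc σ) := by
  unfold Setup.onEndorsement
  simp only
  split
  · rename_i hif
    obtain ⟨hV, hn, ⟨src, hreq⟩, hver⟩ := hif
    have hleg : LegitCert S K F (Function.update (st.ballot s).sigs j (some σ)) :=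
      (h.ballot s).sigs_legit.update fun hj s' vc' => hG.endorsement j s vc σ hj hr s' vc'
    have hall : ∀ j' σ', Function.update (st.ballot s).sigs j (some σ) j' = some σ' →
        C.sig.verify k (S.vk j') (.endorse s vc) σ' = true := by
      intro j' σ' h'
      rw [Function.update_apply] at h'
      split at h'
      · rename_i e
        cases h'
        exact e ▸ hver
      · exact (h.ballot s).sigs_req vc src hreq j' σ' h'
    have hb : BInv S K F E s st.Ended
        { st.ballot s with sigs := Function.update (st.ballot s).sigs j (some σ) } :=
      { h.ballot s with
        sigs_legit := hleg
        sigs_req := fun vc' src' he j' σ' h' => by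
          rw [show (st.ballot s).req = some (vc', src') from he] at hreq
          cases hreq
          exact hall j' σ' h' }
    have hle : ∀ {b : VCBallot C k}, b.ann = (st.ballot s).ann →
        b.entered = (st.ballot s).entered → b.decided = (st.ballot s).decided →
        VLe st (st.set s b) := fun h1 h2 h3 =>
      .set (fun c hc => by rw [hn] at hc; cases hc) (fun _ _ h => h1 ▸ h) (fun _ h => h2 ▸ h)
        fun _ h => h3 ▸ h
    split
    · rename_i l hl
      split
      · rename_i hcnt
        refine fun E' hE => ⟨h.use hV hb hn (by simp [hl]) ?_ hleg hE, hle rfl rfl rfl⟩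
        refine hcnt.trans (Finset.card_le_card fun j' hj' => ?_)
        obtain ⟨σ', hσ'⟩ := Option.isSome_iff_exists.mp (Finset.mem_filter.mp hj').2
        exact Finset.mem_filter.mpr ⟨Finset.mem_univ _, σ', hσ', hall j' σ' hσ'⟩
      · exact fun E' hE => ⟨h.set hE (hb.mono hE (by simp) id), hle rfl rfl rfl⟩
    · exact h.skip
  · exact h.skip

theorem VCState.set_self (st : VCState C k) (s : Fin P.n) : st.set s (st.ballot s) = st := by
  unfold VCState.set
  rw [Function.update_eq_self]

theorem addShare_inv (h : VInv S K F i E st) {j : Fin P.Nv} {s : Fin P.n} {x : Word 64}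
    {c : Word 128 × Cert C k} (hu : (st.ballot s).used = some c)
    (hj : j ∉ K.vcs → E.voteP j s c.1) :
    VStep S K F i E st (Setup.addShare st s j x) := by
  unfold Setup.addShare
  simp only
  set lrs := Function.update (st.ballot s).lrs j (some x) with hlrs
  have hl : ∀ j', j' ∉ K.vcs → (lrs j').isSome → E.voteP j' s c.1 := by
    intro j' hj' hs
    by_cases e : j' = j
    · exact e ▸ hj (e ▸ hj')
    · rw [hlrs, Function.update_of_ne e] at hs
      obtain ⟨c', h1, h2⟩ := (h.ballot s).lrs j' hj' hs
      rw [hu] at h1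
      cases h1
      exact h2
  split
  · rename_i hif
    have hq : Quorum K fun j => E.voteP j s c.1 :=
      .of_subset hif.2 fun j' hj' hk => hl j' hk (Finset.mem_filter.mp hj').2
    set r := (toField 64).symm (shamirRec (fun i => (P.pt64 i : GaloisField 2 64))
      fun i => (lrs i).map (toField 64)) with hr
    intro E' hE
    have hout : ∀ o ∈ (match (st.ballot s).req, (st.ballot s).used with
        | some (vc, src), some (vc', _) =>
          if vc = vc' then [(src, (.receipt r : Msg C k))] else []
        | _, _ => []), (∃ src, o = (src, .receipt r) ∧ (st.ballot s).req = some (c.1, src)) := by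
      intro o ho
      rw [hu] at ho
      split at ho
      · rename_i vc src vc' u h1 h2
        cases h2
        split at ho
        · rename_i e
          subst e
          simp only [List.mem_singleton] at ho
          exact ⟨src, ho, h1⟩
        · simp at ho
      · simp at ho
    refine ⟨h.set hE { ((h.ballot s).mono hE (fun o ho => ?_) id) with
        lrs := fun j' hj' hs => ⟨c, hu, hE.voteP _ _ _ (hl j' hj' hs)⟩
        receipt := fun _ => ⟨c, hu, hq.mono fun j _ => hE.voteP _ _ _⟩ }
        (fun s' _ o ho => ?_) (fun o ho => ?_) ?_,
      .set⟩
    · obtain ⟨_, rfl, -⟩ := hout o ho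
      exact id
    · obtain ⟨_, rfl, -⟩ := hout o ho
      exact id
    · obtain ⟨_, rfl, -⟩ := hout o ho
      simp
    · intro v r' hv ho
      obtain ⟨_, h1, h2⟩ := hout _ ho
      cases h1
      exact ⟨s, c.1, hE.cast _ _ _ ((h.ballot s).req _ v hv h2), hq.mono fun j _ => hE.voteP _ _ _⟩
  · intro E' hE
    refine ⟨h.set hE { ((h.ballot s).mono hE (by simp) id) with
        lrs := fun j' hj' hs => ⟨c, hu, hE.voteP _ _ _ (hl j' hj' hs)⟩ }, .set⟩

theorem onVoteP_inv (h : VInv S K F i E st) (hG : E.Good S K F) {j : Fin P.Nv} {s : Fin P.n}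
    {vc : Word 128} {x : Word 64} {σ : Sg C k} {u : Cert C k}
    (hr : E.rcv (.vc j) (.voteP s vc x σ u)) :
    VStep S K F i E st (S.onVoteP i st j s vc x σ u) := by
  unfold Setup.onVoteP
  simp only
  split
  · exact h.skip
  rename_i hV
  push Not at hV
  split
  · exact h.skip
  rename_i l hl
  split
  · split
    · rename_i hn
      intro E' hE
      obtain ⟨E₁, h1, h2, -⟩ := hE.split
      have h3 := h.use hV.1 (h.ballot s) hn (by simp [hl]) hV.2 (hG.votePCert j s vc x σ u hr) h1
      have h4 := addShare_inv (j := j) (s := s) (x := x) (c := (vc, u)) h3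
        (by rw [VCState.set_ballot, if_pos rfl])
        (fun hj => h1.voteP _ _ _ (hG.voteP j s vc x σ u hj hr)) _ h2
      refine ⟨h4.1, VLe.trans ?_ h4.2⟩
      exact .set (fun c hc => by rw [hn] at hc; cases hc) (fun _ _ h => h) (fun _ h => h)
        fun _ h => h
    · rename_i vc' u' hu
      split
      · rename_i e
        subst e
        exact addShare_inv h hu fun hj => hG.voteP j s _ x σ u hj hr
      · exact h.skip
  · exact h.skip

theorem vcHandle_inv (h : VInv S K F i E st) (hG : E.Good S K F) {src : Party P} {x : Msg C k}
    (hr : E.rcv src x) :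
    VStep S K F i E st (S.vcHandle i st src x) := by
  unfold Setup.vcHandle
  split
  · exact onVote_inv h hG hr
  · exact onEndorse_inv h
  · exact onEndorsement_inv h hG hr
  · exact onVoteP_inv h hG hr
  · rename_i j s c
    simp only
    split
    · rename_i hn
      intro E' hE
      have hupd : ∀ j' c', (st.ballot s).ann j' = some c' →
          Function.update (st.ballot s).ann j (some c) j' = some c' := by
        intro j' c' hc'
        rw [Function.update_of_ne, hc']
        rintro rfl
        rw [hn] at hc'
        cases hc'
      refine ⟨h.set hE { ((h.ballot s).mono hE (by simp) id) with
          ann := fun j' c' ha => ?_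
          entered := fun y hy => ?_ },
        .set (fun _ h => h) hupd (fun _ h => h) fun _ h => h⟩
      · change Function.update _ _ _ _ = _ at ha
        rw [Function.update_apply] at ha
        split at ha
        · rename_i e
          cases ha
          exact e ▸ hE.rcv _ _ hr
        · exact hE.rcv _ _ ((h.ballot s).ann j' c' ha)
      · obtain ⟨h1, h2, J, hJ, h3⟩ := (h.ballot s).entered y hy
        exact ⟨h1, h2, J, hJ, fun j' hj' => (h3 j' hj').imp fun c' hc' => ⟨hupd _ _ hc'.1, hc'.2⟩⟩
    · exact h.skip
  · rename_i j s
    split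
    · rename_i vc u hu
      split
      · intro E' hE
        have h' : VInv S K F i E' (st.set s (st.ballot s)) := by
          refine h.set hE ((h.ballot s).ext hE id ⟨?_, ?_, ?_, ?_, ?_⟩) ?_
          · simp
          · simp
          · simp
          · simp only [List.mem_singleton, Prod.mk.injEq, Party.vc.injEq, Msg.recoverResp.injEq]
            rintro j' vc' u' ⟨rfl, -, rfl, rfl⟩
            exact ⟨((h.ballot s).used _ hu).1, hE.rcv _ _ hr⟩
          · simp
          · simp only [List.mem_singleton]
            rintro s' hs _ rfl e
            exact hs e.symm
        rw [VCState.set_self] at h'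
        exact ⟨h', .refl _⟩
      · exact h.skip
    · exact h.skip
  · rename_i j s vc u
    simp only
    split
    · rename_i hif
      intro E' hE
      exact ⟨h.set hE (((h.ballot s).use hif.2.1 hif.2.2
          (hG.recoverResp j s vc u hr)).mono hE (by simp) id),
        .set (fun c hc => by rw [hif.2.1] at hc; cases hc) (fun _ _ h => h) (fun _ h => h)
          fun _ h => h⟩
    · exact h.skip
  · exact h.skip

theorem vcAdvance_used_of_some {s : Fin P.n} {b : VCBallot C k} {c : Word 128 × Cert C k}
    (h : b.used = some c) : (S.vcAdvance s b).used = some c := by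
  unfold Setup.vcAdvance
  simp only
  split <;> simp [h]

theorem vcAdvance_entered_of_some {s : Fin P.n} {b : VCBallot C k} {x : Bool}
    (h : b.entered = some x) : (S.vcAdvance s b).entered = some x := by
  unfold Setup.vcAdvance
  simp only
  split <;> simp_all

theorem vcAdvance_rest (s : Fin P.n) (b : VCBallot C k) :
    (S.vcAdvance s b).ann = b.ann ∧ (S.vcAdvance s b).decided = b.decided := by
  unfold Setup.vcAdvance
  simp only
  split <;> exact ⟨rfl, rfl⟩

theorem vcAdvance_used_isSome {s : Fin P.n} {b : VCBallot C k} {j : Fin P.Nv}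
    {c : Word 128 × Cert C k} (h : b.ann j = some (some c)) (hc : S.Certified s c) :
    (S.vcAdvance s b).used.isSome := by
  have : ((List.finRange P.Nv).findSome? fun j =>
      (b.ann j).join.filter fun c => decide (S.Certified s c)).isSome := by
    rw [List.findSome?_isSome_iff]
    exact ⟨j, List.mem_finRange j, by simp [h, hc]⟩
  unfold Setup.vcAdvance
  simp only
  split <;> (cases hu : b.used <;> simp [this])

theorem vcAdvance_entered_isSome {s : Fin P.n} {b : VCBallot C k}
    (h : P.Nv - P.fv ≤ count b.ann) : (S.vcAdvance s b).entered.isSome := by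
  unfold Setup.vcAdvance
  simp only
  split
  · rfl
  · rename_i hn
    push Not at hn
    by_contra h'
    exact absurd h (not_le.mpr (hn (by simpa using h')))

theorem BInv.advance {s : Fin P.n} {b : VCBallot C k} {ended : Prop} (h : BInv S K F E s ended b)
    (hG : E.Good S K F) (he : ended) : BInv S K F E s ended (S.vcAdvance s b) := by
  obtain ⟨u', hu', hb', hnone⟩ : ∃ u', u' = (b.used <|> (List.finRange P.Nv).findSome? fun j =>
      (b.ann j).join.filter fun c => decide (S.Certified s c)) ∧
      BInv S K F E s ended { b with used := u' } ∧
      (u' = none → ∀ j c, b.ann j = some (some c) → ¬ S.Certified s c) := by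
    refine ⟨_, rfl, ?_, ?_⟩
    · cases hu : b.used with
      | some c =>
        change BInv S K F E s ended { b with used := some c }
        rw [← hu]
        exact h
      | none =>
        change BInv S K F E s ended { b with used := List.findSome? _ _ }
        cases hf : (List.finRange P.Nv).findSome? fun j =>
            (b.ann j).join.filter fun c => decide (S.Certified s c) with
        | none => rw [← hu]; exact h
        | some c =>
          obtain ⟨j, -, hj⟩ := List.exists_of_findSome?_eq_some hf
          obtain ⟨h1, h2⟩ := Option.filter_eq_some_iff.mp hj
          exact h.use hu (of_decide_eq_true h2)
            (hG.announce j s c (h.ann j _ (Option.join_eq_some_iff.mp h1)))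
    · intro hn j c hj hc
      rw [Option.orElse_eq_none, List.findSome?_eq_none_iff] at hn
      have := hn.2 j (List.mem_finRange j)
      simp [hj, hc] at this
  unfold Setup.vcAdvance
  simp only
  rw [← hu']
  split
  · rename_i hif
    exact { hb' with
      entered := fun x hx => by
        simp only [Option.some.injEq] at hx
        refine ⟨he, fun h => by rw [h] at hx; exact hx, _, hif.2, fun j hj => ?_⟩
        obtain ⟨c, hc⟩ := Option.isSome_iff_exists.mp (Finset.mem_filter.mp hj).2
        refine ⟨c, hc, ?_⟩
        rintro hf c' rfl
        refine hnone ?_ j c' hc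
        rw [hf] at hx
        simpa using hx
      decided := fun x hx => ⟨(hb'.decided x hx).1, rfl⟩ }
  · exact hb'

/-- No step of vote set consensus is enabled. -/
def Settled (S : Setup C k) (st : VCState C k) : Prop :=
  st.Ended → (∀ s, (∀ j c, (st.ballot s).ann j = some (some c) → S.Certified s c →
      (st.ballot s).used.isSome) ∧
    (P.Nv - P.fv ≤ count (st.ballot s).ann → (st.ballot s).entered.isSome)) ∧
  ((∀ s, (st.ballot s).decided = some false ∨
    ((st.ballot s).decided = some true ∧ (st.ballot s).used.isSome)) → st.done = true)

theorem vcSettle_le (i : Fin P.Nv) (st : VCState C k) : VLe st (S.vcSettle i st).1 := by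
  have hle : ∀ d, VLe st { st with ballot := fun s => S.vcAdvance s (st.ballot s), done := d } :=
    fun d => ⟨le_rfl, fun s c => vcAdvance_used_of_some,
      fun s j c hc => by rw [← hc]; exact congrFun (vcAdvance_rest s _).1 j,
      fun s c => vcAdvance_entered_of_some, fun s c hc => by
        rw [← hc]; exact (vcAdvance_rest s _).2⟩
  unfold Setup.vcSettle
  simp only
  split
  · exact .refl _
  split
  · exact hle true
  · exact hle st.done

theorem vcSettle_inv (h : VInv S K F i E st) (hG : E.Good S K F)
    (hE : E.Ext (S.vcSettle i st).2 E') : VInv S K F i E' (S.vcSettle i st).1 ∧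
      Settled S (S.vcSettle i st).1 := by
  revert hE
  unfold Setup.vcSettle
  simp only
  split
  · exact fun hE => ⟨h.nil hE, fun h' => absurd h' ‹_›⟩
  rename_i hend
  rw [not_not] at hend
  set out : Outbox C k := (List.finRange P.n).filterMap _ with hout
  have hmem : ∀ o ∈ out, ∃ s b, o = (.env, .bcInput s b) := by
    intro o ho
    obtain ⟨s, -, hs⟩ := List.mem_filterMap.mp ho
    split at hs
    · cases hs
      exact ⟨_, _, rfl⟩
    · cases hs
  have hnc : ∀ s, ∀ o ∈ out, ¬ Concerns s o.2 := by
    intro s o ho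
    obtain ⟨_, _, rfl⟩ := hmem o ho
    exact id
  have hset : ∀ s, (∀ j c, (S.vcAdvance s (st.ballot s)).ann j = some (some c) → S.Certified s c →
      (S.vcAdvance s (st.ballot s)).used.isSome) ∧
    (P.Nv - P.fv ≤ count (S.vcAdvance s (st.ballot s)).ann →
      (S.vcAdvance s (st.ballot s)).entered.isSome) := by
    intro s
    rw [(vcAdvance_rest s _).1]
    exact ⟨fun j c => vcAdvance_used_isSome, vcAdvance_entered_isSome⟩
  have hstep : ∀ {E₁}, E.Ext out E₁ →
      VInv S K F i E₁ { st with ballot := fun s => S.vcAdvance s (st.ballot s) } := by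
    intro E₁ h1
    exact h.update h1 (fun s => ((h.ballot s).advance hG hend).mono h1 (hnc s) id)
      (fun o ho => by obtain ⟨_, _, rfl⟩ := hmem o ho; simp)
      (fun v r _ ho => by obtain ⟨_, _, h⟩ := hmem _ ho; cases h)
  split
  · rename_i hif
    intro hE
    obtain ⟨E₁, h1, h2, -⟩ := hE.split
    have h3 := hstep h1
    set Q : VoteSet P := fun s => if (S.vcAdvance s (st.ballot s)).decided = some true then
      (S.vcAdvance s (st.ballot s)).used.map Prod.fst else none with hQ
    have hbb : ∀ {o}, o ∈ toBBs (P := P) (.voteSet Q (S.kshare i) (S.kshareSig i)) →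
        ∃ j, o = (.bb j, .voteSet Q (S.kshare i) (S.kshareSig i)) := mem_toBBs
    refine ⟨⟨fun s => (h3.ballot s).ext h2 id ?_, fun he s j => ?_, fun _ => ⟨Q, fun b => ?_⟩,
      fun v r hv ho => ?_, fun d Q' x σ ho => ?_⟩, fun _ => ⟨hset, fun _ => rfl⟩⟩
    · refine ⟨fun d vc x σ u ho => ?_, fun d c ho => ?_, fun d ho => ?_, fun j vc u ho => ?_,
        fun d Q' x σ ho => ?_⟩ <;> obtain ⟨j', e⟩ := hbb ho <;> cases e
      rcases hif.2 s with hd | ⟨hd, hu⟩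
      · exact .inl ⟨hd, by simp [hQ, hd]⟩
      · obtain ⟨c, hc⟩ := Option.isSome_iff_exists.mp hu
        exact .inr ⟨hd, c, hc, by simp [hQ, hd, hc]⟩
    · exact (h3.announced he s j).imp fun c hc => (h2.own _ _).mpr (.inl hc)
    · exact (h2.own _ _).mpr (.inr (List.mem_map.mpr ⟨b, List.mem_finRange b, rfl⟩))
    · rcases (h2.own _ _).mp ho with ho | ho
      · obtain ⟨s, vc, h4, h5⟩ := h3.own_receipt v r hv ho
        exact ⟨s, vc, h2.cast _ _ _ h4, h5.mono fun j _ => h2.voteP _ _ _⟩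
      · obtain ⟨_, e⟩ := hbb ho
        cases e
    · rcases (h2.own _ _).mp ho with ho | ho
      · exact h3.own_share d Q' x σ ho
      · obtain ⟨_, e⟩ := hbb ho
        cases e
        exact ⟨rfl, rfl⟩
  · rename_i hif
    refine fun hE => ⟨hstep hE, fun _ => ⟨hset, fun ha => ?_⟩⟩
    by_contra hd
    exact hif ⟨by simpa using hd, ha⟩

/-- A step followed by the steps of vote set consensus that it enables. -/
theorem vcFinish_inv {r : VCState C k × Outbox C k} (hE : E.Ext (S.vcFinish i r).2 E')
    (hG : E.Good S K F) (hrcv : ∀ d x, E'.rcv d x → E.rcv d x)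
    (h : VStep S K F i E st r) :
    VInv S K F i E' (S.vcFinish i r).1 ∧ VLe st (S.vcFinish i r).1 ∧
      Settled S (S.vcFinish i r).1 := by
  obtain ⟨E₁, h1, h2, h3⟩ := hE.split
  obtain ⟨h4, h5⟩ := h _ h1
  obtain ⟨h6, h7⟩ := vcSettle_inv h4 (hG.ext h1 fun d x hx => hrcv d x (h3 ▸ hx)) h2
  exact ⟨h6, h5.trans (vcSettle_le i _), h7⟩

theorem vcRecv_inv (h : VInv S K F i E st) (hG : E.Good S K F) {src : Party P} {x : Msg C k}
    (hr : E.rcv src x) (hE : E.Ext (S.vcRecv i st src x).2 E')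
    (hrcv : ∀ d x, E'.rcv d x → E.rcv d x) :
    VInv S K F i E' (S.vcRecv i st src x).1 ∧ VLe st (S.vcRecv i st src x).1 ∧
      Settled S (S.vcRecv i st src x).1 :=
  vcFinish_inv hE hG hrcv (vcHandle_inv h hG hr)

theorem vcTick_inv (h : VInv S K F i E st) (hG : E.Good S K F)
    (hE : E.Ext (S.vcTick i st).2 E') (hrcv : ∀ d x, E'.rcv d x → E.rcv d x) :
    VInv S K F i E' (S.vcTick i st).1 ∧ VLe st (S.vcTick i st).1 ∧ Settled S (S.vcTick i st).1 := by
  refine vcFinish_inv (st := st) hE hG hrcv fun E₁ h1 => ⟨?_, le_add_right le_rfl,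
    fun _ _ h => h, fun _ _ _ h => h, fun _ _ h => h, fun _ _ h => h⟩
  have hmem : ∀ {o}, o ∈ (if st.clock + 1 = P.Tend then (List.finRange P.n).flatMap fun s =>
      toVCs (.announce s (st.ballot s).used) else [] : Outbox C k) →
      st.clock + 1 = P.Tend ∧ ∃ s j, o = (.vc j, .announce s (st.ballot s).used) := by
    intro o ho
    split at ho
    · obtain ⟨s, -, hs⟩ := List.mem_flatMap.mp ho
      obtain ⟨j, rfl⟩ := mem_toVCs hs
      exact ⟨‹_›, s, j, rfl⟩
    · simp at ho
  have hold : ∀ {d x}, (∀ s c, x ≠ .announce s c) → E₁.own d x → E.own d x := by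
    intro d x hx ho
    refine ((h1.own _ _).mp ho).resolve_right fun ho => ?_
    obtain ⟨-, s, j, e⟩ := hmem ho
    exact hx s _ (congrArg Prod.snd e)
  refine ⟨fun s => (h.ballot s).ext h1 (fun he : P.Tend ≤ st.clock => Nat.le_succ_of_le he)
    ⟨fun d vc x σ u ho => ?_, fun d c ho => ?_, fun d ho => ?_, fun j vc u ho => ?_,
      fun d Q' x σ ho => ?_⟩, fun he s j => ?_,
    fun hd => (h.done hd).imp fun Q hQ b => (h1.own _ _).mpr (.inl (hQ b)),
    fun v r hv ho => ?_, fun d Q x σ ho => h.own_share d Q x σ (hold (by simp) ho)⟩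
  any_goals (obtain ⟨h2, s', j', e⟩ := hmem ho; cases e)
  · exact ⟨h2.ge, rfl⟩
  · by_cases hc : st.Ended
    · exact (h.announced hc s j).imp fun c hc => (h1.own _ _).mpr (.inl hc)
    · have he' : st.clock + 1 = P.Tend := by
        unfold VCState.Ended at he hc
        simp only at he
        omega
      refine ⟨(st.ballot s).used, (h1.own _ _).mpr (.inr ?_)⟩
      simp only
      rw [if_pos he']
      exact List.mem_flatMap.mpr ⟨s, List.mem_finRange s,
        List.mem_map.mpr ⟨j, List.mem_finRange j, rfl⟩⟩
  · obtain ⟨s, vc, h3, h4⟩ := h.own_receipt v r hv (hold (by simp) ho)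
    exact ⟨s, vc, h1.cast _ _ _ h3, h4.mono fun j _ => h1.voteP _ _ _⟩

theorem vcDecide_inv (h : VInv S K F i E st) (hG : E.Good S K F) {s : Fin P.n} {v : Bool}
    (hv : E.bc s = some v) (hs : Settled S st) (hE : E.Ext (S.vcDecide i st s v).2 E')
    (hrcv : ∀ d x, E'.rcv d x → E.rcv d x) :
    VInv S K F i E' (S.vcDecide i st s v).1 ∧ VLe st (S.vcDecide i st s v).1 ∧
      Settled S (S.vcDecide i st s v).1 := by
  revert hE
  unfold Setup.vcDecide
  simp only
  split
  · rename_i hif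
    intro hE
    refine vcFinish_inv (st := st) hE hG hrcv fun E₁ h1 => ⟨?_, .set (fun _ h => h)
      (fun _ _ h => h) (fun _ h => h) fun c hc => by rw [hif.2] at hc; cases hc⟩
    have hmem : ∀ {o}, o ∈ (if v = true ∧ (st.ballot s).used = none then
        toVCs (.recoverReq s) else [] : Outbox C k) →
        v = true ∧ ∃ j, o = (.vc j, .recoverReq s) := by
      intro o ho
      split at ho
      · exact ⟨(‹_› : _ ∧ _).1, mem_toVCs ho⟩
      · simp at ho
    have hold : ∀ {d x}, (∀ s', x ≠ .recoverReq s') → E₁.own d x → E.own d x := by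
      intro d x hx ho
      refine ((h1.own _ _).mp ho).resolve_right fun ho => ?_
      obtain ⟨-, j, e⟩ := hmem ho
      exact hx s (congrArg Prod.snd e)
    have hb := h.ballot s
    have hb' : BInv S K F { E₁ with own := E.own } s st.Ended (st.ballot s) :=
      hb.mono (out := []) ⟨fun _ _ => by simp, h1.rcv, h1.voteP, h1.cast, h1.bc⟩ (by simp) id
    have hd : ∀ {x}, (st.ballot s).decided = some x → False := fun hx => by
      rw [hif.2] at hx; cases hx
    refine h.set h1 { hb' with
      decided := fun x hx => by
        cases hx
        exact ⟨h1.bc _ _ hv, hif.1⟩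
      recover := fun hx => ?_
      own_voteP := fun d vc x σ u ho => hb.own_voteP d vc x σ u (hold (by simp) ho)
      own_announce := fun d c ho => (hb.own_announce d c (hold (by simp) ho)).imp_right
        fun h2 d' vc x σ u h3 => h2 d' vc x σ u (hold (by simp) h3)
      own_req := fun d ho => by
        rcases (h1.own _ _).mp ho with ho | ho
        · exact (hd (hb.own_req d ho)).elim
        · rw [(hmem ho).1]
      own_resp := fun j vc u ho => hb'.own_resp j vc u (hold (by simp) ho)
      own_set := fun d Q x σ ho => by
        rcases hb.own_set d Q x σ (hold (by simp) ho) with h' | h'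
        · exact (hd h'.1).elim
        · exact (hd h'.1).elim } (fun s' hs o ho => ?_) (fun o ho => ?_) (fun _ _ _ ho => ?_)
    · by_cases hu : (st.ballot s).used = none
      · refine .inr fun j => (h1.own _ _).mpr (.inr ?_)
        simp only [Option.some.injEq] at hx
        simp only
        rw [if_pos ⟨hx, hu⟩]
        exact List.mem_map.mpr ⟨j, List.mem_finRange j, rfl⟩
      · exact .inl (Option.isSome_iff_ne_none.mpr hu)
    · obtain ⟨-, j, rfl⟩ := hmem ho
      exact fun e => hs e.symm
    · obtain ⟨-, j, rfl⟩ := hmem ho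
      simp
    · obtain ⟨-, j, e⟩ := hmem ho
      cases e
  · exact fun hE => ⟨h.nil hE, .refl _, hs⟩

end Inv

end

section

variable {P : Params} {C : Prims P} {k : ℕ}

/-! ### Reconstruction of shared secrets -/

theorem shamirRec_eq {F : Type} [Field F] {N t : ℕ} (ht : 1 ≤ t) {x : Fin N → F}
    (hx : Function.Injective x) {secret : F} {c : Fin (t - 1) → F} {sh : Fin N → Option F}
    (hsh : ∀ i y, sh i = some y → y = shamirShare secret c (x i)) (hc : t ≤ count sh) :
    shamirRec x sh = secret := by
  let p : Polynomial F :=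
    Polynomial.C secret + ∑ j : Fin (t - 1), Polynomial.C (c j) * Polynomial.X ^ (j.val + 1)
  have hp : ∀ z, p.eval z = shamirShare secret c z := fun z => by
    simp [p, shamirShare, Polynomial.eval_finsetSum]
  have hd : p.degree < t := by
    refine (Polynomial.degree_add_le _ _).trans_lt (max_lt ?_ ?_)
    · exact Polynomial.degree_C_le.trans_lt (by exact_mod_cast ht)
    · refine (Polynomial.degree_sum_le _ _).trans_lt ((Finset.sup_lt_iff (WithBot.bot_lt_coe t)).mpr
        fun j _ => (Polynomial.degree_C_mul_X_pow_le _ _).trans_lt ?_)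
      have := j.2
      exact Nat.cast_lt.mpr (by omega : j.val + 1 < t)
  unfold shamirRec
  rw [← Lagrange.eq_interpolate_of_eval_eq _ hx.injOn (f := p)
    (hd.trans_le (by exact_mod_cast hc)), hp]
  · simp [shamirShare]
  · intro i hi
    obtain ⟨y, hy⟩ := Option.isSome_iff_exists.mp (Finset.mem_filter.mp hi).2
    rw [hp, hy, ← hsh i y hy, Option.getD_some]

theorem tpt_injective (h : P.Nt < C.grp.q k) : Function.Injective (tpt C k) := by
  intro a b hab
  unfold tpt at hab
  rw [ZMod.natCast_eq_natCast_iff', Nat.mod_eq_of_lt (by omega), Nat.mod_eq_of_lt (by omega)] at hab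
  exact Fin.ext (by omega)

theorem tallyShare_fst (S : Setup C k) (E : Finset (Fin P.n × Line P)) (t : Fin P.Nt)
    (o : Fin P.m) : (S.tallyShare E t o).1 = shamirShare (∑ x ∈ E, S.unit x.1 x.2 o)
      (fun j => ∑ x ∈ E, (S.tpoly x.1 x.2 o j).1) (tpt C k t) := by
  simp only [Setup.tallyShare, Finset.sum_apply, Prod.fst_sum, Setup.tshare, shamirShare,
    Finset.sum_add_distrib]
  rw [Finset.sum_comm]
  simp only [Finset.sum_mul]

/-! ### Invariants of BB nodes and trustees -/

/-- The validly signed master key shares that a BB node has received. -/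
def Setup.keyShares (S : Setup C k) (st : BBState C k) (i : Fin P.Nv) : Option (Word 128) :=
  (st.got i).bind fun g =>
    if C.sig.verify k S.eaVk (.kshare i g.2.1) g.2.2 = true then some g.2.1 else none

/-- The master key reconstructed by a BB node. -/
def Setup.recKey (S : Setup C k) (st : BBState C k) : Word 128 :=
  (toField 128).symm (shamirRec (fun i => (P.pt128 i : GaloisField 2 128))
    fun i => (S.keyShares st i).map (toField 128))

/-- Invariants of a BB node that has received the messages `rcv` and sent the messages `own`. -/
structure BBInv (S : Setup C k) (rcv own : Party P → Msg C k → Prop) (st : BBState C k) :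
    Prop where
  got : ∀ i Q x σ, st.got i = some (Q, x, σ) → rcv (.vc i) (.voteSet Q x σ)
  got_some : ∀ i Q x σ, rcv (.vc i) (.voteSet Q x σ) → (st.got i).isSome
  pub : ∀ Q, st.pub = some Q →
    P.fv + 1 ≤ (Finset.univ.filter fun j => (st.got j).map Prod.fst = some Q).card
  pub_some : ∀ Q, P.fv + 1 ≤ (Finset.univ.filter fun j => (st.got j).map Prod.fst = some Q).card →
    st.pub.isSome
  key : ∀ κ, st.key = some κ → C.hash.hash k S.hk (κ, S.saltM) = S.hmsk
  posts : ∀ t T, st.posts t = some T → ∃ o, rcv (.tr t) (.opening o T)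
  posts_some : ∀ t o T, rcv (.tr t) (.opening o T) → (st.posts t).isSome
  shown : st.shown = true → ∃ Q κ, st.pub = some Q ∧ st.key = some κ ∧
    ∀ t, own (.tr t) (.bbData Q (S.codes κ))
  own_data : ∀ d Q D, own d (.bbData Q D) → ∃ κ, st.pub = some Q ∧ st.key = some κ ∧ D = S.codes κ
  result : ∀ R, st.result = some R → ∃ Q κ, st.pub = some Q ∧ st.key = some κ ∧
    ∀ o, R o = ∑ x ∈ tallySet Q (S.codes κ), S.unit x.1 x.2 o

/-- No step of a BB node is enabled. -/
structure BBSettled (S : Setup C k) (st : BBState C k) : Prop where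
  key : P.Nv - P.fv ≤ count (S.keyShares st) →
    C.hash.hash k S.hk (S.recKey st, S.saltM) = S.hmsk → st.key.isSome
  rest : ∀ Q κ, st.pub = some Q → st.key = some κ → st.shown = true ∧
    (P.ht ≤ count (fun t => (st.posts t).filter fun T =>
      decide (S.ValidPost (tallySet Q (S.codes κ)) t T)) → st.result.isSome)

section BB

variable {S : Setup C k} {rcv own rcv' own' : Party P → Msg C k → Prop} {st : BBState C k}
  {src : Party P} {x : Msg C k}

theorem update_of_none {ι α : Type} [DecidableEq ι] {f : ι → Option α} {i j : ι} {a b : α}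
    (h : f i = none) (hj : f j = some b) : Function.update f i (some a) j = some b := by
  rw [Function.update_of_ne, hj]
  rintro rfl
  rw [h] at hj
  cases hj

theorem bbHandle_inv (h : BBInv S rcv own st)
    (hr : ∀ d y, rcv' d y ↔ rcv d y ∨ (d = src ∧ y = x)) :
    BBInv S rcv' own (Setup.bbHandle st src x).1 ∧
      ∀ d Q D, (d, .bbData Q D) ∉ (Setup.bbHandle st src x).2 := by
  -- what is left to check when the message is ignored
  have hsame : (∀ i Q y σ, src = .vc i → x = .voteSet Q y σ → (st.got i).isSome) →
      (∀ t o T, src = .tr t → x = .opening o T → (st.posts t).isSome) → BBInv S rcv' own st :=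
    fun h1 h2 => { h with
      got := fun i Q y σ hg => (hr _ _).mpr (.inl (h.got i Q y σ hg))
      got_some := fun i Q y σ h' => ((hr _ _).mp h').elim (h.got_some i Q y σ)
        fun h' => h1 i Q y σ h'.1.symm h'.2.symm
      posts := fun t T hp => (h.posts t T hp).imp fun o ho => (hr _ _).mpr (.inl ho)
      posts_some := fun t o T h' => ((hr _ _).mp h').elim (h.posts_some t o T)
        fun h' => h2 t o T h'.1.symm h'.2.symm }
  unfold Setup.bbHandle
  split
  · rename_i i Q y σ
    split
    · rename_i hn
      simp only
      set got := Function.update st.got i (some (Q, y, σ)) with hgot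
      have hmono : ∀ {j : Fin P.Nv} {Q'}, (st.got j).map Prod.fst = some Q' →
          (got j).map Prod.fst = some Q' := by
        intro j Q' hj
        obtain ⟨g, hg, rfl⟩ := Option.map_eq_some_iff.mp hj
        rw [hgot, update_of_none hn hg, Option.map_some]
      have hg1 : ∀ j Q' y' σ', got j = some (Q', y', σ') → rcv' (.vc j) (.voteSet Q' y' σ') := by
        intro j Q' y' σ' hj
        rw [hgot, Function.update_apply] at hj
        split at hj
        · rename_i e
          cases hj
          exact (hr _ _).mpr (.inr ⟨by rw [e], rfl⟩)
        · exact (hr _ _).mpr (.inl (h.got _ _ _ _ hj))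
      have hg2 : ∀ j Q' y' σ', rcv' (.vc j) (.voteSet Q' y' σ') → (got j).isSome := by
        intro j Q' y' σ' hj
        rcases (hr _ _).mp hj with hj | ⟨e, -⟩
        · obtain ⟨g, hg⟩ := Option.isSome_iff_exists.mp (h.got_some _ _ _ _ hj)
          rw [hgot, update_of_none hn hg]
          rfl
        · cases e
          rw [hgot, Function.update_self]
          rfl
      have hp1 : ∀ t T, st.posts t = some T → ∃ o, rcv' (.tr t) (.opening o T) :=
        fun t T hp => (h.posts t T hp).imp fun o ho => (hr _ _).mpr (.inl ho)
      have hp2 : ∀ t o T, rcv' (.tr t) (.opening o T) → (st.posts t).isSome :=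
        fun t o T h' => ((hr _ _).mp h').elim (h.posts_some t o T) fun h' => by cases h'.1
      have hlast : ∀ Q', P.fv + 1 ≤ (Finset.univ.filter fun j =>
            (got j).map Prod.fst = some Q').card → Q' ≠ Q → st.pub.isSome := by
        intro Q' hQ' hne
        refine h.pub_some Q' (hQ'.trans (Finset.card_le_card fun j hj => ?_))
        simp only [Finset.mem_filter, Finset.mem_univ, true_and] at hj ⊢
        rw [hgot, Function.update_apply] at hj
        split at hj
        · simp only [Option.map_some, Option.some.injEq] at hj
          exact absurd hj.symm hne
        · exact hj
      split
      · rename_i hif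
        refine ⟨⟨hg1, hg2, fun Q' hQ' => ?_, fun _ _ => rfl, h.key, hp1, hp2, fun hs => ?_,
          fun d Q' D ho => ?_, fun R hR => ?_⟩, by simp⟩
        · cases hQ'
          exact hif.2
        · obtain ⟨Q', κ, h', -⟩ := h.shown hs
          rw [hif.1] at h'
          cases h'
        · obtain ⟨κ, h', -⟩ := h.own_data d Q' D ho
          rw [hif.1] at h'
          cases h'
        · obtain ⟨Q', κ, h', -⟩ := h.result R hR
          rw [hif.1] at h'
          cases h'
      · rename_i hif
        refine ⟨⟨hg1, hg2, fun Q' hQ' => (h.pub Q' hQ').trans (Finset.card_le_card fun j hj => ?_),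
          fun Q' hQ' => ?_, h.key, hp1, hp2, h.shown, h.own_data, h.result⟩, by simp⟩
        · simp only [Finset.mem_filter, Finset.mem_univ, true_and] at hj ⊢
          exact hmono hj
        · by_cases e : Q' = Q
          · subst e
            by_contra hp
            exact hif ⟨by simpa using hp, hQ'⟩
          · exact hlast Q' hQ' e
    · rename_i hn
      refine ⟨hsame (fun i' Q' y' σ' h1 h2 => ?_) (fun t o T h1 => by cases h1), by simp⟩
      cases h1
      exact Option.isSome_iff_ne_none.mpr hn
  · rename_i t o T
    split
    · rename_i hn
      refine ⟨{ h with
        got := fun i Q y σ hg => (hr _ _).mpr (.inl (h.got i Q y σ hg))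
        got_some := fun i Q y σ h' => ((hr _ _).mp h').elim (h.got_some i Q y σ)
          fun h' => by cases h'.1
        posts := fun t' T' hp => ?_
        posts_some := fun t' o' T' h' => ?_ }, by simp⟩
      · change Function.update _ _ _ _ = _ at hp
        rw [Function.update_apply] at hp
        split at hp
        · rename_i e
          cases hp
          exact ⟨o, (hr _ _).mpr (.inr ⟨by rw [e], rfl⟩)⟩
        · exact (h.posts t' T' hp).imp fun o ho => (hr _ _).mpr (.inl ho)
      · change (Function.update st.posts t (some T) t').isSome
        rcases (hr _ _).mp h' with h' | ⟨e, -⟩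
        · obtain ⟨g, hg⟩ := Option.isSome_iff_exists.mp (h.posts_some _ _ _ h')
          rw [update_of_none hn hg]
          rfl
        · cases e
          rw [Function.update_self]
          rfl
    · rename_i hn
      refine ⟨hsame (fun i' Q' y' σ' h1 h2 => by cases h1) (fun t' o' T' h1 _ => ?_), by simp⟩
      cases h1
      exact Option.isSome_iff_ne_none.mpr hn
  · rename_i hno1 hno2
    exact ⟨hsame (fun i Q y σ h1 h2 => (hno1 i Q y σ h1 h2).elim)
      (fun t o T h1 h2 => (hno2 t o T h1 h2).elim), by simp⟩

theorem bbKey_inv (h : BBInv S rcv own st) : BBInv S rcv own (S.bbKey st) ∧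
    (P.Nv - P.fv ≤ count (S.keyShares (S.bbKey st)) →
      C.hash.hash k S.hk (S.recKey (S.bbKey st), S.saltM) = S.hmsk → (S.bbKey st).key.isSome) := by
  have e : S.bbKey st = if st.key = none ∧ P.Nv - P.fv ≤ count (S.keyShares st) ∧
      C.hash.hash k S.hk (S.recKey st, S.saltM) = S.hmsk then { st with key := some (S.recKey st) }
      else st := rfl
  rw [e]
  split
  · rename_i hif
    have hk : ∀ {κ}, st.key = some κ → False := fun hk => by rw [hif.1] at hk; cases hk
    refine ⟨{ h with
      key := fun κ hκ => by cases hκ; exact hif.2.2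
      shown := fun hs => ?_
      own_data := fun d Q D ho => ?_
      result := fun R hR => ?_ }, fun _ _ => rfl⟩
    · obtain ⟨_, _, _, h', _⟩ := h.shown hs
      exact (hk h').elim
    · obtain ⟨_, _, h', _⟩ := h.own_data d Q D ho
      exact (hk h').elim
    · obtain ⟨_, _, _, h', _⟩ := h.result R hR
      exact (hk h').elim
  · rename_i hif
    refine ⟨h, fun h1 h2 => ?_⟩
    by_contra h3
    exact hif ⟨by simpa using h3, h1, h2⟩

theorem bbRecv_inv (hht : 1 ≤ P.ht) (hq : P.Nt < C.grp.q k) (h : BBInv S rcv own st)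
    (hr : ∀ d y, rcv' d y ↔ rcv d y ∨ (d = src ∧ y = x))
    (ho : ∀ d y, own' d y ↔ own d y ∨ (d, y) ∈ (S.bbRecv st src x).2) :
    BBInv S rcv' own' (S.bbRecv st src x).1 ∧ BBSettled S (S.bbRecv st src x).1 := by
  obtain ⟨h1, hno⟩ := bbHandle_inv h hr
  obtain ⟨h2, hkey⟩ := bbKey_inv h1
  unfold Setup.bbRecv at ho ⊢
  simp only at ho ⊢
  set st₂ := S.bbKey (Setup.bbHandle st src x).1 with hst
  have ho' : ∀ d Q D, own' d (.bbData Q D) ↔ own d (.bbData Q D) ∨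
      (d, .bbData Q D) ∈ (S.bbSettle st₂).2 := fun d Q D => by
    rw [ho, List.mem_append, or_iff_right (hno d Q D)]
  clear ho hno
  revert ho'
  unfold Setup.bbSettle
  split
  · rename_i Q κ hQ hκ
    simp only
    -- the publication of the data
    have hdata : ∀ {l : Outbox C k}, (∀ d Q' D, (d, .bbData Q' D) ∉ l) →
        (∀ d Q' D, own' d (.bbData Q' D) ↔ own d (.bbData Q' D) ∨ (d, .bbData Q' D) ∈
          (if st₂.shown = false then (.env, .bbData Q (S.codes κ)) :: toTrs (.bbData Q (S.codes κ))
            else []) ++ l) →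
        (∀ t, own' (.tr t) (.bbData Q (S.codes κ))) ∧
        ∀ d Q' D, own' d (.bbData Q' D) →
          ∃ κ', st₂.pub = some Q' ∧ st₂.key = some κ' ∧ D = S.codes κ' := by
      intro l hl ho
      refine ⟨fun t => (ho _ _ _).mpr ?_, fun d Q' D h' => ?_⟩
      · by_cases hs : st₂.shown = false
        · right
          rw [if_pos hs]
          exact List.mem_append_left _ (List.mem_cons_of_mem _
            (List.mem_map.mpr ⟨t, List.mem_finRange t, rfl⟩))
        · obtain ⟨Q', κ', h3, h4, h5⟩ := h2.shown (by simpa using hs)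
          rw [hQ] at h3
          rw [hκ] at h4
          cases h3
          cases h4
          exact .inl (h5 t)
      · rcases (ho _ _ _).mp h' with h' | h'
        · exact h2.own_data d Q' D h'
        · rcases List.mem_append.mp h' with h' | h'
          · split at h'
            · rcases List.mem_cons.mp h' with e | h'
              · cases e
                exact ⟨κ, hQ, hκ, rfl⟩
              · obtain ⟨t, -, e⟩ := List.mem_map.mp h'
                cases e
                exact ⟨κ, hQ, hκ, rfl⟩
            · simp at h'
          · exact (hl _ _ _ h').elim
    split
    · rename_i hif
      intro ho
      obtain ⟨h3, h4⟩ := hdata (by simp) ho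
      refine ⟨{ h2 with
        shown := fun _ => ⟨Q, κ, hQ, hκ, h3⟩
        own_data := h4
        result := fun R hR => ⟨Q, κ, hQ, hκ, fun o => ?_⟩ }, hkey,
        fun _ _ _ _ => ⟨rfl, fun _ => rfl⟩⟩
      cases hR
      refine shamirRec_eq hht (tpt_injective hq)
        (c := fun j => ∑ x ∈ tallySet Q (S.codes κ), (S.tpoly x.1 x.2 o j).1) ?_ ?_
      · intro t y hy
        obtain ⟨T, hT, rfl⟩ := Option.map_eq_some_iff.mp hy
        rw [← tallyShare_fst]
        have := of_decide_eq_true (Option.filter_eq_some_iff.mp hT).2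
        rw [(validPost_iff _ _ _ _).mp this]
      · refine hif.2.trans (le_of_eq ?_)
        simp [count]
    · rename_i hif
      intro ho
      obtain ⟨h3, h4⟩ := hdata (l := []) (by simp) (by simpa using ho)
      refine ⟨{ h2 with
        shown := fun _ => ⟨Q, κ, hQ, hκ, h3⟩
        own_data := h4 }, hkey, fun Q' κ' h5 h6 => ⟨rfl, fun h7 => ?_⟩⟩
      rw [hQ] at h5
      rw [hκ] at h6
      cases h5
      cases h6
      by_contra h8
      exact hif ⟨by simpa using h8, h7⟩
  · rename_i hno
    intro ho
    exact ⟨{ h2 with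
      shown := fun hs => by
        obtain ⟨Q, κ, h3, h4, -⟩ := h2.shown hs
        exact (hno Q κ h3 h4).elim
      own_data := fun d Q D h' => h2.own_data d Q D (((ho _ _ _).mp h').resolve_right (by simp)) },
      hkey, fun Q κ h3 h4 => (hno Q κ h3 h4).elim⟩

end BB

/-- Invariants of a trustee that has received the messages `rcv` and sent the messages `own`. -/
structure TrInv (S : Setup C k) (t : Fin P.Nt) (rcv own : Party P → Msg C k → Prop)
    (st : TrState P) : Prop where
  got : ∀ b Q D, st.got b = some (Q, D) → rcv (.bb b) (.bbData Q D)
  got_some : ∀ b Q D, rcv (.bb b) (.bbData Q D) → (st.got b).isSome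
  done : ∀ Q D, P.fb + 1 ≤ (Finset.univ.filter fun b => st.got b = some (Q, D)).card →
    st.done = true
  own_opening : ∀ d o T, own d (.opening o T) → ∃ Q D,
    P.fb + 1 ≤ (Finset.univ.filter fun b => st.got b = some (Q, D)).card ∧
      T = S.tallyShare (tallySet Q D) t
  sent : st.done = true → ∀ b, ∃ o T, own (.bb b) (.opening o T)

theorem trRecv_inv {S : Setup C k} {t : Fin P.Nt} {rcv own rcv' own' : Party P → Msg C k → Prop}
    {st : TrState P} {src : Party P} {x : Msg C k} (h : TrInv S t rcv own st)
    (hr : ∀ d y, rcv' d y ↔ rcv d y ∨ (d = src ∧ y = x))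
    (ho : ∀ d y, own' d y ↔ own d y ∨ (d, y) ∈ (S.trRecv t st src x).2) :
    TrInv S t rcv' own' (S.trRecv t st src x).1 := by
  have hsame : own' = own → (∀ b Q D, src = .bb b → x = .bbData Q D → (st.got b).isSome) →
      TrInv S t rcv' own' st := fun e h1 => by
    rw [e]
    exact { h with
      got := fun b Q D hg => (hr _ _).mpr (.inl (h.got b Q D hg))
      got_some := fun b Q D h' => ((hr _ _).mp h').elim (h.got_some b Q D)
        fun h' => h1 b Q D h'.1.symm h'.2.symm }
  have hnil : (∀ d y, own' d y ↔ own d y ∨ (d, y) ∈ ([] : Outbox C k)) → own' = own :=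
    fun h => by funext d y; simpa using h d y
  revert ho
  unfold Setup.trRecv
  split
  · rename_i b Q D
    split
    · rename_i hn
      simp only
      set got := Function.update st.got b (some (Q, D)) with hgot
      have hg1 : ∀ j Q' D', got j = some (Q', D') → rcv' (.bb j) (.bbData Q' D') := by
        intro j Q' D' hj
        rw [hgot, Function.update_apply] at hj
        split at hj
        · rename_i e
          cases hj
          exact (hr _ _).mpr (.inr ⟨by rw [e], rfl⟩)
        · exact (hr _ _).mpr (.inl (h.got _ _ _ hj))
      have hg2 : ∀ j Q' D', rcv' (.bb j) (.bbData Q' D') → (got j).isSome := by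
        intro j Q' D' hj
        rcases (hr _ _).mp hj with hj | ⟨e, -⟩
        · obtain ⟨g, hg⟩ := Option.isSome_iff_exists.mp (h.got_some _ _ _ hj)
          rw [hgot, update_of_none hn hg]
          rfl
        · cases e
          rw [hgot, Function.update_self]
          rfl
      have hmono : ∀ Q' D', (Finset.univ.filter fun b => st.got b = some (Q', D')).card ≤
          (Finset.univ.filter fun b => got b = some (Q', D')).card := fun Q' D' =>
        Finset.card_le_card fun j hj => by
          simp only [Finset.mem_filter, Finset.mem_univ, true_and] at hj ⊢
          exact update_of_none hn hj
      have hown := fun d o T h' => (h.own_opening d o T h').imp fun Q' h' => h'.imp fun D' h' =>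
        h'.imp_left fun h' => h'.trans (hmono Q' D')
      have hdone : ∀ Q' D', P.fb + 1 ≤ (Finset.univ.filter fun b => got b = some (Q', D')).card →
          (Q', D') ≠ (Q, D) → st.done = true := by
        intro Q' D' h' hne
        refine h.done Q' D' (h'.trans (Finset.card_le_card fun j hj => ?_))
        simp only [Finset.mem_filter, Finset.mem_univ, true_and] at hj ⊢
        rw [hgot, Function.update_apply] at hj
        split at hj
        · cases hj
          exact absurd rfl hne
        · exact hj
      split
      · rename_i hif
        intro ho
        refine ⟨hg1, hg2, fun _ _ _ => rfl, fun d o T h' => ?_, fun _ b' =>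
          ⟨_, _, (ho _ _).mpr (.inr (List.mem_map.mpr ⟨b', List.mem_finRange b', rfl⟩))⟩⟩
        rcases (ho _ _).mp h' with h' | h'
        · exact hown d o T h'
        · obtain ⟨_, e⟩ := mem_toBBs h'
          cases e
          exact ⟨Q, D, hif.2, rfl⟩
      · rename_i hif
        intro ho
        rw [hnil ho]
        refine ⟨hg1, hg2, fun Q' D' h' => ?_, hown, h.sent⟩
        by_cases e : (Q', D') = (Q, D)
        · cases e
          by_contra hd
          exact hif ⟨by simpa using hd, h'⟩
        · exact hdone Q' D' h' e
    · rename_i hn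
      intro ho
      refine hsame (hnil ho) fun b' Q' D' h1 _ => ?_
      cases h1
      exact Option.isSome_iff_ne_none.mpr hn
  · rename_i hno
    exact fun ho => hsame (hnil ho) fun b Q D h1 h2 => (hno b Q D h1 h2).elim

end

section

variable {P : Params} {C : Prims P} {k : ℕ}

/-! ### Invariants of the system -/

/-- Signatures of honest VC nodes in a message are on vote codes they have endorsed. -/
def Legit (S : Setup C k) (K : Corruption P) (F : CodePred P) :
    Envelope C k → Prop
  | (.vc j, _, .endorsement _ _ σ) => j ∉ K.vcs → ∀ s vc,
      C.sig.verify k (S.vk j) (.endorse s vc) σ = true → F j s vc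
  | (_, _, .voteP _ _ _ _ u) => LegitCert S K F u
  | (_, _, .announce _ (some c)) => LegitCert S K F c.2
  | (_, _, .recoverResp _ _ u) => LegitCert S K F u
  | _ => True

/-- VC node `j` has disclosed its receipt share for vote code `vc` of ballot `s`. -/
def Sys.VoteP (y : Sys C k) (j : Fin P.Nv) (s : Fin P.n) (vc : Word 128) : Prop :=
  ∃ d x σ u, (.vc j, d, .voteP s vc x σ u) ∈ y.sent

/-- The surroundings of VC node `i` when the messages `D` have been delivered. -/
def Sys.venv (y : Sys C k) (S : Setup C k) (D : List (Envelope C k)) (i : Fin P.Nv) :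
    VEnv C k where
  own d x := (.vc i, d, x) ∈ y.sent
  rcv d x := (d, .vc i, x) ∈ D
  voteP := y.VoteP
  cast v s vc := s = v ∧ ∃ c, (y.voter v).choice = some c ∧ vc = S.code v c
  bc := y.bc

/-- Invariants of an honest VC node of the system. -/
structure VCInv (S : Setup C k) (K : Corruption P) (F : CodePred P)
    (y : Sys C k) (i : Fin P.Nv) : Prop where
  inv : VInv S K F i (y.venv S y.delivered i) (y.vc i)
  settled : Settled S (y.vc i)
  ann : ∀ j s c, (.vc j, .vc i, .announce s c) ∈ y.delivered → (((y.vc i).ballot s).ann j).isSome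
  resp : ∀ j s vc u, j ∉ K.vcs → (.vc j, .vc i, .recoverResp s vc u) ∈ y.delivered →
    ((y.vc i).ballot s).used.isSome

/-- Invariants of the system. If consensus on a ballot has result `true`, then an honest node
(that has entered with opinion `true`) answers all requests for the vote code. -/
structure SysInv (S : Setup C k) (K : Corruption P) (F : CodePred P)
    (y : Sys C k) : Prop where
  good : ∀ e ∈ y.sent, ¬ K.Bad e.1
  auth : ∀ e ∈ y.delivered, K.Bad e.1 ∨ e ∈ y.sent
  legit : ∀ e ∈ y.delivered, Legit S K F e
  voter : ∀ v d x, (.voter v, d, x) ∈ y.sent →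
    ∃ c, x = .vote v (S.code v c) ∧ (y.voter v).choice = some c
  vc : ∀ i, i ∉ K.vcs → VCInv S K F y i
  bb : ∀ b, b ∉ K.bbs → BBInv S (fun d x => (d, .bb b, x) ∈ y.delivered)
    (fun d x => (.bb b, d, x) ∈ y.sent) (y.bb b) ∧ BBSettled S (y.bb b)
  tr : ∀ t, t ∉ K.trs → TrInv S t (fun d x => (d, .tr t, x) ∈ y.delivered)
    (fun d x => (.tr t, d, x) ∈ y.sent) (y.tr t)
  bc : ∀ s b, y.bc s = some b → ∃ i, i ∉ K.vcs ∧ ((y.vc i).ballot s).entered = some b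
  recover : ∀ s, y.bc s = some true → ∃ j, j ∉ K.vcs ∧ ((y.vc j).ballot s).entered = some true ∧
    ∀ i, i ∉ K.vcs → (.vc i, .vc j, .recoverReq s) ∈ y.delivered →
      ∃ vc u, (.vc j, .vc i, .recoverResp s vc u) ∈ y.sent

/-- Party `p` makes a step: it receives `new` and sends `out`. -/
structure StepBy (p : Party P) (new : List (Envelope C k)) (out : Outbox C k) (y y' : Sys C k) :
    Prop where
  sent : y'.sent = y.sent ++ out.map (fun o => (p, o.1, o.2)) := by simp [Setup.receive, Sys.emit]
  delivered : y'.delivered = new ++ y.delivered := by rfl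
  dst : ∀ e ∈ new, e.2.1 = p := by simp
  vc : ∀ i, p ≠ .vc i → y'.vc i = y.vc i := by exact fun _ _ => rfl
  bb : ∀ i, p ≠ .bb i → y'.bb i = y.bb i := by exact fun _ _ => rfl
  tr : ∀ i, p ≠ .tr i → y'.tr i = y.tr i := by exact fun _ _ => rfl
  choice : ∀ v c, (y.voter v).choice = some c → (y'.voter v).choice = some c := by
    exact fun _ _ h => h
  bc : ∀ s b, y.bc s = some b → y'.bc s = some b := by exact fun _ _ h => h

section Step

variable {S : Setup C k} {K : Corruption P} {F : CodePred P}
  {p : Party P} {new : List (Envelope C k)} {out : Outbox C k} {y y' : Sys C k}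

theorem StepBy.mem_sent (hs : StepBy p new out y y') {q d : Party P} {x : Msg C k} :
    (q, d, x) ∈ y'.sent ↔ (q, d, x) ∈ y.sent ∨ p = q ∧ (d, x) ∈ out := by
  rw [hs.sent, List.mem_append, List.mem_map]
  refine or_congr Iff.rfl ⟨?_, ?_⟩
  · rintro ⟨o, ho, e⟩
    cases e
    exact ⟨rfl, ho⟩
  · rintro ⟨rfl, ho⟩
    exact ⟨_, ho, rfl⟩

theorem StepBy.mem_delivered (hs : StepBy p new out y y') {q d : Party P} {x : Msg C k}
    (hd : p ≠ d) : (q, d, x) ∈ y'.delivered ↔ (q, d, x) ∈ y.delivered := by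
  rw [hs.delivered, List.mem_append, or_iff_right]
  exact fun h => hd (hs.dst _ h).symm

theorem StepBy.mem (hs : StepBy p new out y y') {e : Envelope C k} (he : e ∈ y'.delivered) :
    e ∈ new ∨ e ∈ y.delivered :=
  List.mem_append.mp (hs.delivered ▸ he)

theorem StepBy.voteP (hs : StepBy p new out y y') {j : Fin P.Nv} {s : Fin P.n} {vc : Word 128} :
    y.VoteP j s vc → y'.VoteP j s vc := by
  rintro ⟨d, x, σ, u, h⟩
  exact ⟨d, x, σ, u, hs.mem_sent.mpr (.inl h)⟩

theorem StepBy.ext (hs : StepBy p new out y y') {i : Fin P.Nv} (D : List (Envelope C k))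
    (hD : ∀ e ∈ D, e ∈ y'.delivered) :
    (y.venv S D i).Ext (if p = .vc i then out else []) (y'.venv S y'.delivered i) where
  own d x := by
    refine hs.mem_sent.trans (or_congr Iff.rfl ?_)
    split <;> simp [*]
  rcv d x h := hD _ h
  voteP _ _ _ := hs.voteP
  cast v s vc h := h.imp_right fun h => h.imp fun c h => h.imp_left (hs.choice v c)
  bc := hs.bc

theorem SysInv.step (h : SysInv S K F y) (hs : StepBy p new out y y')
    (hp : out ≠ [] → ¬ K.Bad p := by simp)
    (hnew : ∀ e ∈ new, (K.Bad e.1 ∨ e ∈ y.sent) ∧ Legit S K F e := by simp)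
    (hvoter : ∀ v, p = .voter v → ∀ o ∈ out,
      ∃ c, o.2 = .vote v (S.code v c) ∧ (y'.voter v).choice = some c := by simp)
    (hvc : ∀ i, p = .vc i → i ∉ K.vcs → VCInv S K F y' i ∧ VLe (y.vc i) (y'.vc i) := by nofun)
    (hbb : ∀ b, p = .bb b → b ∉ K.bbs → BBInv S (fun d x => (d, .bb b, x) ∈ y'.delivered)
      (fun d x => (.bb b, d, x) ∈ y'.sent) (y'.bb b) ∧ BBSettled S (y'.bb b) := by nofun)
    (htr : ∀ t, p = .tr t → t ∉ K.trs → TrInv S t (fun d x => (d, .tr t, x) ∈ y'.delivered)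
      (fun d x => (.tr t, d, x) ∈ y'.sent) (y'.tr t) := by nofun)
    (hbc : ∀ s b, y.bc s = none → y'.bc s = some b →
      ∃ i, i ∉ K.vcs ∧ ((y.vc i).ballot s).entered = some b := by
        intro s b h1 h2; cases h1.symm.trans h2)
    (hrec : ∀ i j s, (.vc i, .vc j, .recoverReq s) ∈ new →
      ((y.vc j).ballot s).entered = some true →
      ∃ vc u, (.vc j, .vc i, .recoverResp s vc u) ∈ y'.sent := by simp) : SysInv S K F y' := by
  have hle : ∀ i, i ∉ K.vcs → VLe (y.vc i) (y'.vc i) := fun i hi => by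
    by_cases e : p = .vc i
    · exact (hvc i e hi).2
    · rw [hs.vc i e]
      exact .refl _
  have hown : ∀ {q}, p ≠ q → (fun d x => (q, d, x) ∈ y'.sent) = fun d x => (q, d, x) ∈ y.sent :=
    fun hq => by funext d x; simp [hs.mem_sent, hq]
  have hrcv : ∀ {q}, p ≠ q → (fun d x => (d, q, x) ∈ y'.delivered) =
      fun d x => (d, q, x) ∈ y.delivered :=
    fun hq => by funext d x; rw [hs.mem_delivered hq]
  have hbc' : ∀ s b, y'.bc s = some b →
      ∃ i, i ∉ K.vcs ∧ ((y.vc i).ballot s).entered = some b := fun s b hb => by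
    cases hy : y.bc s with
    | none => exact hbc s b hy hb
    | some b' =>
      obtain rfl : b' = b := Option.some.inj ((hs.bc s b' hy).symm.trans hb)
      exact h.bc s b' hy
  refine ⟨fun ⟨q, d, x⟩ he => ?_, fun e he => ?_, fun e he => ?_, fun v d x he => ?_,
    fun i hi => ?_, fun b hb => ?_, fun t ht => ?_, fun s b hb => ?_, fun s hb => ?_⟩
  · rcases hs.mem_sent.mp he with he | ⟨rfl, h'⟩
    · exact h.good _ he
    · exact hp (List.ne_nil_of_mem h')
  · rw [hs.sent, List.mem_append, ← or_assoc]
    left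
    exact (hs.mem he).elim (fun he => (hnew e he).1) (h.auth e)
  · exact (hs.mem he).elim (fun he => (hnew e he).2) (h.legit e)
  · rcases hs.mem_sent.mp he with he | ⟨rfl, he⟩
    · exact (h.voter v d x he).imp fun c hc => hc.imp_right (hs.choice v c)
    · exact hvoter v rfl _ he
  · by_cases e : p = .vc i
    · exact (hvc i e hi).1
    · have hi' := h.vc i hi
      have hext := hs.ext (S := S) (i := i) y.delivered (fun e he => by
        rw [hs.delivered]; exact List.mem_append_right _ he)
      rw [if_neg e] at hext
      refine ⟨?_, ?_, ?_, ?_⟩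
      all_goals rw [hs.vc i e]
      · exact hi'.inv.nil hext
      · exact hi'.settled
      · exact fun j s c hd => hi'.ann j s c ((hs.mem_delivered e).mp hd)
      · exact fun j s vc u hj hd => hi'.resp j s vc u hj ((hs.mem_delivered e).mp hd)
  · by_cases e : p = .bb b
    · exact hbb b e hb
    · rw [hs.bb b e, hown e, hrcv e]
      exact h.bb b hb
  · by_cases e : p = .tr t
    · exact htr t e ht
    · rw [hs.tr t e, hown e, hrcv e]
      exact h.tr t ht
  · obtain ⟨i, hi, h1⟩ := hbc' s b hb
    exact ⟨i, hi, (hle i hi).entered s b h1⟩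
  · cases hy : y.bc s with
    | none =>
      obtain ⟨j, hj, h1⟩ := hbc s true hy hb
      refine ⟨j, hj, (hle j hj).entered s true h1, fun i hi hd => ?_⟩
      rcases hs.mem hd with hd | hd
      · exact hrec i j s hd h1
      · -- the request was sent after a decision, which requires a result of consensus
        have h2 := ((h.vc i hi).inv.ballot s).own_req _ ((h.auth _ hd).resolve_left hi)
        have h3 := (((h.vc i hi).inv.ballot s).decided _ h2).1
        change y.bc s = _ at h3
        rw [hy] at h3
        cases h3
    | some b =>
      obtain rfl : b = true := Option.some.inj ((hs.bc s b hy).symm.trans hb)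
      obtain ⟨j, hj, h1, h2⟩ := h.recover s hy
      refine ⟨j, hj, (hle j hj).entered s true h1, fun i hi hd => ?_⟩
      rcases hs.mem hd with hd | hd
      · exact hrec i j s hd h1
      · obtain ⟨vc, u, h3⟩ := h2 i hi hd
        exact ⟨vc, u, hs.mem_sent.mpr (.inl h3)⟩

theorem SysInv.good_venv (h : SysInv S K F y) (i : Fin P.Nv)
    (hnew : ∀ e ∈ new, (K.Bad e.1 ∨ e ∈ y.sent) ∧ Legit S K F e) :
    (y.venv S (new ++ y.delivered) i).Good S K F := by
  have hD : ∀ {e}, e ∈ new ++ y.delivered → (K.Bad e.1 ∨ e ∈ y.sent) ∧ Legit S K F e := fun he =>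
    (List.mem_append.mp he).elim (hnew _) fun he => ⟨h.auth _ he, h.legit _ he⟩
  refine ⟨fun j s vc x σ u hj hr => ⟨_, x, σ, u, (hD hr).1.resolve_left hj⟩,
    fun v s vc hv hr => ?_, fun j s vc σ hj hr => (hD hr).2 hj, fun j s vc x σ u hr => (hD hr).2,
    fun j s c hr => (hD hr).2, fun j s vc u hr => (hD hr).2⟩
  obtain ⟨c, e, hc⟩ := h.voter v _ _ ((hD hr).1.resolve_left hv)
  cases e
  exact ⟨rfl, c, hc, rfl⟩

theorem SysInv.vcStep (h : SysInv S K F y) {i : Fin P.Nv} (hi : i ∉ K.vcs)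
    (hs : StepBy (.vc i) new out y y') (hbc : y'.bc = y.bc)
    (hnew : ∀ e ∈ new, (K.Bad e.1 ∨ e ∈ y.sent) ∧ Legit S K F e)
    (hstep : ∀ E E' : VEnv C k, VInv S K F i E (y.vc i) → E.Good S K F → E.Ext out E' →
      (∀ d x, E'.rcv d x → E.rcv d x) → (∀ e ∈ new, E.rcv e.1 e.2.2) → E.bc = y.bc →
      VInv S K F i E' (y'.vc i) ∧ VLe (y.vc i) (y'.vc i) ∧ Settled S (y'.vc i))
    (hann : ∀ j s c, (.vc j, .vc i, .announce s c) ∈ new → (((y'.vc i).ballot s).ann j).isSome)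
    (hresp : ∀ j s vc u, j ∉ K.vcs → (.vc j, .vc i, .recoverResp s vc u) ∈ new →
      ((y'.vc i).ballot s).used.isSome)
    (hrec : ∀ j s, (.vc j, .vc i, .recoverReq s) ∈ new →
      ((y.vc i).ballot s).entered = some true →
      ∃ vc u, (.vc i, .vc j, .recoverResp s vc u) ∈ y'.sent) : SysInv S K F y' := by
  refine h.step hs (fun _ => hi) hnew (hvoter := nofun) (hvc := ?_)
    (hbc := fun s b h1 h2 => by rw [hbc, h1] at h2; cases h2) (hrec := ?_)
  · intro i' e hi'
    cases e
    have hext := hs.ext (S := S) (i := i) (new ++ y.delivered) (fun e he => by rwa [hs.delivered])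
    rw [if_pos rfl] at hext
    have hold := h.vc i hi
    obtain ⟨h1, h2, h3⟩ := hstep _ _ (hold.inv.nil (E' := y.venv S (new ++ y.delivered) i)
      ⟨fun _ _ => by simp [Sys.venv], fun _ _ h => List.mem_append_right _ h, fun _ _ _ h => h,
        fun _ _ _ h => h, fun _ _ h => h⟩)
      (h.good_venv i hnew) hext (fun d x hx => by rw [← hs.delivered]; exact hx)
      (fun e he => List.mem_append_left _ (by rw [← hs.dst e he]; exact he)) rfl
    refine ⟨⟨h1, h3, fun j s c hd => ?_, fun j s vc u hj hd => ?_⟩, h2⟩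
    · rcases hs.mem hd with hd | hd
      · exact hann j s c hd
      · obtain ⟨c', hc⟩ := Option.isSome_iff_exists.mp (hold.ann j s c hd)
        exact Option.isSome_iff_exists.mpr ⟨c', h2.ann s j c' hc⟩
    · rcases hs.mem hd with hd | hd
      · exact hresp j s vc u hj hd
      · obtain ⟨c', hc⟩ := Option.isSome_iff_exists.mp (hold.resp j s vc u hj hd)
        exact Option.isSome_iff_exists.mpr ⟨c', h2.used s c' hc⟩
  · intro i' j s hd
    cases hs.dst _ hd
    exact hrec i' s hd

theorem voterRecv_choice (v : Fin P.n) (st : VoterState P) (src : Party P) (x : Msg C k) :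
    (S.voterRecv v st src x).choice = st.choice := by
  unfold Setup.voterRecv
  split
  · split <;> rfl
  · rfl

theorem receive_inv (hht : 1 ≤ P.ht) (hq : P.Nt < C.grp.q k) (h : SysInv S K F y)
    {e : Envelope C k} (he : K.Bad e.1 ∨ e ∈ y.sent) (hd : ¬ K.Bad e.2.1) (hl : Legit S K F e) :
    SysInv S K F (S.receive y e) := by
  have hnew : ∀ e' ∈ [e], (K.Bad e'.1 ∨ e' ∈ y.sent) ∧ Legit S K F e' := by
    simpa using ⟨he, hl⟩
  obtain ⟨src, d, x⟩ := e
  cases d with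
  | vc i =>
    have hi : i ∉ K.vcs := hd
    refine h.vcStep (y' := S.receive y (src, .vc i, x)) (out := (S.vcRecv i (y.vc i) src x).2)
      (new := [(src, .vc i, x)]) hi
      { vc := fun j hj => Function.update_of_ne (fun e => hj (by rw [e])) _ _ } rfl hnew ?_ ?_ ?_ ?_
    all_goals simp only [Setup.receive, Sys.emit, Function.update_self, List.mem_singleton,
      Prod.mk.injEq, true_and]
    · intro E E' h1 h2 h3 h4 h5 _
      exact vcRecv_inv h1 h2 (h5 _ rfl) h3 h4
    all_goals have hle := vcSettle_le (S := S) i (S.vcHandle i (y.vc i) src x).1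
    · rintro j s c ⟨rfl, rfl⟩
      cases hc : ((y.vc i).ballot s).ann j with
      | some c' =>
        refine Option.isSome_iff_exists.mpr ⟨c', hle.ann s j c' ?_⟩
        simp [Setup.vcHandle, hc]
      | none =>
        refine Option.isSome_iff_exists.mpr ⟨c, hle.ann s j c ?_⟩
        simp [Setup.vcHandle, hc, VCState.set]
    · rintro j s vc u hj ⟨rfl, rfl⟩
      obtain ⟨h1, h2⟩ := ((h.vc j hj).inv.ballot s).own_resp _ _ _ (he.resolve_left hj)
      have h3 := ((h.vc i hi).inv.ballot s).own_req _ ((h.auth _ h2).resolve_left hi)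
      cases hc : ((y.vc i).ballot s).used with
      | some c' =>
        refine Option.isSome_iff_exists.mpr ⟨c', hle.used s c' ?_⟩
        simp [Setup.vcHandle, hc]
      | none =>
        refine Option.isSome_iff_exists.mpr ⟨(vc, u), hle.used s _ ?_⟩
        simp [Setup.vcHandle, hc, h1, h3, VCState.set]
    · rintro j s ⟨rfl, rfl⟩ h1
      obtain ⟨h2, h3, -⟩ := ((h.vc i hi).inv.ballot s).entered _ h1
      obtain ⟨⟨vc, u⟩, hu⟩ := Option.isSome_iff_exists.mp (h3 rfl)
      refine ⟨vc, u, List.mem_append_right _ (List.mem_map.mpr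
        ⟨(.vc j, .recoverResp s vc u), List.mem_append_left _ ?_, rfl⟩)⟩
      simp [Setup.vcHandle, hu, h2]
  | bb b =>
    have hs : StepBy (.bb b) [(src, .bb b, x)] (S.bbRecv (y.bb b) src x).2 y
        (S.receive y (src, .bb b, x)) :=
      { bb := fun j hj => Function.update_of_ne (fun e => hj (by rw [e])) _ _ }
    refine h.step hs (fun _ => hd) hnew (hvoter := nofun) (hbb := fun b' e hb => ?_)
    cases e
    rw [show (S.receive y (src, .bb b, x)).bb b = (S.bbRecv (y.bb b) src x).1 from
      Function.update_self _ _ _]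
    refine bbRecv_inv hht hq (h.bb b hb).1 (fun d z => ?_) (fun d z => ?_)
    · rw [hs.delivered]
      simp [or_comm]
    · rw [hs.mem_sent]
      simp
  | tr t =>
    have hs : StepBy (.tr t) [(src, .tr t, x)] (S.trRecv t (y.tr t) src x).2 y
        (S.receive y (src, .tr t, x)) :=
      { tr := fun j hj => Function.update_of_ne (fun e => hj (by rw [e])) _ _ }
    refine h.step hs (fun _ => hd) hnew (hvoter := nofun) (htr := fun t' e ht => ?_)
    cases e
    rw [show (S.receive y (src, .tr t, x)).tr t = (S.trRecv t (y.tr t) src x).1 from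
      Function.update_self _ _ _]
    refine trRecv_inv (h.tr t ht) (fun d z => ?_) (fun d z => ?_)
    · rw [hs.delivered]
      simp [or_comm]
    · rw [hs.mem_sent]
      simp
  | voter v =>
    refine h.step (p := .voter v) (out := []) (new := [(src, .voter v, x)])
      (y' := S.receive y (src, .voter v, x))
      { choice := fun v' c hc => ?_ } (by simp) hnew
    change (Function.update y.voter v _ v').choice = some c
    rw [Function.update_apply]
    split
    · rename_i e
      rw [voterRecv_choice, ← e, hc]
    · exact hc
  | env => exact (hd trivial).elim

/-- Actions of the adversary preserve the invariants. -/
theorem exec_inv (hht : 1 ≤ P.ht) (hq : P.Nt < C.grp.q k) (h : SysInv S K F y) {a : Act C k}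
    (hl : ∀ e, a = .deliver e → Legit S K F e) : SysInv S K F (S.exec K y a) := by
  cases a with
  | deliver e =>
    simp only [Setup.exec]
    split
    · rename_i hif
      exact receive_inv hht hq h hif.1 hif.2 (hl e rfl)
    · exact h
  | tick i =>
    simp only [Setup.exec]
    split
    · exact h
    · rename_i hi
      refine h.vcStep (out := (S.vcTick i (y.vc i)).2) (new := []) hi
        { vc := fun j hj => Function.update_of_ne (fun e => hj (by rw [e])) _ _ } rfl (by simp)
        (fun E E' h1 h2 h3 h4 _ _ => ?_) (by simp) (by simp) (by simp)
      simp only [Sys.emit, Function.update_self]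
      exact vcTick_inv h1 h2 h3 h4
  | engage v c =>
    simp only [Setup.exec]
    split
    · rename_i hif
      refine h.step (p := .env) (out := []) (new := [])
        { choice := fun v' c' hc => ?_ }
      simp only
      rw [Function.update_of_ne, hc]
      rintro rfl
      rw [hif.2] at hc
      cases hc
    · exact h
  | contact v i =>
    simp only [Setup.exec]
    split
    · rename_i c hc
      split
      · rename_i hif
        have hch : ∀ v', (Function.update y.voter v { y.voter v with
            contacted := insert i (y.voter v).contacted } v').choice = (y.voter v').choice := by
          intro v'
          rw [Function.update_apply]
          split
          · rename_i e
            rw [e]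
          · rfl
        refine h.step (p := .voter v) (out := [(.vc i, .vote v (S.code v c))]) (new := [])
          { choice := fun v' c' hc => by simpa only [Sys.emit, hch] using hc }
          (fun _ => hif.1) (hvoter := fun v' e o ho => ?_)
        cases e
        rw [List.mem_singleton.mp ho]
        exact ⟨c, rfl, by simpa only [Sys.emit, hch] using hc⟩
      · exact h
    · exact h
  | bcFix s b =>
    simp only [Setup.exec]
    split
    · rename_i hif
      refine h.step (p := .env) (out := []) (new := [])
        { bc := fun s' b' hb => ?_ } (hbc := fun s' b' h1 h2 => ?_)
      · simp only
        rw [Function.update_of_ne, hb]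
        rintro rfl
        rw [hif.1] at hb
        cases hb
      · simp only [Function.update_apply] at h2
        split at h2
        · rename_i e
          cases h2
          exact e ▸ hif.2
        · rw [h1] at h2
          cases h2
    · exact h
  | bcReturn s i =>
    simp only [Setup.exec]
    split
    · rename_i b hb
      split
      · exact h
      · rename_i hi
        refine h.vcStep (out := (S.vcDecide i (y.vc i) s b).2) (new := []) hi
          { vc := fun j hj => Function.update_of_ne (fun e => hj (by rw [e])) _ _ } rfl (by simp)
          (fun E E' h1 h2 h3 h4 _ h5 => ?_) (by simp) (by simp) (by simp)
        simp only [Sys.emit, Function.update_self]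
        exact vcDecide_inv h1 h2 (by rw [h5, hb]) (h.vc i hi).settled h3 h4
    · exact h

end Step

theorem sysInv_init {S : Setup C k} {K : Corruption P}
    {F : CodePred P} (hT : P.Tbeg < P.Tend) (hfv : 3 * P.fv < P.Nv) :
    SysInv S K F {} := by
  have hend : ¬ ({} : VCState C k).Ended := fun h => by
    have : P.Tend ≤ 0 := h
    omega
  refine ⟨by simp, by simp, by simp, by simp, fun i _ => ⟨⟨fun s => ?_, fun h => (hend h).elim,
    by simp, fun _ _ _ h => by simp [Sys.venv] at h, fun _ _ _ _ h => by simp [Sys.venv] at h⟩,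
    fun h => (hend h).elim, by simp, by simp⟩, fun b _ => ⟨?_, ?_, by simp⟩, fun t _ => ?_,
    by simp, by simp⟩
  · constructor <;> simp [Sys.venv, LegitCert, -Prod.forall]
  · constructor <;> simp
  · intro h
    simp [Setup.keyShares, count] at h
    omega
  · constructor <;> simp

end

section

variable {P : Params} {C : Prims P} {k : ℕ}

/-! ### Safety from the invariants -/

section Safety

variable {S : Setup C k} {K : Corruption P} {F : CodePred P}
  {y : Sys C k}

theorem Collides.eq (h : ¬ Collides S) {a b : Word 128 × Word 64}
    (he : C.hash.hash k S.hk a = C.hash.hash k S.hk b) : a = b := by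
  by_contra hn
  exact h ⟨a, b, hn, he⟩

theorem codes_msk (s : Fin P.n) (l : Line P) : S.codes S.msk s l = S.code s (S.opt s l) :=
  C.sym.dec_enc _ _ _

theorem opt_bijective (s : Fin P.n) : Function.Bijective (S.opt s) := by
  refine ⟨fun ⟨X, p⟩ ⟨X', p'⟩ h => ?_, fun ⟨X, o⟩ =>
    ⟨(X, (S.perm s X).symm o), by simp [Setup.opt]⟩⟩
  simp only [Setup.opt, Prod.mk.injEq] at h
  obtain ⟨rfl, h⟩ := h
  rw [(S.perm s X).injective h]

/-- The total of the unit vectors over the tally set is the number of votes in the vote set. -/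
theorem sum_unit (Q : VoteSet P) (o : Fin P.m) :
    ∑ x ∈ tallySet Q (S.codes S.msk), S.unit x.1 x.2 o = (S.votesFor Q o : ZMod (C.grp.q k)) := by
  simp only [Setup.unit, Finset.sum_boole, Setup.votesFor]
  congr 1
  refine Finset.card_bij (fun x _ => x.1) ?_ ?_ ?_
  · rintro ⟨s, l⟩ hx
    simp only [tallySet, codes_msk, Finset.mem_filter, Finset.mem_univ, true_and] at hx ⊢
    exact ⟨l.1, by rw [hx.1.1, ← hx.2]; rfl⟩
  · rintro ⟨s, l⟩ hx ⟨s', l'⟩ hx' (rfl : s = s')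
    simp only [tallySet, codes_msk, Finset.mem_filter, Finset.mem_univ, true_and] at hx hx'
    rw [hx.1.1] at hx'
    rw [hx'.1.2 l (Option.some.inj hx'.1.1)]
  · intro s hs
    obtain ⟨X, hX⟩ := (Finset.mem_filter.mp hs).2
    obtain ⟨l, hl⟩ := (opt_bijective (S := S) s).2 (X, o)
    refine ⟨(s, l), ?_, rfl⟩
    simp only [tallySet, codes_msk, Finset.mem_filter, Finset.mem_univ, true_and]
    exact ⟨⟨by rw [hl, hX], fun l' h => (opt_bijective s).1 ((S.code s).injective h)⟩, by rw [hl]⟩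

theorem exists_not_mem_of_card {α : Type} {f : ℕ} {s t : Finset α} (ht : t.card ≤ f)
    (h : f + 1 ≤ s.card) : ∃ i ∈ s, i ∉ t := by
  by_contra hn
  push Not at hn
  exact absurd (Finset.card_le_card hn) (by omega)

theorem le_card_of_honest {N f : ℕ} {t : Finset (Fin N)} (ht : t.card ≤ f) {p : Fin N → Prop}
    [DecidablePred p] (h : ∀ i, i ∉ t → p i) : N - f ≤ (Finset.univ.filter p).card := by
  have h1 : tᶜ ⊆ Finset.univ.filter p := fun i hi => by simpa using h i (by simpa using hi)
  have h2 := Finset.card_le_card h1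
  rw [Finset.card_compl, Fintype.card_fin] at h2
  omega

theorem le_count_of_honest {N f : ℕ} {t : Finset (Fin N)} (ht : t.card ≤ f) {α : Type}
    {g : Fin N → Option α} (h : ∀ i, i ∉ t → (g i).isSome) : N - f ≤ count g :=
  le_card_of_honest ht h

/-- No VC node has endorsed two vote codes of a ballot. -/
def Unique (F : CodePred P) : Prop :=
  ∀ j s vc vc', F j s vc → F j s vc' → vc = vc'

/-- There are no valid certificates for different vote codes of a ballot. -/
theorem SysInv.used_eq (h : SysInv S K F y) (hfv : 3 * P.fv < P.Nv) (hF : Unique F)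
    {i i' : Fin P.Nv} (hi : i ∉ K.vcs) (hi' : i' ∉ K.vcs) {s : Fin P.n} {c c' : Word 128 × Cert C k}
    (hc : ((y.vc i).ballot s).used = some c) (hc' : ((y.vc i').ballot s).used = some c') :
    c.1 = c'.1 := by
  have h1 := ((h.vc i hi).inv.ballot s).used c hc
  have h2 := ((h.vc i' hi').inv.ballot s).used c' hc'
  obtain ⟨j, -, h3, h4⟩ := (h1.2.quorum h1.1.2).inter hfv (h2.2.quorum h2.1.2)
  exact hF j s _ _ h3 h4

theorem SysInv.voteSet_eq (h : SysInv S K F y) (hfv : 3 * P.fv < P.Nv) (hF : Unique F)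
    {i i' : Fin P.Nv} (hi : i ∉ K.vcs) (hi' : i' ∉ K.vcs) {d d' : Party P} {Q Q' : VoteSet P}
    {x x' : Word 128} {σ σ' : Sg C k} (h1 : (.vc i, d, .voteSet Q x σ) ∈ y.sent)
    (h2 : (.vc i', d', .voteSet Q' x' σ') ∈ y.sent) : Q = Q' := by
  funext s
  have h3 := (h.vc i hi).inv.ballot s
  have h4 := (h.vc i' hi').inv.ballot s
  rcases h3.own_set _ _ _ _ h1 with ⟨h5, h6⟩ | ⟨h5, c, h6, h7⟩ <;>
    rcases h4.own_set _ _ _ _ h2 with ⟨h8, h9⟩ | ⟨h8, c', h9, h10⟩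
  · rw [h6, h9]
  · cases (h3.decided _ h5).1.symm.trans (h4.decided _ h8).1
  · cases (h3.decided _ h5).1.symm.trans (h4.decided _ h8).1
  · rw [h7, h10, h.used_eq hfv hF hi hi' h6 h9]

/-- A vote code for which a quorum of VC nodes has disclosed receipt shares is in the vote set:
one of those nodes takes part in any collection of announcements on which an opinion is based. -/
theorem SysInv.voteSet_of_quorum (h : SysInv S K F y) (hfv : 3 * P.fv < P.Nv) (hF : Unique F)
    {i : Fin P.Nv} (hi : i ∉ K.vcs) {d : Party P} {Q : VoteSet P} {x : Word 128} {σ : Sg C k}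
    (h1 : (.vc i, d, .voteSet Q x σ) ∈ y.sent) {s : Fin P.n} {vc : Word 128}
    (hq : Quorum K fun j => y.VoteP j s vc) : Q s = some vc := by
  rcases ((h.vc i hi).inv.ballot s).own_set _ _ _ _ h1 with ⟨h5, -⟩ | ⟨-, c, h6, h7⟩
  · obtain ⟨i', hi', h2⟩ := h.bc s false (((h.vc i hi).inv.ballot s).decided _ h5).1
    obtain ⟨-, -, J, hJ, h3⟩ := ((h.vc i' hi').inv.ballot s).entered _ h2
    obtain ⟨j, hj, ⟨d', x', σ', u, h4⟩, c, h6, h7⟩ := hq.inter hfv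
      (Quorum.of_subset (K := K) hJ fun j hj _ => h3 j hj)
    have h8 := (h.auth _ (((h.vc i' hi').inv.ballot s).ann j c h6)).resolve_left hj
    obtain ⟨u', h9, h10⟩ := (((h.vc j hj).inv.ballot s).own_announce _ c h8).2 _ _ _ _ _ h4
    exact absurd h10 (h7 rfl _ h9)
  · obtain ⟨j, hj, ⟨d', x', σ', u, h4⟩, -⟩ := hq.inter hfv hq
    obtain ⟨u', h8⟩ := ((h.vc j hj).inv.ballot s).own_voteP _ _ _ _ _ h4
    rw [h7, h.used_eq hfv hF hi hj h6 h8]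

theorem SysInv.pub (h : SysInv S K F y) {b : Fin P.Nb} (hb : b ∉ K.bbs) {Q : VoteSet P}
    (hQ : (y.bb b).pub = some Q) :
    ∃ i, i ∉ K.vcs ∧ ∃ d x σ, (.vc i, d, .voteSet Q x σ) ∈ y.sent := by
  obtain ⟨i, hi, hk⟩ := exists_not_mem_of_card K.vcs_le ((h.bb b hb).1.pub Q hQ)
  obtain ⟨⟨Q', x, σ⟩, hg, e⟩ := Option.map_eq_some_iff.mp (Finset.mem_filter.mp hi).2
  cases e
  exact ⟨i, hk, _, x, σ, (h.auth _ ((h.bb b hb).1.got i _ _ _ hg)).resolve_left hk⟩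

theorem SysInv.key (h : SysInv S K F y) (hcol : ¬ Collides S) {b : Fin P.Nb} (hb : b ∉ K.bbs)
    {κ : Word 128} (hκ : (y.bb b).key = some κ) : κ = S.msk :=
  congrArg Prod.fst (Collides.eq hcol ((h.bb b hb).1.key κ hκ))

/-- In a complete run, all honest VC nodes have sent the same vote set to all BB nodes. -/
theorem SysInv.done (h : SysInv S K F y) (hc : y.Complete K)
    {i : Fin P.Nv} (hi : i ∉ K.vcs) : (y.vc i).done = true := by
  obtain ⟨hend, hdel, hdec⟩ := hc
  refine ((h.vc i hi).settled (hend i hi)).2 fun s => ?_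
  have hent : ∀ i, i ∉ K.vcs → ((y.vc i).ballot s).entered.isSome := fun i hi => by
    refine (((h.vc i hi).settled (hend i hi)).1 s).2 (le_count_of_honest K.vcs_le fun j hj => ?_)
    obtain ⟨c, h1⟩ := (h.vc j hj).inv.announced (hend j hj) s i
    exact (h.vc i hi).ann j s c (hdel _ h1 trivial trivial hi)
  obtain ⟨v, hv⟩ := Option.isSome_iff_exists.mp (hdec s hent i hi)
  cases v with
  | false => exact .inl hv
  | true =>
    refine .inr ⟨hv, ?_⟩
    rcases ((h.vc i hi).inv.ballot s).recover hv with h1 | h1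
    · exact h1
    · obtain ⟨j, hj, -, h2⟩ := h.recover s (((h.vc i hi).inv.ballot s).decided _ hv).1
      obtain ⟨vc, u, h3⟩ := h2 i hi (hdel _ (h1 j) trivial trivial hj)
      exact (h.vc i hi).resp j s vc u hj (hdel _ h3 trivial trivial hi)

/-- Shares accepted by a BB node are shares of the master key. -/
theorem recKey_eq {st : BBState C k} (hfv : P.fv < P.Nv)
    (hea : ∀ i x, S.keyShares st i = some x → x = S.kshare i)
    (hc : P.Nv - P.fv ≤ count (S.keyShares st)) : S.recKey st = S.msk := by
  unfold Setup.recKey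
  rw [Equiv.symm_apply_eq]
  refine shamirRec_eq (t := P.Nv - P.fv) (by omega)
    (Units.val_injective.comp P.pt128.injective) (c := S.mpoly) (fun i z hz => ?_) ?_
  · obtain ⟨x, hx, rfl⟩ := Option.map_eq_some_iff.mp hz
    rw [hea i x hx, Setup.kshare, Equiv.apply_symm_apply]
    rfl
  · simpa [count] using hc

theorem safe_of_inv (h : SysInv S K F y) (hfv : 3 * P.fv < P.Nv) (hfb : 2 * P.fb < P.Nb)
    (hNt : P.ht ≤ P.Nt) (hn : P.n < C.grp.q k) (hF : Unique F) (hcol : ¬ Collides S)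
    (hea : ∀ e ∈ y.delivered, ∀ Q x σ, e.2.2 = .voteSet Q x σ → ∀ i,
      C.sig.verify k S.eaVk (.kshare i x) σ = true → x = S.kshare i)
    (hok : ∀ v, v ∉ K.voters → (y.voter v).ok = true → ∃ c, (y.voter v).choice = some c ∧
      Quorum K fun j => y.VoteP j v (S.code v c)) : Safe S K y := by
  intro v hv hvok
  obtain ⟨c, hc, hq⟩ := hok v hv hvok
  refine ⟨c, hc, fun b hb => ⟨fun Q hQ => ?_, fun R hR => ?_, fun hcomp => ?_⟩⟩
  · obtain ⟨i, hi, d, x, σ, h1⟩ := h.pub hb hQ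
    exact h.voteSet_of_quorum hfv hF hi h1 hq
  · obtain ⟨Q, κ, h1, h2, h3⟩ := (h.bb b hb).1.result R hR
    refine ⟨Q, h1, fun o => ?_⟩
    rw [h3, h.key hcol hb h2, sum_unit, ZMod.val_natCast_of_lt]
    exact ((Finset.card_le_univ _).trans (Fintype.card_fin _).le).trans_lt hn
  · have hdel := hcomp.2.1
    -- every honest BB node has received the vote sets and key shares of all honest VC nodes
    have hgot : ∀ b, b ∉ K.bbs → ∀ i, i ∉ K.vcs → ∃ Q, (.vc i, .bb b,
        .voteSet Q (S.kshare i) (S.kshareSig i)) ∈ y.sent ∧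
        (y.bb b).got i = some (Q, S.kshare i, S.kshareSig i) := fun b hb i hi => by
      obtain ⟨Q, h1⟩ := (h.vc i hi).inv.done (h.done hcomp hi)
      obtain ⟨⟨Q', x, σ⟩, h2⟩ := Option.isSome_iff_exists.mp
        ((h.bb b hb).1.got_some i _ _ _ (hdel _ (h1 b) trivial trivial hb))
      have h3 := (h.auth _ ((h.bb b hb).1.got i _ _ _ h2)).resolve_left hi
      obtain ⟨rfl, rfl⟩ := (h.vc i hi).inv.own_share _ _ _ _ h3
      exact ⟨Q', h3, h2⟩
    obtain ⟨i₀, -, hi₀⟩ := exists_not_mem_of_card K.vcs_le (s := Finset.univ)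
      (by rw [Finset.card_univ, Fintype.card_fin]; omega)
    obtain ⟨Q, hQ, -⟩ := hgot b hb i₀ hi₀
    have hpub : ∀ b, b ∉ K.bbs → (y.bb b).pub = some Q := fun b hb => by
      obtain ⟨Q', hQ'⟩ := Option.isSome_iff_exists.mp ((h.bb b hb).1.pub_some Q
        (le_trans (b := P.Nv - P.fv) (by omega) (le_card_of_honest K.vcs_le
            (p := fun j => ((y.bb b).got j).map Prod.fst = some Q) fun i hi => by
          obtain ⟨Q', h1, h2⟩ := hgot b hb i hi
          rw [h2, h.voteSet_eq hfv hF hi₀ hi hQ h1]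
          rfl)))
      obtain ⟨i, hi, d, x, σ, h1⟩ := h.pub hb hQ'
      rw [hQ', h.voteSet_eq hfv hF hi hi₀ h1 hQ]
    have hkey : ∀ b, b ∉ K.bbs → (y.bb b).key = some S.msk := fun b hb => by
      have h1 : P.Nv - P.fv ≤ count (S.keyShares (y.bb b)) :=
        le_count_of_honest K.vcs_le fun i hi => by
          obtain ⟨Q', -, h2⟩ := hgot b hb i hi
          rw [Setup.keyShares, h2, Option.bind_some, if_pos]
          · rfl
          · exact C.sig.correct _ _ _ _
      have h2 : S.recKey (y.bb b) = S.msk := recKey_eq (by omega) (fun i x hx => by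
        obtain ⟨⟨Q', x', σ⟩, h3, h4⟩ := Option.bind_eq_some_iff.mp hx
        split at h4
        · cases h4
          exact hea _ ((h.bb b hb).1.got i _ _ _ h3) _ _ _ rfl i ‹_›
        · cases h4) h1
      obtain ⟨κ, hκ⟩ := Option.isSome_iff_exists.mp ((h.bb b hb).2.key h1 (by rw [h2]; rfl))
      rw [hκ, h.key hcol hb hκ]
    -- the only data sent by honest BB nodes
    have hdata : ∀ b, b ∉ K.bbs → ∀ d Q' D, (.bb b, d, .bbData Q' D) ∈ y.sent →
        Q' = Q ∧ D = S.codes S.msk := fun b hb d Q' D h1 => by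
      obtain ⟨κ, h2, h3, rfl⟩ := (h.bb b hb).1.own_data _ _ _ h1
      rw [hpub b hb] at h2
      exact ⟨(Option.some.inj h2).symm, by rw [h.key hcol hb h3]⟩
    have hopen : ∀ t, t ∉ K.trs → ∀ d o T, (.tr t, d, .opening o T) ∈ y.sent →
        T = S.tallyShare (tallySet Q (S.codes S.msk)) t := fun t ht d o T h1 => by
      obtain ⟨Q', D, h2, rfl⟩ := (h.tr t ht).own_opening _ _ _ h1
      obtain ⟨b', hb', h3⟩ := exists_not_mem_of_card K.bbs_le h2
      obtain ⟨rfl, rfl⟩ := hdata b' h3 _ _ _ ((h.auth _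
        ((h.tr t ht).got b' _ _ (Finset.mem_filter.mp hb').2)).resolve_left h3)
      rfl
    have hpost : ∀ t, t ∉ K.trs → (y.bb b).posts t =
        some (S.tallyShare (tallySet Q (S.codes S.msk)) t) := fun t ht => by
      have h1 : (y.tr t).done = true := (h.tr t ht).done Q (S.codes S.msk)
        (le_trans (b := P.Nb - P.fb) (by omega) (le_card_of_honest K.bbs_le fun b' hb' => by
          obtain ⟨Q', κ, h2, h3, h4⟩ := (h.bb b' hb').1.shown
            ((h.bb b' hb').2.rest Q _ (hpub b' hb') (hkey b' hb')).1
          obtain ⟨⟨Q'', D⟩, h5⟩ := Option.isSome_iff_exists.mp ((h.tr t ht).got_some b' _ _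
            (hdel _ (h4 t) trivial trivial ht))
          obtain ⟨rfl, rfl⟩ := hdata b' hb' _ _ _
            ((h.auth _ ((h.tr t ht).got b' _ _ h5)).resolve_left hb')
          exact h5))
      obtain ⟨o, T, h2⟩ := (h.tr t ht).sent h1 b
      obtain ⟨T', h3⟩ := Option.isSome_iff_exists.mp ((h.bb b hb).1.posts_some t o T
        (hdel _ h2 trivial trivial hb))
      obtain ⟨o', h4⟩ := (h.bb b hb).1.posts t T' h3
      rw [h3, hopen t ht _ _ _ ((h.auth _ h4).resolve_left ht)]
    refine ⟨by rw [hpub b hb]; rfl, ((h.bb b hb).2.rest Q _ (hpub b hb) (hkey b hb)).2 ?_⟩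
    refine le_trans (b := P.Nt - (P.Nt - P.ht)) (by omega)
      (le_count_of_honest K.trs_le fun t ht => ?_)
    rw [hpost t ht, Option.filter_some, if_pos (decide_eq_true ((validPost_iff _ _ _ _).mpr rfl))]
    rfl

end Safety

/-! ### Invariants along runs -/

section Run

variable (A : Adversary C k) (ω : A.Runs)

theorem Adversary.sysAt_induct {p : Sys C k → Prop} (h0 : p {})
    (h1 : ∀ r a, A.actAt ω r = some a → p (A.sysAt ω r) → p (ω.1.exec A.corr (A.sysAt ω r) a))
    (h2 : ∀ y, p y → p { y with unread := y.unread.tail }) (r : ℕ) : p (A.sysAt ω r) := by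
  induction r with
  | zero => exact h0
  | succ r ih =>
    by_cases hr : r < A.alg.rounds
    · rw [A.sysAt_succ ω ⟨r, hr⟩]
      apply h2
      unfold Adversary.midAt
      cases ha : A.actAt ω ⟨r, hr⟩ with
      | none => exact ih
      | some a => exact h1 _ a ha ih
    · rw [A.sysAt_of_le ω (by omega : _ ≤ r + 1), ← A.sysAt_of_le ω (by omega : _ ≤ r)]
      exact ih

theorem exec_delivered {S : Setup C k} {K : Corruption P} {y : Sys C k} {a : Act C k}
    {e : Envelope C k} (h : e ∈ (S.exec K y a).delivered) : e ∈ y.delivered ∨ a = .deliver e := by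
  revert h
  cases a with
  | deliver e' =>
    simp only [Setup.exec]
    split
    · obtain ⟨src, d, x⟩ := e'
      cases d <;> simp [Setup.receive, Sys.emit, or_comm, eq_comm]
    · exact .inl
  | _ => simp only [Setup.exec]; split_ifs <;> first | exact .inl | (split <;> exact .inl)

theorem Adversary.delivered_act {r : ℕ} {e : Envelope C k} (h : e ∈ (A.sysAt ω r).delivered) :
    ∃ r', A.actAt ω r' = some (.deliver e) := by
  revert e
  refine A.sysAt_induct ω (p := fun y => ∀ {e}, e ∈ y.delivered →
    ∃ r', A.actAt ω r' = some (.deliver e)) (by simp) (fun r a ha ih e he => ?_) (fun y h => h) r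
  rcases exec_delivered he with he | rfl
  · exact ih he
  · exact ⟨r, ha⟩

/-- Bounds on the numbers of servers, and voting hours that are not empty. -/
structure Admissible (C : Prims P) (k : ℕ) : Prop where
  time : P.Tbeg < P.Tend
  vc : 3 * P.fv < P.Nv
  bb : 2 * P.fb < P.Nb
  ht : 1 ≤ P.ht
  tr : P.ht ≤ P.Nt
  n : P.n < C.grp.q k
  q : P.Nt < C.grp.q k

theorem Adversary.sysInv_sysAt (hP : Admissible C k) {F : CodePred P}
    (hl : ∀ r e, A.actAt ω r = some (.deliver e) → Legit ω.1 A.corr F e) (r : ℕ) :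
    SysInv ω.1 A.corr F (A.sysAt ω r) :=
  A.sysAt_induct ω (sysInv_init hP.time hP.vc)
    (fun r _ ha h => exec_inv hP.ht hP.q h fun e he => hl r e (he ▸ ha))
    (fun _ h => ⟨h.good, h.auth, h.legit, h.voter,
      fun i hi => ⟨(h.vc i hi).inv, (h.vc i hi).settled, (h.vc i hi).ann, (h.vc i hi).resp⟩,
      h.bb, h.tr, h.bc, h.recover⟩) r

theorem legit_of_not_forgesVC {A : Adversary C k} {ω : A.Runs}
    (h : ¬ ForgesVC A ω) {r : Fin A.alg.rounds} {e : Envelope C k}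
    (he : A.actAt ω r = some (.deliver e)) : Legit ω.1 A.corr (Endorsed (A.run ω)) e := by
  have key : ∀ j, j ∉ A.corr.vcs → ∀ σ, sigAt j (.deliver e) = some σ → ∀ s vc,
      C.sig.verify k (ω.1.vk j) (.endorse s vc) σ = true → Endorsed (A.run ω) j s vc := by
    intro j hj σ hσ s vc hv
    by_contra hn
    exact h ⟨j, hj, r, _, σ, s, vc, he, hσ, hv, hn⟩
  clear he h
  unfold Legit
  split
  · exact fun hj => key _ hj _ rfl
  · exact key
  · exact key
  · exact key
  · trivial

theorem unique_endorsed (y : Sys C k) : Unique (Endorsed y) := by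
  rintro j s vc vc' ⟨σ, h⟩ ⟨σ', h'⟩
  rw [h] at h'
  cases h'
  rfl

end Run

end

section

variable {P : Params} {C : Prims P} {k : ℕ}

/-! ### Changing a receipt without changing the shares of a set of nodes -/

/-- The polynomial with value `1` at `0` and value `0` at the points of the nodes in `D`. -/
def maskPoly (D : Finset (Fin P.Nv)) : Polynomial (GaloisField 2 64) :=
  ∏ j ∈ D, (1 - Polynomial.C (P.pt64 j : GaloisField 2 64)⁻¹ * Polynomial.X)

/-- Higher coefficients of `maskPoly`. -/
def maskCoeff (D : Finset (Fin P.Nv)) (j : Fin (P.Nv - P.fv - 1)) : GaloisField 2 64 :=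
  (maskPoly D).coeff (j.val + 1)

theorem shamirShare_mask (hfv : P.fv < P.Nv) {D : Finset (Fin P.Nv)} (hD : D.card < P.Nv - P.fv)
    (a δ : GaloisField 2 64) (f : Fin (P.Nv - P.fv - 1) → GaloisField 2 64) {i : Fin P.Nv}
    (hi : i ∈ D) : shamirShare (t := P.Nv - P.fv) (a + δ) (f + δ • maskCoeff D) (P.pt64 i) =
      shamirShare (t := P.Nv - P.fv) a f (P.pt64 i : GaloisField 2 64) := by
  set x : GaloisField 2 64 := Units.val (P.pt64 i)
  have h0 : (maskPoly D).eval x = 0 := by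
    rw [maskPoly, Polynomial.eval_prod]
    exact Finset.prod_eq_zero hi (by simp [x])
  have hdeg : (maskPoly D).natDegree < P.Nv - P.fv - 1 + 1 := by
    refine ((Polynomial.natDegree_prod_le _ _).trans (Finset.sum_le_card_nsmul _ _ 1
      fun j _ => ?_)).trans_lt (by simp; omega)
    refine (Polynomial.natDegree_sub_le _ _).trans (max_le (by simp) ?_)
    exact (Polynomial.natDegree_C_mul_le _ _).trans Polynomial.natDegree_X_le
  rw [Polynomial.eval_eq_sum_range' hdeg, Finset.sum_range_succ', ← Fin.sum_univ_eq_sum_range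
    (fun j => (maskPoly D).coeff (j + 1) * x ^ (j + 1))] at h0
  have h1 : (maskPoly D).coeff 0 = 1 := by
    rw [Polynomial.coeff_zero_eq_eval_zero, maskPoly, Polynomial.eval_prod]
    simp
  rw [h1] at h0
  simp only [shamirShare, Pi.add_apply, Pi.smul_apply, smul_eq_mul, add_mul,
    Finset.sum_add_distrib, mul_assoc, ← Finset.mul_sum]
  unfold maskCoeff
  linear_combination δ * h0

/-- The position of a (part, option). -/
def Setup.pos (S : Setup C k) (v : Fin P.n) (c : Line P) : Line P :=
  (c.1, (S.perm v c.1).symm c.2)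

theorem opt_pos (S : Setup C k) (v : Fin P.n) (c : Line P) : S.opt v (S.pos v c) = c := by
  simp [Setup.opt, Setup.pos]

/-- Add `δ` to the receipt of voter `v` for choice `c`, leaving the shares of the nodes in `D`
unchanged. -/
def Setup.shift (S : Setup C k) (v : Fin P.n) (c : Line P) (D : Finset (Fin P.Nv))
    (δ : GaloisField 2 64) : Setup C k :=
  { S with
    rcpt := Function.update S.rcpt v (Function.update (S.rcpt v) c
      ((toField 64).symm (toField 64 (S.rcpt v c) + δ)))
    rpoly := Function.update S.rpoly v (Function.update (S.rpoly v) (S.pos v c)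
      (S.rpoly v (S.pos v c) + δ • maskCoeff D)) }

section Shift

variable {S : Setup C k} {v : Fin P.n} {c : Line P} {D : Finset (Fin P.Nv)} {δ : GaloisField 2 64}

theorem shift_rcpt_self : (S.shift v c D δ).rcpt v c =
    (toField 64).symm (toField 64 (S.rcpt v c) + δ) := by
  simp [Setup.shift]

theorem shift_rcpt_of_ne {v' : Fin P.n} {c' : Line P} (h : (v', c') ≠ (v, c)) :
    (S.shift v c D δ).rcpt v' c' = S.rcpt v' c' := by
  simp only [Setup.shift]
  by_cases e : v' = v
  · subst e
    rw [Function.update_self, Function.update_of_ne]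
    rintro rfl
    exact h rfl
  · rw [Function.update_of_ne e]

theorem shift_shift : (S.shift v c D δ).shift v c D (-δ) = S := by
  cases S
  simp [Setup.shift, Setup.pos]

theorem shift_rshare (hfv : P.fv < P.Nv) (hD : D.card < P.Nv - P.fv) {s : Fin P.n} {l : Line P}
    {i : Fin P.Nv} (h : i ∈ D ∨ (s, S.opt s l) ≠ (v, c)) :
    (S.shift v c D δ).rshare s l i = S.rshare s l i := by
  unfold Setup.rshare
  congr 1
  by_cases hs : (s, S.opt s l) = (v, c)
  · obtain ⟨rfl, hl⟩ := Prod.mk.inj hs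
    have hl' : S.pos s c = l := (opt_bijective s).1 ((opt_pos S s c).trans hl.symm)
    have e1 : (S.shift s c D δ).opt s l = c := hl
    have e2 : (S.shift s c D δ).rpoly s l = S.rpoly s l + δ • maskCoeff D := by
      simp [Setup.shift, hl']
    rw [e1, shift_rcpt_self, e2, Equiv.apply_symm_apply, hl]
    exact shamirShare_mask hfv hD _ _ _ (h.resolve_right (not_not.mpr hs))
  · rw [show (S.shift v c D δ).opt s l = S.opt s l from rfl, shift_rcpt_of_ne hs]
    congr 1
    simp only [Setup.shift]
    by_cases e : s = v
    · subst e
      rw [Function.update_self, Function.update_of_ne]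
      rintro rfl
      exact hs (by rw [opt_pos])
    · rw [Function.update_of_ne e]

theorem shift_view (hfv : P.fv < P.Nv) (hD : D.card < P.Nv - P.fv) {K : Corruption P}
    (hK : K.vcs ⊆ D) (hv : v ∉ K.voters) : (S.shift v c D δ).view K = S.view K := by
  unfold Setup.view
  refine congrArg₂ _ rfl (congrArg₂ _ ?_ (congrArg₂ _ rfl ?_))
  · funext i
    by_cases hi : i ∈ K.vcs
    · have h := fun s l => shift_rshare (δ := δ) (v := v) (c := c) (S := S) hfv hD (s := s)
        (l := l) (.inl (hK hi))
      simp only [if_pos hi, Setup.rshareSig, h]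
      rfl
    · rw [if_neg hi, if_neg hi]
  · funext v'
    by_cases hv' : v' ∈ K.voters
    · have h := fun c' => shift_rcpt_of_ne (S := S) (D := D) (δ := δ) (c := c) (c' := c')
        (v := v) (v' := v') (fun e => hv ((Prod.mk.inj e).1 ▸ hv'))
      simp only [if_pos hv', h]
      rfl
    · rw [if_neg hv', if_neg hv']

theorem shift_rel (hfv : P.fv < P.Nv) (hD : D.card < P.Nv - P.fv) {dis : Fin P.Nv → Fin P.n →
    Line P → Prop} (h : ∀ i s l, dis i s l → i ∈ D ∨ (s, S.opt s l) ≠ (v, c)) :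
    SetupRel (PayRel.eq C k) (fun _ _ _ => True) dis S (S.shift v c D δ) :=
  let r := setupRel_refl S
  ⟨r.lineOf, r.verify, r.verifyEA, r.endorse, fun i s l hd => by
    have e := shift_rshare (δ := δ) hfv hD (h i s l hd)
    exact ⟨e.symm, by rw [Setup.rshareSig, Setup.rshareSig, e]; rfl⟩,
    r.kshare, r.hmsk, r.codes, r.post, r.tshare, r.code, r.os_refl, r.op_refl, r.rs_refl⟩

end Shift

/-! ### Answers to voters -/

section Voter

variable {S : Setup C k} {K : Corruption P} {y : Sys C k}

theorem voterRecv_spec (v : Fin P.n) (st : VoterState P) (src : Party P) (x : Msg C k) :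
    st.answered ⊆ (S.voterRecv v st src x).answered ∧
    (st.ok = true → (S.voterRecv v st src x).ok = true) ∧
    ((S.voterRecv v st src x).ok = true → st.ok = true ∨ ∃ i c, src = .vc i ∧
      x = .receipt (S.rcpt v c) ∧ st.choice = some c ∧ i ∈ st.contacted ∧ i ∉ st.answered) := by
  unfold Setup.voterRecv
  split
  · rename_i i r c hc
    split
    · rename_i hif
      refine ⟨Finset.subset_insert _ _, fun h => by simp [h], fun h => ?_⟩
      simp only [Bool.or_eq_true, decide_eq_true_eq] at h
      exact h.imp_right fun h => ⟨i, c, rfl, by rw [h], hc, hif⟩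
    · exact ⟨subset_rfl, id, .inl⟩
  · exact ⟨subset_rfl, id, .inl⟩

/-- How an action changes the state of a voter. -/
theorem exec_voter (S : Setup C k) (K : Corruption P) (y : Sys C k) (a : Act C k) (v : Fin P.n) :
    (∀ c, (y.voter v).choice = some c → ((S.exec K y a).voter v).choice = some c) ∧
    (((S.exec K y a).voter v).answered = (y.voter v).answered ∧
      ((S.exec K y a).voter v).ok = (y.voter v).ok ∨ ∃ src x, a = .deliver (src, .voter v, x) ∧
        (K.Bad src ∨ (src, .voter v, x) ∈ y.sent) ∧
        (S.exec K y a).voter v = S.voterRecv v (y.voter v) src x) := by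
  cases a with
  | deliver e =>
    obtain ⟨src, d, x⟩ := e
    simp only [Setup.exec]
    split
    · rename_i hif
      cases d with
      | voter v' =>
        by_cases e : v = v'
        · subst e
          have h : (S.receive y (src, .voter v, x)).voter v = S.voterRecv v (y.voter v) src x :=
            Function.update_self _ _ _
          rw [h]
          exact ⟨fun c hc => by rw [voterRecv_choice, hc], .inr ⟨src, x, rfl, hif.1, rfl⟩⟩
        · have h : (S.receive y (src, .voter v', x)).voter v = y.voter v :=
            Function.update_of_ne e _ _
          rw [h]
          exact ⟨fun _ h => h, .inl ⟨rfl, rfl⟩⟩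
      | _ => exact ⟨fun _ h => h, .inl ⟨rfl, rfl⟩⟩
    · exact ⟨fun _ h => h, .inl ⟨rfl, rfl⟩⟩
  | engage v' c =>
    simp only [Setup.exec]
    split
    · rename_i hif
      refine ⟨?_, .inl ?_⟩ <;> by_cases e : v = v' <;> simp_all
    · exact ⟨fun _ h => h, .inl ⟨rfl, rfl⟩⟩
  | contact v' i =>
    simp only [Setup.exec]
    split
    · split
      · refine ⟨?_, .inl ?_⟩ <;> by_cases e : v = v' <;> simp_all [Sys.emit]
      · exact ⟨fun _ h => h, .inl ⟨rfl, rfl⟩⟩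
    · exact ⟨fun _ h => h, .inl ⟨rfl, rfl⟩⟩
  | tick i =>
    simp only [Setup.exec]
    split <;> exact ⟨fun _ h => h, .inl ⟨rfl, rfl⟩⟩
  | bcFix s b =>
    simp only [Setup.exec]
    split <;> exact ⟨fun _ h => h, .inl ⟨rfl, rfl⟩⟩
  | bcReturn s i =>
    simp only [Setup.exec]
    split
    · split <;> exact ⟨fun _ h => h, .inl ⟨rfl, rfl⟩⟩
    · exact ⟨fun _ h => h, .inl ⟨rfl, rfl⟩⟩

end Voter

section Run

variable (A : Adversary C k) (ω : A.Runs)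

theorem Adversary.voter_mono {r r' : ℕ} (h : r ≤ r') (v : Fin P.n) :
    (∀ c, ((A.sysAt ω r).voter v).choice = some c → ((A.sysAt ω r').voter v).choice = some c) ∧
    ((A.sysAt ω r).voter v).answered ⊆ ((A.sysAt ω r').voter v).answered ∧
    (((A.sysAt ω r).voter v).ok = true → ((A.sysAt ω r').voter v).ok = true) ∧
    ((A.sysAt ω r).sent ⊆ (A.sysAt ω r').sent) :=
  A.sysAt_mono ω (p := fun y => (∀ c, ((A.sysAt ω r).voter v).choice = some c →
      (y.voter v).choice = some c) ∧ ((A.sysAt ω r).voter v).answered ⊆ (y.voter v).answered ∧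
      (((A.sysAt ω r).voter v).ok = true → (y.voter v).ok = true) ∧ (A.sysAt ω r).sent ⊆ y.sent)
    (fun y a hy => by
      obtain ⟨h1, h2⟩ := exec_voter ω.1 A.corr y a v
      obtain ⟨es, h3, -⟩ := exec_lists ω.1 A.corr y a
      refine ⟨fun c hc => h1 c (hy.1 c hc), ?_, ?_, fun e he => by
        rw [h3]; exact List.mem_append_left _ (hy.2.2.2 he)⟩
      · rcases h2 with h2 | ⟨src, x, -, -, h2⟩
        · rw [h2.1]
          exact hy.2.1
        · rw [h2]
          exact hy.2.1.trans (voterRecv_spec v _ src x).1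
      · rcases h2 with h2 | ⟨src, x, -, -, h2⟩
        · rw [h2.2]
          exact hy.2.2.1
        · rw [h2]
          exact fun h => (voterRecv_spec v _ src x).2.1 (hy.2.2.1 h))
    (fun _ h => h) h ⟨fun _ h => h, subset_rfl, id, List.Subset.refl _⟩

/-- In round `r` voter `v`, who has made choice `c`, gets and considers the answer `x` from VC
node `i`. -/
def Accepts (v : Fin P.n) (i : Fin P.Nv) (r : Fin A.alg.rounds) (c : Line P) (x : Word 64) : Prop :=
  A.actAt ω r = some (.deliver (.vc i, .voter v, .receipt x)) ∧
  ((A.sysAt ω r).voter v).choice = some c ∧ i ∈ ((A.sysAt ω r).voter v).contacted ∧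
  i ∉ ((A.sysAt ω r).voter v).answered

variable {A ω}

theorem Accepts.next {v : Fin P.n} {i : Fin P.Nv} {r : Fin A.alg.rounds} {c : Line P} {x : Word 64}
    (h : Accepts A ω v i r c x) (hv : v ∉ A.corr.voters)
    (hi : A.corr.Bad (.vc i) ∨ (.vc i, .voter v, .receipt x) ∈ (A.sysAt ω r).sent) :
    i ∈ ((A.sysAt ω (r + 1)).voter v).answered ∧
      (x = ω.1.rcpt v c → ((A.sysAt ω (r + 1)).voter v).ok = true) := by
  rw [A.sysAt_succ ω r]
  unfold Adversary.midAt
  rw [h.1]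
  simp only [Setup.exec]
  rw [if_pos ⟨hi, hv⟩]
  have e : (ω.1.receive (A.sysAt ω r) (.vc i, .voter v, .receipt x)).voter v =
    ω.1.voterRecv v ((A.sysAt ω r).voter v) (.vc i) (.receipt x) := Function.update_self _ _ _
  rw [e]
  simp only [Setup.voterRecv, h.2.1, if_pos h.2.2]
  exact ⟨Finset.mem_insert_self _ _, fun h => by simp [h]⟩

/-- A corrupted node is heard by a voter once. -/
theorem Accepts.unique {v : Fin P.n} (hv : v ∉ A.corr.voters) {i : Fin P.Nv} (hi : i ∈ A.corr.vcs)
    {r r' : Fin A.alg.rounds} {c c' : Line P} {x x' : Word 64} (h : Accepts A ω v i r c x)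
    (h' : Accepts A ω v i r' c' x') : r = r' ∧ c = c' ∧ x = x' := by
  have key : ∀ {r r' : Fin A.alg.rounds} {c c' x x'}, Accepts A ω v i r c x →
      Accepts A ω v i r' c' x' → ¬ r < r' := fun {r r' c c' x x'} h h' hlt =>
    h'.2.2.2 ((A.voter_mono ω (Nat.succ_le_of_lt hlt) v).2.1 (h.next hv (.inl hi)).1)
  obtain rfl : r = r' := le_antisymm (not_lt.mp (key h' h)) (not_lt.mp (key h h'))
  have h1 := h.1.symm.trans h'.1
  have h2 := h.2.1.symm.trans h'.2.1
  simp only [Option.some.injEq, Act.deliver.injEq, Prod.mk.injEq, Msg.receipt.injEq, true_and]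
    at h1 h2
  exact ⟨rfl, h2, h1⟩

/-- A voter gets her receipt from corrupted node `i` although too few shares are disclosed. -/
def Cheats (A : Adversary C k) (ω : A.Runs) (v : Fin P.n) (i : Fin P.Nv)
    (r : Fin A.alg.rounds) (c : Line P) : Prop :=
  Accepts A ω v i r c (ω.1.rcpt v c) ∧ ((A.sysAt ω r).voter v).ok = false ∧
    ¬ Quorum A.corr fun j => (A.sysAt ω r).VoteP j v (ω.1.code v c)

/-- The answer of a VC node that a voter considers. -/
def answer (A : Adversary C k) (ω : A.Runs) (v : Fin P.n) (i : Fin P.Nv) :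
    Word 64 :=
  if h : ∃ x r c, Accepts A ω v i r c x then h.choose else fun _ => false

theorem sysInv_true (hP : Admissible C k) (A : Adversary C k) (ω : A.Runs) (r : ℕ) :
    SysInv ω.1 A.corr (fun _ _ _ => True) (A.sysAt ω r) :=
  A.sysInv_sysAt ω hP (fun _ e _ => by
    have hc : ∀ u, LegitCert ω.1 A.corr (fun _ _ _ => True) u := fun _ _ _ _ _ _ _ _ => trivial
    unfold Legit
    split
    · exact fun _ _ _ _ => trivial
    · exact hc _
    · exact hc _
    · exact hc _
    · trivial) r

/-- Only a quorum of nodes enables an honest node to send an answer to a voter. -/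
theorem SysInv.quorum_of_receipt {S : Setup C k} {K : Corruption P}
    {F : CodePred P} {y : Sys C k} (h : SysInv S K F y) {i : Fin P.Nv}
    (hi : i ∉ K.vcs) {v : Fin P.n} (hv : v ∉ K.voters) {x : Word 64} {c : Line P}
    (hs : (.vc i, .voter v, .receipt x) ∈ y.sent) (hc : (y.voter v).choice = some c) :
    Quorum K fun j => y.VoteP j v (S.code v c) := by
  obtain ⟨s, vc, ⟨rfl, c', h1, rfl⟩, h2⟩ := (h.vc i hi).inv.own_receipt v x hv hs
  rw [hc] at h1
  cases h1
  exact h2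

theorem certRel_eq {u u' : Cert C k} (h : CertRel (PayRel.eq C k) u u') : u = u' :=
  funext fun j => by
    have h := h j
    generalize u j = a, u' j = b at h
    cases h with
    | some h => exact congrArg some h
    | none => rfl

theorem envRel_eq {e e' : Envelope C k} (h : EnvRel (PayRel.eq C k) e e') : e = e' := by
  obtain ⟨a, b, m⟩ := e
  obtain ⟨a', b', m'⟩ := e'
  obtain ⟨rfl, rfl, h⟩ := h
  congr 2
  cases h
  case voteP h hu => rw [show _ = _ from h, certRel_eq hu]
  case announce h =>
    rcases h with h | _
    · rw [Prod.ext h.1 (certRel_eq h.2)]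
    · rfl
  case recoverResp h => rw [certRel_eq h]
  case opening h h' => rw [show _ = _ from h, show _ = _ from h']
  case endorsement h => rw [show _ = _ from h]
  case voteSet h => rw [show _ = _ from h]
  case result h => rw [show _ = _ from h]
  all_goals rfl

/-- Nodes that are corrupted or have disclosed their receipt shares. -/
def disclosing (A : Adversary C k) (ω : A.Runs) (v : Fin P.n) (r : ℕ)
    (c : Line P) : Finset (Fin P.Nv) :=
  Finset.univ.filter fun j => j ∈ A.corr.vcs ∨ (A.sysAt ω r).VoteP j v (ω.1.code v c)

theorem Adversary.conf_zero (A : Adversary C k) (ω : A.Runs) :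
    A.conf ω 0 = (A.alg.start.eval (Bits.enc (ω.1.view A.corr)), none, {}) :=
  rfl

theorem Adversary.sysAt_zero (A : Adversary C k) (ω : A.Runs) :
    A.sysAt ω 0 = {} :=
  rfl

/-- Up to the round in which the receipt is guessed, nothing changes when the receipt is changed
to another value that has not been tried as an answer. -/
theorem Cheats.conf_eq (hP : Admissible C k) (hcol : ¬ Collides ω.1)
    {v : Fin P.n} (hv : v ∉ A.corr.voters)
    {i : Fin P.Nv} {r : Fin A.alg.rounds} {c : Line P} (h : Cheats A ω v i r c)
    {δ : GaloisField 2 64} (hδ : ∀ j ∈ A.corr.vcs,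
      toField 64 (answer A ω v j) ≠ toField 64 (ω.1.rcpt v c) + δ) {r' : ℕ} (hr' : r' ≤ r) :
    let ω' := (ω.1.shift v c (disclosing A ω v r c) δ, ω.2)
    (A.conf ω' r').1 = (A.conf ω r').1 ∧ (A.conf ω' r').2.1 = (A.conf ω r').2.1 ∧
      SysRel (PayRel.eq C k) (A.sysAt ω r') (A.sysAt ω' r') ∧
      (A.sysAt ω r').sent = (A.sysAt ω' r').sent ∧
      (A.sysAt ω r').unread = (A.sysAt ω' r').unread := by
  intro ω'
  have hω : ω'.2 = ω.2 := rfl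
  obtain ⟨hacc, hok, hnq⟩ := h
  set D := disclosing A ω v r c with hDdef
  have hfv' : P.fv < P.Nv := by have := hP.vc; omega
  have hD : D.card < P.Nv - P.fv := not_le.mp hnq
  have hmem : ∀ {j}, j ∈ D ↔ j ∈ A.corr.vcs ∨ (A.sysAt ω r).VoteP j v (ω.1.code v c) := by
    simp [hDdef, disclosing]
  have hrel := shift_rel (S := ω.1) (v := v) (c := c) (δ := δ) hfv' hD
    (dis := Disclosed ω.1 (A.sysAt ω r)) fun j s l ⟨d, vc, x, σ, u, h1, h2⟩ => by
      refine or_iff_not_imp_right.mpr fun hs => hmem.mpr (.inr ?_)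
      obtain ⟨rfl, hl⟩ := Prod.mk.inj (not_not.mp hs)
      have h3 := List.find?_some h2
      have h4 := congrArg Prod.fst (Collides.eq hcol (of_decide_eq_true h3))
      simp only [hl] at h4
      exact ⟨d, x, σ, u, h4 ▸ h1⟩
  induction r' with
  | zero =>
    have hview : ω'.1.view A.corr = ω.1.view A.corr :=
      shift_view hfv' hD (fun j hj => hmem.mpr (.inl hj)) hv
    exact ⟨by rw [A.conf_zero, A.conf_zero, hview], by rw [A.conf_zero, A.conf_zero], by
      rw [A.sysAt_zero, A.sysAt_zero]; exact ⟨sysRel_refl _, rfl, rfl⟩⟩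
  | succ r' ih =>
    obtain ⟨h1, h2, h3, h4, h5⟩ := ih (by omega)
    have hlt : r' < A.alg.rounds := by omega
    have hact : A.actAt ω' ⟨r', hlt⟩ = A.actAt ω ⟨r', hlt⟩ := by
      unfold Adversary.actAt Machine.act
      rw [h1, h2, hω]
    have hmid : SysRel (PayRel.eq C k) (A.midAt ω ⟨r', hlt⟩) (A.midAt ω' ⟨r', hlt⟩) ∧
        (A.midAt ω ⟨r', hlt⟩).sent = (A.midAt ω' ⟨r', hlt⟩).sent ∧
        (A.midAt ω ⟨r', hlt⟩).unread = (A.midAt ω' ⟨r', hlt⟩).unread := by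
      have hsent : (A.midAt ω ⟨r', hlt⟩).sent ⊆ (A.sysAt ω r).sent := by
        have := (A.voter_mono ω hr' v).2.2.2
        rwa [A.sysAt_succ ω ⟨r', hlt⟩] at this
      revert hsent
      unfold Adversary.midAt
      rw [hact]
      cases ha : A.actAt ω ⟨r', hlt⟩ with
      | none => exact fun _ => ⟨h3, h4, h5⟩
      | some a =>
        intro hsent
        by_cases hex : ∃ e, a = .deliver e ∧
            ¬ ((A.corr.Bad e.1 ∨ e ∈ (A.sysAt ω r').sent) ∧ ¬ A.corr.Bad e.2.1)
        · obtain ⟨e, rfl, hex⟩ := hex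
          simp only [Setup.exec]
          rw [if_neg hex, if_neg (by rwa [← h4])]
          exact ⟨h3, h4, h5⟩
        push Not at hex
        obtain ⟨h6, es, es', h7, h8, h9, h10, h11, -⟩ := exec_rel hrel h3 (actRel_refl a)
          (K := A.corr) (fun e e' h h' => by
            subst h
            cases h'
            rw [h4])
          (fun e v' hae hd => by
            obtain ⟨src, d, x⟩ := e
            obtain rfl : d = .voter v' := hd
            simp only [Setup.voterRecv]
            split
            · rename_i j x' c' hc'
              split
              · rename_i hif
                congr 3
                by_cases e1 : v' = v
                swap
                · exact congrArg _ (shift_rcpt_of_ne fun h => e1 (Prod.mk.inj h).1).symm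
                subst e1
                have hacc' : Accepts A ω v' j ⟨r', hlt⟩ c' x' :=
                  ⟨by rw [ha, hae], hc', hif⟩
                obtain rfl : c' = c := Option.some.inj
                  (((A.voter_mono ω (Nat.le_of_succ_le hr') v').1 c' hc').symm.trans hacc.2.1)
                obtain ⟨hbad, -⟩ := hex _ hae
                -- an honest node answers only after a quorum of disclosures
                have hj : j ∈ A.corr.vcs := by
                  by_contra hj
                  have h8 := (sysInv_true hP A ω r').quorum_of_receipt hj hv
                    (hbad.resolve_left hj) hc'
                  exact hnq (h8.mono fun j _ ⟨d, x, σ, u, h⟩ =>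
                    ⟨d, x, σ, u, (A.voter_mono ω (Nat.le_of_succ_le hr') v').2.2.2 h⟩)
                have hans : answer A ω v' j = x' := by
                  have hx : ∃ x r c, Accepts A ω v' j r c x := ⟨_, _, _, hacc'⟩
                  unfold answer
                  rw [dif_pos hx]
                  obtain ⟨_, _, h⟩ := hx.choose_spec
                  exact (h.unique hv hj hacc').2.2
                -- the old receipt would have been accepted, and `δ` avoids this answer
                have hne1 : x' ≠ ω.1.rcpt v' c' := fun e => by
                  have := (A.voter_mono ω hr' v').2.2.1 ((hacc'.next hv hbad).2 e)
                  rw [hok] at this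
                  cases this
                have hne2 : x' ≠ (ω.1.shift v' c' D δ).rcpt v' c' := fun e => by
                  refine hδ j hj ?_
                  rw [hans, e, shift_rcpt_self, Equiv.apply_symm_apply]
                exact (eq_false hne1).trans (eq_false hne2).symm
              · rfl
            · rfl)
          (fun _ _ _ _ => trivial) (fun j s l ⟨d, vc, x, σ, u, h⟩ =>
            ⟨d, vc, x, σ, u, hsent h.1, h.2⟩)
        have h12 : es = es' := List.forall₂_eq_eq_eq ▸ h11.imp fun _ _ h => envRel_eq h
        exact ⟨h6, by rw [h7, h8, h4, h12], by rw [h9, h10, h5, h12]⟩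
    obtain ⟨h6, h7, h8⟩ := hmid
    rw [A.sysAt_succ ω ⟨r', hlt⟩, A.sysAt_succ ω' ⟨r', hlt⟩, A.conf_succ ω ⟨r', hlt⟩,
      A.conf_succ ω' ⟨r', hlt⟩]
    refine ⟨?_, by rw [h8], ⟨h6.vc, h6.bb, h6.tr, h6.voter, h6.bc⟩, h7, by rw [h8]⟩
    rw [h1, h2, hω]

theorem Cheats.accepts_shift (hP : Admissible C k) (hcol : ¬ Collides ω.1)
    {v : Fin P.n} (hv : v ∉ A.corr.voters)
    {i : Fin P.Nv} {r : Fin A.alg.rounds} {c : Line P} (h : Cheats A ω v i r c)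
    {δ : GaloisField 2 64} (hδ : ∀ j ∈ A.corr.vcs,
      toField 64 (answer A ω v j) ≠ toField 64 (ω.1.rcpt v c) + δ) :
    let ω' := (ω.1.shift v c (disclosing A ω v r c) δ, ω.2)
    Accepts A ω' v i r c (ω.1.rcpt v c) ∧ disclosing A ω' v r c = disclosing A ω v r c := by
  intro ω'
  obtain ⟨h1, h2, h3, h4, -⟩ := h.conf_eq hP hcol hv hδ le_rfl
  have hact : A.actAt ω' r = A.actAt ω r := by
    unfold Adversary.actAt Machine.act
    rw [h1, h2]
  obtain ⟨⟨a1, a2⟩, -⟩ := h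
  refine ⟨⟨hact.trans a1, ?_⟩, ?_⟩
  · rw [← h3.voter]
    exact a2
  · have h4' : (A.sysAt ω' r).sent = (A.sysAt ω r).sent := h4.symm
    have hcode : ω'.1.code = ω.1.code := rfl
    exact Finset.filter_congr fun j _ => by simp only [Sys.VoteP, h4', hcode]

theorem card_field : Nat.card (GaloisField 2 64) = 2 ^ 64 :=
  GaloisField.card 2 64 (by norm_num)

theorem fv_lt_two_pow (hfv : 3 * P.fv < P.Nv) : P.fv < 2 ^ 64 := by
  have h := Nat.card_le_card_of_injective (fun i => (P.pt64 i : GaloisField 2 64))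
    (Units.val_injective.comp P.pt64.injective)
  rw [Nat.card_fin, card_field] at h
  omega

/-- Among the values that the receipt may have without any change of the run before `i` answers,
the adversary has singled out one. -/
theorem prob_cheats_le (hP : Admissible C k) {v : Fin P.n} (hv : v ∉ A.corr.voters) {i : Fin P.Nv}
    (hi : i ∈ A.corr.vcs) : prob A.Runs
      (fun ω => ¬ Collides ω.1 ∧ ∃ r c, Cheats A ω v i r c) ≤ 1 / (2 ^ 64 - P.fv) := by
  have := Fintype.ofFinite A.Runs
  set B := Finset.univ.filter fun ω : A.Runs =>
    ¬ Collides ω.1 ∧ ∃ r c, Cheats A ω v i r c with hB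
  have hlt := fv_lt_two_pow hP.vc
  have hpos : (0 : ℝ) < 2 ^ 64 - P.fv := by
    rw [sub_pos]
    exact_mod_cast hlt
  unfold prob
  rw [show Nat.card {ω : A.Runs // ¬ Collides ω.1 ∧ ∃ r c, Cheats A ω v i r c} =
    B.card by rw [hB, Nat.card_eq_fintype_card, Fintype.card_subtype]]
  rcases B.eq_empty_or_nonempty with h0 | ⟨ω₀, h0⟩
  · rw [h0]
    simpa using hpos.le
  have : Nonempty (Fin A.alg.rounds × Line P) := by
    obtain ⟨-, r, c, -⟩ := (Finset.mem_filter.mp h0).2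
    exact ⟨r, c⟩
  have hex : ∀ ω ∈ B, ∃ rc : Fin A.alg.rounds × Line P, ¬ Collides ω.1 ∧
      Cheats A ω v i rc.1 rc.2 := fun ω h => by
    obtain ⟨h1, r, c, h2⟩ := (Finset.mem_filter.mp h).2
    exact ⟨(r, c), h1, h2⟩
  have := Fintype.ofFinite (GaloisField 2 64)
  choose! rc hrc using hex
  let G (ω : A.Runs) : Finset (GaloisField 2 64) :=
    Finset.univ \ A.corr.vcs.image fun j =>
      toField 64 (answer A ω v j) - toField 64 (ω.1.rcpt v (rc ω).2)
  have hG : ∀ ω, 2 ^ 64 - P.fv ≤ (G ω).card := fun ω => by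
    have h2 := (Finset.card_image_le (s := A.corr.vcs) (f := fun j =>
      toField 64 (answer A ω v j) - toField 64 (ω.1.rcpt v (rc ω).2))).trans A.corr.vcs_le
    rw [Finset.card_univ_sdiff, ← Nat.card_eq_fintype_card, card_field]
    exact Nat.sub_le_sub_left h2 _
  -- a run can be recovered from the shifted one, where the answer still is the old receipt
  have hcard : (B.sigma G).card ≤ (Finset.univ : Finset A.Runs).card := by
    refine Finset.card_le_card_of_injOn (fun x => (x.1.1.shift v (rc x.1).2
      (disclosing A x.1 v (rc x.1).1 (rc x.1).2) x.2, x.1.2)) (fun _ _ => Finset.mem_univ _) ?_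
    have key : ∀ x ∈ B.sigma G,
        let ω' := (x.1.1.shift v (rc x.1).2 (disclosing A x.1 v (rc x.1).1 (rc x.1).2) x.2, x.1.2)
        Accepts A ω' v i (rc x.1).1 (rc x.1).2 (x.1.1.rcpt v (rc x.1).2) ∧
          disclosing A ω' v (rc x.1).1 (rc x.1).2 =
            disclosing A x.1 v (rc x.1).1 (rc x.1).2 := fun x hx => by
      obtain ⟨h1, h2⟩ := Finset.mem_sigma.mp hx
      refine (hrc _ h1).2.accepts_shift hP (hrc _ h1).1 hv fun j hj e => ?_
      exact (Finset.mem_sdiff.mp h2).2 (Finset.mem_image.mpr ⟨j, hj, by rw [e]; ring⟩)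
    rintro ⟨ω₁, δ₁⟩ hx₁ ⟨ω₂, δ₂⟩ hx₂ he
    obtain ⟨k1, d1⟩ := key _ hx₁
    obtain ⟨k2, d2⟩ := key _ hx₂
    simp only at he k1 d1 k2 d2
    generalize rc ω₁ = rc₁ at he k1 d1
    generalize rc ω₂ = rc₂ at he k2 d2
    rw [he] at k1 d1
    obtain ⟨e1, e2, e3⟩ := k1.unique hv hi k2
    obtain ⟨r, c⟩ := rc₁
    obtain ⟨r', c'⟩ := rc₂
    simp only at e1 e2 e3
    subst e1 e2
    rw [d2] at d1
    simp only at d1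
    rw [d1] at he
    obtain ⟨he, hc⟩ := Prod.mk.inj he
    have h3 := congrArg (fun S : Setup C k => toField 64 (S.rcpt v c)) he
    simp only [shift_rcpt_self, Equiv.apply_symm_apply, e3, add_right_inj] at h3
    subst h3
    have h4 := congrArg (fun S : Setup C k => S.shift v c (disclosing A ω₁ v r c) (-δ₁)) he
    simp only [shift_shift] at h4
    rw [Prod.ext h4 hc]
  rw [Finset.card_sigma] at hcard
  have h5 := (Finset.card_nsmul_le_sum B (fun ω => (G ω).card) _ fun ω _ => hG ω).trans hcard
  have h6 : (B.card : ℝ) * (2 ^ 64 - P.fv) ≤ Nat.card A.Runs := by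
    rw [Nat.card_eq_fintype_card, ← Finset.card_univ]
    have := (Nat.cast_le (α := ℝ)).mpr h5
    rw [smul_eq_mul, Nat.cast_mul, Nat.cast_sub hlt.le] at this
    exact_mod_cast this
  rw [div_le_div_iff₀ _ hpos, one_mul]
  · exact h6
  · exact_mod_cast Nat.card_pos_iff.mpr ⟨⟨ω₀⟩, inferInstance⟩

/-- If no receipt is guessed, a valid receipt shows that a quorum of nodes has disclosed its
shares. -/
theorem quorum_of_ok (hP : Admissible C k) {v : Fin P.n} (hv : v ∉ A.corr.voters)
    (h : ∀ i ∈ A.corr.vcs, ∀ r c, ¬ Cheats A ω v i r c) (r : ℕ) :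
    ((A.sysAt ω r).voter v).ok = true → ∃ c, ((A.sysAt ω r).voter v).choice = some c ∧
      Quorum A.corr fun j => (A.sysAt ω r).VoteP j v (ω.1.code v c) := by
  refine A.sysAt_induct ω (p := fun y => (y.voter v).ok = true → ∃ c,
    (y.voter v).choice = some c ∧ Quorum A.corr fun j => y.VoteP j v (ω.1.code v c))
    (by simp) (fun r a ha ih hok => ?_) (fun _ h => h) r
  obtain ⟨h1, h2⟩ := exec_voter ω.1 A.corr (A.sysAt ω r) a v
  obtain ⟨es, h3, -⟩ := exec_lists ω.1 A.corr (A.sysAt ω r) a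
  suffices hs : ∃ c, ((A.sysAt ω r).voter v).choice = some c ∧
      Quorum A.corr fun j => (A.sysAt ω r).VoteP j v (ω.1.code v c) by
    obtain ⟨c, hc, hs⟩ := hs
    refine ⟨c, h1 c hc, hs.mono fun j _ ⟨d, x, σ, u, h⟩ => ⟨d, x, σ, u, ?_⟩⟩
    rw [h3]
    exact List.mem_append_left _ h
  by_cases hok' : ((A.sysAt ω r).voter v).ok = true
  · exact ih hok'
  rcases h2 with h2 | ⟨src, x, rfl, hsent, h2⟩
  · exact absurd (h2.2.symm.trans hok) hok'
  rw [h2] at hok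
  obtain ⟨i, c, rfl, rfl, hc, hi⟩ := ((voterRecv_spec v _ src x).2.2 hok).resolve_left hok'
  refine ⟨c, hc, ?_⟩
  by_cases hbad : i ∈ A.corr.vcs
  · by_contra hn
    exact h i hbad r c ⟨⟨ha, hc, hi⟩, Bool.eq_false_of_not_eq_true hok', hn⟩
  · exact (sysInv_true hP A ω r).quorum_of_receipt hbad hv (hsent.resolve_left hbad) hc

/-- Some honest voter gets a receipt that the adversary has guessed. -/
def Guesses (A : Adversary C k) (ω : A.Runs) : Prop :=
  ¬ Collides ω.1 ∧ ∃ v, v ∉ A.corr.voters ∧ ∃ i ∈ A.corr.vcs, ∃ r c, Cheats A ω v i r c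

theorem prob_guesses_le (hP : Admissible C k) (A : Adversary C k) : prob A.Runs (Guesses A) ≤
      P.n * P.fv / (2 ^ 64 - P.fv) := by
  have hpos : (0 : ℝ) < 2 ^ 64 - P.fv := by
    rw [sub_pos]
    exact_mod_cast fv_lt_two_pow hP.vc
  refine (prob_mono (F := fun ω => ∃ t : {v // v ∉ A.corr.voters} × {i // i ∈ A.corr.vcs},
    ¬ Collides ω.1 ∧ ∃ r c, Cheats A ω t.1 t.2 r c)
    fun ω ⟨h, v, hv, i, hi, h'⟩ => ⟨(⟨v, hv⟩, ⟨i, hi⟩), h, h'⟩).trans ?_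
  refine (prob_exists_le _).trans ((Finset.sum_le_card_nsmul _ _ _ fun t _ =>
    prob_cheats_le hP t.1.2 t.2.2).trans ?_)
  rw [nsmul_eq_mul, mul_one_div]
  refine div_le_div_of_nonneg_right ?_ hpos.le
  rw [Finset.card_univ, Fintype.card_prod, Fintype.card_coe]
  have h1 : Fintype.card {v // v ∉ A.corr.voters} ≤ P.n :=
    (Fintype.card_subtype_le _).trans (Fintype.card_fin _).le
  exact_mod_cast Nat.mul_le_mul h1 A.corr.vcs_le

theorem safe_of_not (hP : Admissible C k)
    (hF : ¬ ForgesVC A ω) (hE : ¬ ForgesEA A ω) (hC : ¬ Collides ω.1) (hG : ¬ Guesses A ω) :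
    Safe ω.1 A.corr (A.run ω) := by
  refine safe_of_inv (F := Endorsed (A.run ω)) ?_ hP.vc hP.bb hP.tr hP.n (unique_endorsed _)
    hC ?_ ?_
  · rw [A.run_eq]
    refine A.sysInv_sysAt ω hP (fun r e he => ?_) _
    rw [← A.run_eq]
    exact legit_of_not_forgesVC hF he
  · rintro ⟨src, dst, _⟩ he Q x σ rfl i hσ
    rw [A.run_eq] at he
    obtain ⟨r, hr⟩ := A.delivered_act ω he
    by_contra hne
    exact hE ⟨r, src, dst, Q, i, x, σ, hr, hσ, hne⟩
  · rw [A.run_eq]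
    exact fun v hv => quorum_of_ok hP hv
      (fun i hi r c h => hG ⟨hC, v, hv, i, hi, r, c, h⟩) _

end Run

end

end DDemos

end

theorem mainTheorem2 (P : DDemos.Params)
    (hfv : 3 * P.fv < P.Nv) (hfb : 2 * P.fb < P.Nb)
    (hht : 1 ≤ P.ht) (hNt : P.ht ≤ P.Nt)
    (hm : 2 * P.m ≤ 2 ^ 128) (hT : P.Tbeg < P.Tend)
    (C : DDemos.Prims P)
    (hsigEff : C.sig.Efficient) (hsig : C.sig.EUFCMA)
    (hhashEff : C.hash.Efficient) (hhash : C.hash.CollisionResistant)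
    (hqPoly : DDemos.PolyBounded fun k => (C.grp.q k).size)
    (hqn : ∀ k, P.n < C.grp.q k) (hqNt : ∀ k, P.Nt < C.grp.q k)
    (A : ∀ k, DDemos.Adversary C k)
    (hA : DDemos.PolyBounded fun k => (A k).alg.cost) :
    ∃ negl : ℕ → ℝ, DDemos.Negligible negl ∧ ∀ k,
      1 - (P.n * P.fv : ℝ) / (2 ^ 64 - P.fv) - negl k ≤
        DDemos.prob (DDemos.Setup C k × (A k).alg.Coins)
          (fun ω => DDemos.Safe ω.1 (A k).corr ((A k).run ω)) := by
  have hne : ∀ k, Nonempty (DDemos.Setup C k × (A k).alg.Coins) := fun k =>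
    ⟨(DDemos.Setup.nonempty hm C k).some, fun _ _ => false⟩
  have hE : C.Efficient := ⟨hsigEff, hqPoly⟩
  have hP : ∀ k, DDemos.Admissible C k := fun k => ⟨hT, hfv, hfb, hht, hNt, hqn k, hqNt k⟩
  have hEA := DDemos.negligible_forgesEA (by omega) hm hE hsig hA
  refine ⟨_, ((DDemos.negligible_forgesVC hm hE hsig hA).add hEA).add
    (DDemos.negligible_collides hm hhash (Z := fun k => (A k).alg.Coins)), fun k => ?_⟩
  refine le_trans ?_ (DDemos.one_sub_prob_le (E := fun ω => ((DDemos.ForgesVC (A k) ω ∨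
    DDemos.ForgesEA (A k) ω) ∨ DDemos.Collides ω.1) ∨ DDemos.Guesses (A k) ω) fun ω h => ?_)
  · have h1 := DDemos.prob_guesses_le (hP k) (A k)
    have h2 := DDemos.prob_or_le (fun ω => (DDemos.ForgesVC (A k) ω ∨
      DDemos.ForgesEA (A k) ω) ∨ DDemos.Collides ω.1) (DDemos.Guesses (A k))
    have h3 := DDemos.prob_or_le (fun ω => DDemos.ForgesVC (A k) ω ∨
      DDemos.ForgesEA (A k) ω) (fun ω => DDemos.Collides ω.1)
    have h4 := DDemos.prob_or_le (DDemos.ForgesVC (A k)) (DDemos.ForgesEA (A k))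
    linarith
  · simp only [not_or] at h
    exact DDemos.safe_of_not (hP k) h.1.1.1 h.1.1.2 h.1.2 h.2
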